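/- **Setting.** A *manifold* is $\Omega=\psi(T\times\{0\})\subset\mathbb R^3$, where $T\subset\mathbb R^2$ is bounded and open, $\mathcal H^1(\partial T)<\infty$, $T$ has a unit outer normal $\tilde n$ with $\nabla\mathbb 1_T=-\tilde n\,\mathcal H^1|_{\partial T}$ in the sense of distributions (for instance $T$ is a bounded Lipschitz domain), and $\psi$ is a $C^2$ diffeomorphism of an open neighbourhood of $\overline T\times\{0\}$ onto its image such that $\partial_3\psi(x,0)$ is the unit normal $\nu=\partial_1\psi\times\partial_2\psi/|\partial_1\psi\times\partial_2\psi|$ for $x\in\overline T$. Put $\psi_0=\psi(\cdot,0)$, $J=|\det D\psi|$, $J_0=\sqrt{\det(D\psi_0^TD\psi_0)}$, $\Omega_h=\psi(T\times(-h,h))$, $\partial\Omega=\psi_0(\partial T)$, and let $n$ be the outward unit normal of $\partial\Omega$ in the tangent plane of $\Omega$. A *choice* $(O,\mathscr L,\Omega,\Box)$ consists of an origin $O\in\mathbb R^2$, a lattice $\mathscr L\subset\mathbb R^2$ with a basis, a manifold, and a bounded measurable unit cell $\Box$ with a corner vector $f$ such that the translates of $f+\Box$ by $\mathscr L$ tile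 $\mathbb R^2$. For $l>0$ the scaled cells are $\hat x+l\Box$, $\hat x\in O+l(\mathscr L+f)$; a cell is full if it is contained in $T$, and partial if it meets both $T$ and $T^c$. Let $\alpha\ge0$, let $l,h\to0^+$ be sequences with $h/l\to\alpha$, and let $\rho_l:\mathbb R^3\to\mathbb R$ be uniformly bounded charge distributions. A choice is *admissible* for $(\rho_l)$ if, for all small $l$, $\rho_l$ vanishes outside $\Omega_h$ and is continuous on $\Omega_h$. With $\rho=\rho_l(\psi(\hat x+ly+hze_3))\,J(\hat x+ly+hze_3)$, put for a full cell $$J_0q_l=\frac1{l|\Box|}\int_\Box\int_{-1}^1\rho\,dz\,dy,\quad J_0p_{p,l}=\frac1{|\Box|}\int_\Box\int_{-1}^1y\,\rho\,dz\,dy,\quad J_0p_{3,l}=\frac1{|\Box|}\int_\Box\int_{-1}^1z\,\rho\,dz\,dy,$$ and for a partial cell $s_l=\int_{\{y\in\Box:\,\hat x+ly\in T\}}\int_{-1}^1\rho\,dz\,dy$. The functions $q,p_3$ (continuous), $p_p$ ($C^1$ up to the boundary) and $\sigma\in L^1(\partial\Omega)$ are the *homogenized free charge, normal polarization, tangential polarization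 and surface charge* for the choice if for every $\varphi\in C_c(\mathbb R^2)$ one has $\sum_{\rm full}|\Box|l^2\varphi(\hat x)J_0q_l\to\int_T\varphi qJ_0\,dx$, the same for $p_p$ and $p_3$, and $\sum_{\rm partial}l\,\varphi(\hat x)s_l\to\int_{\partial\Omega}(\varphi\circ\psi_0^{-1})\,\sigma\,ds$. Here $q,p_3,\sigma$ are viewed as functions on $\Omega$ or $\partial\Omega$ and $p_p$ as its chart components or as the tangent vector field $D\psi_0\,p_p$, and $\operatorname{div}_S(J_0p_p)/J_0$ is $J_0^{-1}\operatorname{div}_{x}(J_0p_p)$ in the chart. For a function $w$ on $\Omega$, $w\,\partial\mathbb 1_\Omega/\partial\nu$ is the distribution $\phi\mapsto-\int_\Omega w\,\partial_\nu\phi\,dS$. The *homogenized problem* of the choice is $$-\Delta\Phi_0=\Big(\alpha q-\alpha\frac{\operatorname{div}_S(J_0p_p)}{J_0}\Big)\mathbb 1_\Omega-\alpha^2p_3\frac{\partial\mathbb 1_\Omega}{\partial\nu}+\alpha(\sigma+p_p\cdot n)\mathbb 1_{\partial\Omega}\ \text{ in }\mathscr D'(\mathbb R^3),\qquad \Phi_0\to0\text{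 at infinity},$$ for $\Phi_0\in L^1_{\rm loc}(\mathbb R^3)$. **Theorem.** 1. *(Potential, field, energy.)* Given $(\rho_l)$ there is one function $\Phi_0$ such that for every admissible choice with homogenized fields, $\Phi_0$ solves the homogenized problem of that choice and is, up to null sets, its only solution. Moreover, if there is such a choice, then for small $l$ the problem $-\Delta\Phi_l=\rho_l/l^2$, $\Phi_l\to0$ at infinity, has a solution, and any such solutions $\Phi_l$ converge to $\Phi_0$ in the sense of distributions. Hence in any open region $W$ on which the weak field $E=-\nabla\Phi_0\in L^1_{\rm loc}(W)$ exists, $E$ and the energy $\frac12\int_W|E|^2\in[0,\infty]$ are also independent of the choice. 2. *(Uniqueness.)* For any two admissible choices for the same $(\rho_l)$ with homogenized fields, the bulk distributions $\big(\alpha q-\alpha\operatorname{div}_S(J_0p_p)/J_0\big)\mathbb 1_\Omega-\alpha^2p_3\,\partial\mathbb 1_\Omega/\partial\nu$ on $\mathbb R^3$ coincide, and so do the boundary distributions $\alpha(\sigma+p_p\cdot n)\mathbb 1_{\partial\Omega}$. If the two choices have the same set $\Omega$, then $\alpha q-\alpha\operatorname{div}_S(J_0p_p)/J_0$ coincide at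 every point of $\Omega$, $\alpha(\sigma+p_p\cdot n)$ coincide almost everywhere on $\partial\Omega$ with respect to length, and, if $\alpha>0$, the vectors $p_3\nu$ coincide at every point of $\Omega$; so $p_3$ is unique once $\nu$ is fixed. 3. *(Non-uniqueness.)* For every $\alpha\ge0$ there are $(\rho_l)$ and an admissible choice $(O,\mathscr L,\Omega,\Box)$ with homogenized fields such that changing only $O$, or only $\mathscr L$, or only $\Omega$, or only $\Box$ in a suitable way gives another admissible choice with homogenized fields for the same $(\rho_l)$, for which the free charge and the tangential polarization (as a vector field in space) each differ at some common point of the two manifolds, and the surface charge differs on a subset of the common boundary of positive length. -/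

import Mathlib

open MeasureTheory Filter Topology Set
open scoped ContDiff Laplacian RealInnerProductSpace Matrix

noncomputable section

namespace TwoDMaterial

/-- The parameter plane and the physical space, with their Euclidean norms. -/
abbrev E2 := EuclideanSpace ℝ (Fin 2)
abbrev E3 := EuclideanSpace ℝ (Fin 3)

/-- The point `(x₁, x₂, t)` of the parameter space. -/
def lift (x : E2) (t : ℝ) : E3 := !₂[x 0, x 1, t]

/-- The third coordinate direction of the parameter space. -/
def dir3 : E3 := !₂[0, 0, 1]

/-- Coordinate directions of the parameter plane. -/
def dir (i : Fin 2) : E2 := EuclideanSpace.single i 1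

/-- Vector product in physical space. -/
def cross (u v : E3) : E3 := WithLp.toLp 2 (WithLp.ofLp u ⨯₃ WithLp.ofLp v)

/-- The vector `v / |v|`. -/
def unitVec (v : E3) : E3 := ‖v‖⁻¹ • v

/-- Rotation by a right angle in the parameter plane. -/
def rot (v : E2) : E2 := !₂[-v 1, v 0]

/-- Divergence in the parameter plane. -/
def div2 (X : E2 → E2) (x : E2) : ℝ := ∑ i : Fin 2, (fderiv ℝ X x (dir i)) i

/-- Divergence in physical space. -/
def div3 (X : E3 → E3) (r : E3) : ℝ :=
  ∑ i : Fin 3, (fderiv ℝ X r (EuclideanSpace.single i 1)) i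

/-! ### Surfaces and thin films -/

/-- `n` is the outer unit normal of `T`: the distributional gradient of the indicator function
of `T` is the vector measure `-n μH[1]` on the topological boundary of `T`
(De Giorgi's definition of the outer normal and of the perimeter measure). Every bounded
Lipschitz domain has such a normal, namely the classical one. -/
def IsOuterNormal (T : Set E2) (n : E2 → E2) : Prop :=
  Measurable n ∧ (∀ x ∈ frontier T, ‖n x‖ = 1) ∧
    ∀ X : E2 → E2, ContDiff ℝ 1 X → HasCompactSupport X →
      ∫ x in T, div2 X x = ∫ x in frontier T, ⟪X x, n x⟫ ∂(μH[1] : Measure E2)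

/-- Unit normal `ν` of the parametrized surface `x ↦ ψ (x, 0)`. -/
def unitNormal (ψ : E3 → E3) (x : E2) : E3 :=
  unitVec (cross (fderiv ℝ (fun y => ψ (lift y 0)) x (dir 0))
    (fderiv ℝ (fun y => ψ (lift y 0)) x (dir 1)))

/-- A two-dimensional manifold `Ω = ψ (T × {0})` with its parametric map `ψ`, which is a
`C²` diffeomorphism of a neighbourhood of `closure T × {0}` onto its image and
leaves `Ω` in the normal direction with unit speed. -/
structure Sheet where
  T : Set E2
  isOpen_T : IsOpen T
  isBounded_T : Bornology.IsBounded T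
  finite_boundary : (μH[1] : Measure E2) (frontier T) < ⊤
  /-- outer unit normal of `T` in the parameter plane -/
  nT : E2 → E2
  isOuterNormal : IsOuterNormal T nT
  ψ : E3 → E3
  U : Set E3
  isOpen_U : IsOpen U
  mem_U : ∀ x ∈ closure T, lift x 0 ∈ U
  contDiffOn : ContDiffOn ℝ 2 ψ U
  injOn : InjOn ψ U
  det_ne_zero : ∀ X ∈ U, (fderiv ℝ ψ X).det ≠ 0
  normal_coord : ∀ x ∈ closure T, fderiv ℝ ψ (lift x 0) dir3 = unitNormal ψ x

namespace Sheet

variable (M : Sheet)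

/-- `ψ₀`, the restriction of `ψ` to the plane `x₃ = 0`. -/
def ψ₀ (x : E2) : E3 := M.ψ (lift x 0)

/-- The manifold `Ω`. -/
def Ω : Set E3 := M.ψ₀ '' M.T

/-- The thin film `Ω_h = Ω × (-h, h)`, that is `ψ (T × (-h, h))`. -/
def film (h : ℝ) : Set E3 :=
  (fun X : E2 × ℝ => M.ψ (lift X.1 X.2)) '' (M.T ×ˢ Ioo (-h) h)

/-- The differential of `ψ₀`. -/
def D (x : E2) : E2 →L[ℝ] E3 := fderiv ℝ M.ψ₀ x

/-- The Jacobian `J = |det Dψ|`. -/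
def J (X : E3) : ℝ := |(fderiv ℝ M.ψ X).det|

/-- The surface Jacobian `J₀ = √ det (Dψ₀ᵀ Dψ₀)`. -/
def J₀ (x : E2) : ℝ := √(((M.D x).adjoint ∘L (M.D x)).det)

/-- The unit normal `ν` of `Ω` at `ψ₀ x`. -/
def ν (x : E2) : E3 := unitNormal M.ψ x

/-- Image in space of the unit tangent of `∂T`; its length is the line Jacobian of `ψ₀` on `∂T`. -/
def bdTangent (x : E2) : E3 := M.D x (rot (M.nT x))

/-- The line Jacobian: `∂Ω` carries the length element `lineJ dμH[1]` on `∂T`. -/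
def lineJ (x : E2) : ℝ := ‖M.bdTangent x‖

/-- Outward unit normal of `∂Ω` lying in the tangent plane of `Ω`, at `ψ₀ x`, `x ∈ ∂T`. -/
def conormal (x : E2) : E3 := cross (unitVec (M.bdTangent x)) (M.ν x)

end Sheet

/-! ### Choices of origin, lattice, manifold and unit cell -/

/-- A choice of origin, lattice basis, manifold, and unit cell with corner vector. The translates
of `corner + cell` by the lattice tile the plane (for the scaled lattice and cell this is the same
condition). -/
structure Choice where
  origin : E2
  basis : Fin 2 → E2
  linearIndependent : LinearIndependent ℝ basis
  sheet : Sheet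
  cell : Set E2
  corner : E2
  measurableSet_cell : MeasurableSet cell
  isBounded_cell : Bornology.IsBounded cell
  tiling : ∀ x : E2, ∃! n : Fin 2 → ℤ,
    ∃ y ∈ cell, x = (∑ i, (n i : ℝ) • basis i) + (corner + y)

namespace Choice

variable (c : Choice)

/-- The lattice `ℒ`. -/
def lattice : Set E2 := range fun n : Fin 2 → ℤ => ∑ i, (n i : ℝ) • c.basis i

/-- The corner `x̂` of the scaled cell with index `n`. -/
def cornerAt (l : ℝ) (n : Fin 2 → ℤ) : E2 :=
  c.origin + l • ((∑ i, (n i : ℝ) • c.basis i) + c.corner)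

/-- The scaled cell with index `n`. -/
def cellAt (l : ℝ) (n : Fin 2 → ℤ) : Set E2 := (fun y => c.cornerAt l n + l • y) '' c.cell

/-- Indices of the scaled cells contained in `T`. -/
def fullCells (l : ℝ) : Set (Fin 2 → ℤ) := {n | c.cellAt l n ⊆ c.sheet.T}

/-- Indices of the scaled cells which meet `T` without being contained in it. -/
def partialCells (l : ℝ) : Set (Fin 2 → ℤ) :=
  {n | (c.cellAt l n ∩ c.sheet.T).Nonempty ∧ ¬ c.cellAt l n ⊆ c.sheet.T}

/-- Area of the unscaled cell. -/
def area : ℝ := (volume : Measure E2).real c.cell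

end Choice

/-! ### Charge distributions and their cell moments -/

/-- A uniformly bounded sequence of charge distributions `ρ k` with lattice scale `l k → 0`,
film half-thickness `h k → 0` and `h k / l k → α`. -/
structure ChargeSequence (α : ℝ) where
  l : ℕ → ℝ
  h : ℕ → ℝ
  l_pos : ∀ k, 0 < l k
  h_pos : ∀ k, 0 < h k
  l_tendsto : Tendsto l atTop (𝓝 0)
  h_tendsto : Tendsto h atTop (𝓝 0)
  ratio_tendsto : Tendsto (fun k => h k / l k) atTop (𝓝 α)
  ρ : ℕ → E3 → ℝ
  bounded : ∃ C : ℝ, ∀ k r, |ρ k r| ≤ C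

namespace ChargeSequence

variable {α : ℝ} (S : ChargeSequence α) (c : Choice)

/-- For small scales the charge is supported in the film of the manifold and continuous there. -/
def AdaptedTo : Prop :=
  ∀ᶠ k in atTop, ContinuousOn (S.ρ k) (c.sheet.film (S.h k)) ∧
    Function.support (S.ρ k) ⊆ c.sheet.film (S.h k)

/-- The charge in parameter space, `(ρ ∘ ψ) J` at `(x, h z)`. -/
def paramCharge (k : ℕ) (x : E2) (z : ℝ) : ℝ :=
  S.ρ k (c.sheet.ψ (lift x (S.h k * z))) * c.sheet.J (lift x (S.h k * z))

/-- `J₀ q` of the full cell `n` (free charge of order `(1, 0)`), per unit area of the cell. -/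
def cellCharge (k : ℕ) (n : Fin 2 → ℤ) : ℝ :=
  (S.l k)⁻¹ * (c.area⁻¹ * ∫ y in c.cell, ∫ z in (-1 : ℝ)..1,
    S.paramCharge c k (c.cornerAt (S.l k) n + S.l k • y) z)

/-- `J₀ p_p` of the full cell `n`: the in-plane dipole moment, per unit area of the cell. -/
def cellDipole (k : ℕ) (n : Fin 2 → ℤ) : E2 :=
  c.area⁻¹ • ∫ y in c.cell, ∫ z in (-1 : ℝ)..1,
    S.paramCharge c k (c.cornerAt (S.l k) n + S.l k • y) z • y

/-- `J₀ p₃` of the full cell `n`: the normal dipole moment, per unit area of the cell. -/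
def cellNormalDipole (k : ℕ) (n : Fin 2 → ℤ) : ℝ :=
  c.area⁻¹ * ∫ y in c.cell, ∫ z in (-1 : ℝ)..1,
    z * S.paramCharge c k (c.cornerAt (S.l k) n + S.l k • y) z

/-- Charge of the partial cell `n`. -/
def partialCharge (k : ℕ) (n : Fin 2 → ℤ) : ℝ :=
  ∫ y in {y | y ∈ c.cell ∧ c.cornerAt (S.l k) n + S.l k • y ∈ c.sheet.T},
    ∫ z in (-1 : ℝ)..1, S.paramCharge c k (c.cornerAt (S.l k) n + S.l k • y) z

end ChargeSequence

/-! ### Homogenized fields -/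

/-- Candidates for the homogenized fields, written in the parameter plane: free charge `q`,
tangential polarization `p` (components in the chart), normal polarization `p₃`, and surface
charge `σ` (per unit length of `∂Ω`). Only the values of `q, p, p₃` on `closure T`
and of `σ` on `∂T` matter. -/
structure Fields where
  q : E2 → ℝ
  p : E2 → E2
  p₃ : E2 → ℝ
  σ : E2 → ℝ
  continuous_q : Continuous q
  contDiff_p : ContDiff ℝ 1 p
  continuous_p₃ : Continuous p₃

/-- `F` consists of the (weak) limits, as the scales tend to zero, of the cell moments of the
charge distributions with respect to the choice `c`. -/
structure IsHomogenized {α : ℝ} (S : ChargeSequence α) (c : Choice) (F : Fields) : Prop where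
  integrable_σ : IntegrableOn F.σ (frontier c.sheet.T) (μH[1] : Measure E2)
  free_charge : ∀ φ : E2 → ℝ, Continuous φ → HasCompactSupport φ →
    Tendsto (fun k => ∑ᶠ n ∈ c.fullCells (S.l k),
        (c.area * S.l k ^ 2) * (φ (c.cornerAt (S.l k) n) * S.cellCharge c k n))
      atTop (𝓝 (∫ x in c.sheet.T, φ x * F.q x * c.sheet.J₀ x))
  tangential : ∀ φ : E2 → ℝ, Continuous φ → HasCompactSupport φ →
    Tendsto (fun k => ∑ᶠ n ∈ c.fullCells (S.l k),
        (c.area * S.l k ^ 2) • (φ (c.cornerAt (S.l k) n) • S.cellDipole c k n))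
      atTop (𝓝 (∫ x in c.sheet.T, (φ x * c.sheet.J₀ x) • F.p x))
  normal : ∀ φ : E2 → ℝ, Continuous φ → HasCompactSupport φ →
    Tendsto (fun k => ∑ᶠ n ∈ c.fullCells (S.l k),
        (c.area * S.l k ^ 2) * (φ (c.cornerAt (S.l k) n) * S.cellNormalDipole c k n))
      atTop (𝓝 (∫ x in c.sheet.T, φ x * F.p₃ x * c.sheet.J₀ x))
  surface_charge : ∀ φ : E2 → ℝ, Continuous φ → HasCompactSupport φ →
    Tendsto (fun k => ∑ᶠ n ∈ c.partialCells (S.l k),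
        S.l k * (φ (c.cornerAt (S.l k) n) * S.partialCharge c k n))
      atTop (𝓝 (∫ x in frontier c.sheet.T, φ x * F.σ x * c.sheet.lineJ x ∂(μH[1] : Measure E2)))

/-- Tangential polarization as a vector in space, at `ψ₀ x`. -/
def tangentialPolarization (M : Sheet) (F : Fields) (x : E2) : E3 := M.D x (F.p x)

/-- The density `α q - α div_S (J₀ p_p) / J₀` on `Ω`, at `ψ₀ x`. -/
def bulkDensity (α : ℝ) (M : Sheet) (F : Fields) (x : E2) : ℝ :=
  α * F.q x - α * (div2 (fun y => M.J₀ y • F.p y) x / M.J₀ x)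

/-- The density `α (σ + p_p · n)` on `∂Ω`, at `ψ₀ x`, `x ∈ ∂T`. -/
def boundaryDensity (α : ℝ) (M : Sheet) (F : Fields) (x : E2) : ℝ :=
  α * (F.σ x + ⟪tangentialPolarization M F x, M.conormal x⟫)

/-- The distribution `∂𝟙_Ω/∂ν` multiplied by the function `w`:
it sends `φ` to `-∫_Ω w ∂φ/∂ν dS`. -/
def normalDerivIndicator (M : Sheet) (w : E2 → ℝ) (φ : E3 → ℝ) : ℝ :=
  -∫ x in M.T, w x * fderiv ℝ φ (M.ψ₀ x) (M.ν x) * M.J₀ x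

/-- The distribution `(α q - α div_S (J₀ p_p) / J₀) 𝟙_Ω - α² p₃ ∂𝟙_Ω/∂ν`. -/
def bulkSource (α : ℝ) (M : Sheet) (F : Fields) (φ : E3 → ℝ) : ℝ :=
  (∫ x in M.T, bulkDensity α M F x * φ (M.ψ₀ x) * M.J₀ x)
    - α ^ 2 * normalDerivIndicator M F.p₃ φ

/-- The distribution `α (σ + p_p · n) 𝟙_∂Ω`. -/
def boundarySource (α : ℝ) (M : Sheet) (F : Fields) (φ : E3 → ℝ) : ℝ :=
  ∫ x in frontier M.T, boundaryDensity α M F x * φ (M.ψ₀ x) * M.lineJ x ∂(μH[1] : Measure E2)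

/-! ### Poisson's equation, fields and energies -/

/-- Test functions on space. -/
def IsTestFunction (φ : E3 → ℝ) : Prop := ContDiff ℝ ∞ φ ∧ HasCompactSupport φ

/-- `-ΔΦ = D` in the sense of distributions on space, and `Φ → 0` at infinity. -/
def SolvesPoisson (D : (E3 → ℝ) → ℝ) (Φ : E3 → ℝ) : Prop :=
  LocallyIntegrable Φ ∧ Tendsto Φ (cocompact E3) (𝓝 0) ∧
    ∀ φ, IsTestFunction φ → -∫ r, Φ r * Laplacian.laplacian φ r = D φ

/-- The distribution `ρ k / (l k)²`. -/
def ChargeSequence.source {α : ℝ} (S : ChargeSequence α) (k : ℕ) (φ : E3 → ℝ) : ℝ :=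
  ∫ r, S.ρ k r / S.l k ^ 2 * φ r

/-- `Φ` solves the homogenized Poisson problem of the choice `c` with homogenized fields `F`. -/
def SolvesHomogenized (α : ℝ) (c : Choice) (F : Fields) (Φ : E3 → ℝ) : Prop :=
  SolvesPoisson (fun φ => bulkSource α c.sheet F φ + boundarySource α c.sheet F φ) Φ

/-- Weak convergence (in the sense of distributions). -/
def ConvergesWeakly (Φ : ℕ → E3 → ℝ) (Φ₀ : E3 → ℝ) : Prop :=
  ∀ φ, IsTestFunction φ → Tendsto (fun k => ∫ r, Φ k r * φ r) atTop (𝓝 (∫ r, Φ₀ r * φ r))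

/-- `E = -∇Φ` on the open set `W`, in the weak sense. -/
def IsElectricField (W : Set E3) (Φ : E3 → ℝ) (E : E3 → E3) : Prop :=
  LocallyIntegrableOn E W ∧ ∀ X : E3 → E3, ContDiff ℝ ∞ X → HasCompactSupport X → tsupport X ⊆ W →
    ∫ r in W, ⟪E r, X r⟫ = ∫ r, Φ r * div3 X r

/-- Electrostatic energy in the region `W` of the field `E` (possibly infinite). -/
def fieldEnergy (W : Set E3) (E : E3 → E3) : ENNReal :=
  2⁻¹ * ∫⁻ r in W, ‖E r‖ₑ ^ 2

/-- Free charge, tangential polarization and surface charge of two choices all differ: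
the first two at some common points of the manifolds, the last one on a set of positive length. -/
def FieldsDiffer (M : Sheet) (F : Fields) (M' : Sheet) (F' : Fields) : Prop :=
  (∃ x ∈ M.T, ∃ x' ∈ M'.T, M.ψ₀ x = M'.ψ₀ x' ∧ F.q x ≠ F'.q x') ∧
  (∃ x ∈ M.T, ∃ x' ∈ M'.T, M.ψ₀ x = M'.ψ₀ x' ∧
    tangentialPolarization M F x ≠ tangentialPolarization M' F' x') ∧
  ¬ ∀ᵐ x ∂((μH[1] : Measure E2).restrict (frontier M.T)), ∀ x' ∈ frontier M'.T,
    M.ψ₀ x = M'.ψ₀ x' → F.σ x = F'.σ x'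

end TwoDMaterial

end

open TwoDMaterial

open scoped Pointwise

/-! The homogenized source is the limit of the charges themselves, and the charges do not know the
choice. Pulled back by the chart, `ρ / l²` tested with a smooth function is `(h / l) · l⁻¹` times an
integral over `T` of a bounded density. The test function is expanded about the corner of each cell.
In a full cell the linear terms are the dipole moments and the remainder is quadratic in `l`; in a
partial cell only the total charge is kept and the error is linear in `l`. After division by `l` the
first error still tends to zero, and so does the second, because the partial cells crowd towards
`∂T`, which has finite length and hence zero area (`tendsto_testedCharge_sub`). The limits that
define the fields then apply, and the divergence theorem on `T` moves the derivative from the test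
function to the tangential polarization; this produces the term with `div_S` and the flux `p_p · n`
(`mul_multipoleLimit`, `tendsto_source`). Uniqueness of limits makes the total source independent of
the choice (`sources_eq`).

Potentials are constructed by duality: `Φ` is the Newtonian potential of `D` if its pairing with
each test function `φ` is `D (newton φ)`. The Coulomb kernel and its first derivatives are locally
integrable, so Fubini's theorem yields such potentials for surface charges, line charges and
dipoles. Two solutions of Poisson's problem differ by a weakly harmonic function that vanishes at
infinity; its mollifications vanish by the maximum principle (`ae_eq_zero_of_weakly_harmonic`). Weak
convergence of the potentials is convergence of the sources tested with `newton φ`.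

To split the total source into its bulk and boundary parts, it is tested with `η · profile
(height)`. These functions tend to zero uniformly, but their normal derivative on `Ω` remains `η`
and their gradient tends to zero off `Ω`, so that only the dipoles on `Ω` are seen
(`tendsto_bulkSource_probe`). For two sheets this gives `p₃ = p₃' ⟪ν, ν'⟫` as measures, and in both
directions; hence almost everywhere the polarization vanishes or the normals are parallel, and the
dipole distributions agree (`dipole_eq`). Off the two boundaries the charges then agree
(`monopole_eq`). The boundaries have zero area on either sheet, so the bulk sources agree, and
therefore so do the boundary sources. On a common `Ω` the change of parameters and continuity give
the pointwise statements. For the boundary density it must be known that the length measure of `∂Ω`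
does not depend on the chart: Stokes' theorem shows this for the vector measure of tangent times
length, up to orientation, and length is its total variation (`lineMeasure_eq`).

Non-uniqueness comes from the charge `x₀ · wave (x₀ / l) · taper x₁` in a flat film. A cell carries
a charge proportional to the cosine of the phase at its left edge. If these cosines have mean `m`,
the fields are `q = m · taper`, `p_p = m · x₀ · taper` in the direction `e₀`, and `σ = (1 - m) · x₀
· taper · n₀`. The sums `q - div p_p` and `σ + p_p · n` do not involve `m`. Moving the origin, the
chart or the cell by half a period changes `m` from `1` to `-1`; shearing the lattice by half a
period per row changes it to `0` (`isHomogenized_flat`, `fieldsDiffer_flat`). -/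

namespace TwoDMaterial

/-! ### Coordinate derivatives and the Laplacian -/

/-- Coordinate directions of physical space. -/
noncomputable abbrev ax (i : Fin 3) : E3 := EuclideanSpace.single i 1

theorem laplacian_eq_sum {φ : E3 → ℝ} (hφ : ContDiff ℝ 2 φ) (x : E3) :
    Laplacian.laplacian φ x = ∑ i, fderiv ℝ (fun y => fderiv ℝ φ y (ax i)) x (ax i) := by
  have h := congrFun (InnerProductSpace.laplacian_eq_iteratedFDeriv_orthonormalBasis φ
    (EuclideanSpace.basisFun (Fin 3) ℝ)) x
  rw [h]
  refine Finset.sum_congr rfl fun i _ => ?_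
  rw [iteratedFDeriv_two_apply]
  have hd : DifferentiableAt ℝ (fderiv ℝ φ) x :=
    ((hφ.fderiv_right (m := 1) (by norm_num)).differentiable (by norm_num)) x
  rw [fderiv_clm_apply hd (differentiableAt_const _)]
  simp

theorem contDiff_fderiv_apply {E F : Type*} [NormedAddCommGroup E] [NormedSpace ℝ E]
    [NormedAddCommGroup F] [NormedSpace ℝ F] {φ : E → F} {n m : WithTop ℕ∞}
    (hφ : ContDiff ℝ n φ) (hm : m + 1 ≤ n) (v : E) : ContDiff ℝ m fun y => fderiv ℝ φ y v :=
  (hφ.fderiv_right hm).clm_apply contDiff_const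

theorem hasCompactSupport_fderiv_apply {E F : Type*} [NormedAddCommGroup E] [NormedSpace ℝ E]
    [NormedAddCommGroup F] [NormedSpace ℝ F] {φ : E → F}
    (hφ : HasCompactSupport φ) (v : E) : HasCompactSupport fun y => fderiv ℝ φ y v :=
  (hφ.fderiv (𝕜 := ℝ)).comp_left (g := fun L : E →L[ℝ] F => L v) (by simp)

theorem continuous_laplacian {φ : E3 → ℝ} (hφ : ContDiff ℝ 2 φ) :
    Continuous (Laplacian.laplacian φ) := by
  have : Laplacian.laplacian φ =
      fun x => ∑ i, fderiv ℝ (fun y => fderiv ℝ φ y (ax i)) x (ax i) :=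
    funext (laplacian_eq_sum hφ)
  rw [this]
  refine continuous_finsetSum _ fun i _ => ?_
  exact (contDiff_fderiv_apply (m := 0) (contDiff_fderiv_apply (m := 1) hφ (by norm_num) _)
    (by norm_num) _).continuous

theorem hasCompactSupport_laplacian {φ : E3 → ℝ} (hφ : ContDiff ℝ 2 φ) (hc : HasCompactSupport φ) :
    HasCompactSupport (Laplacian.laplacian φ) := by
  have : Laplacian.laplacian φ =
      fun x => ∑ i, fderiv ℝ (fun y => fderiv ℝ φ y (ax i)) x (ax i) :=
    funext (laplacian_eq_sum hφ)
  rw [this]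
  have h := fun i : Fin 3 => hasCompactSupport_fderiv_apply
    (hasCompactSupport_fderiv_apply hc (ax i)) (ax i)
  simp only [Fin.sum_univ_three]
  exact ((h 0).add (h 1)).add (h 2)

theorem fderiv_comp_const_sub {φ : E3 → ℝ} (hφ : Differentiable ℝ φ) (x t v : E3) :
    fderiv ℝ (fun s => φ (x - s)) t v = -fderiv ℝ φ (x - t) v := by
  have h1 : HasFDerivAt (fun s : E3 => x - s) (-ContinuousLinearMap.id ℝ E3) t := by
    simpa using (hasFDerivAt_id t).const_sub x
  have := ((hφ (x - t)).hasFDerivAt.comp t h1).fderiv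
  simp only [Function.comp_def] at this
  rw [this]; simp

/-- The reflection changes the sign of every first derivative and so leaves the second derivatives
alone. This makes `φ (x - ·)` usable as a test function against a weak Laplacian. -/
theorem laplacian_comp_const_sub {φ : E3 → ℝ} (hφ : ContDiff ℝ 2 φ) (x t : E3) :
    Laplacian.laplacian (fun s => φ (x - s)) t = Laplacian.laplacian φ (x - t) := by
  have hφ' : ContDiff ℝ 2 fun s => φ (x - s) := hφ.comp (contDiff_const.sub contDiff_id)
  rw [laplacian_eq_sum hφ, laplacian_eq_sum hφ']
  refine Finset.sum_congr rfl fun i _ => ?_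
  have h1 : (fun y => fderiv ℝ (fun s => φ (x - s)) y (ax i)) =
      fun y => -(fun z => fderiv ℝ φ z (ax i)) (x - y) :=
    funext fun y => fderiv_comp_const_sub (hφ.differentiable (by norm_num)) x y _
  have h2 := fderiv_comp_const_sub ((contDiff_fderiv_apply (m := 1) hφ (by norm_num)
    (ax i)).differentiable (by norm_num)) x t (ax i)
  rw [h1, fderiv_fun_neg]
  simp only [neg_apply]
  rw [h2, neg_neg]

/-! ### Convolution with a test function -/

/-- The integral is written with `t` as the argument of `Φ`, so that for fixed `x` it is the pairing
of `Φ` with the translated and reflected function `f (x - ·)`. -/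
theorem contDiff_conv {f Φ : E3 → ℝ} {n : ℕ∞} (hf : ContDiff ℝ n f) (hc : HasCompactSupport f)
    (hΦ : LocallyIntegrable Φ) : ContDiff ℝ n fun x => ∫ t, f (x - t) * Φ t := by
  have := hc.contDiff_convolution_left (ContinuousLinearMap.mul ℝ ℝ) (n := n) hf hΦ
  have e : (convolution f Φ (ContinuousLinearMap.mul ℝ ℝ) volume) =
      fun x => ∫ t, f (x - t) * Φ t := by
    ext x; rw [convolution_eq_swap]; simp
  rwa [e] at this

theorem fderiv_conv {f Φ : E3 → ℝ} (hf : ContDiff ℝ 1 f) (hc : HasCompactSupport f)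
    (hΦ : LocallyIntegrable Φ) (x v : E3) :
    fderiv ℝ (fun x => ∫ t, f (x - t) * Φ t) x v = ∫ t, fderiv ℝ f (x - t) v * Φ t := by
  have h := hc.hasFDerivAt_convolution_left (ContinuousLinearMap.mul ℝ ℝ) hf hΦ x
  have e : (convolution f Φ (ContinuousLinearMap.mul ℝ ℝ) volume) =
      fun x => ∫ t, f (x - t) * Φ t := by
    ext x; rw [convolution_eq_swap]; simp
  rw [e] at h
  rw [h.fderiv, convolution_eq_swap, ContinuousLinearMap.integral_apply]
  · simp [ContinuousLinearMap.precompL_apply]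
  · have := (hc.fderiv (𝕜 := ℝ)).convolutionExists_left
      (ContinuousLinearMap.precompL E3 (ContinuousLinearMap.mul ℝ ℝ))
      (hf.continuous_fderiv (by norm_num)) hΦ x
    exact this.integrable_swap

theorem laplacian_conv {f Φ : E3 → ℝ} (hf : ContDiff ℝ 2 f) (hc : HasCompactSupport f)
    (hΦ : LocallyIntegrable Φ) (x : E3) :
    Laplacian.laplacian (fun x => ∫ t, f (x - t) * Φ t) x =
      ∫ t, Laplacian.laplacian f (x - t) * Φ t := by
  have h2 : ContDiff ℝ 2 fun x => ∫ t, f (x - t) * Φ t := by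
    exact_mod_cast contDiff_conv (n := 2) (by exact_mod_cast hf) hc hΦ
  rw [laplacian_eq_sum h2]
  have h1 : ∀ i, ContDiff ℝ 1 fun y => fderiv ℝ f y (ax i) := fun i =>
    contDiff_fderiv_apply hf (by norm_num) _
  have hc1 := fun i => hasCompactSupport_fderiv_apply hc (ax i)
  simp only [fderiv_conv (hf.of_le (by norm_num)) hc hΦ]
  have : ∀ i, fderiv ℝ (fun x => ∫ t, fderiv ℝ f (x - t) (ax i) * Φ t) x (ax i) =
      ∫ t, fderiv ℝ (fun y => fderiv ℝ f y (ax i)) (x - t) (ax i) * Φ t := fun i =>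
    fderiv_conv (h1 i) (hc1 i) hΦ x _
  simp only [this]
  rw [← integral_finsetSum]
  · refine integral_congr_ae (Eventually.of_forall fun t => ?_)
    simp only [laplacian_eq_sum hf, Finset.sum_mul]
  · intro i _
    have := (hasCompactSupport_fderiv_apply (hc1 i) (ax i)).convolutionExists_left
      (ContinuousLinearMap.mul ℝ ℝ)
      (contDiff_fderiv_apply (m := 0) (h1 i) (by norm_num) (ax i)).continuous hΦ x
    simpa using this.integrable_swap

/-! ### Maximum principle and Liouville theorem -/

/-- On the line through `x` in direction `v`, a positive second derivative would make the maximum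
also a local minimum; the function would be constant near `0` and its second derivative zero after
all. -/
theorem second_deriv_nonpos_of_isLocalMax {w : E3 → ℝ} (hw : ContDiff ℝ 2 w) {x : E3}
    (hx : IsLocalMax w x) (v : E3) : fderiv ℝ (fun y => fderiv ℝ w y v) x v ≤ 0 := by
  set s : ℝ → ℝ := fun t => w (x + t • v) with hs
  have hline : ∀ t : ℝ, HasDerivAt (fun t : ℝ => x + t • v) v t := fun t => by
    simpa using ((hasDerivAt_id t).smul_const v).const_add x
  have hd : deriv s = fun t => fderiv ℝ w (x + t • v) v := by
    ext t
    exact (((hw.differentiable (by norm_num)) _).hasFDerivAt.comp_hasDerivAt t (hline t)).deriv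
  have hdd : deriv (deriv s) 0 = fderiv ℝ (fun y => fderiv ℝ w y v) x v := by
    rw [hd]
    have h1 := ((contDiff_fderiv_apply (m := 1) hw (by norm_num) v).differentiable
      (by norm_num)) (x + (0 : ℝ) • v)
    have h2 := h1.hasFDerivAt.comp_hasDerivAt (0 : ℝ) (hline 0)
    have := h2.deriv
    simpa [Function.comp_def] using this
  have hmax : IsLocalMax s 0 := by
    have hc : ContinuousAt (fun t : ℝ => x + t • v) 0 := (hline 0).continuousAt
    have hx' : IsLocalMax w (x + (0 : ℝ) • v) := by simpa using hx
    exact IsMaxFilter.comp_tendsto (g := fun t : ℝ => x + t • v) (b := (0 : ℝ)) hx' hc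
  by_contra! hpos
  rw [← hdd] at hpos
  have hsc : Continuous s := by
    have := hw.continuous; fun_prop
  have hmin : IsLocalMin s 0 :=
    isLocalMin_of_deriv_deriv_pos hpos hmax.deriv_eq_zero hsc.continuousAt
  have hconst : s =ᶠ[𝓝 0] fun _ => s 0 := by
    filter_upwards [hmin, hmax] with t h1 h2 using le_antisymm h2 h1
  have h0 : deriv (deriv s) 0 = 0 := by
    have h1 := hconst.deriv
    rw [h1.deriv_eq]
    simp
  linarith

/-- A harmonic function may have a degenerate interior maximum, but `u + δ‖y‖²` has Laplacian `6δ >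
0` and so has no interior maximum at all. -/
theorem nonpos_of_laplacian_eq_zero {u : E3 → ℝ} (hu : ContDiff ℝ 2 u)
    (hΔ : ∀ x, Laplacian.laplacian u x = 0) (h0 : Tendsto u (cocompact E3) (𝓝 0)) (x : E3) :
    u x ≤ 0 := by
  by_contra! hx
  have h1 : ∀ᶠ y in cocompact E3, u y < u x / 2 := h0.eventually (gt_mem_nhds (by linarith))
  obtain ⟨R, hR⟩ : ∃ R : ℝ, ∀ y, R ≤ ‖y‖ → u y < u x / 2 := by
    rw [← Metric.cobounded_eq_cocompact] at h1
    obtain ⟨R, -, hR⟩ := (hasBasis_cobounded_norm (E := E3)).eventually_iff.1 h1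
    exact ⟨R, fun y hy => hR hy⟩
  have hxR : ‖x‖ < R := by
    by_contra! h
    linarith [hR x h]
  have hRpos : 0 < R := (norm_nonneg x).trans_lt hxR
  -- On the sphere of radius `R` the perturbation adds `u x / 4` to values below `u x / 2`, which
  -- stays below `u x`. The maximum over the ball is therefore attained inside.
  set δ := u x / (4 * R ^ 2) with hδ
  have hδpos : 0 < δ := by positivity
  set w : E3 → ℝ := fun y => u y + δ * ‖y‖ ^ 2 with hw
  have hq : ContDiff ℝ 2 (fun y : E3 => δ * ‖y‖ ^ 2) := contDiff_const.mul (contDiff_norm_sq ℝ)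
  have hwc : ContDiff ℝ 2 w := hu.add hq
  obtain ⟨z, hz, hzmax⟩ := (isCompact_closedBall (0 : E3) R).exists_isMaxOn
    ⟨x, by simpa using hxR.le⟩ hwc.continuous.continuousOn
  have hzR : ‖z‖ < R := by
    by_contra! h
    have h2 : ‖z‖ = R := le_antisymm (by simpa using hz) h
    have h3 : w x ≤ w z := hzmax (by simpa using hxR.le)
    have h4 := hR z h
    have h5 : δ * R ^ 2 = u x / 4 := by rw [hδ]; field_simp
    simp only [hw, h2, h5] at h3
    nlinarith [mul_nonneg hδpos.le (sq_nonneg ‖x‖)]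
  have hloc : IsLocalMax w z :=
    hzmax.isLocalMax (Metric.closedBall_mem_nhds_of_mem (by simpa using hzR))
  have hle : Laplacian.laplacian w z ≤ 0 := by
    rw [laplacian_eq_sum hwc]
    exact Finset.sum_nonpos fun i _ => second_deriv_nonpos_of_isLocalMax hwc hloc _
  have hΔq : Laplacian.laplacian (fun y : E3 => δ * ‖y‖ ^ 2) z = 6 * δ := by
    rw [laplacian_eq_sum hq]
    have h1 : ∀ i, (fun y : E3 => fderiv ℝ (fun y : E3 => δ * ‖y‖ ^ 2) y (ax i)) =
        fun y => (2 * δ) * y i := by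
      intro i; ext y
      have := ((hasStrictFDerivAt_norm_sq y).hasFDerivAt.const_mul δ).fderiv
      rw [this]
      simp [EuclideanSpace.inner_single_right]; ring
    simp only [h1]
    have h2 : ∀ i : Fin 3, fderiv ℝ (fun y : E3 => (2 * δ) * y i) z (ax i) = 2 * δ := by
      intro i
      have h3 : HasFDerivAt (fun y : E3 => (2 * δ) * y i)
          ((2 * δ) • (EuclideanSpace.proj i : E3 →L[ℝ] ℝ)) z :=
        ((EuclideanSpace.proj i : E3 →L[ℝ] ℝ).hasFDerivAt).const_mul (2 * δ)
      rw [h3.fderiv]; simp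
    simp only [h2, Finset.sum_const, Finset.card_univ, Fintype.card_fin]
    ring
  have hadd := hu.contDiffAt.laplacian_add (x := z) hq.contDiffAt
  have : Laplacian.laplacian w z = Laplacian.laplacian u z +
    Laplacian.laplacian (fun y : E3 => δ * ‖y‖ ^ 2) z := hadd
  rw [this, hΔ, hΔq] at hle
  linarith

theorem eq_zero_of_laplacian_eq_zero {u : E3 → ℝ} (hu : ContDiff ℝ 2 u)
    (hΔ : ∀ x, Laplacian.laplacian u x = 0) (h0 : Tendsto u (cocompact E3) (𝓝 0)) (x : E3) :
    u x = 0 := by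
  refine le_antisymm (nonpos_of_laplacian_eq_zero hu hΔ h0 x) ?_
  have := nonpos_of_laplacian_eq_zero hu.neg (fun y => ?_) (by simpa using h0.neg) x
  · linarith
  · have h := congrFun (InnerProductSpace.laplacian_neg (f := u)) y
    have h' : Laplacian.laplacian (-u) y = -Laplacian.laplacian u y := h
    change Laplacian.laplacian (-u) y = 0
    rw [h', hΔ, neg_zero]

/-- If the support of `f` lies in the ball of radius `R`, the integral at `x` involves `Φ t` only
for `‖t‖ ≥ ‖x‖ - R`, where it is small. -/
theorem tendsto_conv_cocompact {f Φ : E3 → ℝ} (hf : Continuous f) (hc : HasCompactSupport f)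
    (hΦ : Tendsto Φ (cocompact E3) (𝓝 0)) :
    Tendsto (fun x => ∫ t, f (x - t) * Φ t) (cocompact E3) (𝓝 0) := by
  rw [← Metric.cobounded_eq_cocompact] at hΦ ⊢
  obtain ⟨R, hR⟩ := hc.isCompact.isBounded.exists_norm_le
  have hint : Integrable f := hf.integrable_of_hasCompactSupport hc
  rw [Metric.tendsto_nhds] at hΦ ⊢
  intro ε hε
  set I := ∫ t, ‖f t‖ with hI
  have hI0 : 0 ≤ I := integral_nonneg fun _ => norm_nonneg _
  have hev := hΦ (ε / (I + 1)) (by positivity)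
  obtain ⟨M, -, hM⟩ := (hasBasis_cobounded_norm (E := E3)).eventually_iff.1 hev
  refine (hasBasis_cobounded_norm (E := E3)).eventually_iff.2 ⟨M + R, trivial, fun x hx => ?_⟩
  have hx' : M + R ≤ ‖x‖ := hx
  simp only [dist_zero_right] at hM ⊢
  have hb : ∀ t, ‖f (x - t) * Φ t‖ ≤ ‖f (x - t)‖ * (ε / (I + 1)) := by
    intro t
    rw [norm_mul]
    by_cases h : f (x - t) = 0
    · simp [h]
    · have h1 : ‖x - t‖ ≤ R := hR _ (subset_tsupport f h)
      have h2 : M ≤ ‖t‖ := by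
        have := norm_sub_norm_le x t
        linarith
      gcongr
      exact (hM h2).le
  have hint' : Integrable fun t => ‖f (x - t)‖ * (ε / (I + 1)) :=
    ((hint.comp_sub_left x).norm).mul_const _
  calc ‖∫ t, f (x - t) * Φ t‖ ≤ ∫ t, ‖f (x - t)‖ * (ε / (I + 1)) :=
        norm_integral_le_of_norm_le hint' (Eventually.of_forall hb)
    _ = I * (ε / (I + 1)) := by
        rw [integral_mul_const, hI]
        congr 1
        exact integral_sub_left_eq_self (fun t => ‖f t‖) volume x
    _ < ε := by
        rw [← mul_div_assoc, div_lt_iff₀ (by positivity)]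
        nlinarith

/-- Mollification turns weak harmonicity into harmonicity and keeps the decay at infinity, so every
mollification vanishes identically. With the reflected kernel its value at the origin is the pairing
of `Φ` with `g`. -/
theorem ae_eq_zero_of_weakly_harmonic {Φ : E3 → ℝ} (hΦ : LocallyIntegrable Φ)
    (h0 : Tendsto Φ (cocompact E3) (𝓝 0))
    (hΔ : ∀ φ, IsTestFunction φ → ∫ r, Φ r * Laplacian.laplacian φ r = 0) :
    Φ =ᵐ[volume] 0 := by
  refine ae_eq_zero_of_integral_contDiff_smul_eq_zero hΦ fun g hg hgc => ?_
  set f : E3 → ℝ := fun s => g (-s) with hf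
  have hfs : ContDiff ℝ ∞ f := hg.comp contDiff_neg
  have hfc : HasCompactSupport f := hgc.comp_homeomorph (Homeomorph.neg E3)
  have hf2 : ContDiff ℝ 2 f := by
    exact_mod_cast contDiff_infty.1 hfs 2
  have h2 : ContDiff ℝ 2 fun x => ∫ t, f (x - t) * Φ t := by
    exact_mod_cast contDiff_conv (n := 2) (by exact_mod_cast hf2) hfc hΦ
  have key := eq_zero_of_laplacian_eq_zero h2 (fun x => ?_)
    (tendsto_conv_cocompact hfs.continuous hfc h0) 0
  · simpa [hf] using key
  · rw [laplacian_conv hf2 hfc hΦ]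
    have ht : IsTestFunction fun s => f (x - s) :=
      ⟨hfs.comp (contDiff_const.sub contDiff_id), hfc.comp_homeomorph (Homeomorph.subLeft x)⟩
    rw [← hΔ _ ht]
    refine integral_congr_ae (Eventually.of_forall fun t => ?_)
    simp only [laplacian_comp_const_sub hf2]
    ring

/-! ### The Coulomb kernel -/

/-- A locally integrable bound for the Coulomb kernel and its first derivatives. -/
noncomputable def singBound (r : E3) : ℝ := ‖r‖⁻¹ + (‖r‖⁻¹) ^ 2

theorem singBound_nonneg (r : E3) : 0 ≤ singBound r := by unfold singBound; positivity

/-- The exponents of the singularity, `1` and `2`, are smaller than the dimension `3`. -/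
theorem integrableOn_singBound (R : ℝ) : IntegrableOn singBound (Metric.ball 0 R) := by
  have h : ∀ (a : ℕ), a < 3 → IntegrableOn (fun r : E3 => (‖r‖⁻¹) ^ a) (Metric.ball 0 R) := by
    intro a ha
    refine integrableOn_ball_of_norm_le_rpow (C := 1) (α := a) (by simp) (by simpa using ha) ?_
      (by fun_prop)
    refine Eventually.of_forall fun r => ?_
    rw [Real.rpow_neg (norm_nonneg _), Real.rpow_natCast]
    simp
  have h1 := h 1 (by norm_num)
  simp only [pow_one] at h1
  exact h1.add (h 2 (by norm_num))

/-- The integral of `singBound` over the ball of radius `R`. -/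
noncomputable def singMass (R : ℝ) : ℝ := ∫ r in Metric.ball (0 : E3) R, singBound r

theorem integrable_kernel_mul {κ h : E3 → ℝ} (hκ : Measurable κ) (hκb : ∀ r, |κ r| ≤ singBound r)
    (hh : Measurable h) {C R : ℝ} (hC : ∀ r, |h r| ≤ C) (hR : ∀ r, R ≤ ‖r‖ → h r = 0) :
    Integrable fun r => κ r * h r := by
  have hC0 : 0 ≤ C := (abs_nonneg _).trans (hC 0)
  have hi : Integrable ((Metric.ball (0 : E3) R).indicator fun r => singBound r * C) :=
    (integrable_indicator_iff Metric.isOpen_ball.measurableSet).2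
      ((integrableOn_singBound R).mul_const C)
  refine hi.mono' (hκ.mul hh).aestronglyMeasurable (Eventually.of_forall fun r => ?_)
  by_cases hr : r ∈ Metric.ball (0 : E3) R
  · rw [indicator_of_mem hr, norm_mul]
    exact mul_le_mul (hκb r) (hC r) (abs_nonneg _) (singBound_nonneg r)
  · rw [indicator_of_notMem hr, hR r (by simpa using hr)]
    simp

/-- The bound sees `h` only through its supremum and the radius outside which it vanishes. It is
thus uniform under bounded translations, which is what Fubini's theorem will require. -/
theorem integral_kernel_mul_le {κ h : E3 → ℝ} (hκb : ∀ r, |κ r| ≤ singBound r)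
    {C R : ℝ} (hC : ∀ r, |h r| ≤ C) (hR : ∀ r, R ≤ ‖r‖ → h r = 0) :
    ∫ r, ‖κ r * h r‖ ≤ singMass R * C := by
  have hC0 : 0 ≤ C := (abs_nonneg _).trans (hC 0)
  have hi : Integrable ((Metric.ball (0 : E3) R).indicator fun r => singBound r * C) :=
    (integrable_indicator_iff Metric.isOpen_ball.measurableSet).2
      ((integrableOn_singBound R).mul_const C)
  have hle : ∀ r, ‖κ r * h r‖ ≤ (Metric.ball (0 : E3) R).indicator
      (fun r => singBound r * C) r := by
    intro r
    by_cases hr : r ∈ Metric.ball (0 : E3) R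
    · rw [indicator_of_mem hr, norm_mul]
      exact mul_le_mul (hκb r) (hC r) (abs_nonneg _) (singBound_nonneg r)
    · rw [indicator_of_notMem hr, hR r (by simpa using hr)]
      simp
  calc ∫ r, ‖κ r * h r‖ ≤ ∫ r, (Metric.ball (0 : E3) R).indicator (fun r => singBound r * C) r :=
        integral_mono_of_nonneg (Eventually.of_forall fun _ => norm_nonneg _) hi
          (Eventually.of_forall hle)
    _ = singMass R * C := by
        rw [integral_indicator Metric.isOpen_ball.measurableSet, integral_mul_const, singMass]

theorem exists_bound_of_hasCompactSupport {E F : Type*} [NormedAddCommGroup E]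
    [NormedAddCommGroup F] {h : E → F} (hh : Continuous h) (hc : HasCompactSupport h) :
    ∃ C R, 0 ≤ C ∧ 0 < R ∧ (∀ r, ‖h r‖ ≤ C) ∧ ∀ r, R ≤ ‖r‖ → h r = 0 := by
  obtain ⟨C, hC⟩ := hc.exists_bound_of_continuous hh
  obtain ⟨R, hR⟩ := hc.isCompact.isBounded.exists_norm_le
  refine ⟨C, |R| + 1, (norm_nonneg _).trans (hC 0), by positivity, hC, fun r hr => ?_⟩
  by_contra hne
  have := hR r (subset_tsupport h hne)
  linarith [le_abs_self R]

/-- The regularized squared distance. -/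
noncomputable def regSq (ε : ℝ) (r : E3) : ℝ := ‖r‖ ^ 2 + ε ^ 2

theorem regSq_pos {ε : ℝ} (hε : 0 < ε) (r : E3) : 0 < regSq ε r := by unfold regSq; positivity

theorem hasFDerivAt_regSq_rpow {ε : ℝ} (hε : 0 < ε) (a : ℝ) (r : E3) :
    HasFDerivAt (fun r => regSq ε r ^ a)
      ((a * regSq ε r ^ (a - 1)) • (2 • innerSL ℝ r)) r := by
  have h := (hasStrictFDerivAt_norm_sq r).hasFDerivAt.add_const (ε ^ 2)
  exact h.rpow_const (p := a) (Or.inl (regSq_pos hε r).ne')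

theorem contDiff_regSq_rpow {ε : ℝ} (hε : 0 < ε) (a : ℝ) :
    ContDiff ℝ 2 fun r => regSq ε r ^ a := by
  have h : ContDiff ℝ 2 (regSq ε) := (contDiff_norm_sq ℝ).add contDiff_const
  exact h.rpow_const_of_ne fun r => (regSq_pos hε r).ne'

/-- Integration by parts against a compactly supported function. -/
theorem integral_mul_fderiv_of_hasCompactSupport {E : Type*} [NormedAddCommGroup E]
    [NormedSpace ℝ E] [FiniteDimensional ℝ E] [MeasurableSpace E] [BorelSpace E]
    {μ : Measure E} [μ.IsAddHaarMeasure] {f g : E → ℝ} (hf : ContDiff ℝ 1 f) (hg : ContDiff ℝ 1 g)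
    (hgc : HasCompactSupport g) (v : E) :
    ∫ r, f r * fderiv ℝ g r v ∂μ = -∫ r, fderiv ℝ f r v * g r ∂μ := by
  have h1 : Continuous fun r => fderiv ℝ f r v :=
    (contDiff_fderiv_apply (m := 0) hf (by norm_num) v).continuous
  have h2 : Continuous fun r => fderiv ℝ g r v :=
    (contDiff_fderiv_apply (m := 0) hg (by norm_num) v).continuous
  refine integral_mul_fderiv_eq_neg_fderiv_mul_of_integrable ?_ ?_ ?_
    (fun x _ => hf.differentiable (by norm_num) x) (fun x _ => hg.differentiable (by norm_num) x)
  · exact (h1.mul hg.continuous).integrable_of_hasCompactSupport hgc.mul_left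
  · exact (hf.continuous.mul h2).integrable_of_hasCompactSupport
      (hasCompactSupport_fderiv_apply hgc v).mul_left
  · exact (hf.continuous.mul hg.continuous).integrable_of_hasCompactSupport hgc.mul_left

theorem regSq_ge {ε : ℝ} (r : E3) : ‖r‖ ^ 2 ≤ regSq ε r := by
  unfold regSq; nlinarith [sq_nonneg ε]

theorem regSq_rpow_nonneg (ε : ℝ) (r : E3) (a : ℝ) : 0 ≤ regSq ε r ^ a :=
  Real.rpow_nonneg (by unfold regSq; positivity) _

theorem norm_sq_rpow (r : E3) (a : ℝ) : (‖r‖ ^ 2) ^ a = ‖r‖ ^ (2 * a) := by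
  rw [← Real.rpow_natCast, ← Real.rpow_mul (norm_nonneg _)]; norm_num

theorem tendsto_regSq_rpow {r : E3} (hr : r ≠ 0) (a : ℝ) :
    Tendsto (fun n : ℕ => regSq (1 / ((n : ℝ) + 1)) r ^ a) atTop (𝓝 ((‖r‖ ^ 2) ^ a)) := by
  have h : Tendsto (fun n : ℕ => regSq (1 / ((n : ℝ) + 1)) r) atTop (𝓝 (‖r‖ ^ 2)) := by
    have := (tendsto_one_div_add_atTop_nhds_zero_nat (𝕜 := ℝ)).pow 2
    simpa [regSq] using this.const_add (‖r‖ ^ 2)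
  exact h.rpow_const (Or.inl (by positivity))

theorem regSq_rpow_le {ε : ℝ} {r : E3} (hr : r ≠ 0) {a : ℝ} (ha : 0 ≤ a) :
    regSq ε r ^ (-a) ≤ (‖r‖ ^ 2) ^ (-a) := by
  have h : 0 < ‖r‖ ^ 2 := by positivity
  exact Real.rpow_le_rpow_of_nonpos h (regSq_ge r) (by linarith)

theorem norm_sq_rpow_neg_half (r : E3) : (‖r‖ ^ 2) ^ (-(1 / 2) : ℝ) = ‖r‖⁻¹ := by
  rw [norm_sq_rpow, show (2 * (-(1 / 2)) : ℝ) = -1 by norm_num, Real.rpow_neg_one]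

theorem norm_sq_rpow_neg_three_half (r : E3) : (‖r‖ ^ 2) ^ (-(3 / 2) : ℝ) = (‖r‖⁻¹) ^ 3 := by
  rw [norm_sq_rpow, show (2 * (-(3 / 2)) : ℝ) = -((3 : ℕ) : ℝ) by norm_num,
    Real.rpow_neg (norm_nonneg _), Real.rpow_natCast, inv_pow]

/-- The derivative of the Coulomb kernel in direction `v`, up to sign. -/
noncomputable def dipoleKernel (v r : E3) : ℝ := ⟪r, v⟫ * (‖r‖⁻¹) ^ 3

theorem measurable_dipoleKernel (v : E3) : Measurable (dipoleKernel v) := by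
  unfold dipoleKernel; fun_prop

theorem abs_dipoleKernel_le {v : E3} (hv : ‖v‖ ≤ 1) (r : E3) : |dipoleKernel v r| ≤ singBound r := by
  rcases eq_or_ne r 0 with rfl | hr
  · simp [dipoleKernel, singBound]
  have hn : 0 < ‖r‖ := norm_pos_iff.2 hr
  have h1 : |⟪r, v⟫| ≤ ‖r‖ := (abs_real_inner_le_norm r v).trans
    (by nlinarith [norm_nonneg v])
  calc |dipoleKernel v r| = |⟪r, v⟫| * (‖r‖⁻¹) ^ 3 := by
        rw [dipoleKernel, abs_mul, abs_of_nonneg (by positivity : 0 ≤ (‖r‖⁻¹) ^ 3)]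
    _ ≤ ‖r‖ * (‖r‖⁻¹) ^ 3 := by gcongr
    _ = (‖r‖⁻¹) ^ 2 := by field_simp
    _ ≤ singBound r := by unfold singBound; linarith [inv_nonneg.2 hn.le]

theorem abs_inv_norm_le (r : E3) : |‖r‖⁻¹| ≤ singBound r := by
  rw [abs_of_nonneg (by positivity)]
  unfold singBound
  nlinarith [sq_nonneg (‖r‖⁻¹)]

theorem ae_ne_zero_E3 : ∀ᵐ r : E3, r ≠ 0 := by
  simp [ae_iff, measure_singleton]

theorem tendsto_integral_regSq_neg_half {g : E3 → ℝ} (hg : Continuous g)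
    (hgc : HasCompactSupport g) :
    Tendsto (fun n : ℕ => ∫ r, regSq (1 / ((n : ℝ) + 1)) r ^ (-(1 / 2) : ℝ) * g r) atTop
      (𝓝 (∫ r, ‖r‖⁻¹ * g r)) := by
  obtain ⟨C, R, -, -, hC, hR⟩ := exists_bound_of_hasCompactSupport hg hgc
  have hi : Integrable fun r : E3 => ‖r‖⁻¹ * |g r| :=
    integrable_kernel_mul (κ := fun r => ‖r‖⁻¹) (by fun_prop) abs_inv_norm_le
      hg.abs.measurable (C := C) (R := R) (by simpa using hC) (fun r hr => by simp [hR r hr])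
  refine tendsto_integral_of_dominated_convergence _ (fun n => ?_) hi (fun n => ?_) ?_
  · have hpos : (0 : ℝ) < 1 / ((n : ℝ) + 1) := by positivity
    exact ((contDiff_regSq_rpow hpos _).continuous.mul hg).aestronglyMeasurable
  · filter_upwards [ae_ne_zero_E3] with r hr
    rw [norm_mul, Real.norm_eq_abs, Real.norm_eq_abs, abs_of_nonneg
      (regSq_rpow_nonneg _ _ _), ← norm_sq_rpow_neg_half]
    exact mul_le_mul_of_nonneg_right (regSq_rpow_le hr (by norm_num)) (abs_nonneg _)
  · filter_upwards [ae_ne_zero_E3] with r hr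
    rw [← norm_sq_rpow_neg_half]
    exact (tendsto_regSq_rpow hr _).mul_const _

theorem fderiv_regSq_neg_half {ε : ℝ} (hε : 0 < ε) (r v : E3) :
    fderiv ℝ (fun r => regSq ε r ^ (-(1 / 2) : ℝ)) r v =
      -(⟪r, v⟫ * regSq ε r ^ (-(3 / 2) : ℝ)) := by
  rw [(hasFDerivAt_regSq_rpow hε _ r).fderiv]
  simp
  rw [show (-2⁻¹ - 1 : ℝ) = -(3 / 2) by norm_num]
  ring

/-- Integration by parts against the Coulomb kernel. -/
theorem integral_inv_norm_mul_fderiv {g : E3 → ℝ} (hg : ContDiff ℝ 1 g)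
    (hgc : HasCompactSupport g) {v : E3} (hv : ‖v‖ ≤ 1) :
    ∫ r, ‖r‖⁻¹ * fderiv ℝ g r v = ∫ r, dipoleKernel v r * g r := by
  have hgv : Continuous fun r => fderiv ℝ g r v :=
    (contDiff_fderiv_apply (m := 0) hg (by norm_num) v).continuous
  -- The kernel is singular at the origin. Integration by parts is carried out for the smooth
  -- kernels `regSq ε r ^ (-1/2)`, and both sides converge by domination as `ε → 0`.
  have h1 := tendsto_integral_regSq_neg_half hgv (hasCompactSupport_fderiv_apply hgc v)
  refine tendsto_nhds_unique h1 ?_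
  obtain ⟨C, R, -, -, hC, hR⟩ := exists_bound_of_hasCompactSupport hg.continuous hgc
  have hi : Integrable fun r : E3 => ‖dipoleKernel v r * g r‖ :=
    (integrable_kernel_mul (measurable_dipoleKernel v) (abs_dipoleKernel_le hv)
      hg.continuous.measurable (C := C) (R := R) (by simpa using hC) hR).norm
  have e : ∀ n : ℕ, ∫ r, regSq (1 / ((n : ℝ) + 1)) r ^ (-(1 / 2) : ℝ) * fderiv ℝ g r v =
      ∫ r, (⟪r, v⟫ * regSq (1 / ((n : ℝ) + 1)) r ^ (-(3 / 2) : ℝ)) * g r := by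
    intro n
    have hpos : (0 : ℝ) < 1 / ((n : ℝ) + 1) := by positivity
    rw [integral_mul_fderiv_of_hasCompactSupport ((contDiff_regSq_rpow hpos _).of_le
      (by norm_num)) hg hgc, ← integral_neg]
    refine integral_congr_ae (Eventually.of_forall fun r => ?_)
    simp only [fderiv_regSq_neg_half hpos]
    ring
  simp only [e]
  refine tendsto_integral_of_dominated_convergence _ (fun n => ?_) hi (fun n => ?_) ?_
  · have hpos : (0 : ℝ) < 1 / ((n : ℝ) + 1) := by positivity
    have hc1 := (contDiff_regSq_rpow hpos (-(3 / 2))).continuous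
    have hc2 := hg.continuous
    exact Continuous.aestronglyMeasurable (by fun_prop)
  · filter_upwards [ae_ne_zero_E3] with r hr
    rw [norm_mul, norm_mul, dipoleKernel, norm_mul, norm_mul, ← norm_sq_rpow_neg_three_half,
      Real.norm_of_nonneg (regSq_rpow_nonneg _ _ _),
      Real.norm_of_nonneg (Real.rpow_nonneg (by positivity) _)]
    exact mul_le_mul_of_nonneg_right (mul_le_mul_of_nonneg_left
      (regSq_rpow_le hr (by norm_num)) (norm_nonneg _)) (norm_nonneg _)
  · filter_upwards [ae_ne_zero_E3] with r hr
    rw [dipoleKernel, ← norm_sq_rpow_neg_three_half]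
    exact ((tendsto_regSq_rpow hr _).const_mul _).mul_const _

/-- The normalization constant of the Coulomb kernel (it equals `4π`). -/
noncomputable def coulombConst : ℝ := ∫ s : E3, 3 * regSq 1 s ^ (-(5 / 2) : ℝ)

theorem integrable_regSq_one : Integrable fun s : E3 => 3 * regSq 1 s ^ (-(5 / 2) : ℝ) := by
  have h := (integrable_rpow_neg_one_add_norm_sq (E := E3) (μ := volume) (r := 5)
    (by simp; norm_num)).const_mul 3
  refine h.congr (Eventually.of_forall fun s => ?_)
  simp only [regSq]
  rw [show ((-5 / 2 : ℝ)) = -(5 / 2) by norm_num, one_pow, add_comm]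

theorem coulombConst_pos : 0 < coulombConst := by
  unfold coulombConst
  rw [integral_pos_iff_support_of_nonneg _ integrable_regSq_one]
  · have : Function.support (fun s : E3 => 3 * regSq 1 s ^ (-(5 / 2) : ℝ)) = univ := by
      ext s
      simp only [Function.mem_support, mem_univ, iff_true]
      have := Real.rpow_pos_of_pos (regSq_pos one_pos s) (-(5 / 2))
      positivity
    rw [this]
    simp
  · intro s
    have := Real.rpow_pos_of_pos (regSq_pos one_pos s) (-(5 / 2))
    simp only [Pi.zero_apply]
    positivity

theorem regSq_smul {ε : ℝ} (hε : 0 < ε) (s : E3) : regSq ε (ε • s) = ε ^ 2 * regSq 1 s := by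
  unfold regSq
  rw [norm_smul, Real.norm_of_nonneg hε.le]; ring

/-- The Laplacian of `(‖r‖² + ε²)^(-1/2)` is `-3 ε² (‖r‖² + ε²)^(-5/2)`. Under `r = ε • s` this
becomes a fixed integrable profile, so it is an approximate identity as `ε → 0`. -/
theorem integral_regSq_laplacian {ε : ℝ} (hε : 0 < ε) {φ : E3 → ℝ} (hφ : ContDiff ℝ 2 φ)
    (hc : HasCompactSupport φ) :
    ∫ r, regSq ε r ^ (-(1 / 2) : ℝ) * Laplacian.laplacian φ r =
      -∫ s, 3 * regSq 1 s ^ (-(5 / 2) : ℝ) * φ (ε • s) := by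
  have hK := contDiff_regSq_rpow hε (-(1 / 2))
  have hK3 := contDiff_regSq_rpow hε (-(3 / 2))
  have hφ1 : ∀ i, ContDiff ℝ 1 fun y => fderiv ℝ φ y (ax i) := fun i =>
    contDiff_fderiv_apply hφ (by norm_num) _
  have hc1 := fun i => hasCompactSupport_fderiv_apply hc (ax i)
  have hpos : ∀ r, 0 < regSq ε r := regSq_pos hε
  have hG : ∀ i : Fin 3, ContDiff ℝ 1 fun r : E3 => r i * regSq ε r ^ (-(3 / 2) : ℝ) := fun i =>
    ((EuclideanSpace.proj i : E3 →L[ℝ] ℝ).contDiff).mul (hK3.of_le (by norm_num))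
  have hGd : ∀ (i : Fin 3) (r : E3),
      fderiv ℝ (fun r : E3 => r i * regSq ε r ^ (-(3 / 2) : ℝ)) r (ax i) =
        regSq ε r ^ (-(3 / 2) : ℝ) - 3 * (r i) ^ 2 * regSq ε r ^ (-(5 / 2) : ℝ) := by
    intro i r
    have h1 : HasFDerivAt (fun r : E3 => r i) (EuclideanSpace.proj i : E3 →L[ℝ] ℝ) r :=
      (EuclideanSpace.proj i : E3 →L[ℝ] ℝ).hasFDerivAt
    rw [(h1.fun_mul (hasFDerivAt_regSq_rpow hε (-(3 / 2)) r)).fderiv]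
    simp [EuclideanSpace.inner_single_right]
    rw [show (-(3 / 2) - 1 : ℝ) = -(5 / 2) by norm_num]
    ring
  have step : ∀ i : Fin 3, ∫ r, regSq ε r ^ (-(1 / 2) : ℝ) *
      fderiv ℝ (fun y => fderiv ℝ φ y (ax i)) r (ax i) =
      -∫ r, (regSq ε r ^ (-(3 / 2) : ℝ) - 3 * (r i) ^ 2 * regSq ε r ^ (-(5 / 2) : ℝ)) * φ r := by
    intro i
    rw [integral_mul_fderiv_of_hasCompactSupport (hK.of_le (by norm_num)) (hφ1 i) (hc1 i)]
    have e : ∀ r, fderiv ℝ (fun r => regSq ε r ^ (-(1 / 2) : ℝ)) r (ax i) * fderiv ℝ φ r (ax i) =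
        -((r i * regSq ε r ^ (-(3 / 2) : ℝ)) * fderiv ℝ φ r (ax i)) := by
      intro r
      rw [fderiv_regSq_neg_half hε]
      simp [EuclideanSpace.inner_single_right]
    simp only [e]
    rw [integral_neg, neg_neg,
      integral_mul_fderiv_of_hasCompactSupport (hG i) (hφ.of_le (by norm_num)) hc]
    simp only [hGd]
  have hint : ∀ i : Fin 3, Integrable fun r => regSq ε r ^ (-(1 / 2) : ℝ) *
      fderiv ℝ (fun y => fderiv ℝ φ y (ax i)) r (ax i) := fun i =>
    (hK.continuous.mul (contDiff_fderiv_apply (m := 0) (hφ1 i) (by norm_num)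
      _).continuous).integrable_of_hasCompactSupport
      (hasCompactSupport_fderiv_apply (hc1 i) _).mul_left
  have hint2 : ∀ i : Fin 3, Integrable fun r : E3 => (regSq ε r ^ (-(3 / 2) : ℝ) -
      3 * (r i) ^ 2 * regSq ε r ^ (-(5 / 2) : ℝ)) * φ r := by
    intro i
    have c5 := (contDiff_regSq_rpow hε (-(5 / 2))).continuous
    have c3 := hK3.continuous
    have cφ := hφ.continuous
    refine Continuous.integrable_of_hasCompactSupport (by fun_prop) hc.mul_left
  have e0 : ∀ r, regSq ε r ^ (-(1 / 2) : ℝ) * Laplacian.laplacian φ r =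
      ∑ i, regSq ε r ^ (-(1 / 2) : ℝ) * fderiv ℝ (fun y => fderiv ℝ φ y (ax i)) r (ax i) := by
    intro r; rw [laplacian_eq_sum hφ, Finset.mul_sum]
  simp only [e0]
  rw [integral_finsetSum _ fun i _ => hint i]
  simp only [step]
  rw [Finset.sum_neg_distrib, ← integral_finsetSum _ fun i _ => hint2 i]
  congr 1
  -- The three summands give `3 regSq^(-3/2) - 3 ‖r‖² regSq^(-5/2)`. With the first term written as
  -- `3 (‖r‖² + ε²) regSq^(-5/2)` only the part with `ε²` survives.
  have e1 : ∀ r : E3, ∑ i, (regSq ε r ^ (-(3 / 2) : ℝ) -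
      3 * (r i) ^ 2 * regSq ε r ^ (-(5 / 2) : ℝ)) * φ r =
      3 * ε ^ 2 * regSq ε r ^ (-(5 / 2) : ℝ) * φ r := by
    intro r
    have h1 : regSq ε r ^ (-(3 / 2) : ℝ) = regSq ε r * regSq ε r ^ (-(5 / 2) : ℝ) := by
      rw [show (-(3 / 2) : ℝ) = 1 + -(5 / 2) by norm_num, Real.rpow_add (hpos r), Real.rpow_one]
    have h2 : ‖r‖ ^ 2 = r 0 ^ 2 + r 1 ^ 2 + r 2 ^ 2 := by
      rw [EuclideanSpace.real_norm_sq_eq, Fin.sum_univ_three]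
    rw [Fin.sum_univ_three, h1]
    have h3 : regSq ε r = r 0 ^ 2 + r 1 ^ 2 + r 2 ^ 2 + ε ^ 2 := by rw [regSq, h2]
    generalize regSq ε r ^ (-(5 / 2) : ℝ) = A
    rw [h3]; ring
  simp only [e1]
  have hsc := Measure.integral_comp_smul (volume : Measure E3)
    (fun r : E3 => 3 * ε ^ 2 * regSq ε r ^ (-(5 / 2) : ℝ) * φ r) ε
  have e2 : ∀ s : E3, 3 * ε ^ 2 * regSq ε (ε • s) ^ (-(5 / 2) : ℝ) * φ (ε • s) =
      (ε ^ 3)⁻¹ * (3 * regSq 1 s ^ (-(5 / 2) : ℝ) * φ (ε • s)) := by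
    intro s
    rw [regSq_smul hε, Real.mul_rpow (by positivity) (regSq_pos one_pos s).le,
      ← Real.rpow_natCast, ← Real.rpow_mul hε.le]
    rw [show ((2 : ℕ) : ℝ) * (-(5 / 2)) = -((5 : ℕ) : ℝ) by norm_num, Real.rpow_neg hε.le,
      Real.rpow_natCast, Real.rpow_natCast]
    field_simp
  simp only [e2] at hsc
  rw [integral_const_mul] at hsc
  simp only [finrank_euclideanSpace, Fintype.card_fin, smul_eq_mul] at hsc
  rw [abs_of_pos (by positivity)] at hsc
  exact (mul_left_cancel₀ (by positivity) hsc).symm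

/-- The Coulomb kernel is a fundamental solution of the Laplacian. -/
theorem integral_inv_norm_laplacian {φ : E3 → ℝ} (hφ : ContDiff ℝ 2 φ)
    (hc : HasCompactSupport φ) :
    ∫ r, ‖r‖⁻¹ * Laplacian.laplacian φ r = -(coulombConst * φ 0) := by
  have h1 := tendsto_integral_regSq_neg_half (continuous_laplacian hφ)
    (hasCompactSupport_laplacian hφ hc)
  refine tendsto_nhds_unique h1 ?_
  have e : ∀ n : ℕ, _ := fun n : ℕ => integral_regSq_laplacian
    (ε := 1 / ((n : ℝ) + 1)) (by positivity) hφ hc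
  simp only [e]
  refine Tendsto.neg ?_
  rw [coulombConst, ← integral_mul_const]
  obtain ⟨C, R, -, -, hC, hR⟩ := exists_bound_of_hasCompactSupport hφ.continuous hc
  refine tendsto_integral_of_dominated_convergence
    (fun s => 3 * regSq 1 s ^ (-(5 / 2) : ℝ) * C) (fun n => ?_)
    (integrable_regSq_one.mul_const C) (fun n => ?_) ?_
  · have c5 := (contDiff_regSq_rpow one_pos (-(5 / 2))).continuous
    have cφ := hφ.continuous
    exact Continuous.aestronglyMeasurable (by fun_prop)
  · refine Eventually.of_forall fun s => ?_
    have := Real.rpow_pos_of_pos (regSq_pos one_pos s) (-(5 / 2))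
    rw [norm_mul, Real.norm_of_nonneg (by positivity)]
    gcongr
    exact hC _
  · refine Eventually.of_forall fun s => ?_
    refine Tendsto.const_mul _ ?_
    have h2 : Tendsto (fun n : ℕ => (1 / ((n : ℝ) + 1)) • s) atTop (𝓝 ((0 : ℝ) • s)) :=
      (tendsto_one_div_add_atTop_nhds_zero_nat (𝕜 := ℝ)).smul_const s
    rw [zero_smul] at h2
    exact (hφ.continuous.tendsto 0).comp h2

/-! ### Potentials of charges and dipoles -/

section Potential

variable {X : Type*} [MeasurableSpace X]

/-- The potential with kernel `κ` of the charge `f μ`, placed in space by `g`. -/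
noncomputable def potential (μ : Measure X) (g : X → E3) (f : X → ℝ) (κ : E3 → ℝ) (r : E3) : ℝ :=
  ∫ x, f x * κ (r - g x) ∂μ

variable {μ : Measure X} {g : X → E3} {f : X → ℝ} {κ : E3 → ℝ}

theorem integrable_prod_kernel (hg : AEMeasurable g μ) (hf : Integrable f μ)
    (hκ : Measurable κ) (hκb : ∀ r, |κ r| ≤ singBound r) {R : ℝ} (hgR : ∀ᵐ x ∂μ, ‖g x‖ ≤ R)
    {h : E3 → ℝ} (hh : Measurable h) {C M : ℝ} (hC : ∀ r, |h r| ≤ C)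
    (hM : ∀ r, M ≤ ‖r‖ → h r = 0) :
    Integrable (fun p : X × E3 => f p.1 * κ (p.2 - g p.1) * h p.2) (μ.prod volume) := by
  have hmeas : AEStronglyMeasurable (fun p : X × E3 => f p.1 * κ (p.2 - g p.1) * h p.2)
      (μ.prod volume) := by
    have h1 : AEMeasurable (fun p : X × E3 => p.2 - g p.1) (μ.prod volume) :=
      measurable_snd.aemeasurable.sub hg.comp_fst
    exact ((hf.aestronglyMeasurable.comp_fst).mul
      (hκ.comp_aemeasurable h1).aestronglyMeasurable).mul
      (hh.comp measurable_snd).aestronglyMeasurable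
  -- A translation by `a` moves the support of `h` by at most `R`, so the inner integrals are
  -- bounded independently of the position of the source point.
  have key : ∀ a : E3, ‖a‖ ≤ R → (Integrable (fun r => κ (r - a) * h r)) ∧
      ∫ r, ‖κ (r - a) * h r‖ ≤ singMass (M + R) * C := by
    intro a ha
    have hh' : Measurable fun r => h (r + a) := hh.comp (measurable_id.add_const a)
    have hM' : ∀ r : E3, M + R ≤ ‖r‖ → h (r + a) = 0 := by
      intro r hr
      refine hM _ ?_
      have := norm_sub_norm_le r (-a)
      rw [norm_neg, sub_neg_eq_add] at this
      linarith
    have i1 := integrable_kernel_mul hκ hκb hh' (fun r => hC (r + a)) hM'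
    have i2 := integral_kernel_mul_le hκb (fun r => hC (r + a)) hM'
    constructor
    · simpa using i1.comp_sub_right a
    · calc ∫ r, ‖κ (r - a) * h r‖ = ∫ r, (fun r => ‖κ r * h (r + a)‖) (r - a) := by simp
        _ = ∫ r, ‖κ r * h (r + a)‖ :=
          integral_sub_right_eq_self (fun r => ‖κ r * h (r + a)‖) a
        _ ≤ _ := i2
  rw [integrable_prod_iff hmeas]
  constructor
  · filter_upwards [hgR] with x hx
    simpa only [mul_assoc] using (key _ hx).1.const_mul (f x)
  · refine (hf.norm.mul_const (singMass (M + R) * C)).mono' hmeas.norm.integral_prod_right' ?_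
    filter_upwards [hgR] with x hx
    rw [Real.norm_of_nonneg (integral_nonneg fun _ => norm_nonneg _)]
    have : ∀ r, ‖f x * κ (r - g x) * h r‖ = ‖f x‖ * ‖κ (r - g x) * h r‖ := fun r => by
      rw [mul_assoc, norm_mul]
    simp only [this]
    rw [integral_const_mul]
    exact mul_le_mul_of_nonneg_left (key _ hx).2 (norm_nonneg _)

/-- Fubini's theorem is applied with the indicator of a large ball as the bounded factor `h`. -/
theorem locallyIntegrable_potential [SFinite μ] (hg : AEMeasurable g μ) (hf : Integrable f μ)
    (hκ : Measurable κ) (hκb : ∀ r, |κ r| ≤ singBound r) {R : ℝ} (hgR : ∀ᵐ x ∂μ, ‖g x‖ ≤ R) :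
    LocallyIntegrable (potential μ g f κ) := by
  rw [locallyIntegrable_iff]
  intro K hK
  obtain ⟨M, hM⟩ := hK.isBounded.exists_norm_le
  have hB : MeasurableSet (Metric.ball (0 : E3) (M + 1)) := Metric.isOpen_ball.measurableSet
  have h1 := (integrable_prod_kernel hg hf hκ hκb hgR
    (h := (Metric.ball (0 : E3) (M + 1)).indicator fun _ => 1) (measurable_const.indicator hB)
    (C := 1) (M := M + 1) (fun r => by
      by_cases hr : r ∈ Metric.ball (0 : E3) (M + 1) <;> simp [hr])
    (fun r hr => by simp [hr])).integral_prod_right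
  simp only [integral_mul_const] at h1
  have h2 : IntegrableOn (potential μ g f κ) (Metric.ball 0 (M + 1)) := by
    rw [← integrable_indicator_iff hB]
    refine h1.congr (Eventually.of_forall fun r => ?_)
    by_cases hr : r ∈ Metric.ball (0 : E3) (M + 1) <;> simp [hr, potential]
  exact h2.mono_set fun r hr => by simpa using (hM r hr).trans_lt (by linarith)

theorem integral_potential_mul [SFinite μ] (hg : AEMeasurable g μ) (hf : Integrable f μ)
    (hκ : Measurable κ) (hκb : ∀ r, |κ r| ≤ singBound r) {R : ℝ} (hgR : ∀ᵐ x ∂μ, ‖g x‖ ≤ R)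
    {h : E3 → ℝ} (hh : Continuous h) (hc : HasCompactSupport h) :
    ∫ r, potential μ g f κ r * h r = ∫ x, f x * (∫ r, κ (r - g x) * h r) ∂μ := by
  obtain ⟨C, M, -, -, hC, hM⟩ := exists_bound_of_hasCompactSupport hh hc
  have h1 := integrable_prod_kernel hg hf hκ hκb hgR hh.measurable (by simpa using hC) hM
  have h2 := integral_integral_swap (f := fun x r => f x * κ (r - g x) * h r) h1
  simp only [integral_mul_const] at h2
  simp only [potential, ← h2, mul_assoc, integral_const_mul]

/-- A finite total charge sits in the ball of radius `R`, so seen from `r` it is at distance at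
least `‖r‖ - R`, and the kernel is uniformly small there. -/
theorem tendsto_potential_cocompact (hf : Integrable f μ)
    (hκb : ∀ r, |κ r| ≤ singBound r) {R : ℝ} (hgR : ∀ᵐ x ∂μ, ‖g x‖ ≤ R) :
    Tendsto (potential μ g f κ) (cocompact E3) (𝓝 0) := by
  set B : E3 → ℝ := fun r => (∫ x, ‖f x‖ ∂μ) * ((‖r‖ - R)⁻¹ + ((‖r‖ - R)⁻¹) ^ 2) with hB
  have hlim : Tendsto B (cocompact E3) (𝓝 0) := by
    have h1 : Tendsto (fun r : E3 => ‖r‖ - R) (cocompact E3) atTop :=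
      tendsto_atTop_add_const_right _ (-R) (tendsto_norm_cocompact_atTop (E := E3))
    have h2 := tendsto_inv_atTop_zero.comp h1
    have h3 := (h2.add (h2.pow 2)).const_mul (∫ x, ‖f x‖ ∂μ)
    rwa [zero_pow two_ne_zero, add_zero, mul_zero] at h3
  refine squeeze_zero_norm' ?_ hlim
  have hev : ∀ᶠ r : E3 in cocompact E3, R < ‖r‖ :=
    (tendsto_norm_cocompact_atTop (E := E3)).eventually_gt_atTop R
  filter_upwards [hev] with r hr
  rw [hB, potential]
  simp only
  rw [← integral_mul_const]
  refine norm_integral_le_of_norm_le (hf.norm.mul_const _) ?_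
  filter_upwards [hgR] with x hx
  rw [norm_mul]
  refine mul_le_mul_of_nonneg_left ((hκb _).trans ?_) (norm_nonneg _)
  have h1 : ‖r‖ - R ≤ ‖r - g x‖ := by linarith [norm_sub_norm_le r (g x)]
  have h2 : 0 < ‖r‖ - R := by linarith
  have h3 : ‖r - g x‖⁻¹ ≤ (‖r‖ - R)⁻¹ := inv_anti₀ h2 h1
  unfold singBound
  have h4 : 0 ≤ ‖r - g x‖⁻¹ := by positivity
  nlinarith

end Potential

/-- The Newtonian potential of the function `φ`. -/
noncomputable def newton (φ : E3 → ℝ) (a : E3) : ℝ :=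
  coulombConst⁻¹ * ∫ r, ‖r - a‖⁻¹ * φ r

/-- This is the identity for the fundamental solution, reflected and translated to `a`. It converts
the duality that defines Newtonian potentials into Poisson's equation. -/
theorem newton_laplacian {φ : E3 → ℝ} (hφ : ContDiff ℝ 2 φ) (hc : HasCompactSupport φ) (a : E3) :
    newton (Laplacian.laplacian φ) a = -φ a := by
  have hφ' : ContDiff ℝ 2 fun s => φ (a - s) := hφ.comp (contDiff_const.sub contDiff_id)
  have h := integral_inv_norm_laplacian hφ' (hc.comp_homeomorph (Homeomorph.subLeft a))
  simp only [laplacian_comp_const_sub hφ, sub_zero] at h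
  have h2 := integral_sub_left_eq_self (fun r => ‖r - a‖⁻¹ * Laplacian.laplacian φ r) volume a
  have e : ∀ r : E3, ‖a - r - a‖⁻¹ * Laplacian.laplacian φ (a - r) =
      ‖r‖⁻¹ * Laplacian.laplacian φ (a - r) := by
    intro r
    rw [sub_sub_cancel_left, norm_neg]
  simp only [e] at h2
  rw [newton, ← h2, h]
  field_simp [coulombConst_pos.ne']

theorem locallyIntegrable_inv_norm : LocallyIntegrable fun r : E3 => ‖r‖⁻¹ := by
  rw [locallyIntegrable_iff]
  intro K hK
  obtain ⟨M, hM⟩ := hK.isBounded.exists_norm_le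
  have h := (integrableOn_singBound (M + 1)).mono_set (s := K)
    fun r hr => by simpa using (hM r hr).trans_lt (by linarith)
  refine h.mono' (by fun_prop) (Eventually.of_forall fun r => ?_)
  exact abs_inv_norm_le r

theorem newton_eq_conv (φ : E3 → ℝ) :
    newton φ = fun a => coulombConst⁻¹ * ∫ t, φ (a - t) * ‖t‖⁻¹ := by
  ext a
  rw [newton]
  congr 1
  rw [← integral_sub_left_eq_self (fun r => ‖r - a‖⁻¹ * φ r) volume a]
  refine integral_congr_ae (Eventually.of_forall fun t => ?_)
  simp only [sub_sub_cancel_left, norm_neg]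
  ring

theorem contDiff_newton {φ : E3 → ℝ} {n : ℕ∞} (hφ : ContDiff ℝ n φ) (hc : HasCompactSupport φ) :
    ContDiff ℝ n (newton φ) := by
  rw [newton_eq_conv]
  exact contDiff_const.mul (contDiff_conv hφ hc locallyIntegrable_inv_norm)

theorem fderiv_newton {φ : E3 → ℝ} (hφ : ContDiff ℝ 1 φ) (hc : HasCompactSupport φ) (a v : E3) :
    fderiv ℝ (newton φ) a v = newton (fun r => fderiv ℝ φ r v) a := by
  have hd : Differentiable ℝ fun a => ∫ t, φ (a - t) * ‖t‖⁻¹ :=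
    (contDiff_conv (n := 1) (by exact_mod_cast hφ) hc locallyIntegrable_inv_norm).differentiable
      (by norm_num)
  rw [newton_eq_conv, newton_eq_conv, fderiv_const_mul (hd a)]
  simp only [FunLike.coe_smul, Pi.smul_apply, smul_eq_mul]
  rw [fderiv_conv hφ hc locallyIntegrable_inv_norm]

/-- The derivative passes from the density to the kernel. The dipole kernel obtained in this way is
still locally integrable, so layers of dipoles have potentials that are functions. -/
theorem newton_fderiv {φ : E3 → ℝ} (hφ : ContDiff ℝ 1 φ) (hc : HasCompactSupport φ) (a : E3)
    {v : E3} (hv : ‖v‖ ≤ 1) :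
    newton (fun r => fderiv ℝ φ r v) a =
      coulombConst⁻¹ * ∫ r, dipoleKernel v (r - a) * φ r := by
  rw [newton]
  congr 1
  have hφ' : ContDiff ℝ 1 fun s => φ (s + a) := hφ.comp (contDiff_id.add contDiff_const)
  have h := integral_inv_norm_mul_fderiv hφ' (hc.comp_homeomorph (Homeomorph.addRight a)) hv
  have hd : ∀ r, fderiv ℝ (fun s => φ (s + a)) r v = fderiv ℝ φ (r + a) v := by
    intro r; rw [fderiv_comp_add_right]
  simp only [hd] at h
  have h1 := integral_sub_right_eq_self (fun r => ‖r‖⁻¹ * fderiv ℝ φ (r + a) v) a (μ := volume)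
  have h2 := integral_sub_right_eq_self (fun r => dipoleKernel v r * φ (r + a)) a (μ := volume)
  simp only [sub_add_cancel] at h1 h2
  rw [h1, h2, h]

/-! ### Cutoff functions and determination of measures by test functions -/

section Cutoff

variable {E : Type*} [NormedAddCommGroup E] [NormedSpace ℝ E] [FiniteDimensional ℝ E]

theorem exists_smooth_zero_one {s t : Set E} (hs : IsClosed s) (ht : IsClosed t)
    (hd : Disjoint s t) : ∃ f : E → ℝ, ContDiff ℝ ∞ f ∧ (∀ᶠ x in 𝓝ˢ s, f x = 0) ∧
      (∀ᶠ x in 𝓝ˢ t, f x = 1) ∧ ∀ x, f x ∈ Icc (0 : ℝ) 1 := by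
  obtain ⟨f, h0, h1, hf⟩ :=
    exists_contMDiffMap_zero_one_nhds_of_isClosed (n := ⊤) (modelWithCornersSelf ℝ E) hs ht hd
  exact ⟨f, f.contMDiff.contDiff, h0, h1, hf⟩

/-- A smooth cutoff function equal to one near a compact set and supported in a given
neighbourhood. -/
theorem exists_cutoff {K U : Set E} (hK : IsCompact K) (hU : IsOpen U) (hKU : K ⊆ U) :
    ∃ χ : E → ℝ, ContDiff ℝ ∞ χ ∧ HasCompactSupport χ ∧ tsupport χ ⊆ U ∧
      (∀ᶠ x in 𝓝ˢ K, χ x = 1) ∧ ∀ x, χ x ∈ Icc (0 : ℝ) 1 := by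
  obtain ⟨V, hV, hKV, hVU, hVc⟩ := exists_open_between_and_isCompact_closure hK hU hKU
  obtain ⟨χ, h, h0, h1, hm⟩ := exists_smooth_zero_one hV.isClosed_compl hK.isClosed
    (disjoint_compl_left_iff_subset.2 hKV)
  have hs : Function.support χ ⊆ V := by
    intro x hx
    by_contra hxV
    exact hx (h0.self_of_nhdsSet x hxV)
  have ht : tsupport χ ⊆ closure V := closure_mono hs
  exact ⟨χ, h, hVc.of_isClosed_subset (isClosed_tsupport _) ht, ht.trans hVU, h1, hm⟩

variable {F : Type*} [NormedAddCommGroup F] [NormedSpace ℝ F]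

-- Outside `U` nothing is known about `f`, but there `χ` vanishes in a whole neighbourhood and the
-- product is locally zero.
omit [FiniteDimensional ℝ E] in
theorem contDiff_cutoff_smul {χ : E → ℝ} {U : Set E} {f : E → F} {n : WithTop ℕ∞}
    (hχ : ContDiff ℝ n χ) (hU : IsOpen U) (hs : tsupport χ ⊆ U) (hf : ContDiffOn ℝ n f U) :
    ContDiff ℝ n fun x => χ x • f x := by
  rw [contDiff_iff_contDiffAt]
  intro x
  by_cases hx : x ∈ U
  · exact hχ.contDiffAt.smul (hf.contDiffAt (hU.mem_nhds hx))
  · have h0 : χ =ᶠ[𝓝 x] 0 := notMem_tsupport_iff_eventuallyEq.1 fun h => hx (hs h)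
    refine (contDiffAt_const (c := (0 : F))).congr_of_eventuallyEq ?_
    filter_upwards [h0] with y hy
    simp [hy]

end Cutoff

/-- Two finite real measures that agree on the test functions supported in an open set agree on
the bounded measurable functions that vanish outside it. -/
theorem integral_eq_of_test {μ μ' : Measure E3} [IsFiniteMeasure μ] [IsFiniteMeasure μ']
    {f f' : E3 → ℝ} (hf : Integrable f μ) (hf' : Integrable f' μ') {V : Set E3} (hV : IsOpen V)
    (h : ∀ φ, IsTestFunction φ → tsupport φ ⊆ V → ∫ r, φ r * f r ∂μ = ∫ r, φ r * f' r ∂μ')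
    {φ : E3 → ℝ} (hφ : Measurable φ) {C : ℝ} (hC : ∀ r, |φ r| ≤ C) (hφV : ∀ r ∉ V, φ r = 0) :
    ∫ r, φ r * f r ∂μ = ∫ r, φ r * f' r ∂μ' := by
  -- Both measures have densities with respect to their sum, so the difference of the two real
  -- measures is given by a single integrable function `w`. Vanishing against all test functions in
  -- `V` forces `w = 0` almost everywhere on `V`.
  set Λ := μ + μ' with hΛ
  have : IsFiniteMeasure Λ := by rw [hΛ]; infer_instance
  have : μ.HaveLebesgueDecomposition Λ := Measure.haveLebesgueDecomposition_of_sigmaFinite μ Λ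
  have : μ'.HaveLebesgueDecomposition Λ := Measure.haveLebesgueDecomposition_of_sigmaFinite μ' Λ
  have hμ : μ ≪ Λ := Measure.AbsolutelyContinuous.rfl.add_right μ'
  have hμ' : μ' ≪ Λ := by
    rw [hΛ, add_comm]; exact Measure.AbsolutelyContinuous.rfl.add_right μ
  set w : E3 → ℝ := fun r => (μ.rnDeriv Λ r).toReal • f r - (μ'.rnDeriv Λ r).toReal • f' r with hw
  have i1 : Integrable (fun r => (μ.rnDeriv Λ r).toReal • f r) Λ :=
    (integrable_rnDeriv_smul_iff hμ).2 hf
  have i2 : Integrable (fun r => (μ'.rnDeriv Λ r).toReal • f' r) Λ :=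
    (integrable_rnDeriv_smul_iff hμ').2 hf'
  have hwi : Integrable w Λ := i1.sub i2
  have key : ∀ {ψ : E3 → ℝ}, Measurable ψ → ∀ {C : ℝ}, (∀ r, |ψ r| ≤ C) →
      ∫ r, ψ r * w r ∂Λ = ∫ r, ψ r * f r ∂μ - ∫ r, ψ r * f' r ∂μ' := by
    intro ψ hψ C hC
    have j1 := i1.bdd_mul hψ.aestronglyMeasurable (Eventually.of_forall hC)
    have j2 := i2.bdd_mul hψ.aestronglyMeasurable (Eventually.of_forall hC)
    rw [← integral_rnDeriv_smul hμ, ← integral_rnDeriv_smul hμ']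
    simp only [hw, mul_sub]
    rw [integral_sub j1 j2]
    congr 1 <;> refine integral_congr_ae (Eventually.of_forall fun r => ?_) <;>
      simp only [smul_eq_mul] <;> ring
  have hz : ∀ᵐ r ∂Λ, r ∈ V → w r = 0 := by
    refine hV.ae_eq_zero_of_integral_contDiff_smul_eq_zero
      (hwi.locallyIntegrable.locallyIntegrableOn V) fun g hg hgc hgs => ?_
    obtain ⟨C, hC⟩ := hgc.exists_bound_of_continuous hg.continuous
    simp only [smul_eq_mul]
    rw [key hg.continuous.measurable (C := C) (by simpa using hC), h g ⟨hg, hgc⟩ hgs, sub_self]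
  have h0 : ∫ r, φ r * w r ∂Λ = 0 := by
    rw [← integral_zero E3 ℝ (μ := Λ)]
    refine integral_congr_ae ?_
    filter_upwards [hz] with r hr
    by_cases hrV : r ∈ V
    · simp [hr hrV]
    · simp [hφV r hrV]
  rw [key hφ hC] at h0
  linarith

/-! ### Uniqueness for Poisson's problem and for the electric field -/

theorem integrable_mul_of_locallyIntegrable {Φ φ : E3 → ℝ} (hΦ : LocallyIntegrable Φ)
    (hφ : Continuous φ) (hc : HasCompactSupport φ) : Integrable fun r => Φ r * φ r := by
  have := hΦ.integrable_smul_right_of_hasCompactSupport hφ hc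
  simpa using this

/-- The source cancels in the difference, which is weakly harmonic and tends to zero at infinity. -/
theorem SolvesPoisson.ae_eq {D : (E3 → ℝ) → ℝ} {Φ Φ' : E3 → ℝ} (h : SolvesPoisson D Φ)
    (h' : SolvesPoisson D Φ') : Φ =ᵐ[volume] Φ' := by
  have hz : Φ - Φ' =ᵐ[volume] 0 := by
    refine ae_eq_zero_of_weakly_harmonic (h.1.sub h'.1) ?_ ?_
    · have := h.2.1.sub h'.2.1
      rwa [sub_zero] at this
    intro φ hφ
    have h2 : ContDiff ℝ 2 φ := by exact_mod_cast contDiff_infty.1 hφ.1 2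
    have c := continuous_laplacian h2
    have s := hasCompactSupport_laplacian h2 hφ.2
    have e1 := h.2.2 φ hφ
    have e2 := h'.2.2 φ hφ
    simp only [Pi.sub_apply, sub_mul]
    rw [integral_sub (integrable_mul_of_locallyIntegrable h.1 c s)
      (integrable_mul_of_locallyIntegrable h'.1 c s)]
    linarith
  filter_upwards [hz] with r hr
  simpa [sub_eq_zero] using hr

/-- The vector fields `g • ax i` isolate the components of the field, and potentials that differ on
a null set have the same pairing with `div3`. -/
theorem IsElectricField.ae_eq {W : Set E3} (hW : IsOpen W) {Φ Φ' : E3 → ℝ} {E E' : E3 → E3}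
    (hΦ : Φ =ᵐ[volume] Φ') (h : IsElectricField W Φ E) (h' : IsElectricField W Φ' E') :
    E =ᵐ[volume.restrict W] E' := by
  have hcoord : ∀ i : Fin 3, ∀ᵐ r, r ∈ W → (E r - E' r) i = 0 := by
    intro i
    have hloc : LocallyIntegrableOn (fun r => (E r - E' r) i) W := by
      intro x hx
      obtain ⟨s, hs, hs'⟩ := (h.1.sub h'.1) x hx
      exact ⟨s, hs, (EuclideanSpace.proj i : E3 →L[ℝ] ℝ).integrable_comp hs'⟩
    refine hW.ae_eq_zero_of_integral_contDiff_smul_eq_zero hloc fun g hg hgc hgs => ?_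
    set X : E3 → E3 := fun r => g r • ax i with hX
    have hXs : ContDiff ℝ ∞ X := hg.smul contDiff_const
    have hXc : HasCompactSupport X := hgc.smul_right
    have hXt : tsupport X ⊆ W := (closure_mono (Function.support_smul_subset_left g _)).trans hgs
    have e1 := h.2 X hXs hXc hXt
    have e2 := h'.2 X hXs hXc hXt
    have e3 : ∫ r, Φ r * div3 X r = ∫ r, Φ' r * div3 X r := by
      refine integral_congr_ae ?_
      filter_upwards [hΦ] with r hr
      rw [hr]
    have hin : ∀ (V : E3 → E3), (fun r => ⟪V r, X r⟫) = fun r => g r * V r i := by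
      intro V; ext r
      simp [hX, inner_smul_right, EuclideanSpace.inner_single_right]
    have hint : ∀ {V : E3 → E3}, LocallyIntegrableOn V W →
        Integrable (fun r => g r * V r i) (volume.restrict W) := by
      intro V hV
      have hK : IntegrableOn V (tsupport g) :=
        hV.integrableOn_compact_subset hgs hgc.isCompact
      have hKi : IntegrableOn (fun r => V r i) (tsupport g) :=
        (EuclideanSpace.proj i : E3 →L[ℝ] ℝ).integrable_comp hK
      obtain ⟨C, hC⟩ := hgc.exists_bound_of_continuous hg.continuous
      have h3 : IntegrableOn (fun r => g r * V r i) (tsupport g) :=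
        hKi.bdd_mul hg.continuous.aestronglyMeasurable (Eventually.of_forall hC)
      refine ((integrableOn_iff_integrable_of_support_subset (s := tsupport g) ?_).1
        h3).integrableOn
      intro r hr
      exact subset_tsupport g fun h0 => hr (by simp [h0])
    rw [hin E] at e1
    rw [hin E'] at e2
    have e4 : ∫ r in W, g r * (E r - E' r) i = 0 := by
      have : (fun r => g r * (E r - E' r) i) = fun r => g r * E r i - g r * E' r i := by
        ext r; simp [mul_sub]
      rw [this, integral_sub (hint h.1) (hint h'.1), e1, e2, e3, sub_self]
    rw [← e4]
    symm
    simp only [smul_eq_mul]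
    refine setIntegral_eq_integral_of_forall_compl_eq_zero fun r hr => ?_
    have : g r = 0 := by
      by_contra h0
      exact hr (hgs (subset_tsupport g h0))
    simp [this]
  refine (ae_restrict_iff' hW.measurableSet).2 ?_
  have := ae_all_iff.2 hcoord
  filter_upwards [this] with r hr hrW
  rw [← sub_eq_zero]
  ext i
  simpa using hr i hrW

theorem fieldEnergy_congr {W : Set E3} {E E' : E3 → E3} (h : E =ᵐ[volume.restrict W] E') :
    fieldEnergy W E = fieldEnergy W E' := by
  unfold fieldEnergy
  congr 1
  refine lintegral_congr_ae ?_
  filter_upwards [h] with r hr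
  rw [hr]

/-! ### The parameter space -/

/-- The embedding `x ↦ (x, 0)` of the parameter plane. -/
noncomputable def liftL : E2 →L[ℝ] E3 :=
  LinearMap.toContinuousLinearMap
    { toFun := fun x => lift x 0
      map_add' := fun x y => by ext i; fin_cases i <;> simp [lift]
      map_smul' := fun a x => by ext i; fin_cases i <;> simp [lift] }

theorem liftL_apply (x : E2) : liftL x = lift x 0 := rfl

theorem lift_eq (x : E2) (t : ℝ) : lift x t = liftL x + t • dir3 := by
  ext i; fin_cases i <;> simp [lift, liftL_apply, dir3]

theorem lift_add_smul (x v : E2) (s : ℝ) : lift (x + v) s = lift x 0 + (liftL v + s • dir3) := by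
  rw [lift_eq, map_add, add_assoc, liftL_apply]

theorem norm_dir3 : ‖dir3‖ = 1 := by
  simp [dir3, EuclideanSpace.norm_eq, Fin.sum_univ_three]

theorem norm_liftL (x : E2) : ‖liftL x‖ = ‖x‖ := by
  simp [liftL_apply, lift, EuclideanSpace.norm_eq, Fin.sum_univ_three, Fin.sum_univ_two]

theorem continuous_lift : Continuous fun p : E2 × ℝ => lift p.1 p.2 := by
  simp only [lift_eq]
  fun_prop

/-- The projection of the parameter space onto the parameter plane. -/
noncomputable def planeProj : E3 →L[ℝ] E2 :=
  LinearMap.toContinuousLinearMap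
    { toFun := fun X => !₂[X 0, X 1]
      map_add' := fun x y => by ext i; fin_cases i <;> simp
      map_smul' := fun a x => by ext i; fin_cases i <;> simp }

theorem planeProj_lift (x : E2) (t : ℝ) : planeProj (lift x t) = x := by
  ext i; fin_cases i <;> simp [planeProj, lift]

theorem lift_planeProj (X : E3) : lift (planeProj X) (X 2) = X := by
  ext i; fin_cases i <;> simp [planeProj, lift]

theorem lift_third (x : E2) (t : ℝ) : lift x t 2 = t := by simp [lift]

theorem lift_injective {x y : E2} {s t : ℝ} (h : lift x s = lift y t) : x = y ∧ s = t :=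
  ⟨by rw [← planeProj_lift x s, h, planeProj_lift], by rw [← lift_third x s, h, lift_third]⟩

/-- The identification of the parameter space with the product of the plane and the line. -/
noncomputable def liftEquiv : E2 × ℝ ≃ₜ E3 where
  toFun p := lift p.1 p.2
  invFun X := (planeProj X, X 2)
  left_inv p := by simp [planeProj_lift, lift_third]
  right_inv X := lift_planeProj X
  continuous_toFun := continuous_lift
  continuous_invFun := by fun_prop

theorem measurePreserving_lift : MeasurePreserving (fun p : E2 × ℝ => lift p.1 p.2) := by
  have h1 : MeasurePreserving (fun p : E2 × ℝ => ((p.2, WithLp.ofLp p.1) : ℝ × (Fin 2 → ℝ))) :=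
    Measure.measurePreserving_swap.comp
      ((PiLp.volume_preserving_ofLp (Fin 2)).prod (MeasurePreserving.id (volume : Measure ℝ)))
  have h2 := (volume_preserving_piFinSuccAbove (fun _ : Fin 3 => ℝ) (Fin.last 2)).symm
  have h3 := (PiLp.volume_preserving_toLp (Fin 3)).comp (h2.comp h1)
  convert h3 using 1
  ext p i
  fin_cases i <;> simp [lift, Function.comp_def, MeasurableEquiv.piFinSuccAbove,
    Fin.insertNthEquiv, Fin.insertNth_apply_below, Fin.last]

/-- Finite length implies zero two-dimensional Hausdorff measure, and the latter is a Haar measure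
of the plane. That `∂T` has no area is the reason why the boundary layer of cells disappears in the
limit. -/
theorem volume_eq_zero_of_hausdorff_lt_top {s : Set E2} (hs : (μH[1] : Measure E2) s < ⊤) :
    volume s = 0 := by
  have h2 : (μH[2] : Measure E2) s = 0 := by
    rcases Measure.hausdorffMeasure_zero_or_top (X := E2) (d₁ := 1) (d₂ := 2) (by norm_num) s with
      h | h
    · exact h
    · exact absurd h hs.ne
  have hH : ((μH[(Module.finrank ℝ E2 : ℝ)] : Measure E2)).IsAddHaarMeasure := inferInstance
  have h3 : (Module.finrank ℝ E2 : ℝ) = 2 := by simp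
  rw [h3] at hH
  exact (Measure.absolutelyContinuous_isAddHaarMeasure volume (μH[2] : Measure E2)) h2

/-! ### Vector algebra -/

theorem inner_E3 (u v : E3) : ⟪u, v⟫ = u 0 * v 0 + u 1 * v 1 + u 2 * v 2 := by
  simp [PiLp.inner_apply, Fin.sum_univ_three]; ring

theorem inner_E2 (u v : E2) : ⟪u, v⟫ = u 0 * v 0 + u 1 * v 1 := by
  simp [PiLp.inner_apply, Fin.sum_univ_two]; ring

theorem cross_apply_zero (u v : E3) : cross u v 0 = u 1 * v 2 - u 2 * v 1 := by
  simp [cross, crossProduct]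

theorem cross_apply_one (u v : E3) : cross u v 1 = u 2 * v 0 - u 0 * v 2 := by
  simp [cross, crossProduct]

theorem cross_apply_two (u v : E3) : cross u v 2 = u 0 * v 1 - u 1 * v 0 := by
  simp [cross, crossProduct]

theorem inner_cross_self_left (u v : E3) : ⟪u, cross u v⟫ = 0 := by
  rw [inner_E3, cross_apply_zero, cross_apply_one, cross_apply_two]; ring

theorem inner_cross_self_right (u v : E3) : ⟪v, cross u v⟫ = 0 := by
  rw [inner_E3, cross_apply_zero, cross_apply_one, cross_apply_two]; ring

theorem cross_smul_left (a : ℝ) (u v : E3) : cross (a • u) v = a • cross u v := by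
  ext i; fin_cases i <;> simp [cross_apply_zero, cross_apply_one, cross_apply_two] <;> ring

theorem cross_smul_right (a : ℝ) (u v : E3) : cross u (a • v) = a • cross u v := by
  ext i; fin_cases i <;> simp [cross_apply_zero, cross_apply_one, cross_apply_two] <;> ring

theorem norm_cross_sq (u v : E3) : ‖cross u v‖ ^ 2 = ⟪u, u⟫ * ⟪v, v⟫ - ⟪u, v⟫ ^ 2 := by
  rw [← real_inner_self_eq_norm_sq]
  simp only [inner_E3, cross_apply_zero, cross_apply_one, cross_apply_two]; ring

theorem continuous_cross : Continuous fun p : E3 × E3 => cross p.1 p.2 := by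
  have : (fun p : E3 × E3 => cross p.1 p.2) = fun p => !₂[p.1 1 * p.2 2 - p.1 2 * p.2 1,
      p.1 2 * p.2 0 - p.1 0 * p.2 2, p.1 0 * p.2 1 - p.1 1 * p.2 0] := by
    ext p i
    fin_cases i <;> simp [cross_apply_zero, cross_apply_one, cross_apply_two]
  rw [this]
  fun_prop

theorem norm_unitVec {v : E3} (hv : v ≠ 0) : ‖unitVec v‖ = 1 := by
  rw [unitVec, norm_smul, norm_inv, norm_norm, inv_mul_cancel₀ (norm_ne_zero_iff.2 hv)]

theorem norm_unitVec_le (v : E3) : ‖unitVec v‖ ≤ 1 := by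
  by_cases hv : v = 0
  · simp [hv, unitVec]
  · exact (norm_unitVec hv).le

/-- A linear map of the plane, expanded in the coordinate directions. -/
theorem clm_apply_E2 {F : Type*} [NormedAddCommGroup F] [NormedSpace ℝ F] (L : E2 →L[ℝ] F)
    (v : E2) : L v = v 0 • L (dir 0) + v 1 • L (dir 1) := by
  have : v = v 0 • dir 0 + v 1 • dir 1 := by
    ext i; fin_cases i <;> simp [dir]
  conv_lhs => rw [this]
  simp

/-- For coordinate tangents `a`, `b` and a normal `n` in the chart, `-n 1 • a + n 0 • b` is the
image of the rotated normal. The identity compares the flux through the boundary in the chart with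
the flux in space. -/
theorem inner_cross_cross (a b : E3) (p n : E2) :
    ⟪p 0 • a + p 1 • b, cross (-n 1 • a + n 0 • b) (cross a b)⟫ =
      ‖cross a b‖ ^ 2 * ⟪p, n⟫ := by
  rw [norm_cross_sq]
  simp only [inner_E3, inner_E2, cross_apply_zero, cross_apply_one, cross_apply_two,
    PiLp.add_apply, PiLp.smul_apply, smul_eq_mul]
  ring

/-- The Gram matrix consists of the inner products of the coordinate tangents, and its determinant
is Lagrange's expression for a squared cross product. Hence `J₀` is the length of the normal vector.
-/
theorem det_adjoint_comp (L : E2 →L[ℝ] E3) :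
    (L.adjoint ∘L L).det = ‖cross (L (dir 0)) (L (dir 1))‖ ^ 2 := by
  rw [ContinuousLinearMap.det, ← LinearMap.det_toMatrix
    (EuclideanSpace.basisFun (Fin 2) ℝ).toBasis, Matrix.det_fin_two, norm_cross_sq]
  have e : ∀ i j : Fin 2, LinearMap.toMatrix (EuclideanSpace.basisFun (Fin 2) ℝ).toBasis
      (EuclideanSpace.basisFun (Fin 2) ℝ).toBasis (L.adjoint ∘L L : E2 →L[ℝ] E2) i j =
      ⟪L (dir i), L (dir j)⟫ := by
    intro i j
    rw [LinearMap.toMatrix_apply]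
    have h1 : ⟪dir i, (L.adjoint) (L (dir j))⟫ = ⟪L (dir i), L (dir j)⟫ :=
      ContinuousLinearMap.adjoint_inner_right L _ _
    rw [← h1]
    simp [dir, EuclideanSpace.inner_single_left]
  simp only [e]
  rw [real_inner_comm (L (dir 0)) (L (dir 1))]
  ring

/-! ### Jacobians, normals and boundary tangents of a sheet -/

namespace Sheet

variable (M : Sheet)

/-- The normal vector `∂₁ψ₀ × ∂₂ψ₀`. -/
noncomputable def normalVec (x : E2) : E3 := cross (M.D x (dir 0)) (M.D x (dir 1))

theorem ν_eq (x : E2) : M.ν x = unitVec (M.normalVec x) := rfl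

theorem J₀_eq (x : E2) : M.J₀ x = ‖M.normalVec x‖ := by
  rw [J₀, det_adjoint_comp, Real.sqrt_sq (norm_nonneg _)]; rfl

theorem norm_ν_le (x : E2) : ‖M.ν x‖ ≤ 1 := norm_unitVec_le _

/-- The part of the domain of the chart that lies in the parameter plane. -/
def baseDomain : Set E2 := {x | lift x 0 ∈ M.U}

theorem isOpen_baseDomain : IsOpen M.baseDomain :=
  M.isOpen_U.preimage (liftL.continuous)

theorem closure_subset_baseDomain : closure M.T ⊆ M.baseDomain := M.mem_U

theorem isCompact_closure : IsCompact (closure M.T) :=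
  M.isBounded_T.isCompact_closure

theorem hasFDerivAt_ψ {X : E3} (hX : X ∈ M.U) : HasFDerivAt M.ψ (fderiv ℝ M.ψ X) X :=
  ((M.contDiffOn.contDiffAt (M.isOpen_U.mem_nhds hX)).differentiableAt (by norm_num)).hasFDerivAt

theorem hasFDerivAt_ψ₀ {x : E2} (hx : x ∈ M.baseDomain) :
    HasFDerivAt M.ψ₀ (fderiv ℝ M.ψ (lift x 0) ∘L liftL) x :=
  (M.hasFDerivAt_ψ hx).comp x liftL.hasFDerivAt

theorem D_apply {x : E2} (hx : x ∈ M.baseDomain) (v : E2) :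
    M.D x v = fderiv ℝ M.ψ (lift x 0) (liftL v) := by
  rw [D, (M.hasFDerivAt_ψ₀ hx).fderiv]; rfl

theorem contDiffOn_ψ₀ : ContDiffOn ℝ 2 M.ψ₀ M.baseDomain :=
  M.contDiffOn.comp liftL.contDiff.contDiffOn fun _ hx => hx

theorem continuousOn_ψ₀ : ContinuousOn M.ψ₀ M.baseDomain := M.contDiffOn_ψ₀.continuousOn

theorem contDiffOn_D : ContDiffOn ℝ 1 M.D M.baseDomain :=
  M.contDiffOn_ψ₀.fderiv_of_isOpen M.isOpen_baseDomain (by norm_num)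

theorem injOn_ψ₀ : InjOn M.ψ₀ M.baseDomain := fun _ hx _ hy h =>
  (lift_injective (M.injOn hx hy h)).1

theorem injective_fderiv {X : E3} (hX : X ∈ M.U) : Function.Injective (fderiv ℝ M.ψ X) := by
  have h : LinearMap.det ((fderiv ℝ M.ψ X) : E3 →ₗ[ℝ] E3) ≠ 0 := M.det_ne_zero X hX
  exact (LinearMap.equivOfDetNeZero _ h).injective

theorem D_injective {x : E2} (hx : x ∈ M.baseDomain) : Function.Injective (M.D x) := by
  intro u v h
  rw [M.D_apply hx, M.D_apply hx] at h
  have := M.injective_fderiv hx h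
  rw [liftL_apply, liftL_apply] at this
  exact (lift_injective this).1

/-- A vanishing cross product means equality in the Cauchy–Schwarz inequality, hence the linear
relation `⟪a, a⟫ • b = ⟪a, b⟫ • a` between the coordinate tangents, against the injectivity of the
differential. -/
theorem normalVec_ne_zero {x : E2} (hx : x ∈ M.baseDomain) : M.normalVec x ≠ 0 := by
  intro h
  have h2 := norm_cross_sq (M.D x (dir 0)) (M.D x (dir 1))
  rw [show cross (M.D x (dir 0)) (M.D x (dir 1)) = 0 from h, norm_zero] at h2
  set a := M.D x (dir 0)
  set b := M.D x (dir 1)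
  have ha : a ≠ 0 := by
    intro h0
    have := M.D_injective hx (h0.trans (map_zero (M.D x)).symm)
    have h3 := congrArg (fun v : E2 => v 0) this
    simp [dir] at h3
  have haa : ⟪a, a⟫ ≠ 0 := fun h0 => ha (inner_self_eq_zero.1 h0)
  have h3 : ⟪⟪a, a⟫ • b - ⟪a, b⟫ • a, ⟪a, a⟫ • b - ⟪a, b⟫ • a⟫ = 0 := by
    simp only [inner_sub_left, inner_sub_right, inner_smul_left, inner_smul_right,
      real_inner_comm a b, RCLike.conj_to_real]
    have e : ⟪a, a⟫ * ⟪b, b⟫ - ⟪a, b⟫ ^ 2 = 0 := by rw [← h2]; norm_num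
    have hc : ⟪b, a⟫ = ⟪a, b⟫ := real_inner_comm _ _
    linear_combination ⟪a, a⟫ * e
  have h4 : M.D x (⟪a, a⟫ • dir 1 - ⟪a, b⟫ • dir 0) = 0 := by
    rw [map_sub, map_smul, map_smul]; exact inner_self_eq_zero.1 h3
  have h5 := M.D_injective hx (h4.trans (map_zero (M.D x)).symm)
  have h6 := congrArg (fun v : E2 => v 1) h5
  simp [dir] at h6
  exact ha h6

theorem J₀_pos {x : E2} (hx : x ∈ M.baseDomain) : 0 < M.J₀ x := by
  rw [J₀_eq]; exact norm_pos_iff.2 (M.normalVec_ne_zero hx)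

theorem norm_ν {x : E2} (hx : x ∈ M.baseDomain) : ‖M.ν x‖ = 1 :=
  norm_unitVec (M.normalVec_ne_zero hx)

theorem contDiffOn_normalVec : ContDiffOn ℝ 1 M.normalVec M.baseDomain := by
  have h : ∀ i : Fin 2, ContDiffOn ℝ 1 (fun x => M.D x (dir i)) M.baseDomain := fun i =>
    M.contDiffOn_D.clm_apply contDiffOn_const
  have hc : ∀ (i : Fin 2) (j : Fin 3), ContDiffOn ℝ 1 (fun x => M.D x (dir i) j) M.baseDomain :=
    fun i j => (EuclideanSpace.proj j : E3 →L[ℝ] ℝ).contDiff.comp_contDiffOn (h i)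
  rw [contDiffOn_euclidean]
  intro j
  fin_cases j
  · exact (((hc 0 1).mul (hc 1 2)).sub ((hc 0 2).mul (hc 1 1))).congr
      fun x _ => by simp [normalVec, cross_apply_zero]
  · exact (((hc 0 2).mul (hc 1 0)).sub ((hc 0 0).mul (hc 1 2))).congr
      fun x _ => by simp [normalVec, cross_apply_one]
  · exact (((hc 0 0).mul (hc 1 1)).sub ((hc 0 1).mul (hc 1 0))).congr
      fun x _ => by simp [normalVec, cross_apply_two]

theorem contDiffOn_J₀ : ContDiffOn ℝ 1 M.J₀ M.baseDomain := by
  have := M.contDiffOn_normalVec.norm ℝ fun x hx => M.normalVec_ne_zero hx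
  exact this.congr fun x _ => M.J₀_eq x

theorem continuousOn_ν : ContinuousOn M.ν M.baseDomain := by
  have h := M.contDiffOn_normalVec.continuousOn
  refine (h.norm.inv₀ fun x hx => norm_ne_zero_iff.2 (M.normalVec_ne_zero hx)).smul h

theorem nT_norm {x : E2} (hx : x ∈ frontier M.T) : ‖M.nT x‖ = 1 := M.isOuterNormal.2.1 x hx

theorem frontier_subset_baseDomain : frontier M.T ⊆ M.baseDomain :=
  frontier_subset_closure.trans M.closure_subset_baseDomain

theorem T_subset_baseDomain : M.T ⊆ M.baseDomain :=
  subset_closure.trans M.closure_subset_baseDomain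

theorem bdTangent_ne_zero {x : E2} (hx : x ∈ frontier M.T) : M.bdTangent x ≠ 0 := by
  intro h
  have h1 := M.D_injective (M.frontier_subset_baseDomain hx) (h.trans (map_zero (M.D x)).symm)
  have h2 := M.nT_norm hx
  have h3 : M.nT x = 0 := by
    have a0 := congrArg (fun v : E2 => v 0) h1
    have a1 := congrArg (fun v : E2 => v 1) h1
    simp [rot] at a0 a1
    ext i; fin_cases i <;> simp [a0, a1]
  simp [h3] at h2

theorem lineJ_pos {x : E2} (hx : x ∈ frontier M.T) : 0 < M.lineJ x :=
  norm_pos_iff.2 (M.bdTangent_ne_zero hx)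

/-- The flux of a tangential field through the boundary, in the chart and in space. -/
theorem J₀_mul_inner_nT {x : E2} (hx : x ∈ frontier M.T) (p : E2) :
    M.J₀ x * ⟪p, M.nT x⟫ = M.lineJ x * ⟪M.D x p, M.conormal x⟫ := by
  have hb := M.frontier_subset_baseDomain hx
  have hl := (M.lineJ_pos hx).ne'
  have hj := (M.J₀_pos hb).ne'
  have ht : M.bdTangent x = -(M.nT x) 1 • M.D x (dir 0) + (M.nT x) 0 • M.D x (dir 1) := by
    rw [bdTangent, clm_apply_E2]; simp [rot]
  have h := inner_cross_cross (M.D x (dir 0)) (M.D x (dir 1)) p (M.nT x)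
  rw [← clm_apply_E2, ← ht] at h
  have h2 : ‖cross (M.D x (dir 0)) (M.D x (dir 1))‖ = M.J₀ x := (M.J₀_eq x).symm
  rw [h2] at h
  rw [conormal, ν_eq, unitVec, unitVec, cross_smul_left, cross_smul_right, inner_smul_right,
    inner_smul_right, ← J₀_eq, normalVec, h]
  change _ = M.lineJ x * ((M.lineJ x)⁻¹ * _)
  field_simp

theorem fderiv_ψ_dir3 {x : E2} (hx : x ∈ closure M.T) :
    fderiv ℝ M.ψ (lift x 0) dir3 = M.ν x := M.normal_coord x hx

end Sheet

/-! ### Scaled cells -/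

/-- Otherwise the segment would be separated by the open sets `T` and `(closure T)ᶜ`. -/
theorem exists_segment_mem_frontier {T : Set E2} (hT : IsOpen T) {x x' : E2} (hx : x ∈ T)
    (hx' : x' ∉ T) : ∃ z ∈ segment ℝ x x', z ∈ frontier T := by
  by_contra! h
  have hcl : ∀ z ∈ segment ℝ x x', z ∉ T → z ∉ closure T := fun z hz hzT hzc =>
    h z hz ⟨hzc, fun hi => hzT (interior_subset hi)⟩
  obtain ⟨z, -, hz⟩ := (convex_segment x x').isPreconnected T (closure T)ᶜ hT
    isClosed_closure.isOpen_compl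
    (fun z hz => (em (z ∈ T)).imp id (hcl z hz)) ⟨x, left_mem_segment ℝ x x', hx⟩
    ⟨x', right_mem_segment ℝ x x', hcl x' (right_mem_segment ℝ x x') hx'⟩
  exact hz.2 (subset_closure hz.1)

namespace Choice

variable (c : Choice) {l : ℝ}

theorem mem_cellAt_iff (hl : 0 < l) (n : Fin 2 → ℤ) (x : E2) :
    x ∈ c.cellAt l n ↔ l⁻¹ • (x - c.cornerAt l n) ∈ c.cell := by
  constructor
  · rintro ⟨y, hy, rfl⟩
    simpa [smul_smul, inv_mul_cancel₀ hl.ne'] using hy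
  · intro h
    exact ⟨_, h, by simp [smul_smul, mul_inv_cancel₀ hl.ne']⟩

theorem cornerAt_add_mem (hl : 0 < l) (n : Fin 2 → ℤ) (y : E2) :
    c.cornerAt l n + l • y ∈ c.cellAt l n ↔ y ∈ c.cell := by
  rw [c.mem_cellAt_iff hl]; simp [smul_smul, inv_mul_cancel₀ hl.ne']

/-- The tiling is given at scale one and is applied to the rescaled point `l⁻¹ • (x - origin)`. -/
theorem existsUnique_mem_cellAt (hl : 0 < l) (x : E2) : ∃! n, x ∈ c.cellAt l n := by
  obtain ⟨n, ⟨y, hy, hxy⟩, hu⟩ := c.tiling (l⁻¹ • (x - c.origin))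
  have key : ∀ n : Fin 2 → ℤ, x ∈ c.cellAt l n ↔
      ∃ y ∈ c.cell, l⁻¹ • (x - c.origin) = (∑ i, (n i : ℝ) • c.basis i) + (c.corner + y) := by
    intro n
    rw [c.mem_cellAt_iff hl]
    have e : l⁻¹ • (x - c.cornerAt l n) =
        l⁻¹ • (x - c.origin) - ((∑ i, (n i : ℝ) • c.basis i) + c.corner) := by
      rw [cornerAt, ← sub_sub, smul_sub, smul_smul, inv_mul_cancel₀ hl.ne', one_smul]
    rw [e]
    constructor
    · intro h
      exact ⟨_, h, by abel⟩
    · rintro ⟨y, hy, h⟩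
      rw [h]
      convert hy using 1
      abel
  exact ⟨n, (key n).2 ⟨y, hy, hxy⟩, fun m hm => hu m ((key m).1 hm)⟩

open Classical in
/-- The index of the scaled cell containing a point. -/
noncomputable def idx (l : ℝ) (x : E2) : Fin 2 → ℤ :=
  if hl : 0 < l then (c.existsUnique_mem_cellAt hl x).choose else 0

theorem mem_cellAt_idx (hl : 0 < l) (x : E2) : x ∈ c.cellAt l (c.idx l x) := by
  rw [idx, dif_pos hl]; exact (c.existsUnique_mem_cellAt hl x).choose_spec.1

theorem mem_cellAt_iff_idx (hl : 0 < l) (n : Fin 2 → ℤ) (x : E2) :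
    x ∈ c.cellAt l n ↔ c.idx l x = n :=
  ⟨fun h => (c.existsUnique_mem_cellAt hl x).unique (c.mem_cellAt_idx hl x) h,
    fun h => h ▸ c.mem_cellAt_idx hl x⟩

theorem pairwise_disjoint_cellAt (hl : 0 < l) :
    Pairwise (Function.onFun Disjoint (c.cellAt l)) := by
  intro m n hmn
  rw [Function.onFun, disjoint_left]
  intro x hx hx'
  rw [c.mem_cellAt_iff_idx hl] at hx hx'
  exact hmn (hx.symm.trans hx')

theorem measurableSet_cellAt (hl : 0 < l) (n : Fin 2 → ℤ) : MeasurableSet (c.cellAt l n) := by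
  have : c.cellAt l n = (fun x => l⁻¹ • (x - c.cornerAt l n)) ⁻¹' c.cell := by
    ext x; exact c.mem_cellAt_iff hl n x
  rw [this]
  exact c.measurableSet_cell.preimage (by fun_prop)

theorem measurable_idx (hl : 0 < l) : Measurable (c.idx l) := by
  refine measurable_to_countable' fun n => ?_
  have : c.idx l ⁻¹' {n} = c.cellAt l n := by
    ext x; exact (c.mem_cellAt_iff_idx hl n x).symm
  rw [this]; exact c.measurableSet_cellAt hl n

/-- The corner of the scaled cell containing a point. -/
noncomputable def cornerOf (l : ℝ) (x : E2) : E2 := c.cornerAt l (c.idx l x)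

theorem measurable_cornerOf (hl : 0 < l) : Measurable (c.cornerOf l) :=
  (measurable_of_countable (c.cornerAt l)).comp (c.measurable_idx hl)

theorem exists_cellRadius : ∃ R, 0 < R ∧ ∀ y ∈ c.cell, ‖y‖ ≤ R := by
  obtain ⟨R, hR⟩ := c.isBounded_cell.exists_norm_le
  exact ⟨|R| + 1, by positivity, fun y hy => (hR y hy).trans (by linarith [le_abs_self R])⟩

/-- A bound for the norms of the points of the unit cell. -/
noncomputable def cellRadius : ℝ := c.exists_cellRadius.choose

theorem cellRadius_pos : 0 < c.cellRadius := c.exists_cellRadius.choose_spec.1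

theorem norm_le_cellRadius {y : E2} (hy : y ∈ c.cell) : ‖y‖ ≤ c.cellRadius :=
  c.exists_cellRadius.choose_spec.2 y hy

theorem norm_sub_cornerAt_le (hl : 0 < l) {n : Fin 2 → ℤ} {x : E2} (hx : x ∈ c.cellAt l n) :
    ‖x - c.cornerAt l n‖ ≤ l * c.cellRadius := by
  obtain ⟨y, hy, rfl⟩ := hx
  rw [add_sub_cancel_left, norm_smul, Real.norm_of_nonneg hl.le]
  exact mul_le_mul_of_nonneg_left (c.norm_le_cellRadius hy) hl.le

theorem norm_sub_cornerOf_le (hl : 0 < l) (x : E2) :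
    ‖x - c.cornerOf l x‖ ≤ l * c.cellRadius :=
  c.norm_sub_cornerAt_le hl (c.mem_cellAt_idx hl x)

theorem setIntegral_cell {F : Type*} [NormedAddCommGroup F] [NormedSpace ℝ F] (hl : 0 < l)
    (n : Fin 2 → ℤ) {S : Set E2} (hS : MeasurableSet S) (g : E2 → F) :
    ∫ y in {y | y ∈ c.cell ∧ c.cornerAt l n + l • y ∈ S}, g (c.cornerAt l n + l • y) =
      (l ^ 2)⁻¹ • ∫ x in c.cellAt l n ∩ S, g x := by
  set a := c.cornerAt l n with ha
  have hm : Measurable fun y : E2 => a + l • y := by fun_prop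
  have hmeas : MeasurableSet {y | y ∈ c.cell ∧ a + l • y ∈ S} :=
    c.measurableSet_cell.inter (hS.preimage hm)
  rw [← integral_indicator hmeas, ← integral_indicator ((c.measurableSet_cellAt hl n).inter hS)]
  have e : ∀ y, ({y | y ∈ c.cell ∧ a + l • y ∈ S}.indicator fun y => g (a + l • y)) y =
      (c.cellAt l n ∩ S).indicator g (a + l • y) := by
    intro y
    have : a + l • y ∈ c.cellAt l n ∩ S ↔ y ∈ {y | y ∈ c.cell ∧ a + l • y ∈ S} :=
      and_congr (c.cornerAt_add_mem hl n y) Iff.rfl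
    by_cases h : y ∈ {y | y ∈ c.cell ∧ a + l • y ∈ S}
    · rw [indicator_of_mem h, indicator_of_mem (this.2 h)]
    · rw [indicator_of_notMem h, indicator_of_notMem fun h' => h (this.1 h')]
  simp only [e]
  have h1 := Measure.integral_comp_smul (volume : Measure E2)
    (fun u => (c.cellAt l n ∩ S).indicator g (a + u)) l
  simp only [finrank_euclideanSpace, Fintype.card_fin] at h1
  rw [abs_of_pos (by positivity)] at h1
  rw [h1, integral_add_left_eq_self]

theorem setIntegral_cell_univ {F : Type*} [NormedAddCommGroup F] [NormedSpace ℝ F] (hl : 0 < l)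
    (n : Fin 2 → ℤ) (g : E2 → F) :
    ∫ y in c.cell, g (c.cornerAt l n + l • y) = (l ^ 2)⁻¹ • ∫ x in c.cellAt l n, g x := by
  simpa using c.setIntegral_cell hl n MeasurableSet.univ g

theorem volume_cell_lt_top : volume c.cell < ⊤ := c.isBounded_cell.measure_lt_top

theorem volume_cellAt (l : ℝ) (n : Fin 2 → ℤ) :
    volume (c.cellAt l n) = ENNReal.ofReal (l ^ 2) * volume c.cell := by
  have : c.cellAt l n = (fun y => c.cornerAt l n + y) '' (l • c.cell) := by
    rw [cellAt, ← image_smul, image_image]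
  rw [this, image_add_left, measure_preimage_add, Measure.addHaar_smul]
  simp

/-- Countably many cells of zero area could not cover the plane. -/
theorem area_pos : 0 < c.area := by
  rw [area, Measure.real, ENNReal.toReal_pos_iff]
  refine ⟨pos_iff_ne_zero.2 fun h => ?_, c.volume_cell_lt_top⟩
  have hU : (univ : Set E2) ⊆ ⋃ n, c.cellAt 1 n := fun x _ =>
    mem_iUnion.2 ⟨_, c.mem_cellAt_idx one_pos x⟩
  have h0 : volume (⋃ n, c.cellAt 1 n) = 0 :=
    measure_iUnion_null fun n => by rw [c.volume_cellAt 1, h, mul_zero]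
  have := measure_mono_null hU h0
  simp at this

theorem isBounded_iUnion_cellAt (hl : 0 < l) {S : Set E2} (hS : Bornology.IsBounded S) :
    Bornology.IsBounded (⋃ n ∈ {n | (c.cellAt l n ∩ S).Nonempty}, c.cellAt l n) := by
  obtain ⟨B, hB⟩ := hS.exists_norm_le
  rw [isBounded_iff_forall_norm_le]
  refine ⟨B + 2 * (l * c.cellRadius), fun x hx => ?_⟩
  simp only [mem_ofPred_eq, mem_iUnion, exists_prop] at hx
  obtain ⟨n, ⟨z, hz, hzS⟩, hx⟩ := hx
  have h1 := c.norm_sub_cornerAt_le hl hx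
  have h2 := c.norm_sub_cornerAt_le hl hz
  have h3 := hB z hzS
  have e : x = z + ((x - c.cornerAt l n) - (z - c.cornerAt l n)) := by abel
  calc ‖x‖ = ‖z + ((x - c.cornerAt l n) - (z - c.cornerAt l n))‖ := by rw [← e]
    _ ≤ ‖z‖ + (‖x - c.cornerAt l n‖ + ‖z - c.cornerAt l n‖) :=
      (norm_add_le _ _).trans (by gcongr; exact norm_sub_le _ _)
    _ ≤ _ := by linarith

/-- The cells that meet a bounded set are disjoint, have one and the same positive area and stay in
a bounded region. Hence the sums over full and over partial cells are genuine finite sums, not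
default values of `finsum`. -/
theorem finite_cells_meeting (hl : 0 < l) {S : Set E2} (hS : Bornology.IsBounded S) :
    {n | (c.cellAt l n ∩ S).Nonempty}.Finite := by
  set N := {n | (c.cellAt l n ∩ S).Nonempty} with hN
  have hpos : 0 < ENNReal.ofReal (l ^ 2) * volume c.cell := by
    have h1 := c.area_pos
    rw [area, Measure.real, ENNReal.toReal_pos_iff] at h1
    exact ENNReal.mul_pos (by simpa using hl.ne') h1.1.ne'
  have h := Measure.finite_const_le_meas_of_disjoint_iUnion (ι := N) (volume : Measure E2)
    hpos (As := fun n => c.cellAt l n) (fun n => c.measurableSet_cellAt hl n)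
    (fun m n hmn => c.pairwise_disjoint_cellAt hl fun h => hmn (Subtype.ext h)) (by
      have hb := (c.isBounded_iUnion_cellAt hl hS).measure_lt_top (μ := volume)
      refine ne_of_lt ((measure_mono ?_).trans_lt hb)
      intro x hx
      obtain ⟨n, hn⟩ := mem_iUnion.1 hx
      exact mem_biUnion n.2 hn)
  have huniv : {i : N | ENNReal.ofReal (l ^ 2) * volume c.cell ≤ volume (c.cellAt l i)} = univ := by
    ext i; simp [c.volume_cellAt l]
  rw [huniv] at h
  exact Set.finite_coe_iff.1 (Set.finite_univ_iff.1 h)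

theorem cell_nonempty : c.cell.Nonempty := by
  by_contra h
  have := c.area_pos
  rw [not_nonempty_iff_eq_empty.1 |> fun f => f h |> fun e => (by rw [area, e]; simp :
    c.area = 0)] at this
  exact lt_irrefl _ this

theorem cellAt_nonempty (n : Fin 2 → ℤ) : (c.cellAt l n).Nonempty := c.cell_nonempty.image _

theorem finite_fullCells (hl : 0 < l) : (c.fullCells l).Finite :=
  (c.finite_cells_meeting hl c.sheet.isBounded_T).subset fun n hn => by
    obtain ⟨x, hx⟩ := c.cellAt_nonempty (l := l) n
    exact ⟨x, hx, hn hx⟩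

theorem finite_partialCells (hl : 0 < l) : (c.partialCells l).Finite :=
  (c.finite_cells_meeting hl c.sheet.isBounded_T).subset fun _ hn => hn.1

/-- The union of the full cells. -/
def fullPart (l : ℝ) : Set E2 := {x | c.cellAt l (c.idx l x) ⊆ c.sheet.T}

/-- The part of `T` covered by partial cells. -/
def partialPart (l : ℝ) : Set E2 := c.sheet.T \ c.fullPart l

theorem fullPart_subset (hl : 0 < l) : c.fullPart l ⊆ c.sheet.T :=
  fun x hx => hx (c.mem_cellAt_idx hl x)

theorem fullPart_eq (hl : 0 < l) : c.fullPart l = ⋃ n ∈ c.fullCells l, c.cellAt l n := by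
  ext x
  simp only [mem_iUnion, exists_prop]
  constructor
  · exact fun h => ⟨_, h, c.mem_cellAt_idx hl x⟩
  · rintro ⟨n, hn, hx⟩
    rw [c.mem_cellAt_iff_idx hl] at hx
    rw [fullPart, mem_ofPred_eq, hx]; exact hn

theorem partialPart_eq (hl : 0 < l) :
    c.partialPart l = ⋃ n ∈ c.partialCells l, c.cellAt l n ∩ c.sheet.T := by
  ext x
  simp only [mem_iUnion, exists_prop]
  constructor
  · exact fun h => ⟨c.idx l x, ⟨⟨x, c.mem_cellAt_idx hl x, h.1⟩, h.2⟩, c.mem_cellAt_idx hl x, h.1⟩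
  · rintro ⟨n, hn, hx, hxT⟩
    refine ⟨hxT, ?_⟩
    rw [c.mem_cellAt_iff_idx hl] at hx
    rw [fullPart, mem_ofPred_eq, hx]; exact hn.2

theorem measurableSet_fullPart (hl : 0 < l) : MeasurableSet (c.fullPart l) := by
  rw [c.fullPart_eq hl]
  exact MeasurableSet.biUnion (to_countable _) fun n _ => c.measurableSet_cellAt hl n

theorem measurableSet_partialPart (hl : 0 < l) : MeasurableSet (c.partialPart l) :=
  c.sheet.isOpen_T.measurableSet.diff (c.measurableSet_fullPart hl)

variable {F : Type*} [NormedAddCommGroup F] [NormedSpace ℝ F]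

/-- A cell is determined by any of its points, so a sum of integrals over cells is one integral
whose integrand reads off the cell with `idx`. In this form the moment sums can be estimated without
counting cells. -/
theorem finsum_full_eq (hl : 0 < l) {G : (Fin 2 → ℤ) → E2 → F}
    (hG : ∀ n ∈ c.fullCells l, IntegrableOn (G n) (c.cellAt l n)) :
    ∑ᶠ n ∈ c.fullCells l, ∫ x in c.cellAt l n, G n x =
      ∫ x in c.fullPart l, G (c.idx l x) x := by
  have hfin := c.finite_fullCells hl
  have hcongr : ∀ n, EqOn (G n) (fun x => G (c.idx l x) x) (c.cellAt l n) := by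
    intro n x hx
    rw [c.mem_cellAt_iff_idx hl] at hx
    simp only [hx]
  rw [c.fullPart_eq hl, finsum_mem_eq_finite_toFinset_sum _ hfin]
  have hU : (⋃ n ∈ c.fullCells l, c.cellAt l n) = ⋃ n ∈ hfin.toFinset, c.cellAt l n := by simp
  rw [hU, integral_biUnion_finset _ (fun n _ => c.measurableSet_cellAt hl n)
    (fun m _ n _ hmn => c.pairwise_disjoint_cellAt hl hmn)]
  · exact Finset.sum_congr rfl fun n _ =>
      setIntegral_congr_fun (c.measurableSet_cellAt hl n) (hcongr n)
  · intro n hn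
    exact (integrableOn_congr_fun (hcongr n) (c.measurableSet_cellAt hl n)).1
      (hG n (by simpa using hn))

theorem finsum_partial_eq (hl : 0 < l) {G : (Fin 2 → ℤ) → E2 → F}
    (hG : ∀ n ∈ c.partialCells l, IntegrableOn (G n) (c.cellAt l n ∩ c.sheet.T)) :
    ∑ᶠ n ∈ c.partialCells l, ∫ x in c.cellAt l n ∩ c.sheet.T, G n x =
      ∫ x in c.partialPart l, G (c.idx l x) x := by
  have hfin := c.finite_partialCells hl
  have hmeas := fun n => (c.measurableSet_cellAt hl n).inter c.sheet.isOpen_T.measurableSet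
  have hcongr : ∀ n, EqOn (G n) (fun x => G (c.idx l x) x) (c.cellAt l n ∩ c.sheet.T) := by
    intro n x hx
    have hx1 := hx.1
    rw [c.mem_cellAt_iff_idx hl] at hx1
    simp only [hx1]
  rw [c.partialPart_eq hl, finsum_mem_eq_finite_toFinset_sum _ hfin]
  have hU : (⋃ n ∈ c.partialCells l, c.cellAt l n ∩ c.sheet.T) =
    ⋃ n ∈ hfin.toFinset, c.cellAt l n ∩ c.sheet.T := by simp
  rw [hU, integral_biUnion_finset _ (fun n _ => hmeas n)
    (fun m _ n _ hmn => (c.pairwise_disjoint_cellAt hl hmn).mono inter_subset_left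
      inter_subset_left)]
  · exact Finset.sum_congr rfl fun n _ => setIntegral_congr_fun (hmeas n) (hcongr n)
  · intro n hn
    exact (integrableOn_congr_fun (hcongr n) (hmeas n)).1 (hG n (by simpa using hn))

/-- A partial cell that contains a point of `T` also contains a point outside `T`. The two are at
most `2 l · cellRadius` apart, and the segment between them crosses the frontier. -/
theorem partialPart_subset (hl : 0 < l) :
    c.partialPart l ⊆ Metric.cthickening (l * (2 * c.cellRadius)) (frontier c.sheet.T) := by
  intro x hx
  obtain ⟨x', hx', hx'T⟩ := not_subset.1 hx.2
  have hxx : ‖x - x'‖ ≤ l * (2 * c.cellRadius) := by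
    have h1 := c.norm_sub_cornerAt_le hl (c.mem_cellAt_idx hl x)
    have h2 := c.norm_sub_cornerAt_le hl hx'
    calc ‖x - x'‖ = ‖(x - c.cornerAt l (c.idx l x)) - (x' - c.cornerAt l (c.idx l x))‖ := by
          congr 1; abel
      _ ≤ _ := (norm_sub_le _ _).trans (by linarith)
  obtain ⟨z, hz, hzf⟩ := exists_segment_mem_frontier c.sheet.isOpen_T hx.1 hx'T
  refine Metric.mem_cthickening_of_dist_le x z _ _ hzf ?_
  rw [dist_eq_norm]
  refine le_trans ?_ hxx
  obtain ⟨a, b, ha, hb, hab, rfl⟩ := hz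
  have : x - (a • x + b • x') = b • (x - x') := by
    have : x = (a + b) • x := by rw [hab, one_smul]
    nth_rewrite 1 [this]
    module
  rw [this, norm_smul, Real.norm_of_nonneg hb]
  nlinarith [norm_nonneg (x - x')]

/-- The closed thickenings of the compact frontier shrink to the frontier, which is a null set, so
their areas tend to zero. No rate is available at this generality. -/
theorem tendsto_volume_partialPart {l : ℕ → ℝ} (hl : ∀ k, 0 < l k)
    (hl0 : Tendsto l atTop (𝓝 0)) :
    Tendsto (fun k => volume.real (c.partialPart (l k))) atTop (𝓝 0) := by
  have hb : Bornology.IsBounded (frontier c.sheet.T) :=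
    c.sheet.isBounded_T.closure.subset frontier_subset_closure
  have h1 := tendsto_measure_cthickening_of_isClosed (μ := (volume : Measure E2))
    (s := frontier c.sheet.T) ⟨1, one_pos, (hb.cthickening.measure_lt_top).ne⟩ isClosed_frontier
  rw [volume_eq_zero_of_hausdorff_lt_top c.sheet.finite_boundary] at h1
  have h2 : Tendsto (fun k => l k * (2 * c.cellRadius)) atTop (𝓝 0) := by
    simpa using hl0.mul_const (2 * c.cellRadius)
  have h3 := (ENNReal.tendsto_toReal ENNReal.zero_ne_top).comp (h1.comp h2)
  refine squeeze_zero (fun _ => measureReal_nonneg) (fun k => ?_) h3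
  exact ENNReal.toReal_mono (hb.cthickening.measure_lt_top).ne
    (measure_mono (c.partialPart_subset (hl k)))

end Choice

/-! ### Integration across the film -/

/-- The integral of `H` across the rescaled film. -/
noncomputable def layer (H : E2 → ℝ → ℝ) (x : E2) : ℝ := ∫ z in Ioo (-1 : ℝ) 1, H x z

theorem intervalIntegral_eq_layer {F : Type*} [NormedAddCommGroup F] [NormedSpace ℝ F]
    (H : ℝ → F) : ∫ z in (-1 : ℝ)..1, H z = ∫ z in Ioo (-1 : ℝ) 1, H z := by
  rw [intervalIntegral.integral_of_le (by norm_num), integral_Ioc_eq_integral_Ioo]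

/-- Charges in the rescaled film over `T` that are continuous and bounded by `C`. -/
structure IsLayerBounded (T : Set E2) (C : ℝ) (H : E2 → ℝ → ℝ) : Prop where
  cont : ContinuousOn (fun p : E2 × ℝ => H p.1 p.2) (T ×ˢ Ioo (-1 : ℝ) 1)
  bound : ∀ x ∈ T, ∀ z ∈ Ioo (-1 : ℝ) 1, |H x z| ≤ C

namespace IsLayerBounded

variable {T : Set E2} {C : ℝ} {H : E2 → ℝ → ℝ}

theorem integrableOn (h : IsLayerBounded T C H) {x : E2} (hx : x ∈ T) :
    IntegrableOn (H x) (Ioo (-1 : ℝ) 1) := by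
  have hc : ContinuousOn (H x) (Ioo (-1 : ℝ) 1) :=
    h.cont.comp (f := fun z : ℝ => ((x, z) : E2 × ℝ)) (by fun_prop) fun z hz => ⟨hx, hz⟩
  refine Integrable.of_bound (hc.aestronglyMeasurable measurableSet_Ioo) C ?_
  exact (ae_restrict_mem measurableSet_Ioo).mono fun z hz => h.bound x hx z hz

theorem abs_layer_le (h : IsLayerBounded T C H) {x : E2} (hx : x ∈ T) : |layer H x| ≤ 2 * C := by
  have := norm_setIntegral_le_of_norm_le_const (μ := volume) (s := Ioo (-1 : ℝ) 1) (f := H x)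
    (C := C) (by simp) (fun z hz => h.bound x hx z hz)
  simp only [Measure.real, Real.volume_Ioo] at this
  norm_num at this
  rw [layer]
  linarith

theorem aestronglyMeasurable (h : IsLayerBounded T C H) (hT : MeasurableSet T) :
    AEStronglyMeasurable (layer H) (volume.restrict T) := by
  have h1 := h.cont.aestronglyMeasurable (μ := volume.prod volume) (hT.prod measurableSet_Ioo)
  rw [← Measure.prod_restrict] at h1
  exact h1.integral_prod_right'

theorem integrableOn_layer (h : IsLayerBounded T C H) (hT : MeasurableSet T)
    (hb : volume T < ⊤) : IntegrableOn (layer H) T := by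
  have : IsFiniteMeasure (volume.restrict T) := ⟨by simpa using hb⟩
  exact Integrable.of_bound (h.aestronglyMeasurable hT) (2 * C)
    ((ae_restrict_mem hT).mono fun _ hx => h.abs_layer_le hx)

theorem mul (h : IsLayerBounded T C H) {g : E2 → ℝ → ℝ} {B : ℝ} (hg : IsLayerBounded T B g) :
    IsLayerBounded T (C * B) fun x z => H x z * g x z where
  cont := h.cont.mul hg.cont
  bound x hx z hz := by
    rw [abs_mul]
    exact mul_le_mul (h.bound x hx z hz) (hg.bound x hx z hz) (abs_nonneg _)
      ((abs_nonneg _).trans (h.bound x hx z hz))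

end IsLayerBounded

theorem isLayerBounded_third (T : Set E2) : IsLayerBounded T 1 fun _ z => z where
  cont := by fun_prop
  bound x _ z hz := abs_le.2 ⟨hz.1.le, hz.2.le⟩

theorem isLayerBounded_comp_lift (T : Set E2) {f : E3 → ℝ} (hf : Continuous f) {B : ℝ}
    (hB : ∀ X, |f X| ≤ B) (h : ℝ) : IsLayerBounded T B fun x z => f (lift x (h * z)) where
  cont := by
    have : Continuous fun p : E2 × ℝ => f (lift p.1 (h * p.2)) :=
      hf.comp (continuous_lift.comp (f := fun p : E2 × ℝ => (p.1, h * p.2)) (by fun_prop))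
    exact this.continuousOn
  bound x _ z _ := hB _

/-! ### Taylor expansion of test functions -/

/-- One constant serves all the estimates: it dominates `f`, its derivative and the Lipschitz
constant of its derivative, all finite by compactness of the support. -/
theorem exists_taylor_bounds {f : E3 → ℝ} (hf : ContDiff ℝ 2 f) (hc : HasCompactSupport f) :
    ∃ L, 0 ≤ L ∧ (∀ X, |f X| ≤ L) ∧ (∀ X, ‖fderiv ℝ f X‖ ≤ L) ∧
      (∀ X v, |f (X + v) - f X| ≤ L * ‖v‖) ∧
      ∀ X v, |f (X + v) - f X - fderiv ℝ f X v| ≤ L * ‖v‖ ^ 2 := by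
  have hd : Differentiable ℝ f := hf.differentiable (by norm_num)
  have hf' : ContDiff ℝ 1 (fderiv ℝ f) := hf.fderiv_right (by norm_num)
  obtain ⟨C0, hC0⟩ := hc.exists_bound_of_continuous hf.continuous
  obtain ⟨C1, hC1⟩ := (hc.fderiv (𝕜 := ℝ)).exists_bound_of_continuous hf'.continuous
  obtain ⟨C2, hC2⟩ := ContDiff.lipschitzWith_of_hasCompactSupport (hc.fderiv (𝕜 := ℝ)) hf'
    (by norm_num)
  have h0 := (norm_nonneg _).trans (hC0 0)
  have h1 := (norm_nonneg _).trans (hC1 0)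
  have h2 : (0 : ℝ) ≤ C2 := C2.2
  refine ⟨C0 + C1 + C2, by positivity, fun X => ?_, fun X => ?_, fun X v => ?_, fun X v => ?_⟩
  · exact (hC0 X).trans (by linarith)
  · exact (hC1 X).trans (by linarith)
  · have := (convex_univ (𝕜 := ℝ) (E := E3)).norm_image_sub_le_of_norm_fderiv_le
      (fun x _ => hd x) (fun x _ => hC1 x) (mem_univ X) (mem_univ (X + v))
    rw [add_sub_cancel_left] at this
    refine this.trans ?_
    gcongr; linarith
  · have := (convex_segment X (X + v)).norm_image_sub_le_of_norm_hasFDerivWithin_le'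
      (f := f) (f' := fderiv ℝ f) (φ := fderiv ℝ f X) (C := C2 * ‖v‖)
      (fun x _ => (hd x).hasFDerivAt.hasFDerivWithinAt) ?_ (left_mem_segment ℝ X (X + v))
      (right_mem_segment ℝ X (X + v))
    · rw [add_sub_cancel_left] at this
      rw [sq, ← mul_assoc]
      refine this.trans ?_
      gcongr; linarith
    · intro Y hY
      have h3 := hC2.dist_le_mul Y X
      rw [dist_eq_norm, dist_eq_norm] at h3
      refine h3.trans ?_
      gcongr
      obtain ⟨a, b, ha, hb, hab, rfl⟩ := hY
      have e : a • X + b • (X + v) - X = b • v := by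
        have : X = (a + b) • X := by rw [hab, one_smul]
        nth_rewrite 3 [this]
        module
      rw [e, norm_smul, Real.norm_of_nonneg hb]
      nlinarith [norm_nonneg v]

/-! ### Moment sums -/

namespace ChargeSequence

variable {α : ℝ} (S : ChargeSequence α) (c : Choice) (k : ℕ)

/-- The weak sum of the cell charges. -/
noncomputable def chargeSum (φ : E2 → ℝ) : ℝ := ∑ᶠ n ∈ c.fullCells (S.l k),
  (c.area * S.l k ^ 2) * (φ (c.cornerAt (S.l k) n) * S.cellCharge c k n)

/-- The weak sum of the tangential dipole moments. -/
noncomputable def dipoleSum (φ : E2 → ℝ) : E2 := ∑ᶠ n ∈ c.fullCells (S.l k),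
  (c.area * S.l k ^ 2) • (φ (c.cornerAt (S.l k) n) • S.cellDipole c k n)

/-- The weak sum of the normal dipole moments. -/
noncomputable def normalSum (φ : E2 → ℝ) : ℝ := ∑ᶠ n ∈ c.fullCells (S.l k),
  (c.area * S.l k ^ 2) * (φ (c.cornerAt (S.l k) n) * S.cellNormalDipole c k n)

/-- The weak sum of the charges of the partial cells. -/
noncomputable def surfaceSum (φ : E2 → ℝ) : ℝ := ∑ᶠ n ∈ c.partialCells (S.l k),
  S.l k * (φ (c.cornerAt (S.l k) n) * S.partialCharge c k n)

variable {S c k} {C : ℝ}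

/-- The substitution that rescales the cell contributes `l⁻²`, which cancels the area `l²` in the
weight. What remains is the factor `l⁻¹` in the definition of the free charge, with `φ` frozen at
the corners. The other sums are rewritten in the same way. -/
theorem chargeSum_eq (hQ : IsLayerBounded c.sheet.T C (S.paramCharge c k)) (φ : E2 → ℝ) :
    S.chargeSum c k φ = (S.l k)⁻¹ * ∫ x in c.fullPart (S.l k),
      φ (c.cornerOf (S.l k) x) * layer (S.paramCharge c k) x := by
  have hl := S.l_pos k
  have hi := hQ.integrableOn_layer c.sheet.isOpen_T.measurableSet
    c.sheet.isBounded_T.measure_lt_top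
  rw [← integral_const_mul]
  have := c.finsum_full_eq hl (G := fun n x => (S.l k)⁻¹ *
    (φ (c.cornerAt (S.l k) n) * layer (S.paramCharge c k) x))
    (fun n hn => ((hi.mono_set hn).const_mul _).const_mul _)
  simp only [Choice.cornerOf]
  rw [← this, chargeSum]
  refine finsum_congr fun n => finsum_congr fun _ => ?_
  rw [integral_const_mul, integral_const_mul, cellCharge]
  have e := c.setIntegral_cell_univ hl n (layer (S.paramCharge c k))
  simp only [intervalIntegral_eq_layer]
  change _ * (_ * (_ * (_ * ∫ y in c.cell, layer (S.paramCharge c k) _))) = _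
  rw [e, smul_eq_mul]
  have := c.area_pos
  field_simp

/-- The cell variable `y` is `l⁻¹ • (x - corner)`. The tangential dipoles thereby acquire the same
factor `l⁻¹` as the charges and supply the first-order Taylor term. -/
theorem dipoleSum_eq (hQ : IsLayerBounded c.sheet.T C (S.paramCharge c k)) (φ : E2 → ℝ) :
    S.dipoleSum c k φ = (S.l k)⁻¹ • ∫ x in c.fullPart (S.l k),
      (φ (c.cornerOf (S.l k) x) * layer (S.paramCharge c k) x) • (x - c.cornerOf (S.l k) x) := by
  have hl := S.l_pos k
  have hi := hQ.integrableOn_layer c.sheet.isOpen_T.measurableSet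
    c.sheet.isBounded_T.measure_lt_top
  rw [← integral_smul]
  have hid : ∀ n ∈ c.fullCells (S.l k), IntegrableOn (fun x =>
      layer (S.paramCharge c k) x • ((S.l k)⁻¹ • (x - c.cornerAt (S.l k) n)))
      (c.cellAt (S.l k) n) := by
    intro n hn
    refine Integrable.smul_bdd (C := c.cellRadius) (hi.mono_set hn)
      (Measurable.aestronglyMeasurable (by fun_prop)) ?_
    refine (ae_restrict_mem (c.measurableSet_cellAt hl n)).mono fun x hx => ?_
    exact c.norm_le_cellRadius ((c.mem_cellAt_iff hl n x).1 hx)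
  have := c.finsum_full_eq hl (G := fun n x => φ (c.cornerAt (S.l k) n) •
    (layer (S.paramCharge c k) x • ((S.l k)⁻¹ • (x - c.cornerAt (S.l k) n))))
    (fun n hn => (hid n hn).smul (φ (c.cornerAt (S.l k) n)))
  have e1 : ∫ x in c.fullPart (S.l k), (S.l k)⁻¹ • ((φ (c.cornerOf (S.l k) x) *
      layer (S.paramCharge c k) x) • (x - c.cornerOf (S.l k) x)) =
      ∫ x in c.fullPart (S.l k), φ (c.cornerAt (S.l k) (c.idx (S.l k) x)) •
        (layer (S.paramCharge c k) x • ((S.l k)⁻¹ • (x - c.cornerAt (S.l k)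
          (c.idx (S.l k) x)))) := by
    refine integral_congr_ae (Eventually.of_forall fun x => ?_)
    simp only [Choice.cornerOf, smul_smul]
    ring_nf
  rw [e1, ← this, dipoleSum]
  refine finsum_congr fun n => finsum_congr fun _ => ?_
  rw [integral_smul, cellDipole]
  have e := c.setIntegral_cell_univ hl n
    (fun x => layer (S.paramCharge c k) x • ((S.l k)⁻¹ • (x - c.cornerAt (S.l k) n)))
  have e2 : ∀ y, c.cornerAt (S.l k) n + S.l k • y - c.cornerAt (S.l k) n = S.l k • y := fun y => by
    abel
  simp only [e2, smul_smul, inv_mul_cancel₀ hl.ne', mul_one] at e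
  simp only [intervalIntegral_eq_layer, integral_smul_const]
  change _ • (_ • (_ • ∫ y in c.cell, layer (S.paramCharge c k) _ • y)) = _
  rw [e]
  simp only [smul_smul]
  congr 1
  have := c.area_pos
  field_simp

theorem normalSum_eq (hQ : IsLayerBounded c.sheet.T C (S.paramCharge c k)) (φ : E2 → ℝ) :
    S.normalSum c k φ = ∫ x in c.fullPart (S.l k),
      φ (c.cornerOf (S.l k) x) * layer (fun x z => z * S.paramCharge c k x z) x := by
  have hl := S.l_pos k
  have hi := ((isLayerBounded_third c.sheet.T).mul hQ).integrableOn_layer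
    c.sheet.isOpen_T.measurableSet c.sheet.isBounded_T.measure_lt_top
  have := c.finsum_full_eq hl (G := fun n x =>
    φ (c.cornerAt (S.l k) n) * layer (fun x z => z * S.paramCharge c k x z) x)
    (fun n hn => (hi.mono_set hn).const_mul _)
  simp only [Choice.cornerOf]
  rw [← this, normalSum]
  refine finsum_congr fun n => finsum_congr fun _ => ?_
  rw [integral_const_mul, cellNormalDipole]
  have e := c.setIntegral_cell_univ hl n (layer (fun x z => z * S.paramCharge c k x z))
  simp only [intervalIntegral_eq_layer]
  change _ * (_ * (_ * ∫ y in c.cell, layer (fun x z => z * S.paramCharge c k x z) _)) = _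
  rw [e, smul_eq_mul]
  have := c.area_pos
  field_simp

theorem surfaceSum_eq (hQ : IsLayerBounded c.sheet.T C (S.paramCharge c k)) (φ : E2 → ℝ) :
    S.surfaceSum c k φ = (S.l k)⁻¹ * ∫ x in c.partialPart (S.l k),
      φ (c.cornerOf (S.l k) x) * layer (S.paramCharge c k) x := by
  have hl := S.l_pos k
  have hi := hQ.integrableOn_layer c.sheet.isOpen_T.measurableSet
    c.sheet.isBounded_T.measure_lt_top
  rw [← integral_const_mul]
  have := c.finsum_partial_eq hl (G := fun n x => (S.l k)⁻¹ *
    (φ (c.cornerAt (S.l k) n) * layer (S.paramCharge c k) x))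
    (fun n _ => ((hi.mono_set inter_subset_right).const_mul _).const_mul _)
  simp only [Choice.cornerOf]
  rw [← this, surfaceSum]
  refine finsum_congr fun n => finsum_congr fun _ => ?_
  rw [integral_const_mul, integral_const_mul, partialCharge]
  have e := c.setIntegral_cell hl n c.sheet.isOpen_T.measurableSet (layer (S.paramCharge c k))
  simp only [intervalIntegral_eq_layer]
  change _ * (_ * ∫ y in _, layer (S.paramCharge c k) _) = _
  rw [e, smul_eq_mul]
  field_simp

end ChargeSequence

/-! ### Multipole expansion -/

/-- The restriction to the parameter plane of a function. -/
noncomputable def base (f : E3 → ℝ) (x : E2) : ℝ := f (lift x 0)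

/-- The restriction to the parameter plane of the derivative in direction `v`. -/
noncomputable def baseDeriv (f : E3 → ℝ) (v : E3) (x : E2) : ℝ := fderiv ℝ f (lift x 0) v

theorem continuous_base {f : E3 → ℝ} (hf : Continuous f) : Continuous (base f) :=
  hf.comp liftL.continuous

theorem hasCompactSupport_comp_lift {f : E3 → ℝ} (hc : HasCompactSupport f) :
    HasCompactSupport fun x => f (lift x 0) := by
  have hi : Isometry liftL := AddMonoidHomClass.isometry_of_norm liftL norm_liftL
  exact hc.comp_isClosedEmbedding hi.isClosedEmbedding

theorem continuous_baseDeriv {f : E3 → ℝ} (hf : ContDiff ℝ 2 f) (v : E3) :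
    Continuous (baseDeriv f v) :=
  (contDiff_fderiv_apply (m := 1) hf (by norm_num) v).continuous.comp liftL.continuous

theorem hasCompactSupport_baseDeriv {f : E3 → ℝ} (hc : HasCompactSupport f) (v : E3) :
    HasCompactSupport (baseDeriv f v) := by
  have h := hasCompactSupport_fderiv_apply hc v
  exact hasCompactSupport_comp_lift (f := fun X => fderiv ℝ f X v) h

namespace ChargeSequence

variable {α : ℝ} (S : ChargeSequence α) (c : Choice) (k : ℕ)

/-- The sum of the monopole and dipole terms of the cells, tested with `f`. -/
noncomputable def multipoleSum (f : E3 → ℝ) : ℝ :=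
  S.chargeSum c k (base f) + ∑ i, S.dipoleSum c k (baseDeriv f (liftL (dir i))) i +
    S.h k / S.l k * S.normalSum c k (baseDeriv f dir3) + S.surfaceSum c k (base f)

/-- The rescaled charge tested with `f`. -/
noncomputable def testedCharge (f : E3 → ℝ) : ℝ :=
  (S.l k)⁻¹ * ∫ x in c.sheet.T,
    layer (fun x z => S.paramCharge c k x z * f (lift x (S.h k * z))) x

variable {S c k} {C : ℝ}

/-- A point of the film lies within `l · cellRadius + h` of the corner of its cell. On full cells
the dipoles account for the linear Taylor term and a quadratic error is left; on partial cells only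
the value at the corner is used, and the linear error is integrated over a small area. The factors
`2` are the length of the interval of `z`. -/
theorem abs_testedCharge_sub_le (hQ : IsLayerBounded c.sheet.T C (S.paramCharge c k))
    {f : E3 → ℝ} (hf : ContDiff ℝ 2 f) {L : ℝ} (hL0 : ∀ X, |f X| ≤ L)
    (hL1 : ∀ X, ‖fderiv ℝ f X‖ ≤ L) (hL2 : ∀ X v, |f (X + v) - f X| ≤ L * ‖v‖)
    (hL3 : ∀ X v, |f (X + v) - f X - fderiv ℝ f X v| ≤ L * ‖v‖ ^ 2) :
    |S.testedCharge c k f - S.multipoleSum c k f| ≤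
      (S.l k)⁻¹ * (C * (L * (S.l k * c.cellRadius + S.h k) ^ 2) * 2 * volume.real c.sheet.T +
        C * (L * (S.l k * c.cellRadius + S.h k)) * 2 * volume.real (c.partialPart (S.l k))) := by
  have hl := S.l_pos k
  have hh := S.h_pos k
  set l := S.l k with hldef
  set h := S.h k with hhdef
  set T := c.sheet.T with hTdef
  set Q := S.paramCharge c k with hQdef
  have hTm : MeasurableSet T := c.sheet.isOpen_T.measurableSet
  have hTv : volume T < ⊤ := c.sheet.isBounded_T.measure_lt_top
  have hFm := c.measurableSet_fullPart hl
  have hPm := c.measurableSet_partialPart hl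
  have hFT := c.fullPart_subset hl
  have hPT : c.partialPart l ⊆ T := sdiff_subset
  -- A point of `T` is needed to know that `C` is nonnegative. Over an empty `T` all the sums
  -- vanish.
  rcases T.eq_empty_or_nonempty with hTe | ⟨x₀, hx₀⟩
  · have e1 : c.fullPart l = ∅ := subset_empty_iff.1 (hTe ▸ hFT)
    have e2 : c.partialPart l = ∅ := subset_empty_iff.1 (hTe ▸ hPT)
    rw [testedCharge, multipoleSum, chargeSum_eq hQ, normalSum_eq hQ, surfaceSum_eq hQ]
    simp only [dipoleSum_eq hQ]
    simp [← hldef, ← hTdef, hTe, e1, e2]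
  have hC0 : 0 ≤ C := (abs_nonneg _).trans (hQ.bound x₀ hx₀ 0 (by norm_num))
  have hLp : 0 ≤ L := (abs_nonneg _).trans (hL0 0)
  have hQf := hQ.mul (isLayerBounded_comp_lift T hf.continuous hL0 h)
  have hQ3 := (isLayerBounded_third T).mul hQ
  have iA := hQf.integrableOn_layer hTm hTv
  have iQ := hQ.integrableOn_layer hTm hTv
  have iQ3 := hQ3.integrableOn_layer hTm hTv
  set A := layer fun x z => Q x z * f (lift x (h * z)) with hA
  have mcorner := c.measurable_cornerOf hl
  have m0 : Measurable fun x => base f (c.cornerOf l x) :=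
    (continuous_base hf.continuous).measurable.comp mcorner
  have md : ∀ v, Measurable fun x => baseDeriv f v (c.cornerOf l x) := fun v =>
    (continuous_baseDeriv hf v).measurable.comp mcorner
  have bd : ∀ v x, ‖baseDeriv f v x‖ ≤ L * ‖v‖ := fun v x =>
    (ContinuousLinearMap.le_opNorm _ _).trans (by gcongr; exact hL1 _)
  have i0 : ∀ s ⊆ T, IntegrableOn (fun x => base f (c.cornerOf l x) * layer Q x) s := fun s hs =>
    (iQ.mono_set hs).bdd_mul (c := L) m0.aestronglyMeasurable
      (Eventually.of_forall fun x => hL0 _)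
  have i3 : IntegrableOn (fun x => baseDeriv f dir3 (c.cornerOf l x) *
      layer (fun x z => z * Q x z) x) (c.fullPart l) :=
    (iQ3.mono_set hFT).bdd_mul (c := L * ‖dir3‖) (md _).aestronglyMeasurable
      (Eventually.of_forall fun x => bd _ _)
  have iv : ∀ i : Fin 2, IntegrableOn (fun x => (baseDeriv f (liftL (dir i)) (c.cornerOf l x) *
      layer Q x) • (x - c.cornerOf l x)) (c.fullPart l) := by
    intro i
    have j1 : IntegrableOn (fun x => baseDeriv f (liftL (dir i)) (c.cornerOf l x) * layer Q x)
        (c.fullPart l) :=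
      (iQ.mono_set hFT).bdd_mul (c := L * ‖liftL (dir i)‖) (md _).aestronglyMeasurable
        (Eventually.of_forall fun x => bd _ _)
    exact Integrable.smul_bdd j1 (C := l * c.cellRadius)
      (measurable_id.sub mcorner).aestronglyMeasurable
      (Eventually.of_forall fun x => c.norm_sub_cornerOf_le hl x)
  have hcoord : ∀ i : Fin 2, (∫ x in c.fullPart l,
      (baseDeriv f (liftL (dir i)) (c.cornerOf l x) * layer Q x) • (x - c.cornerOf l x)) i =
      ∫ x in c.fullPart l, ((baseDeriv f (liftL (dir i)) (c.cornerOf l x) * layer Q x) •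
        (x - c.cornerOf l x)) i := fun i =>
    ((EuclideanSpace.proj i : E2 →L[ℝ] ℝ).integral_comp_comm (iv i)).symm
  have ivc : ∀ i : Fin 2, IntegrableOn (fun x => ((baseDeriv f (liftL (dir i))
      (c.cornerOf l x) * layer Q x) • (x - c.cornerOf l x)) i) (c.fullPart l) := fun i =>
    (EuclideanSpace.proj i : E2 →L[ℝ] ℝ).integrable_comp (iv i)
  -- the sum of the moments as one integral
  have hsum : S.multipoleSum c k f = l⁻¹ * ((∫ x in c.fullPart l,
      (base f (c.cornerOf l x) * layer Q x + ∑ i, ((baseDeriv f (liftL (dir i))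
        (c.cornerOf l x) * layer Q x) • (x - c.cornerOf l x)) i +
        h * (baseDeriv f dir3 (c.cornerOf l x) * layer (fun x z => z * Q x z) x))) +
      ∫ x in c.partialPart l, base f (c.cornerOf l x) * layer Q x) := by
    have jsum : IntegrableOn (fun x => ∑ i, ((baseDeriv f (liftL (dir i))
        (c.cornerOf l x) * layer Q x) • (x - c.cornerOf l x)) i) (c.fullPart l) :=
      integrable_finsetSum _ fun i _ => ivc i
    have jadd : IntegrableOn (fun x => base f (c.cornerOf l x) * layer Q x +
        ∑ i, ((baseDeriv f (liftL (dir i)) (c.cornerOf l x) * layer Q x) •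
          (x - c.cornerOf l x)) i) (c.fullPart l) := (i0 _ hFT).add jsum
    rw [integral_add jadd (i3.const_mul h), integral_add (i0 _ hFT) jsum,
      integral_finsetSum _ fun i _ => ivc i, integral_const_mul]
    rw [multipoleSum, chargeSum_eq hQ, normalSum_eq hQ, surfaceSum_eq hQ]
    simp only [dipoleSum_eq hQ, PiLp.smul_apply, smul_eq_mul]
    simp only [← hldef, ← hQdef, ← hhdef]
    rw [← Finset.mul_sum]
    simp only [hcoord, PiLp.smul_apply, smul_eq_mul]
    field_simp
  have hsplit : ∫ x in T, A x = (∫ x in c.fullPart l, A x) + ∫ x in c.partialPart l, A x := by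
    have := setIntegral_sdiff hFm iA hFT (μ := volume)
    have hp : c.partialPart l = T \ c.fullPart l := rfl
    rw [hp, this]; ring
  have iG : IntegrableOn (fun x => base f (c.cornerOf l x) * layer Q x +
      ∑ i, ((baseDeriv f (liftL (dir i)) (c.cornerOf l x) * layer Q x) •
        (x - c.cornerOf l x)) i + h * (baseDeriv f dir3 (c.cornerOf l x) *
          layer (fun x z => z * Q x z) x)) (c.fullPart l) :=
    ((i0 _ hFT).add (integrable_finsetSum _ fun i _ => ivc i)).add (i3.const_mul h)
  have hlift : ∀ x z, lift x (h * z) = lift (c.cornerOf l x) 0 +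
      (liftL (x - c.cornerOf l x) + (h * z) • dir3) := by
    intro x z
    rw [← lift_add_smul, add_sub_cancel]
  have hvn : ∀ x, ∀ z ∈ Ioo (-1 : ℝ) 1, ‖liftL (x - c.cornerOf l x) + (h * z) • dir3‖ ≤
      l * c.cellRadius + h := by
    intro x z hz
    refine (norm_add_le _ _).trans (add_le_add ?_ ?_)
    · rw [norm_liftL]; exact c.norm_sub_cornerOf_le hl x
    · rw [norm_smul, norm_dir3, mul_one, Real.norm_eq_abs, abs_mul, abs_of_pos hh]
      have : |z| ≤ 1 := abs_le.2 ⟨hz.1.le, hz.2.le⟩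
      nlinarith
  have bF : ∀ x ∈ c.fullPart l, ‖A x - (base f (c.cornerOf l x) * layer Q x +
      ∑ i, ((baseDeriv f (liftL (dir i)) (c.cornerOf l x) * layer Q x) •
        (x - c.cornerOf l x)) i + h * (baseDeriv f dir3 (c.cornerOf l x) *
          layer (fun x z => z * Q x z) x))‖ ≤ C * (L * (l * c.cellRadius + h) ^ 2) * 2 := by
    intro x hx
    have hxT := hFT hx
    set X := c.cornerOf l x with hX
    have esum : ∑ i, ((baseDeriv f (liftL (dir i)) X * layer Q x) • (x - X)) i =
        fderiv ℝ f (lift X 0) (liftL (x - X)) * layer Q x := by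
      have := clm_apply_E2 (fderiv ℝ f (lift X 0) ∘L liftL) (x - X)
      simp only [ContinuousLinearMap.comp_apply, smul_eq_mul] at this
      rw [this, Fin.sum_univ_two]
      simp only [baseDeriv, PiLp.smul_apply, smul_eq_mul]
      ring
    have j0 := hQ.integrableOn hxT
    have j1 := hQf.integrableOn hxT
    have j3 := hQ3.integrableOn hxT
    have e : A x - (base f X * layer Q x + ∑ i, ((baseDeriv f (liftL (dir i)) X * layer Q x) •
        (x - X)) i + h * (baseDeriv f dir3 X * layer (fun x z => z * Q x z) x)) =
        ∫ z in Ioo (-1 : ℝ) 1, Q x z * (f (lift x (h * z)) - f (lift X 0) -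
          fderiv ℝ f (lift X 0) (liftL (x - X) + (h * z) • dir3)) := by
      rw [esum, hA]
      simp only [layer]
      set a := base f X
      set b := fderiv ℝ f (lift X 0) (liftL (x - X))
      set d := baseDeriv f dir3 X
      have k1 : IntegrableOn (fun z => a * Q x z + b * Q x z) (Ioo (-1 : ℝ) 1) :=
        (j0.const_mul a).add (j0.const_mul b)
      have k3 : IntegrableOn (fun z => h * (d * (z * Q x z))) (Ioo (-1 : ℝ) 1) :=
        (j3.const_mul d).const_mul h
      have k4 : IntegrableOn (fun z => a * Q x z + b * Q x z + h * (d * (z * Q x z)))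
        (Ioo (-1 : ℝ) 1) := k1.add k3
      rw [← integral_const_mul, ← integral_const_mul, ← integral_const_mul,
        ← integral_const_mul, ← integral_add (j0.const_mul a) (j0.const_mul b),
        ← integral_add k1 k3, ← integral_sub j1 k4]
      refine integral_congr_ae (Eventually.of_forall fun z => ?_)
      have key : fderiv ℝ f (lift X 0) (liftL (x - X) + (h * z) • dir3) = b + h * z * d := by
        rw [map_add, map_smul, smul_eq_mul]
        rfl
      have key0 : f (lift X 0) = a := rfl
      simp only [key, key0]
      ring
    rw [e]
    have := norm_setIntegral_le_of_norm_le_const (μ := volume) (s := Ioo (-1 : ℝ) 1)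
      (f := fun z => Q x z * (f (lift x (h * z)) - f (lift X 0) -
          fderiv ℝ f (lift X 0) (liftL (x - X) + (h * z) • dir3)))
      (C := C * (L * (l * c.cellRadius + h) ^ 2)) (by simp) (fun z hz => by
        rw [norm_mul]
        refine mul_le_mul (hQ.bound x hxT z hz) ?_ (norm_nonneg _) hC0
        rw [hlift x z]
        refine (hL3 _ _).trans ?_
        gcongr
        exact hvn x z hz)
    refine this.trans (le_of_eq ?_)
    simp only [Measure.real, Real.volume_Ioo]
    norm_num
  have bP : ∀ x ∈ c.partialPart l, ‖A x - base f (c.cornerOf l x) * layer Q x‖ ≤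
      C * (L * (l * c.cellRadius + h)) * 2 := by
    intro x hx
    have hxT := hPT hx
    set X := c.cornerOf l x with hX
    have j0 := hQ.integrableOn hxT
    have j1 := hQf.integrableOn hxT
    have e : A x - base f X * layer Q x =
        ∫ z in Ioo (-1 : ℝ) 1, Q x z * (f (lift x (h * z)) - f (lift X 0)) := by
      rw [hA]
      simp only [layer]
      rw [← integral_const_mul, ← integral_sub j1 (j0.const_mul _)]
      refine integral_congr_ae (Eventually.of_forall fun z => ?_)
      simp only [base]
      ring
    rw [e]
    have := norm_setIntegral_le_of_norm_le_const (μ := volume) (s := Ioo (-1 : ℝ) 1)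
      (f := fun z => Q x z * (f (lift x (h * z)) - f (lift X 0)))
      (C := C * (L * (l * c.cellRadius + h))) (by simp) (fun z hz => by
        rw [norm_mul]
        refine mul_le_mul (hQ.bound x hxT z hz) ?_ (norm_nonneg _) hC0
        rw [hlift x z]
        refine (hL2 _ _).trans ?_
        gcongr
        exact hvn x z hz)
    refine this.trans (le_of_eq ?_)
    simp only [Measure.real, Real.volume_Ioo]
    norm_num
  have e : S.testedCharge c k f - S.multipoleSum c k f =
      l⁻¹ * ((∫ x in c.fullPart l, (A x - (base f (c.cornerOf l x) * layer Q x +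
        ∑ i, ((baseDeriv f (liftL (dir i)) (c.cornerOf l x) * layer Q x) •
        (x - c.cornerOf l x)) i + h * (baseDeriv f dir3 (c.cornerOf l x) *
          layer (fun x z => z * Q x z) x)))) +
        ∫ x in c.partialPart l, (A x - base f (c.cornerOf l x) * layer Q x)) := by
    rw [integral_sub (iA.mono_set hFT) iG, integral_sub (iA.mono_set hPT) (i0 _ hPT), hsum,
      testedCharge, ← hldef, ← hA, hsplit]
    ring
  rw [e, abs_mul, abs_of_pos (inv_pos.2 hl)]
  refine mul_le_mul_of_nonneg_left ((abs_add_le _ _).trans (add_le_add ?_ ?_))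
    (inv_pos.2 hl).le
  · have h1 := norm_setIntegral_le_of_norm_le_const (μ := volume)
      ((measure_mono hFT).trans_lt hTv) bF
    refine h1.trans ?_
    have hR := c.cellRadius_pos
    gcongr
    exact hTv.ne
  · exact norm_setIntegral_le_of_norm_le_const (μ := volume)
      ((measure_mono hPT).trans_lt hTv) bP

/-- Since `h / l` converges, `l⁻¹ (l R + h)²` tends to zero, while `l⁻¹ (l R + h)` stays bounded and
is multiplied by the vanishing area of the partial part. -/
theorem tendsto_testedCharge_sub (hQ : ∀ᶠ k in atTop,
      IsLayerBounded c.sheet.T C (S.paramCharge c k)) {f : E3 → ℝ} (hf : ContDiff ℝ 2 f)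
    (hc : HasCompactSupport f) :
    Tendsto (fun k => S.testedCharge c k f - S.multipoleSum c k f) atTop (𝓝 0) := by
  obtain ⟨L, -, hL0, hL1, hL2, hL3⟩ := exists_taylor_bounds hf hc
  have hvol := c.tendsto_volume_partialPart S.l_pos S.l_tendsto
  set R := c.cellRadius
  have h1 : Tendsto (fun k => R + S.h k / S.l k) atTop (𝓝 (R + α)) :=
    S.ratio_tendsto.const_add R
  have h2 : Tendsto (fun k => S.l k * R + S.h k) atTop (𝓝 0) := by
    simpa using (S.l_tendsto.mul_const R).add S.h_tendsto
  have h3 : Tendsto (fun k => C * L * 2 * volume.real c.sheet.T *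
      ((R + S.h k / S.l k) * (S.l k * R + S.h k)) +
      C * L * 2 * ((R + S.h k / S.l k) * volume.real (c.partialPart (S.l k)))) atTop (𝓝 0) := by
    simpa using ((h1.mul h2).const_mul (C * L * 2 * volume.real c.sheet.T)).add
      ((h1.mul hvol).const_mul (C * L * 2))
  refine squeeze_zero_norm' ?_ h3
  filter_upwards [hQ] with k hk
  refine (abs_testedCharge_sub_le hk hf hL0 hL1 hL2 hL3).trans (le_of_eq ?_)
  have hl := (S.l_pos k).ne'
  field_simp
  ring

end ChargeSequence

namespace Sheet

variable (M : Sheet)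

/-! ### The film in the chart -/

/-- A property that holds near the compact set `closure T × {0}` holds in a thin layer. -/
theorem exists_layer_of_nhdsSet {p : E3 → Prop} (hp : ∀ᶠ X in 𝓝ˢ (liftL '' closure M.T), p X) :
    ∃ δ > 0, ∀ x ∈ closure M.T, ∀ t : ℝ, |t| ≤ δ → p (lift x t) := by
  obtain ⟨V, hV, hKV, hVp⟩ := mem_nhdsSet_iff_exists.1 hp
  obtain ⟨δ, hδ, hsub⟩ := (M.isCompact_closure.image liftL.continuous).exists_cthickening_subset_open
    hV hKV
  refine ⟨δ, hδ, fun x hx t ht => hVp (hsub ?_)⟩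
  refine Metric.mem_cthickening_of_dist_le _ (liftL x) _ _ (mem_image_of_mem _ hx) ?_
  rw [lift_eq, dist_eq_norm, add_sub_cancel_left, norm_smul, norm_dir3, mul_one]
  exact ht

theorem exists_layer_subset : ∃ δ > 0, ∀ x ∈ closure M.T, ∀ t : ℝ, |t| ≤ δ → lift x t ∈ M.U := by
  refine M.exists_layer_of_nhdsSet (p := fun X => X ∈ M.U) (M.isOpen_U.mem_nhdsSet.2 ?_)
  rintro _ ⟨x, hx, rfl⟩
  exact M.mem_U x hx

/-- The composition of a function with the chart, extended to all of the parameter space. -/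
theorem exists_extension {φ : E3 → ℝ} (hφ : ContDiff ℝ 2 φ) :
    ∃ f : E3 → ℝ, ContDiff ℝ 2 f ∧ HasCompactSupport f ∧
      ∀ᶠ X in 𝓝ˢ (liftL '' closure M.T), f X = φ (M.ψ X) := by
  obtain ⟨χ, h1, h2, h3, h4, -⟩ := exists_cutoff (M.isCompact_closure.image liftL.continuous)
    M.isOpen_U (by rintro _ ⟨x, hx, rfl⟩; exact M.mem_U x hx)
  refine ⟨fun X => χ X • φ (M.ψ X), contDiff_cutoff_smul
    (by exact_mod_cast contDiff_infty.1 h1 2) M.isOpen_U h3 (hφ.comp_contDiffOn M.contDiffOn), h2.smul_right, ?_⟩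
  filter_upwards [h4] with X hX
  simp [hX]

theorem base_extension {f φ : E3 → ℝ}
    (hf : ∀ᶠ X in 𝓝ˢ (liftL '' closure M.T), f X = φ (M.ψ X)) {x : E2} (hx : x ∈ closure M.T) :
    base f x = φ (M.ψ₀ x) :=
  hf.self_of_nhdsSet _ (mem_image_of_mem _ hx)

theorem baseDeriv_extension {f φ : E3 → ℝ} (hφ : ContDiff ℝ 2 φ)
    (hf : ∀ᶠ X in 𝓝ˢ (liftL '' closure M.T), f X = φ (M.ψ X)) {x : E2} (hx : x ∈ closure M.T)
    (v : E3) : baseDeriv f v x = fderiv ℝ φ (M.ψ₀ x) (fderiv ℝ M.ψ (lift x 0) v) := by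
  have h : f =ᶠ[𝓝 (lift x 0)] fun X => φ (M.ψ X) :=
    hf.filter_mono (nhds_le_nhdsSet (mem_image_of_mem _ hx))
  have hd : HasFDerivAt (fun X => φ (M.ψ X))
      (fderiv ℝ φ (M.ψ₀ x) ∘L fderiv ℝ M.ψ (lift x 0)) (lift x 0) :=
    (hφ.differentiable (by norm_num) _).hasFDerivAt.comp (lift x 0)
      (M.hasFDerivAt_ψ (M.mem_U x hx))
  rw [baseDeriv, h.fderiv_eq, hd.fderiv]
  rfl

theorem continuousOn_fderiv_ψ : ContinuousOn (fderiv ℝ M.ψ) M.U :=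
  M.contDiffOn.continuousOn_fderiv_of_isOpen M.isOpen_U (by norm_num)

theorem continuousOn_J : ContinuousOn M.J M.U :=
  (ContinuousLinearMap.continuous_det.comp_continuousOn M.continuousOn_fderiv_ψ).abs

/-- Integration over the film in the chart. -/
theorem setIntegral_film {δ h : ℝ} (hU : ∀ x ∈ closure M.T, ∀ t : ℝ, |t| ≤ δ → lift x t ∈ M.U)
    (hδ : h ≤ δ) {g : E3 → ℝ} :
    MeasurableSet (M.film h) ∧ ∫ r in M.film h, g r =
      ∫ p in M.T ×ˢ Ioo (-h) h, g (M.ψ (lift p.1 p.2)) * M.J (lift p.1 p.2) := by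
  have hTo : IsOpen (M.T ×ˢ Ioo (-h) h) := M.isOpen_T.prod isOpen_Ioo
  set A : Set E3 := (fun p : E2 × ℝ => lift p.1 p.2) '' (M.T ×ˢ Ioo (-h) h) with hA
  have hAo : IsOpen A := liftEquiv.isOpenMap _ hTo
  -- The condition `h ≤ δ` keeps the layer inside the domain of the chart, so that the change of
  -- variables by `ψ` is legitimate.
  have hAU : A ⊆ M.U := by
    rintro _ ⟨p, ⟨hp1, hp2⟩, rfl⟩
    exact hU _ (subset_closure hp1) _ (abs_le.2 ⟨by linarith [hp2.1], by linarith [hp2.2]⟩)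
  have hfilm : M.film h = M.ψ '' A := by rw [hA, image_image]; rfl
  have hd : ∀ X ∈ A, HasFDerivWithinAt M.ψ (fderiv ℝ M.ψ X) A X := fun X hX =>
    (M.hasFDerivAt_ψ (hAU hX)).hasFDerivWithinAt
  refine ⟨?_, ?_⟩
  · rw [hfilm]
    exact hAo.measurableSet.image_of_continuousOn_injOn (M.contDiffOn.continuousOn.mono hAU)
      (M.injOn.mono hAU)
  · rw [hfilm, integral_image_eq_integral_abs_det_fderiv_smul volume hAo.measurableSet hd
      (M.injOn.mono hAU), hA]
    have hemb : MeasurableEmbedding fun p : E2 × ℝ => lift p.1 p.2 :=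
      liftEquiv.measurableEmbedding
    rw [measurePreserving_lift.setIntegral_image_emb hemb]
    refine setIntegral_congr_fun hTo.measurableSet fun p _ => ?_
    simp only [smul_eq_mul, J]
    ring

/-! ### Integrability on the sheet and its boundary -/

theorem integrableOn_T {g : E2 → ℝ} (hg : ContinuousOn g (closure M.T)) : IntegrableOn g M.T :=
  (hg.integrableOn_compact M.isCompact_closure).mono_set subset_closure

theorem isCompact_frontier : IsCompact (frontier M.T) :=
  M.isCompact_closure.of_isClosed_subset isClosed_frontier frontier_subset_closure

/-- The length measure on the boundary of the parameter domain. -/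
noncomputable def bdMeasure : Measure E2 := (μH[1] : Measure E2).restrict (frontier M.T)

instance : IsFiniteMeasure M.bdMeasure := ⟨by
  rw [bdMeasure, Measure.restrict_apply_univ]; exact M.finite_boundary⟩

theorem ae_bdMeasure {p : E2 → Prop} (h : ∀ x ∈ frontier M.T, p x) : ∀ᵐ x ∂M.bdMeasure, p x :=
  (ae_restrict_mem isClosed_frontier.measurableSet).mono h

theorem aestronglyMeasurable_bd {F : Type*} [NormedAddCommGroup F] [NormedSpace ℝ F]
    [SecondCountableTopology F] {g : E2 → F}
    (hg : ContinuousOn g (frontier M.T)) : AEStronglyMeasurable g M.bdMeasure :=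
  letI : MeasurableSpace F := borel F
  haveI : BorelSpace F := ⟨rfl⟩
  hg.aestronglyMeasurable isClosed_frontier.measurableSet

theorem integrable_bd_of_bounded {g : E2 → ℝ} (hg : AEStronglyMeasurable g M.bdMeasure) {C : ℝ}
    (hC : ∀ x ∈ frontier M.T, |g x| ≤ C) : Integrable g M.bdMeasure :=
  Integrable.of_bound hg C (M.ae_bdMeasure hC)

theorem exists_bound_frontier {F : Type*} [NormedAddCommGroup F] {g : E2 → F}
    (hg : ContinuousOn g (frontier M.T)) : ∃ C, 0 ≤ C ∧ ∀ x ∈ frontier M.T, ‖g x‖ ≤ C := by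
  obtain ⟨C, hC⟩ := M.isCompact_frontier.exists_bound_of_continuousOn hg
  exact ⟨max C 0, le_max_right _ _, fun x hx => (hC x hx).trans (le_max_left _ _)⟩

theorem abs_inner_nT_le {x : E2} (hx : x ∈ frontier M.T) (v : E2) : |⟪v, M.nT x⟫| ≤ ‖v‖ := by
  have := abs_real_inner_le_norm v (M.nT x)
  rwa [M.nT_norm hx, mul_one] at this

theorem integrable_inner_nT {X : E2 → E2} (hX : ContinuousOn X (frontier M.T)) :
    Integrable (fun x => ⟪X x, M.nT x⟫) M.bdMeasure := by
  obtain ⟨C, -, hC⟩ := M.exists_bound_frontier hX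
  exact M.integrable_bd_of_bounded
    ((M.aestronglyMeasurable_bd hX).inner M.isOuterNormal.1.aestronglyMeasurable)
    fun x hx => (M.abs_inner_nT_le hx _).trans (hC x hx)

theorem aestronglyMeasurable_bdTangent : AEStronglyMeasurable M.bdTangent M.bdMeasure := by
  have h : ∀ i, AEStronglyMeasurable (fun x => M.D x (dir i)) M.bdMeasure := fun i =>
    M.aestronglyMeasurable_bd ((M.contDiffOn_D.continuousOn.mono M.frontier_subset_baseDomain).clm_apply
      continuousOn_const)
  have hn : ∀ i, Measurable fun x => M.nT x i := fun i =>
    (EuclideanSpace.proj i : E2 →L[ℝ] ℝ).measurable.comp M.isOuterNormal.1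
  have := ((hn 1).neg.aestronglyMeasurable.smul (h 0)).add
    ((hn 0).aestronglyMeasurable.smul (h 1))
  refine this.congr (Eventually.of_forall fun x => ?_)
  rw [bdTangent, clm_apply_E2]
  simp [rot]

theorem aestronglyMeasurable_lineJ : AEStronglyMeasurable M.lineJ M.bdMeasure :=
  M.aestronglyMeasurable_bdTangent.norm

theorem norm_rot (v : E2) : ‖rot v‖ = ‖v‖ := by
  rw [EuclideanSpace.norm_eq, EuclideanSpace.norm_eq]
  simp [rot, Fin.sum_univ_two, add_comm]

theorem exists_lineJ_le : ∃ C, 0 ≤ C ∧ ∀ x ∈ frontier M.T, M.lineJ x ≤ C := by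
  obtain ⟨C, h0, hC⟩ := M.exists_bound_frontier
    (M.contDiffOn_D.continuousOn.mono M.frontier_subset_baseDomain)
  refine ⟨C, h0, fun x hx => ((M.D x).le_opNorm _).trans ?_⟩
  rw [norm_rot, M.nT_norm hx, mul_one]
  exact hC x hx

theorem integrable_mul_lineJ {σ : E2 → ℝ} (hσ : Integrable σ M.bdMeasure) :
    Integrable (fun x => σ x * M.lineJ x) M.bdMeasure := by
  obtain ⟨C, -, hC⟩ := M.exists_lineJ_le
  refine hσ.mul_bdd (c := C) M.aestronglyMeasurable_lineJ (M.ae_bdMeasure fun x hx => ?_)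
  rw [Real.norm_eq_abs, abs_of_pos (M.lineJ_pos hx)]
  exact hC x hx

theorem integrable_bd_mul_continuousOn {s g : E2 → ℝ} (hs : Integrable s M.bdMeasure)
    (hg : ContinuousOn g (frontier M.T)) : Integrable (fun x => s x * g x) M.bdMeasure := by
  obtain ⟨C, -, hC⟩ := M.exists_bound_frontier hg
  exact hs.mul_bdd (c := C) (M.aestronglyMeasurable_bd hg) (M.ae_bdMeasure hC)

/-! ### Integration by parts on the parameter domain -/

theorem div2_smul {g : E2 → ℝ} {X : E2 → E2} {x : E2} (hg : DifferentiableAt ℝ g x)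
    (hX : DifferentiableAt ℝ X x) :
    div2 (fun y => g y • X y) x = fderiv ℝ g x (X x) + g x * div2 X x := by
  rw [clm_apply_E2 (fderiv ℝ g x), div2, div2, Fin.sum_univ_two, Fin.sum_univ_two,
    fderiv_fun_smul hg hX]
  simp
  ring

theorem contDiffOn_J₀_smul {p : E2 → E2} (hp : ContDiff ℝ 1 p) :
    ContDiffOn ℝ 1 (fun y => M.J₀ y • p y) M.baseDomain :=
  M.contDiffOn_J₀.smul hp.contDiffOn

theorem continuousOn_div2 {X : E2 → E2} (hX : ContDiffOn ℝ 1 X M.baseDomain) :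
    ContinuousOn (div2 X) M.baseDomain := by
  have h := hX.continuousOn_fderiv_of_isOpen M.isOpen_baseDomain le_rfl
  refine continuousOn_finsetSum _ fun i _ => ?_
  exact (EuclideanSpace.proj i : E2 →L[ℝ] ℝ).continuous.comp_continuousOn
    (h.clm_apply continuousOn_const)

/-- The divergence theorem for fields defined near the closure of the parameter domain. -/
theorem integral_div2 {X : E2 → E2} (hX : ContDiffOn ℝ 1 X M.baseDomain) :
    ∫ x in M.T, div2 X x = ∫ x, ⟪X x, M.nT x⟫ ∂M.bdMeasure := by
  obtain ⟨χ, h1, h2, h3, h4, -⟩ := exists_cutoff M.isCompact_closure M.isOpen_baseDomain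
    M.closure_subset_baseDomain
  have hc := contDiff_cutoff_smul (h1.of_le (by exact_mod_cast le_top)) M.isOpen_baseDomain h3 hX
  have h := M.isOuterNormal.2.2 _ hc h2.smul_right
  have hloc : ∀ x ∈ closure M.T, (fun y => χ y • X y) =ᶠ[𝓝 x] X := fun x hx => by
    filter_upwards [h4.filter_mono (nhds_le_nhdsSet hx)] with y hy
    simp [hy]
  rw [setIntegral_congr_fun (g := div2 X) M.isOpen_T.measurableSet fun x hx => by
    simp only [div2, (hloc x (subset_closure hx)).fderiv_eq]] at h
  rw [h, bdMeasure]
  refine setIntegral_congr_fun isClosed_frontier.measurableSet fun x hx => ?_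
  simp only [(hloc x (frontier_subset_closure hx)).eq_of_nhds]

theorem integral_mul_div2 {g : E2 → ℝ} {X : E2 → E2} (hg : ContDiffOn ℝ 1 g M.baseDomain)
    (hX : ContDiffOn ℝ 1 X M.baseDomain) :
    ∫ x in M.T, fderiv ℝ g x (X x) =
      (∫ x, g x * ⟪X x, M.nT x⟫ ∂M.bdMeasure) - ∫ x in M.T, g x * div2 X x := by
  have h := M.integral_div2 (hg.smul hX)
  have e : ∀ x ∈ M.T, div2 (fun y => g y • X y) x = fderiv ℝ g x (X x) + g x * div2 X x := by
    intro x hx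
    have hn := M.isOpen_baseDomain.mem_nhds (M.T_subset_baseDomain hx)
    exact div2_smul ((hg.contDiffAt hn).differentiableAt (by norm_num))
      ((hX.contDiffAt hn).differentiableAt (by norm_num))
  have hs := M.closure_subset_baseDomain
  have i1 : IntegrableOn (fun x => fderiv ℝ g x (X x)) M.T :=
    M.integrableOn_T (((hg.continuousOn_fderiv_of_isOpen M.isOpen_baseDomain le_rfl).clm_apply
      hX.continuousOn).mono hs)
  have i2 : IntegrableOn (fun x => g x * div2 X x) M.T :=
    M.integrableOn_T ((hg.continuousOn.mul (M.continuousOn_div2 hX)).mono hs)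
  have h' : ∫ x in M.T, div2 (fun y => g y • X y) x =
      (∫ x in M.T, fderiv ℝ g x (X x)) + ∫ x in M.T, g x * div2 X x := by
    rw [setIntegral_congr_fun M.isOpen_T.measurableSet e, integral_add i1 i2]
  have h'' : ∫ x, ⟪g x • X x, M.nT x⟫ ∂M.bdMeasure = ∫ x, g x * ⟪X x, M.nT x⟫ ∂M.bdMeasure := by
    simp only [real_inner_smul_left]
  have h3 : (∫ x in M.T, div2 (fun y => g y • X y) x) = ∫ x, ⟪g x • X x, M.nT x⟫ ∂M.bdMeasure := h
  rw [h', h''] at h3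
  linarith

end Sheet

/-! ### Convergence of the charges -/

theorem layer_scale (G : ℝ → ℝ) {h : ℝ} (hh : 0 < h) :
    ∫ t in Ioo (-h) h, G t = h * ∫ z in Ioo (-1 : ℝ) 1, G (h * z) := by
  rw [← integral_Ioc_eq_integral_Ioo, ← integral_Ioc_eq_integral_Ioo,
    ← intervalIntegral.integral_of_le (by linarith), ← intervalIntegral.integral_of_le (by norm_num),
    ← smul_eq_mul, intervalIntegral.smul_integral_comp_mul_left]
  simp

theorem IsLayerBounded.setIntegral_prod {T : Set E2} {C : ℝ} {H : E2 → ℝ → ℝ}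
    (hH : IsLayerBounded T C H) (hT : IsOpen T) (hb : Bornology.IsBounded T) {h : ℝ} (hh : 0 < h) :
    ∫ p in T ×ˢ Ioo (-h) h, H p.1 (h⁻¹ * p.2) = h * ∫ x in T, layer H x := by
  have hTo : MeasurableSet (T ×ˢ Ioo (-h) h) := (hT.prod isOpen_Ioo).measurableSet
  have hfin : (volume : Measure (E2 × ℝ)) (T ×ˢ Ioo (-h) h) < ⊤ :=
    (hb.prod (Metric.isBounded_Ioo _ _)).measure_lt_top
  have hmap : MapsTo (fun p : E2 × ℝ => (p.1, h⁻¹ * p.2)) (T ×ˢ Ioo (-h) h)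
      (T ×ˢ Ioo (-1 : ℝ) 1) := by
    intro p hp
    refine ⟨hp.1, ?_, ?_⟩
    · change -1 < h⁻¹ * p.2
      rw [inv_mul_eq_div, lt_div_iff₀ hh]; linarith [hp.2.1]
    · change h⁻¹ * p.2 < 1
      rw [inv_mul_eq_div, div_lt_iff₀ hh]; linarith [hp.2.2]
  have hint : IntegrableOn (fun p : E2 × ℝ => H p.1 (h⁻¹ * p.2)) (T ×ˢ Ioo (-h) h) := by
    have : IsFiniteMeasure ((volume : Measure (E2 × ℝ)).restrict (T ×ˢ Ioo (-h) h)) :=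
      ⟨by rwa [Measure.restrict_apply_univ]⟩
    refine Integrable.of_bound (ContinuousOn.aestronglyMeasurable ?_ hTo) C
      ((ae_restrict_mem hTo).mono fun p hp => ?_)
    · exact hH.cont.comp (by fun_prop) hmap
    · exact hH.bound _ (hmap hp).1 _ (hmap hp).2
  rw [Measure.volume_eq_prod] at hint ⊢
  rw [MeasureTheory.setIntegral_prod _ hint, ← integral_const_mul]
  refine integral_congr_ae (Eventually.of_forall fun x => ?_)
  simp only
  rw [layer_scale _ hh, layer]
  congr 1
  refine integral_congr_ae (Eventually.of_forall fun z => ?_)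
  simp only
  rw [inv_mul_cancel_left₀ hh.ne']

namespace ChargeSequence

variable {α : ℝ} {S : ChargeSequence α} {c : Choice}

/-- For small `h` the layer lies in the compact set `closure T × [-δ, δ]`, on which the Jacobian is
bounded. The bound is therefore the same for all small scales. -/
theorem exists_isLayerBounded (hA : S.AdaptedTo c) :
    ∃ C, ∀ᶠ k in atTop, IsLayerBounded c.sheet.T C (S.paramCharge c k) := by
  obtain ⟨δ, hδ, hU⟩ := c.sheet.exists_layer_subset
  obtain ⟨B, hB⟩ := S.bounded
  have hK : IsCompact ((fun p : E2 × ℝ => lift p.1 p.2) '' (closure c.sheet.T ×ˢ Icc (-δ) δ)) :=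
    (c.sheet.isCompact_closure.prod isCompact_Icc).image continuous_lift
  have hKU : (fun p : E2 × ℝ => lift p.1 p.2) '' (closure c.sheet.T ×ˢ Icc (-δ) δ) ⊆ c.sheet.U := by
    rintro _ ⟨p, ⟨hp1, hp2⟩, rfl⟩
    exact hU _ hp1 _ (abs_le.2 hp2)
  obtain ⟨J, hJ⟩ := hK.exists_bound_of_continuousOn (c.sheet.continuousOn_J.mono hKU)
  refine ⟨B * J, ?_⟩
  filter_upwards [hA, S.h_tendsto.eventually_le_const hδ] with k hk hhk
  have hh := S.h_pos k
  have hz : ∀ z ∈ Ioo (-1 : ℝ) 1, |S.h k * z| ≤ S.h k := fun z hz => by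
    rw [abs_mul, abs_of_pos hh]
    have : |z| ≤ 1 := abs_le.2 ⟨hz.1.le, hz.2.le⟩
    nlinarith
  have hlU : ∀ x ∈ c.sheet.T, ∀ z ∈ Ioo (-1 : ℝ) 1, lift x (S.h k * z) ∈ c.sheet.U :=
    fun x hx z hzz => hU x (subset_closure hx) _ ((hz z hzz).trans hhk)
  have hl : Continuous fun p : E2 × ℝ => lift p.1 (S.h k * p.2) :=
    continuous_lift.comp (continuous_fst.prodMk (continuous_const.mul continuous_snd))
  refine ⟨?_, fun x hx z hzz => ?_⟩
  · refine ContinuousOn.mul ?_ ?_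
    · refine hk.1.comp (t := c.sheet.film (S.h k)) (c.sheet.contDiffOn.continuousOn.comp
        hl.continuousOn fun p hp => hlU _ hp.1 _ hp.2) fun p hp => ?_
      refine ⟨(p.1, S.h k * p.2), ⟨hp.1, ?_, ?_⟩, rfl⟩
      · change -S.h k < S.h k * p.2
        nlinarith [hp.2.1]
      · change S.h k * p.2 < S.h k
        nlinarith [hp.2.2]
    · exact c.sheet.continuousOn_J.comp hl.continuousOn fun p hp => hlU _ hp.1 _ hp.2
  · rw [paramCharge, abs_mul]
    refine mul_le_mul (hB _ _) ?_ (abs_nonneg _) ((abs_nonneg _).trans (hB k 0))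
    exact hJ _ ⟨(x, S.h k * z), ⟨subset_closure hx, abs_le.1 ((hz z hzz).trans hhk)⟩, rfl⟩

/-- The charge distribution tested with `φ`, in the chart. -/
theorem eventually_source_eq (hA : S.AdaptedTo c) {f φ : E3 → ℝ} (hf : Continuous f)
    (hfc : HasCompactSupport f)
    (hfφ : ∀ᶠ X in 𝓝ˢ (liftL '' closure c.sheet.T), f X = φ (c.sheet.ψ X)) :
    ∀ᶠ k in atTop, S.source k φ = S.h k / S.l k * S.testedCharge c k f := by
  obtain ⟨δ, hδ, hU⟩ := c.sheet.exists_layer_subset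
  obtain ⟨δ', hδ', hfφ⟩ := c.sheet.exists_layer_of_nhdsSet hfφ
  obtain ⟨C, hC⟩ := exists_isLayerBounded hA
  obtain ⟨B, hB⟩ := hfc.exists_bound_of_continuous hf
  filter_upwards [hA, hC, S.h_tendsto.eventually_le_const hδ,
    S.h_tendsto.eventually_le_const hδ'] with k hk hC hhk hhk'
  have hh := S.h_pos k
  have hl := S.l_pos k
  set h := S.h k with hhdef
  have hT := c.sheet.isOpen_T
  have hbd := (hC.mul (isLayerBounded_comp_lift c.sheet.T hf hB h))
  have e1 : S.source k φ = (S.l k ^ 2)⁻¹ * ∫ r in c.sheet.film h, S.ρ k r * φ r := by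
    rw [source, ← setIntegral_eq_integral_of_forall_compl_eq_zero (s := c.sheet.film h),
      ← integral_const_mul]
    · refine integral_congr_ae (Eventually.of_forall fun r => ?_)
      simp only
      ring
    · intro r hr
      have : S.ρ k r = 0 := by
        by_contra h0
        exact hr (hk.2 h0)
      simp [this]
  have e2 := (c.sheet.setIntegral_film hU hhk (g := fun r => S.ρ k r * φ r)).2
  have hscale : ∀ p ∈ c.sheet.T ×ˢ Ioo (-h) h, (S.ρ k (c.sheet.ψ (lift p.1 p.2)) *
      φ (c.sheet.ψ (lift p.1 p.2)) * c.sheet.J (lift p.1 p.2)) =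
      S.paramCharge c k p.1 (h⁻¹ * p.2) * f (lift p.1 (h * (h⁻¹ * p.2))) := by
    intro p hp
    have : h * (h⁻¹ * p.2) = p.2 := by field_simp
    rw [paramCharge, ← hhdef, this, hfφ _ (subset_closure hp.1) _ (abs_le.2 ⟨by
      linarith [hp.2.1], by linarith [hp.2.2]⟩)]
    ring
  -- Rescaling the thickness produces a factor `h`, and `h · l⁻²` is split as `(h / l) · l⁻¹`; the
  -- second factor belongs to `testedCharge`.
  rw [e1, e2, setIntegral_congr_fun (hT.prod isOpen_Ioo).measurableSet hscale,
    hbd.setIntegral_prod hT c.sheet.isBounded_T hh, testedCharge, ← hhdef]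
  field_simp

/-- The limit of the sums of moments. -/
noncomputable def multipoleLimit (α : ℝ) (M : Sheet) (F : Fields) (f : E3 → ℝ) : ℝ :=
  (∫ x in M.T, base f x * F.q x * M.J₀ x) +
    (∑ i, (∫ x in M.T, (baseDeriv f (liftL (dir i)) x * M.J₀ x) • F.p x) i) +
    α * (∫ x in M.T, baseDeriv f dir3 x * F.p₃ x * M.J₀ x) +
    ∫ x in frontier M.T, base f x * F.σ x * M.lineJ x ∂(μH[1] : Measure E2)

theorem tendsto_multipoleSum {F : Fields} (hH : IsHomogenized S c F) {f : E3 → ℝ}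
    (hf : ContDiff ℝ 2 f) (hc : HasCompactSupport f) :
    Tendsto (fun k => S.multipoleSum c k f) atTop (𝓝 (multipoleLimit α c.sheet F f)) := by
  have c0 := continuous_base hf.continuous
  have s0 : HasCompactSupport (base f) := hasCompactSupport_comp_lift hc
  have cd := continuous_baseDeriv hf
  have sd := hasCompactSupport_baseDeriv hc
  refine (((hH.free_charge _ c0 s0).add (tendsto_finsetSum _ fun i _ => ?_)).add
    (S.ratio_tendsto.mul (hH.normal _ (cd _) (sd _)))).add (hH.surface_charge _ c0 s0)
  exact ((EuclideanSpace.proj i : E2 →L[ℝ] ℝ).continuous.tendsto _).comp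
    (hH.tangential _ (cd _) (sd _))

end ChargeSequence

/-! ### Identification of the limit with the homogenized source -/

theorem lineJ_mul_boundaryDensity (α : ℝ) (M : Sheet) (F : Fields) {x : E2}
    (hx : x ∈ frontier M.T) :
    boundaryDensity α M F x * M.lineJ x =
      α * (F.σ x * M.lineJ x + ⟪M.J₀ x • F.p x, M.nT x⟫) := by
  have h := M.J₀_mul_inner_nT hx (F.p x)
  rw [boundaryDensity, tangentialPolarization, real_inner_smul_left, h]
  ring

theorem integrable_boundaryDensity (α : ℝ) {M : Sheet} {F : Fields}
    (hσ : Integrable F.σ M.bdMeasure) :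
    Integrable (fun x => boundaryDensity α M F x * M.lineJ x) M.bdMeasure := by
  have h := ((M.integrable_mul_lineJ hσ).add (M.integrable_inner_nT
    ((M.contDiffOn_J₀_smul F.contDiff_p).continuousOn.mono M.frontier_subset_baseDomain))).const_mul α
  refine h.congr (M.ae_bdMeasure fun x hx => ?_)
  exact (lineJ_mul_boundaryDensity α M F hx).symm

theorem continuousOn_bulkDensity (α : ℝ) (M : Sheet) (F : Fields) :
    ContinuousOn (bulkDensity α M F) M.baseDomain :=
  (F.continuous_q.continuousOn.const_mul α).sub
    (((M.continuousOn_div2 (M.contDiffOn_J₀_smul F.contDiff_p)).div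
      M.contDiffOn_J₀.continuousOn fun _ hx => (M.J₀_pos hx).ne').const_mul α)

/-- The tangential dipoles pair `J₀ p` with the gradient of the test function in the chart.
Integration by parts yields `-div (J₀ p)` in `T` and the flux `J₀ ⟪p, nT⟫` on `∂T`, which is `lineJ`
times the flux in space. The normal dipoles carry `α²` because `h / l` enters once through the
volume of the film and once through the normal displacement `h z`. -/
theorem mul_multipoleLimit (α : ℝ) {M : Sheet} {F : Fields} (hσ : Integrable F.σ M.bdMeasure)
    {f φ : E3 → ℝ} (hf : ContDiff ℝ 2 f) (hφ : ContDiff ℝ 2 φ)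
    (hfφ : ∀ᶠ X in 𝓝ˢ (liftL '' closure M.T), f X = φ (M.ψ X)) :
    α * ChargeSequence.multipoleLimit α M F f = bulkSource α M F φ + boundarySource α M F φ := by
  have hTm := M.isOpen_T.measurableSet
  have hs := M.closure_subset_baseDomain
  have hb : ContDiff ℝ 1 (base f) :=
    (hf.of_le (by norm_num)).comp (liftL.contDiff (n := 1))
  have hX := M.contDiffOn_J₀_smul F.contDiff_p
  have e0 : ∀ x ∈ closure M.T, base f x = φ (M.ψ₀ x) := fun x hx => M.base_extension hfφ hx
  have e3 : ∀ x ∈ closure M.T, baseDeriv f dir3 x = fderiv ℝ φ (M.ψ₀ x) (M.ν x) := fun x hx => by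
    rw [M.baseDeriv_extension hφ hfφ hx, M.fderiv_ψ_dir3 hx]
  have hfd : ∀ x v, fderiv ℝ (base f) x v = baseDeriv f (liftL v) x := by
    intro x v
    have : HasFDerivAt (base f) (fderiv ℝ f (lift x 0) ∘L liftL) x :=
      (hf.differentiable (by norm_num) _).hasFDerivAt.comp x liftL.hasFDerivAt
    rw [this.fderiv]; rfl
  -- the tangential term
  have cJ : ContinuousOn M.J₀ (closure M.T) := M.contDiffOn_J₀.continuousOn.mono hs
  have ci : ∀ i, ContinuousOn (fun x => (baseDeriv f (liftL (dir i)) x * M.J₀ x) • F.p x)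
      (closure M.T) := fun i => ((continuous_baseDeriv hf _).continuousOn.mul cJ).smul
        F.contDiff_p.continuous.continuousOn
  have ii : ∀ i, IntegrableOn (fun x => (baseDeriv f (liftL (dir i)) x * M.J₀ x) • F.p x) M.T :=
    fun i => ((ci i).integrableOn_compact M.isCompact_closure).mono_set subset_closure
  have htan : (∑ i, (∫ x in M.T, (baseDeriv f (liftL (dir i)) x * M.J₀ x) • F.p x) i) =
      ∫ x in M.T, fderiv ℝ (base f) x (M.J₀ x • F.p x) := by
    have h1 : ∀ i : Fin 2, (∫ x in M.T, (baseDeriv f (liftL (dir i)) x * M.J₀ x) • F.p x) i =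
        ∫ x in M.T, ((baseDeriv f (liftL (dir i)) x * M.J₀ x) • F.p x) i := fun i =>
      ((EuclideanSpace.proj i : E2 →L[ℝ] ℝ).integral_comp_comm (ii i)).symm
    have h2 : ∀ i : Fin 2, IntegrableOn
        (fun x => ((baseDeriv f (liftL (dir i)) x * M.J₀ x) • F.p x) i) M.T := fun i =>
      (EuclideanSpace.proj i : E2 →L[ℝ] ℝ).integrable_comp (ii i)
    simp only [h1]
    rw [← integral_finsetSum _ fun i _ => h2 i]
    refine integral_congr_ae (Eventually.of_forall fun x => ?_)
    simp only
    rw [clm_apply_E2 (fderiv ℝ (base f) x), Fin.sum_univ_two, hfd, hfd]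
    simp only [PiLp.smul_apply, smul_eq_mul]
    ring
  have hparts := M.integral_mul_div2 hb.contDiffOn hX
  -- the bulk
  have hdens : ∀ x ∈ M.T, bulkDensity α M F x * φ (M.ψ₀ x) * M.J₀ x =
      α * (base f x * F.q x * M.J₀ x) -
        α * (base f x * div2 (fun y => M.J₀ y • F.p y) x) := by
    intro x hx
    have hJ := (M.J₀_pos (M.T_subset_baseDomain hx)).ne'
    rw [bulkDensity, e0 x (subset_closure hx)]
    field_simp
  have cb : ContinuousOn (base f) (closure M.T) := hb.continuous.continuousOn
  have i1 : IntegrableOn (fun x => base f x * F.q x * M.J₀ x) M.T :=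
    M.integrableOn_T ((cb.mul F.continuous_q.continuousOn).mul cJ)
  have i2 : IntegrableOn (fun x => base f x * div2 (fun y => M.J₀ y • F.p y) x) M.T :=
    M.integrableOn_T (cb.mul ((M.continuousOn_div2 hX).mono hs))
  have hbulk : bulkSource α M F φ = α * (∫ x in M.T, base f x * F.q x * M.J₀ x) -
      α * (∫ x in M.T, base f x * div2 (fun y => M.J₀ y • F.p y) x) +
      α ^ 2 * ∫ x in M.T, baseDeriv f dir3 x * F.p₃ x * M.J₀ x := by
    have hn : normalDerivIndicator M F.p₃ φ =
        -∫ x in M.T, baseDeriv f dir3 x * F.p₃ x * M.J₀ x := by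
      rw [normalDerivIndicator]
      congr 1
      refine setIntegral_congr_fun hTm fun x hx => ?_
      simp only [e3 x (subset_closure hx)]
      ring
    rw [bulkSource, setIntegral_congr_fun hTm hdens, integral_sub (i1.const_mul α)
      (i2.const_mul α), integral_const_mul, integral_const_mul, hn]
    ring
  -- the boundary
  have j1 : Integrable (fun x => base f x * F.σ x * M.lineJ x) M.bdMeasure := by
    have := M.integrable_bd_mul_continuousOn (M.integrable_mul_lineJ hσ)
      hb.continuous.continuousOn
    refine this.congr (Eventually.of_forall fun x => ?_)
    simp only; ring
  have j2 : Integrable (fun x => base f x * ⟪M.J₀ x • F.p x, M.nT x⟫) M.bdMeasure := by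
    have := M.integrable_bd_mul_continuousOn (M.integrable_inner_nT
      (hX.continuousOn.mono M.frontier_subset_baseDomain)) hb.continuous.continuousOn
    refine this.congr (Eventually.of_forall fun x => ?_)
    simp only; ring
  have hbd : boundarySource α M F φ = α * (∫ x, base f x * F.σ x * M.lineJ x ∂M.bdMeasure) +
      α * ∫ x, base f x * ⟪M.J₀ x • F.p x, M.nT x⟫ ∂M.bdMeasure := by
    rw [← integral_const_mul, ← integral_const_mul, ← integral_add (j1.const_mul α)
      (j2.const_mul α), boundarySource]
    refine integral_congr_ae (M.ae_bdMeasure fun x hx => ?_)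
    simp only
    rw [mul_right_comm, lineJ_mul_boundaryDensity α M F hx, e0 x (frontier_subset_closure hx)]
    ring
  rw [ChargeSequence.multipoleLimit, hbulk, hbd, htan, hparts]
  change α * (_ + _ + _ + ∫ x, base f x * F.σ x * M.lineJ x ∂M.bdMeasure) = _
  ring

/-- The charge distributions converge to the homogenized sources. -/
theorem tendsto_source {α : ℝ} {S : ChargeSequence α} {c : Choice} {F : Fields}
    (hA : S.AdaptedTo c) (hH : IsHomogenized S c F) {φ : E3 → ℝ} (hφ : ContDiff ℝ 2 φ) :
    Tendsto (fun k => S.source k φ) atTop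
      (𝓝 (bulkSource α c.sheet F φ + boundarySource α c.sheet F φ)) := by
  obtain ⟨f, hf, hfc, hfφ⟩ := c.sheet.exists_extension hφ
  obtain ⟨C, hC⟩ := ChargeSequence.exists_isLayerBounded hA
  rw [← mul_multipoleLimit α hH.integrable_σ hf hφ hfφ]
  have h1 := (ChargeSequence.tendsto_testedCharge_sub hC hf hfc).add
    (ChargeSequence.tendsto_multipoleSum hH hf hfc)
  simp only [sub_add_cancel, zero_add] at h1
  refine (S.ratio_tendsto.mul h1).congr' ?_
  filter_upwards [ChargeSequence.eventually_source_eq hA hf.continuous hfc hfφ] with k hk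
  exact hk.symm

/-! ### Newtonian potentials of distributions -/

/-- `Φ` is the Newtonian potential of the distribution `D` of compact support. -/
structure IsNewtonian (D : (E3 → ℝ) → ℝ) (Φ : E3 → ℝ) : Prop where
  locallyIntegrable : LocallyIntegrable Φ
  tendsto_zero : Tendsto Φ (cocompact E3) (𝓝 0)
  integral_mul : ∀ φ, IsTestFunction φ → ∫ r, Φ r * φ r = D (newton φ)

theorem IsTestFunction.contDiff_two {φ : E3 → ℝ} (h : IsTestFunction φ) : ContDiff ℝ 2 φ := by
  exact_mod_cast contDiff_infty.1 h.1 2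

theorem IsTestFunction.laplacian {φ : E3 → ℝ} (h : IsTestFunction φ) :
    IsTestFunction (Laplacian.laplacian φ) := by
  refine ⟨?_, hasCompactSupport_laplacian h.contDiff_two h.2⟩
  have e : Laplacian.laplacian φ = fun x => ∑ i, fderiv ℝ (fun y => fderiv ℝ φ y (ax i)) x (ax i) :=
    funext fun x => laplacian_eq_sum h.contDiff_two x
  rw [e]
  exact ContDiff.sum fun i _ => contDiff_fderiv_apply (m := ∞)
    (contDiff_fderiv_apply (m := ∞) h.1 (by simp) _) (by simp) _

theorem IsTestFunction.contDiff_newton_two {φ : E3 → ℝ} (h : IsTestFunction φ) :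
    ContDiff ℝ 2 (newton φ) :=
  contDiff_newton (n := 2) (by exact_mod_cast h.contDiff_two) h.2

namespace IsNewtonian

variable {D D' : (E3 → ℝ) → ℝ} {Φ Φ' : E3 → ℝ}

/-- The Newtonian potential of a test function is smooth but need not have compact support;
agreement of the two distributions is therefore required on all `C²` functions. -/
theorem congr (h : IsNewtonian D Φ) (hD : ∀ φ, ContDiff ℝ 2 φ → D φ = D' φ) : IsNewtonian D' Φ :=
  ⟨h.1, h.2, fun φ hφ => (h.3 φ hφ).trans (hD _ hφ.contDiff_newton_two)⟩

theorem add (h : IsNewtonian D Φ) (h' : IsNewtonian D' Φ') :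
    IsNewtonian (fun φ => D φ + D' φ) (Φ + Φ') := by
  refine ⟨h.1.add h'.1, ?_, fun φ hφ => ?_⟩
  · have := h.2.add h'.2
    rwa [add_zero] at this
  · simp only [Pi.add_apply, add_mul]
    rw [integral_add (integrable_mul_of_locallyIntegrable h.1 hφ.1.continuous hφ.2)
      (integrable_mul_of_locallyIntegrable h'.1 hφ.1.continuous hφ.2), h.3 φ hφ, h'.3 φ hφ]

/-- The duality is applied to the Laplacian of `φ`, whose Newtonian potential is `-φ`; of the
linearity of `D` only the oddness enters. -/
theorem solvesPoisson (h : IsNewtonian D Φ) (hD : ∀ φ, D (fun x => -φ x) = -D φ) :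
    SolvesPoisson D Φ := by
  refine ⟨h.1, h.2, fun φ hφ => ?_⟩
  rw [h.3 _ hφ.laplacian, show newton (Laplacian.laplacian φ) = fun x => -φ x from
    funext fun a => newton_laplacian hφ.contDiff_two hφ.2 a, hD, neg_neg]

end IsNewtonian

section Layers

variable {X : Type*} [MeasurableSpace X] {μ : Measure X} [SFinite μ] {g : X → E3} {f : X → ℝ}

/-- By Fubini's theorem the kernel can be transferred from the charge to `φ`. The functional `L` is
evaluation for charges and a directional derivative for dipoles, so both kinds of layers are covered
at once. -/
theorem isNewtonian_const_mul_potential (hg : AEMeasurable g μ) (hf : Integrable f μ)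
    {κ : E3 → ℝ} (hκ : Measurable κ) (hκb : ∀ r, |κ r| ≤ singBound r) {R : ℝ}
    (hgR : ∀ᵐ x ∂μ, ‖g x‖ ≤ R) {L : (E3 → ℝ) → E3 → ℝ}
    (hL : ∀ φ, IsTestFunction φ → ∀ a, L (newton φ) a =
      coulombConst⁻¹ * ∫ r, κ (r - a) * φ r) :
    IsNewtonian (fun φ => ∫ x, f x * L φ (g x) ∂μ)
      (fun r => coulombConst⁻¹ * potential μ g f κ r) := by
  refine ⟨(locallyIntegrable_potential hg hf hκ hκb hgR).smul coulombConst⁻¹, ?_, fun φ hφ => ?_⟩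
  · simpa using (tendsto_potential_cocompact hf hκb hgR).const_mul coulombConst⁻¹
  · simp only [mul_assoc]
    rw [integral_const_mul, integral_potential_mul hg hf hκ hκb hgR hφ.1.continuous hφ.2,
      ← integral_const_mul]
    refine integral_congr_ae (Eventually.of_forall fun x => ?_)
    simp only [hL φ hφ]
    ring

/-- The potential of a charge distribution carried by the image of `g`. -/
theorem exists_isNewtonian_charge (hg : AEMeasurable g μ) (hf : Integrable f μ) {R : ℝ}
    (hgR : ∀ᵐ x ∂μ, ‖g x‖ ≤ R) :
    ∃ Φ, IsNewtonian (fun φ => ∫ x, f x * φ (g x) ∂μ) Φ :=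
  ⟨_, isNewtonian_const_mul_potential hg hf (κ := fun r => ‖r‖⁻¹) (by fun_prop) abs_inv_norm_le hgR
    (L := fun φ => φ) fun _ _ _ => rfl⟩

/-- The potential of a distribution of dipoles carried by the image of `g`. -/
theorem exists_isNewtonian_dipole (hg : AEMeasurable g μ) (hf : Integrable f μ) {R : ℝ}
    (hgR : ∀ᵐ x ∂μ, ‖g x‖ ≤ R) {v : E3} (hv : ‖v‖ ≤ 1) :
    ∃ Φ, IsNewtonian (fun φ => ∫ x, f x * fderiv ℝ φ (g x) v ∂μ) Φ :=
  ⟨_, isNewtonian_const_mul_potential hg hf (measurable_dipoleKernel v) (abs_dipoleKernel_le hv) hgR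
    (L := fun φ a => fderiv ℝ φ a v) fun φ hφ a => by
      have h1 : ContDiff ℝ 1 φ := hφ.contDiff_two.of_le (by norm_num)
      rw [fderiv_newton h1 hφ.2, newton_fderiv h1 hφ.2 a hv]⟩

end Layers

theorem clm_apply_E3 (L : E3 →L[ℝ] ℝ) (v : E3) : L v = ∑ i, v i * L (ax i) := by
  conv_lhs => rw [← (EuclideanSpace.basisFun (Fin 3) ℝ).sum_repr v]
  simp [map_sum, ax]

theorem norm_ax (i : Fin 3) : ‖ax i‖ = 1 := by simp [ax]

theorem exists_isNewtonian_homogenized (α : ℝ) (M : Sheet) (F : Fields)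
    (hσ : Integrable F.σ M.bdMeasure) :
    ∃ Φ, IsNewtonian (fun φ => bulkSource α M F φ + boundarySource α M F φ) Φ := by
  have hTm := M.isOpen_T.measurableSet
  have hs := M.closure_subset_baseDomain
  have gT : AEMeasurable M.ψ₀ (volume.restrict M.T) :=
    (M.continuousOn_ψ₀.mono M.T_subset_baseDomain).aemeasurable hTm
  have gB : AEMeasurable M.ψ₀ M.bdMeasure :=
    (M.continuousOn_ψ₀.mono M.frontier_subset_baseDomain).aemeasurable
      isClosed_frontier.measurableSet
  obtain ⟨R, hR⟩ := M.isCompact_closure.exists_bound_of_continuousOn (M.continuousOn_ψ₀.mono hs)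
  have bT : ∀ᵐ x ∂volume.restrict M.T, ‖M.ψ₀ x‖ ≤ R :=
    (ae_restrict_mem hTm).mono fun x hx => hR x (subset_closure hx)
  have bB : ∀ᵐ x ∂M.bdMeasure, ‖M.ψ₀ x‖ ≤ R :=
    M.ae_bdMeasure fun x hx => hR x (frontier_subset_closure hx)
  have cJ := M.contDiffOn_J₀.continuousOn.mono hs
  have i0 : Integrable (fun x => bulkDensity α M F x * M.J₀ x) (volume.restrict M.T) :=
    M.integrableOn_T (((continuousOn_bulkDensity α M F).mono hs).mul cJ)
  have cν : ∀ i : Fin 3, ContinuousOn (fun x => M.ν x i) (closure M.T) := fun i =>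
    (EuclideanSpace.proj i : E3 →L[ℝ] ℝ).continuous.comp_continuousOn (M.continuousOn_ν.mono hs)
  have i1 : ∀ i : Fin 3, Integrable (fun x => α ^ 2 * (F.p₃ x * M.ν x i * M.J₀ x))
      (volume.restrict M.T) := fun i =>
    M.integrableOn_T (((F.continuous_p₃.continuousOn.mul (cν i)).mul cJ).const_mul _)
  obtain ⟨Φ, hΦ⟩ := exists_isNewtonian_charge gT i0 bT
  obtain ⟨Ψ, hΨ⟩ := exists_isNewtonian_charge gB (integrable_boundaryDensity α hσ) bB
  -- The direction of the dipoles varies with the normal. Each dipole is resolved into the three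
  -- fixed coordinate directions, with densities `p₃ ν i`.
  choose χ hχ using fun i => exists_isNewtonian_dipole gT (i1 i) bT (norm_ax i).le
  refine ⟨_, ((((hΦ.add (hχ 0)).add (hχ 1)).add (hχ 2)).add hΨ).congr fun φ hφ => ?_⟩
  have cf : ∀ v, ContinuousOn (fun x => fderiv ℝ φ (M.ψ₀ x) v) (closure M.T) := fun v =>
    (contDiff_fderiv_apply (m := 1) hφ (by norm_num) v).continuous.comp_continuousOn
      (M.continuousOn_ψ₀.mono hs)
  have i2 : ∀ i : Fin 3, IntegrableOn (fun x => α ^ 2 * (F.p₃ x * M.ν x i * M.J₀ x) *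
      fderiv ℝ φ (M.ψ₀ x) (ax i)) M.T := fun i =>
    M.integrableOn_T ((((F.continuous_p₃.continuousOn.mul (cν i)).mul cJ).const_mul _).mul (cf _))
  congr 1
  · rw [bulkSource, normalDerivIndicator, add_assoc, add_assoc, mul_neg, sub_neg_eq_add,
      ← integral_const_mul]
    congr 1
    · exact integral_congr_ae (Eventually.of_forall fun x => mul_right_comm _ _ _)
    · have i3 : IntegrableOn (fun x => α ^ 2 * (F.p₃ x * M.ν x 1 * M.J₀ x) *
          fderiv ℝ φ (M.ψ₀ x) (ax 1) + α ^ 2 * (F.p₃ x * M.ν x 2 * M.J₀ x) *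
          fderiv ℝ φ (M.ψ₀ x) (ax 2)) M.T := (i2 1).add (i2 2)
      rw [← integral_add (i2 1) (i2 2), ← integral_add (i2 0) i3]
      refine integral_congr_ae (Eventually.of_forall fun x => ?_)
      simp only
      rw [clm_apply_E3 _ (M.ν x), Fin.sum_univ_three]
      ring
  · rw [boundarySource]
    exact integral_congr_ae (Eventually.of_forall fun x => mul_right_comm _ _ _)

theorem homogenized_neg (α : ℝ) (M : Sheet) (F : Fields) (φ : E3 → ℝ) :
    bulkSource α M F (fun x => -φ x) + boundarySource α M F (fun x => -φ x) =
      -(bulkSource α M F φ + boundarySource α M F φ) := by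
  simp only [bulkSource, boundarySource, normalDerivIndicator, fderiv_fun_neg,
    neg_apply, mul_neg, neg_mul, integral_neg]
  ring

/-! ### Potentials of the microscopic charges -/

namespace ChargeSequence

variable {α : ℝ} {S : ChargeSequence α}

theorem source_neg (k : ℕ) (φ : E3 → ℝ) : S.source k (fun x => -φ x) = -S.source k φ := by
  simp only [source, mul_neg, integral_neg]

/-- For small scales the charge is a bounded density on a film of finite volume inside a fixed
compact set, so it is a charge layer over the film itself, with the identity as placement. -/
theorem eventually_exists_isNewtonian {c : Choice} (hA : S.AdaptedTo c) :
    ∀ᶠ k in atTop, ∃ Φ, IsNewtonian (S.source k) Φ := by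
  obtain ⟨δ, hδ, hU⟩ := c.sheet.exists_layer_subset
  obtain ⟨B, hB⟩ := S.bounded
  have hK : IsCompact (c.sheet.ψ '' ((fun p : E2 × ℝ => lift p.1 p.2) ''
      (closure c.sheet.T ×ˢ Icc (-δ) δ))) := by
    refine ((c.sheet.isCompact_closure.prod isCompact_Icc).image continuous_lift).image_of_continuousOn
      (c.sheet.contDiffOn.continuousOn.mono ?_)
    rintro _ ⟨p, ⟨hp1, hp2⟩, rfl⟩
    exact hU _ hp1 _ (abs_le.2 hp2)
  obtain ⟨R, hR⟩ := hK.isBounded.exists_norm_le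
  filter_upwards [hA, S.h_tendsto.eventually_le_const hδ] with k hk hhk
  have hfm := (c.sheet.setIntegral_film hU hhk (g := fun _ => 0)).1
  have hsub : c.sheet.film (S.h k) ⊆ c.sheet.ψ '' ((fun p : E2 × ℝ => lift p.1 p.2) ''
      (closure c.sheet.T ×ˢ Icc (-δ) δ)) := by
    rintro _ ⟨p, ⟨hp1, hp2⟩, rfl⟩
    exact mem_image_of_mem _ ⟨p, ⟨subset_closure hp1, by linarith [hp2.1], by linarith [hp2.2]⟩, rfl⟩
  have hfin : IsFiniteMeasure (volume.restrict (c.sheet.film (S.h k))) :=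
    ⟨by rw [Measure.restrict_apply_univ]; exact (hK.isBounded.subset hsub).measure_lt_top⟩
  have hint : Integrable (fun r => S.ρ k r / S.l k ^ 2) (volume.restrict (c.sheet.film (S.h k))) :=
    (Integrable.of_bound (hk.1.aestronglyMeasurable hfm) B
      (Eventually.of_forall fun r => hB k r)).div_const _
  obtain ⟨Φ, hΦ⟩ := exists_isNewtonian_charge (g := fun r => r) aemeasurable_id hint (R := R)
    ((ae_restrict_mem hfm).mono fun r hr => hR r (hsub hr))
  refine ⟨Φ, hΦ.congr fun φ _ => setIntegral_eq_integral_of_forall_compl_eq_zero fun r hr => ?_⟩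
  have : S.ρ k r = 0 := by
    by_contra h0
    exact hr (hk.2 h0)
  simp [this]

end ChargeSequence

/-- Both sides are limits of the same numbers `S.source k φ`, in which no choice appears. All
independence of the choice rests on this. -/
theorem sources_eq {α : ℝ} {S : ChargeSequence α} {c c' : Choice} {F F' : Fields}
    (hA : S.AdaptedTo c) (hH : IsHomogenized S c F) (hA' : S.AdaptedTo c')
    (hH' : IsHomogenized S c' F') {φ : E3 → ℝ} (hφ : ContDiff ℝ 2 φ) :
    bulkSource α c.sheet F φ + boundarySource α c.sheet F φ =
      bulkSource α c'.sheet F' φ + boundarySource α c'.sheet F' φ :=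
  tendsto_nhds_unique (tendsto_source hA hH hφ) (tendsto_source hA' hH' hφ)

/-- Existence, uniqueness and independence of the choice of the homogenized potential. -/
theorem exists_homogenized_potential {α : ℝ} (S : ChargeSequence α) :
    ∃ Φ₀ : E3 → ℝ, ∀ (c : Choice) (F : Fields), S.AdaptedTo c → IsHomogenized S c F →
      SolvesHomogenized α c F Φ₀ ∧
      (∀ Φ : E3 → ℝ, SolvesHomogenized α c F Φ → Φ =ᵐ[volume] Φ₀ ∧
        ∀ (W : Set E3) (E E₀ : E3 → E3), IsOpen W → IsElectricField W Φ E →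
          IsElectricField W Φ₀ E₀ →
            E =ᵐ[volume.restrict W] E₀ ∧ fieldEnergy W E = fieldEnergy W E₀) ∧
      (∀ᶠ k in atTop, ∃ Φ : E3 → ℝ, SolvesPoisson (S.source k) Φ) ∧
      (∀ Φ : ℕ → E3 → ℝ, (∀ᶠ k in atTop, SolvesPoisson (S.source k) (Φ k)) →
        ConvergesWeakly Φ Φ₀) := by
  by_cases hex : ∃ (c : Choice) (F : Fields), S.AdaptedTo c ∧ IsHomogenized S c F
  swap
  · push Not at hex
    -- Without an admissible choice with homogenized fields nothing is claimed and any function will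
    -- do.
    exact ⟨0, fun c F hA hH => absurd hH (hex c F hA)⟩
  obtain ⟨c₀, F₀, hA₀, hH₀⟩ := hex
  obtain ⟨Φ₀, hΦ₀⟩ := exists_isNewtonian_homogenized α c₀.sheet F₀ hH₀.integrable_σ
  refine ⟨Φ₀, fun c F hA hH => ?_⟩
  -- The potential was built for one choice; equality of the sources makes it the Newtonian
  -- potential for every other one.
  have hN := hΦ₀.congr fun φ hφ => sources_eq hA₀ hH₀ hA hH hφ
  have hsol : SolvesHomogenized α c F Φ₀ := hN.solvesPoisson (homogenized_neg α c.sheet F)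
  have hex := ChargeSequence.eventually_exists_isNewtonian hA
  refine ⟨hsol, fun Φ hΦ => ?_, ?_, fun Φ hΦ φ hφ => ?_⟩
  · have hae := SolvesPoisson.ae_eq hΦ hsol
    refine ⟨hae, fun W E E₀ hW hE hE₀ => ?_⟩
    have := IsElectricField.ae_eq hW hae hE hE₀
    exact ⟨this, fieldEnergy_congr this⟩
  · filter_upwards [hex] with k ⟨Φ, hΦ⟩
    exact ⟨Φ, hΦ.solvesPoisson (ChargeSequence.source_neg k)⟩
  -- By duality the claim becomes convergence of the sources tested with `newton φ`. An arbitrary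
  -- solution at scale `k` may be replaced by the Newtonian one, to which it is almost everywhere
  -- equal.
  · rw [hN.3 φ hφ]
    refine (tendsto_source hA hH hφ.contDiff_newton_two).congr' ?_
    filter_upwards [hex, hΦ] with k ⟨Ψ, hΨ⟩ hk
    have hae := SolvesPoisson.ae_eq hk (hΨ.solvesPoisson (ChargeSequence.source_neg k))
    rw [← hΨ.3 φ hφ]
    refine integral_congr_ae ?_
    filter_upwards [hae] with r hr
    rw [hr]

/-! ### Images in space of real measures with densities -/

section Push

variable {X Y : Type*} [MeasurableSpace X] [MeasurableSpace Y] {μ : Measure X} {μ' : Measure Y}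

/-- The image in space of the positive part of the measure with density `f`. -/
noncomputable def pushPos (μ : Measure X) (g : X → E3) (f : X → ℝ) : Measure E3 :=
  (μ.withDensity fun x => ENNReal.ofReal (f x)).map g

theorem isFiniteMeasure_pushPos {g : X → E3} {f : X → ℝ} (hf : Integrable f μ) :
    IsFiniteMeasure (pushPos μ g f) := by
  have := isFiniteMeasure_withDensity_ofReal hf.2
  unfold pushPos
  infer_instance

theorem integral_pushPos {g : X → E3} {f : X → ℝ} (hg : AEMeasurable g μ) (hf : Integrable f μ)
    {φ : E3 → ℝ} (hφ : Measurable φ) :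
    ∫ r, φ r ∂(pushPos μ g f) = ∫ x, max (f x) 0 * φ (g x) ∂μ := by
  rw [pushPos, integral_map (hg.mono_ac (withDensity_absolutelyContinuous _ _))
    hφ.aestronglyMeasurable, integral_withDensity_eq_integral_toReal_smul₀
    hf.aemeasurable.ennreal_ofReal (by simp)]
  simp [ENNReal.toReal_ofReal']

theorem integral_pushPos_sub {g : X → E3} {f : X → ℝ} (hg : AEMeasurable g μ)
    (hf : Integrable f μ) {φ : E3 → ℝ} (hφ : Measurable φ) {C : ℝ} (hC : ∀ r, |φ r| ≤ C) :
    ∫ r, φ r ∂(pushPos μ g f) - ∫ r, φ r ∂(pushPos μ g (-f)) = ∫ x, f x * φ (g x) ∂μ := by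
  have i : ∀ {u : X → ℝ}, Integrable u μ → Integrable (fun z => u z * φ (g z)) μ :=
    fun {u} hu => hu.mul_bdd (c := C) (hφ.comp_aemeasurable hg).aestronglyMeasurable
      (Eventually.of_forall fun z => hC _)
  have i1 : Integrable (fun x => max (f x) 0 * φ (g x)) μ := i hf.pos_part
  have i2 : Integrable (fun x => max ((-f) x) 0 * φ (g x)) μ := i hf.neg.pos_part
  rw [integral_pushPos hg hf hφ, integral_pushPos hg hf.neg hφ, ← integral_sub i1 i2]
  refine integral_congr_ae (Eventually.of_forall fun x => ?_)
  simp only [Pi.neg_apply]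
  rw [← sub_mul, max_zero_sub_max_neg_zero_eq_self]

/-- Two finite real measures, given as images of measures with densities, that agree on the
test functions supported in an open set agree on the bounded measurable functions that vanish
outside it. -/
theorem integral_eq_of_test_map {g : X → E3} {f : X → ℝ} {g' : Y → E3} {f' : Y → ℝ}
    (hg : AEMeasurable g μ) (hf : Integrable f μ) (hg' : AEMeasurable g' μ')
    (hf' : Integrable f' μ') {V : Set E3} (hV : IsOpen V)
    (h : ∀ φ, IsTestFunction φ → tsupport φ ⊆ V →
      ∫ x, f x * φ (g x) ∂μ = ∫ y, f' y * φ (g' y) ∂μ')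
    {φ : E3 → ℝ} (hφ : Measurable φ) {C : ℝ} (hC : ∀ r, |φ r| ≤ C) (hφV : ∀ r ∉ V, φ r = 0) :
    ∫ x, f x * φ (g x) ∂μ = ∫ y, f' y * φ (g' y) ∂μ' := by
  have h1 := isFiniteMeasure_pushPos (g := g) hf
  have h2 := isFiniteMeasure_pushPos (g := g) hf.neg
  have h3 := isFiniteMeasure_pushPos (g := g') hf'
  have h4 := isFiniteMeasure_pushPos (g := g') hf'.neg
  -- The negative part of each real measure is moved to the other side, which leaves an identity
  -- between two positive measures.
  have key : ∀ {ψ : E3 → ℝ}, Measurable ψ → ∀ {C : ℝ}, (∀ r, |ψ r| ≤ C) →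
      (∫ r, ψ r * 1 ∂(pushPos μ g f + pushPos μ' g' (-f'))) -
        ∫ r, ψ r * 1 ∂(pushPos μ g (-f) + pushPos μ' g' f') =
      ∫ x, f x * ψ (g x) ∂μ - ∫ y, f' y * ψ (g' y) ∂μ' := by
    intro ψ hψ C hC
    have b : ∀ (Λ : Measure E3) [IsFiniteMeasure Λ], Integrable ψ Λ := fun Λ _ =>
      Integrable.of_bound hψ.aestronglyMeasurable C (Eventually.of_forall hC)
    simp only [mul_one]
    rw [integral_add_measure (b _) (b _), integral_add_measure (b _) (b _),
      ← integral_pushPos_sub hg hf hψ hC, ← integral_pushPos_sub hg' hf' hψ hC]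
    ring
  have hfin := integral_eq_of_test (f := fun _ => (1 : ℝ)) (f' := fun _ => (1 : ℝ))
    (μ := pushPos μ g f + pushPos μ' g' (-f')) (μ' := pushPos μ g (-f) + pushPos μ' g' f')
    (integrable_const _) (integrable_const _) hV (fun ψ hψ hs => by
      obtain ⟨B, hB⟩ := hψ.2.exists_bound_of_continuous hψ.1.continuous
      have := key hψ.1.continuous.measurable (C := B) hB
      rw [h ψ hψ hs, sub_self] at this
      exact sub_eq_zero.1 this) hφ hC hφV
  have := key hφ hC
  rw [hfin, sub_self] at this
  exact (sub_eq_zero.1 this.symm)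

end Push

/-! ### The inverse of the chart -/

namespace Sheet

variable (M : Sheet)

/-- The inverse of `ψ`. -/
noncomputable def inv : E3 → E3 := Function.invFunOn M.ψ M.U

/-- The coordinate in the parameter plane. -/
noncomputable def coord (r : E3) : E2 := planeProj (M.inv r)

/-- The coordinate normal to the surface. -/
noncomputable def height (r : E3) : ℝ := M.inv r 2

theorem inv_ψ {X : E3} (hX : X ∈ M.U) : M.inv (M.ψ X) = X :=
  M.injOn.leftInvOn_invFunOn hX

theorem coord_ψ₀ {x : E2} (hx : x ∈ M.baseDomain) : M.coord (M.ψ₀ x) = x := by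
  rw [coord, ψ₀, M.inv_ψ hx, planeProj_lift]

theorem height_ψ₀ {x : E2} (hx : x ∈ M.baseDomain) : M.height (M.ψ₀ x) = 0 := by
  rw [height, ψ₀, M.inv_ψ hx, lift_third]

/-- The derivative of the chart as an isomorphism. -/
noncomputable def fderivEquiv {X : E3} (hX : X ∈ M.U) : E3 ≃L[ℝ] E3 :=
  ContinuousLinearEquiv.ofBijective (fderiv ℝ M.ψ X)
    (LinearMap.ker_eq_bot.2 (M.injective_fderiv hX))
    (LinearMap.range_eq_top.2 (LinearMap.injective_iff_surjective.1 (M.injective_fderiv hX)))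

theorem hasStrictFDerivAt_ψ {X : E3} (hX : X ∈ M.U) :
    HasStrictFDerivAt M.ψ (M.fderivEquiv hX : E3 →L[ℝ] E3) X :=
  (M.contDiffOn.contDiffAt (M.isOpen_U.mem_nhds hX)).hasStrictFDerivAt (by norm_num)

theorem isOpen_image {V : Set E3} (hV : IsOpen V) (hVU : V ⊆ M.U) : IsOpen (M.ψ '' V) := by
  rw [isOpen_iff_mem_nhds]
  rintro _ ⟨X, hX, rfl⟩
  rw [← (M.hasStrictFDerivAt_ψ (hVU hX)).map_nhds_eq_of_equiv]
  exact image_mem_map (hV.mem_nhds hX)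

/-- The local inverse from the inverse function theorem takes values in `U` near `ψ X`, and
injectivity of `ψ` on `U` identifies it there with the global inverse. -/
theorem contDiffOn_inv : ContDiffOn ℝ 2 M.inv (M.ψ '' M.U) := by
  rintro _ ⟨X, hX, rfl⟩
  have hc := M.contDiffOn.contDiffAt (M.isOpen_U.mem_nhds hX)
  have hd : HasFDerivAt M.ψ (M.fderivEquiv hX : E3 →L[ℝ] E3) X := M.hasFDerivAt_ψ hX
  have hg := hc.to_localInverse hd (by norm_num)
  have h0 : hc.localInverse hd (by norm_num) (M.ψ X) = X := hc.localInverse_apply_image hd (by norm_num)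
  refine (hg.congr_of_eventuallyEq ?_).contDiffWithinAt
  have hs := M.hasStrictFDerivAt_ψ hX
  have h1 : ∀ᶠ y in 𝓝 (M.ψ X), M.ψ (hc.localInverse hd (by norm_num) y) = y :=
    (hc.hasStrictFDerivAt' hd (by norm_num)).eventually_right_inverse
  have h2 : ∀ᶠ y in 𝓝 (M.ψ X), hc.localInverse hd (by norm_num) y ∈ M.U := by
    refine hg.continuousAt.eventually_mem ?_
    rw [h0]
    exact M.isOpen_U.mem_nhds hX
  filter_upwards [h1, h2] with y hy1 hy2
  conv_lhs => rw [← hy1]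
  exact M.inv_ψ hy2

theorem isOpen_range : IsOpen (M.ψ '' M.U) := M.isOpen_image M.isOpen_U subset_rfl

theorem measurable_inv : Measurable M.inv := by
  classical
  -- Outside the range `Function.invFunOn` returns one and the same default value, so `inv` is a
  -- continuous function on an open set glued to a constant.
  by_cases hne : (M.ψ '' M.U)ᶜ.Nonempty
  · obtain ⟨r₀, hr₀⟩ := hne
    have h : M.inv = (M.ψ '' M.U).piecewise M.inv (fun _ => M.inv r₀) := by
      ext1 r
      by_cases hr : r ∈ M.ψ '' M.U
      · rw [piecewise_eq_of_mem _ _ _ hr]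
      · rw [piecewise_eq_of_notMem _ _ _ hr, inv, Function.invFunOn_neg hr,
          Function.invFunOn_neg hr₀]
    rw [h]
    exact M.contDiffOn_inv.continuousOn.measurable_piecewise continuousOn_const
      M.isOpen_range.measurableSet
  · have h : M.ψ '' M.U = univ := by
      rwa [not_nonempty_iff_eq_empty, compl_empty_iff] at hne
    have := M.contDiffOn_inv.continuousOn
    rw [h, continuousOn_univ] at this
    exact this.measurable

theorem measurable_coord : Measurable M.coord := planeProj.measurable.comp M.measurable_inv

theorem contDiffOn_coord : ContDiffOn ℝ 2 M.coord (M.ψ '' M.U) :=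
  planeProj.contDiff.comp_contDiffOn M.contDiffOn_inv

theorem contDiffOn_height : ContDiffOn ℝ 2 M.height (M.ψ '' M.U) :=
  (EuclideanSpace.proj 2 : E3 →L[ℝ] ℝ).contDiff.comp_contDiffOn M.contDiffOn_inv

theorem ψ₀_mem_range {x : E2} (hx : x ∈ M.baseDomain) : M.ψ₀ x ∈ M.ψ '' M.U :=
  mem_image_of_mem _ hx

/-- A neighbourhood of `Ω` on which `Ω` is the zero set of the height. -/
def tube : Set E3 := M.ψ '' {X ∈ M.U | planeProj X ∈ M.T}

theorem tube_subset : M.tube ⊆ M.ψ '' M.U := image_mono fun _ h => h.1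

theorem isOpen_tube : IsOpen M.tube :=
  M.isOpen_image (M.isOpen_U.inter (M.isOpen_T.preimage planeProj.continuous)) fun _ h => h.1

theorem ψ₀_mem_tube {x : E2} (hx : x ∈ M.T) : M.ψ₀ x ∈ M.tube :=
  ⟨lift x 0, ⟨M.T_subset_baseDomain hx, by rwa [planeProj_lift]⟩, rfl⟩

theorem mem_Ω {x : E2} (hx : x ∈ M.T) : M.ψ₀ x ∈ M.Ω := mem_image_of_mem _ hx

theorem Ω_subset_tube : M.Ω ⊆ M.tube := by
  rintro _ ⟨x, hx, rfl⟩; exact M.ψ₀_mem_tube hx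

theorem mem_Ω_of_mem_tube {r : E3} (hr : r ∈ M.tube) (h0 : M.height r = 0) : r ∈ M.Ω := by
  obtain ⟨X, ⟨hXU, hXT⟩, rfl⟩ := hr
  rw [height, M.inv_ψ hXU] at h0
  refine ⟨planeProj X, hXT, ?_⟩
  rw [ψ₀, ← h0, lift_planeProj]

theorem height_eq_zero {r : E3} (hr : r ∈ M.Ω) : M.height r = 0 := by
  obtain ⟨x, hx, rfl⟩ := hr
  exact M.height_ψ₀ (M.T_subset_baseDomain hx)

/-- The boundary `∂Ω`. -/
def bdΩ : Set E3 := M.ψ₀ '' frontier M.T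

theorem isCompact_bdΩ : IsCompact M.bdΩ :=
  M.isCompact_frontier.image_of_continuousOn (M.continuousOn_ψ₀.mono M.frontier_subset_baseDomain)

/-- Injectivity of `ψ` on all of `U` leaves a boundary point only one parameter, and that lies over
`frontier T`, which the open set `T` does not meet. Functions supported in the tube therefore do not
see the boundary source of the same sheet. -/
theorem notMem_tube_of_mem_bdΩ {r : E3} (hr : r ∈ M.bdΩ) : r ∉ M.tube := by
  rintro ⟨X, ⟨hXU, hXT⟩, hXr⟩
  obtain ⟨x, hx, rfl⟩ := hr
  have h := M.injOn hXU (M.frontier_subset_baseDomain hx) hXr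
  rw [h, planeProj_lift] at hXT
  exact (M.isOpen_T.frontier_eq ▸ hx).2 hXT

theorem inner_ν_D (x v : E2) : ⟪M.ν x, M.D x v⟫ = 0 := by
  rw [ν_eq, unitVec, real_inner_smul_left, real_inner_comm, clm_apply_E2 (M.D x), inner_add_left,
    real_inner_smul_left, real_inner_smul_left, normalVec, inner_cross_self_left,
    inner_cross_self_right]
  ring

/-- On `Ω` the gradient of the height is the normal. -/
theorem fderiv_height {x : E2} (hx : x ∈ closure M.T) (v : E3) :
    fderiv ℝ M.height (M.ψ₀ x) v = ⟪M.ν x, v⟫ := by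
  have hU := M.mem_U x hx
  obtain ⟨w, rfl⟩ := (LinearMap.injective_iff_surjective.1 (M.injective_fderiv hU)) v
  have hh : HasFDerivAt M.height (fderiv ℝ M.height (M.ψ₀ x)) (M.ψ₀ x) :=
    ((M.contDiffOn_height.contDiffAt (M.isOpen_range.mem_nhds
      (M.ψ₀_mem_range hU))).differentiableAt (by norm_num)).hasFDerivAt
  have h1 := hh.comp (lift x 0) (M.hasFDerivAt_ψ hU)
  have h2 : M.height ∘ M.ψ =ᶠ[𝓝 (lift x 0)] fun X => X 2 := by
    filter_upwards [M.isOpen_U.mem_nhds hU] with X hX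
    rw [Function.comp_apply, height, M.inv_ψ hX]
  have h3 : HasFDerivAt (fun X : E3 => X 2) (EuclideanSpace.proj 2 : E3 →L[ℝ] ℝ) (lift x 0) :=
    (EuclideanSpace.proj 2 : E3 →L[ℝ] ℝ).hasFDerivAt
  have h4 := (h1.congr_of_eventuallyEq h2.symm).unique h3
  have h5 := congrArg (fun L : E3 →L[ℝ] ℝ => L w) h4
  simp only [ContinuousLinearMap.comp_apply] at h5
  change fderiv ℝ M.height (M.ψ₀ x) (fderiv ℝ M.ψ (lift x 0) w) = _
  rw [h5]
  have hw : w = liftL (planeProj w) + (w 2) • dir3 := by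
    rw [← lift_eq, lift_planeProj]
  change w 2 = ⟪M.ν x, fderiv ℝ M.ψ (lift x 0) w⟫
  conv_rhs => rw [hw]
  rw [map_add, map_smul, M.fderiv_ψ_dir3 hx, ← M.D_apply hU, inner_add_right, M.inner_ν_D,
    inner_smul_right, real_inner_self_eq_norm_sq, M.norm_ν hU]
  ring

theorem measurable_ν : Measurable M.ν := by
  have h : ∀ i, Measurable fun x => M.D x (dir i) := fun i =>
    (measurable_fderiv ℝ M.ψ₀).apply_continuousLinearMap (dir i)
  have h2 : Measurable M.normalVec := continuous_cross.measurable.comp ((h 0).prodMk (h 1))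
  exact h2.norm.inv.smul h2

theorem measurable_bdTangent : Measurable M.bdTangent := by
  have h : ∀ i, Measurable fun x => M.D x (dir i) := fun i =>
    (measurable_fderiv ℝ M.ψ₀).apply_continuousLinearMap (dir i)
  have hn : ∀ i, Measurable fun x => M.nT x i := fun i =>
    (EuclideanSpace.proj i : E2 →L[ℝ] ℝ).measurable.comp M.isOuterNormal.1
  have e : M.bdTangent = fun x => -(M.nT x) 1 • M.D x (dir 0) + (M.nT x) 0 • M.D x (dir 1) := by
    funext x
    rw [bdTangent, clm_apply_E2]
    simp [rot]
  rw [e]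
  exact ((hn 1).neg.smul (h 0)).add ((hn 0).smul (h 1))

theorem aemeasurable_ψ₀_T : AEMeasurable M.ψ₀ (volume.restrict M.T) :=
  (M.continuousOn_ψ₀.mono M.T_subset_baseDomain).aemeasurable M.isOpen_T.measurableSet

theorem aemeasurable_ψ₀_bd : AEMeasurable M.ψ₀ M.bdMeasure :=
  (M.continuousOn_ψ₀.mono M.frontier_subset_baseDomain).aemeasurable
    isClosed_frontier.measurableSet

theorem measurableSet_Ω : MeasurableSet M.Ω :=
  M.isOpen_T.measurableSet.image_of_continuousOn_injOn
    (M.continuousOn_ψ₀.mono M.T_subset_baseDomain) (M.injOn_ψ₀.mono M.T_subset_baseDomain)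

/-- The surface meets the boundary of another surface in a set of zero area. -/
theorem ae_notMem_bdΩ (M' : Sheet) : ∀ᵐ x ∂volume.restrict M.T, M.ψ₀ x ∉ M'.bdΩ := by
  -- In the chart of `M` the trace of `∂Ω'` is the image of a null set of the plane under a
  -- differentiable map into the plane.
  have hz : volume (M.coord '' (M'.ψ₀ '' {x ∈ frontier M'.T | M'.ψ₀ x ∈ M.ψ '' M.U})) = 0 := by
    rw [image_image]
    refine addHaar_image_eq_zero_of_differentiableOn_of_addHaar_eq_zero volume ?_
      (measure_mono_null (fun x hx => hx.1)
        (volume_eq_zero_of_hausdorff_lt_top M'.finite_boundary))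
    rintro x ⟨hx, hxU⟩
    have h1 := ((M.contDiffOn_coord.contDiffAt (M.isOpen_range.mem_nhds hxU)).differentiableAt
      (by norm_num)).comp x (M'.hasFDerivAt_ψ₀ (M'.frontier_subset_baseDomain hx)).differentiableAt
    exact h1.differentiableWithinAt
  have h := ae_restrict_of_ae (s := M.T) (measure_eq_zero_iff_ae_notMem.1 hz)
  filter_upwards [h, ae_restrict_mem M.isOpen_T.measurableSet] with x hx hxT hmem
  obtain ⟨y, hy, hyx⟩ := hmem
  have hb := M.T_subset_baseDomain hxT
  refine hx ⟨M'.ψ₀ y, ⟨y, ⟨hy, ?_⟩, rfl⟩, ?_⟩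
  · rw [hyx]; exact M.ψ₀_mem_range hb
  · rw [hyx, M.coord_ψ₀ hb]

end Sheet

/-! ### Uniqueness of the bulk source -/

/-- A rescaled profile that is the identity to first order at the origin. -/
noncomputable def profile (N u : ℝ) : ℝ := u / (1 + (N * u) ^ 2)

theorem one_add_sq_pos (a : ℝ) : 0 < 1 + a ^ 2 := by positivity

theorem contDiff_profile (N : ℝ) : ContDiff ℝ 2 (profile N) :=
  contDiff_id.div (contDiff_const.add ((contDiff_const.mul contDiff_id).pow 2))
    fun u => (one_add_sq_pos (N * u)).ne'

theorem hasDerivAt_profile (N u : ℝ) :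
    HasDerivAt (profile N) ((1 - (N * u) ^ 2) / (1 + (N * u) ^ 2) ^ 2) u := by
  have h1 : HasDerivAt (fun u => 1 + (N * u) ^ 2) (2 * (N * u) * N) u := by
    have := (((hasDerivAt_id u).const_mul N).pow 2).const_add 1
    simpa using this
  refine ((hasDerivAt_id u).div h1 (one_add_sq_pos (N * u)).ne').congr_deriv ?_
  simp only [id_eq]
  congr 1
  ring

/-- The profiles tend to zero uniformly, yet their slope at the origin remains one; elsewhere the
slope tends to zero and it is bounded by one throughout. This is what separates dipoles from
charges. -/
theorem abs_profile_le {N : ℝ} (hN : 1 ≤ N) (u : ℝ) : |profile N u| ≤ 1 / N := by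
  have h := one_add_sq_pos (N * u)
  rw [profile, abs_div, abs_of_pos h, div_le_div_iff₀ h (by linarith), ← abs_of_pos (by linarith : 0 < N),
    ← abs_mul, abs_of_pos (by linarith : 0 < N), one_mul]
  rw [abs_le]
  constructor <;> nlinarith [sq_nonneg (N * u - 1), sq_nonneg (N * u + 1)]

theorem abs_profile_deriv_le (a : ℝ) : |(1 - a ^ 2) / (1 + a ^ 2) ^ 2| ≤ 1 / (1 + a ^ 2) := by
  have h := one_add_sq_pos a
  rw [abs_div, abs_of_pos (by positivity : 0 < (1 + a ^ 2) ^ 2), div_le_div_iff₀ (by positivity) h]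
  have : |1 - a ^ 2| ≤ 1 + a ^ 2 := by
    rw [abs_le]; constructor <;> nlinarith [sq_nonneg a]
  nlinarith

theorem tendsto_profile_deriv {u : ℝ} (hu : u ≠ 0) :
    Tendsto (fun n : ℕ => (1 - (((n : ℝ) + 1) * u) ^ 2) / (1 + (((n : ℝ) + 1) * u) ^ 2) ^ 2) atTop
      (𝓝 0) := by
  refine squeeze_zero_norm (fun n => abs_profile_deriv_le _) ?_
  have h : Tendsto (fun n : ℕ => 1 + (((n : ℝ) + 1) * u) ^ 2) atTop atTop := by
    refine tendsto_atTop_add_const_left _ _ ?_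
    simp only [mul_pow]
    refine Tendsto.atTop_mul_const (by positivity) ?_
    exact (tendsto_pow_atTop two_ne_zero).comp
      (tendsto_atTop_add_const_right _ _ tendsto_natCast_atTop_atTop)
  simp only [one_div]
  exact h.inv_tendsto_atTop

namespace Sheet

variable (M M' : Sheet)

/-- The inner product of the unit normals of two surfaces. -/
noncomputable def normalProd (r : E3) : ℝ := ⟪M.ν (M.coord r), M'.ν (M'.coord r)⟫

theorem measurable_normalProd : Measurable (M.normalProd M') :=
  (M.measurable_ν.comp M.measurable_coord).inner (M'.measurable_ν.comp M'.measurable_coord)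

theorem abs_normalProd_le (r : E3) : |M.normalProd M' r| ≤ 1 :=
  (abs_real_inner_le_norm _ _).trans
    (mul_le_one₀ (M.norm_ν_le _) (norm_nonneg _) (M'.norm_ν_le _))

/-- `normalProd` restricted to the first surface. -/
noncomputable def normalCos (r : E3) : ℝ := M.Ω.indicator (M.normalProd M') r

theorem measurable_normalCos : Measurable (M.normalCos M') :=
  (M.measurable_normalProd M').indicator M.measurableSet_Ω

theorem abs_normalCos_le (r : E3) : |M.normalCos M' r| ≤ 1 := by
  unfold normalCos
  by_cases hr : r ∈ M.Ω
  · rw [indicator_of_mem hr]; exact M.abs_normalProd_le M' r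
  · rw [indicator_of_notMem hr]; simp

/-- Test functions probing the normal polarization. -/
noncomputable def probe (η : E3 → ℝ) (n : ℕ) (r : E3) : ℝ :=
  η r • profile ((n : ℝ) + 1) (M.height r)

variable {M M'} {η : E3 → ℝ}

theorem contDiff_probe (hη : IsTestFunction η) (hs : tsupport η ⊆ M.tube) (n : ℕ) :
    ContDiff ℝ 2 (M.probe η n) :=
  contDiff_cutoff_smul hη.contDiff_two M.isOpen_tube hs
    ((contDiff_profile _).comp_contDiffOn (M.contDiffOn_height.mono M.tube_subset))

theorem abs_probe_le {C : ℝ} (hC : ∀ r, |η r| ≤ C) (n : ℕ) (r : E3) :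
    |M.probe η n r| ≤ C * (1 / ((n : ℝ) + 1)) := by
  rw [probe, smul_eq_mul, abs_mul]
  exact mul_le_mul (hC r) (abs_profile_le (by linarith [n.cast_nonneg (α := ℝ)]) _) (abs_nonneg _)
    ((abs_nonneg _).trans (hC r))

theorem fderiv_probe_of_notMem {r : E3} (hr : r ∉ tsupport η) (n : ℕ) :
    fderiv ℝ (M.probe η n) r = 0 := by
  have h : M.probe η n =ᶠ[𝓝 r] fun _ => 0 := by
    filter_upwards [notMem_tsupport_iff_eventuallyEq.1 hr] with y hy
    simp [probe, hy]
  rw [h.fderiv_eq, fderiv_const_apply]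

theorem fderiv_probe (hη : IsTestFunction η) {r : E3} (hr : r ∈ M.tube) (n : ℕ) (v : E3) :
    fderiv ℝ (M.probe η n) r v =
      η r * ((1 - (((n : ℝ) + 1) * M.height r) ^ 2) / (1 + (((n : ℝ) + 1) * M.height r) ^ 2) ^ 2 *
        fderiv ℝ M.height r v) + profile ((n : ℝ) + 1) (M.height r) * fderiv ℝ η r v := by
  have h1 : HasFDerivAt M.height (fderiv ℝ M.height r) r :=
    ((M.contDiffOn_height.contDiffAt (M.isOpen_range.mem_nhds
      (M.tube_subset hr))).differentiableAt (by norm_num)).hasFDerivAt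
  have h2 : HasFDerivAt η (fderiv ℝ η r) r :=
    (hη.contDiff_two.differentiable (by norm_num) r).hasFDerivAt
  have h3 : HasFDerivAt (fun r => profile ((n : ℝ) + 1) (M.height r)) _ r :=
    (hasDerivAt_profile ((n : ℝ) + 1) (M.height r)).comp_hasFDerivAt r h1
  have h4 := h2.mul h3
  have h5 : fderiv ℝ (M.probe η n) r = _ := h4.fderiv
  rw [h5]
  simp

/-- The dipole terms tested with the probes. -/
theorem tendsto_bulkSource_probe (α : ℝ) (F' : Fields) (hη : IsTestFunction η)
    (hs : tsupport η ⊆ M.tube) :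
    Tendsto (fun n => bulkSource α M' F' (M.probe η n)) atTop
      (𝓝 (α ^ 2 * ∫ x in M'.T, F'.p₃ x * M'.J₀ x *
        (M.normalCos M' (M'.ψ₀ x) * η (M'.ψ₀ x)))) := by
  have hTm := M'.isOpen_T.measurableSet
  obtain ⟨C, hC⟩ := hη.2.exists_bound_of_continuous hη.1.continuous
  have hdη : Continuous (fderiv ℝ η) := hη.contDiff_two.continuous_fderiv (by norm_num)
  obtain ⟨C', hC'⟩ := (hη.2.fderiv (𝕜 := ℝ)).exists_bound_of_continuous hdη
  obtain ⟨B, hB⟩ := hη.2.isCompact.exists_bound_of_continuousOn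
    ((M.contDiffOn_height.continuousOn_fderiv_of_isOpen M.isOpen_range (by norm_num)).mono
      (hs.trans M.tube_subset))
  have hC0 : 0 ≤ C := (norm_nonneg _).trans (hC 0)
  have hC0' : 0 ≤ C' := (norm_nonneg _).trans (hC' 0)
  have hs' := M'.closure_subset_baseDomain
  have cJ := M'.contDiffOn_J₀.continuousOn.mono hs'
  -- pointwise limits and bounds
  have hbound : ∀ n r v, ‖v‖ ≤ 1 → |fderiv ℝ (M.probe η n) r v| ≤ C * |B| + C' := by
    intro n r v hv
    by_cases hr : r ∈ tsupport η
    · rw [fderiv_probe hη (hs hr)]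
      refine (abs_add_le _ _).trans (add_le_add ?_ ?_)
      · rw [abs_mul, abs_mul]
        refine mul_le_mul (hC r) ?_ (by positivity) hC0
        have h1 : |(1 - (((n : ℝ) + 1) * M.height r) ^ 2) /
            (1 + (((n : ℝ) + 1) * M.height r) ^ 2) ^ 2| ≤ 1 :=
          (abs_profile_deriv_le _).trans (by
            rw [div_le_one (one_add_sq_pos _)]; nlinarith [sq_nonneg (((n : ℝ) + 1) * M.height r)])
        have h2 : |fderiv ℝ M.height r v| ≤ |B| := by
          refine ((fderiv ℝ M.height r).le_opNorm v).trans ?_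
          have := (hB r hr).trans (le_abs_self B)
          nlinarith [norm_nonneg v, norm_nonneg (fderiv ℝ M.height r)]
        nlinarith [abs_nonneg (fderiv ℝ M.height r v), abs_nonneg B]
      · rw [abs_mul]
        have h1 : |profile ((n : ℝ) + 1) (M.height r)| ≤ 1 := by
          have hn : (1 : ℝ) ≤ (n : ℝ) + 1 := by linarith [n.cast_nonneg (α := ℝ)]
          refine (abs_profile_le hn _).trans ?_
          rw [div_le_one (by linarith)]; exact hn
        have h2 : |fderiv ℝ η r v| ≤ C' := by
          refine ((fderiv ℝ η r).le_opNorm v).trans ?_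
          nlinarith [hC' r, norm_nonneg v, norm_nonneg (fderiv ℝ η r)]
        nlinarith [abs_nonneg (fderiv ℝ η r v)]
    · rw [fderiv_probe_of_notMem hr]
      simp only [zero_apply, abs_zero]
      positivity
  have hlim : ∀ x ∈ M'.T, Tendsto (fun n => fderiv ℝ (M.probe η n) (M'.ψ₀ x) (M'.ν x)) atTop
      (𝓝 (M.normalCos M' (M'.ψ₀ x) * η (M'.ψ₀ x))) := by
    intro x hx
    set r := M'.ψ₀ x with hr
    by_cases hrs : r ∈ tsupport η
    · have hrt := hs hrs
      simp only [fderiv_probe hη hrt]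
      -- On `Ω` the profile vanishes, its slope is one and the gradient of the height is the normal.
      -- Where the height is not zero, both the profile and its slope disappear in the limit.
      by_cases h0 : M.height r = 0
      · have hΩ := M.mem_Ω_of_mem_tube hrt h0
        have e : M.normalCos M' r = fderiv ℝ M.height r (M'.ν x) := by
          rw [normalCos, indicator_of_mem hΩ, normalProd, hr,
            M'.coord_ψ₀ (M'.T_subset_baseDomain hx), ← hr]
          obtain ⟨y, hy, hyr⟩ := hΩ
          rw [← hyr, M.coord_ψ₀ (M.T_subset_baseDomain hy), M.fderiv_height (subset_closure hy)]
        rw [h0, e]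
        simp only [profile, mul_zero, zero_div, zero_mul, add_zero]
        refine tendsto_const_nhds.congr fun n => ?_
        norm_num
        ring
      · have hΩ : r ∉ M.Ω := fun h => h0 (M.height_eq_zero h)
        rw [normalCos, indicator_of_notMem hΩ, zero_mul]
        have h1 := ((tendsto_profile_deriv h0).mul_const (fderiv ℝ M.height r (M'.ν x))).const_mul
          (η r)
        have h2 : Tendsto (fun n : ℕ => profile ((n : ℝ) + 1) (M.height r)) atTop (𝓝 0) :=
          squeeze_zero_norm (fun n => abs_profile_le (by linarith [n.cast_nonneg (α := ℝ)]) _)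
            tendsto_one_div_add_atTop_nhds_zero_nat
        simpa using h1.add (h2.mul_const (fderiv ℝ η r (M'.ν x)))
    · simp only [fderiv_probe_of_notMem hrs, image_eq_zero_of_notMem_tsupport hrs, mul_zero]
      simp
  have iP : Integrable (fun x => F'.p₃ x * M'.J₀ x) (volume.restrict M'.T) :=
    M'.integrableOn_T (F'.continuous_p₃.continuousOn.mul cJ)
  have iD : Integrable (fun x => bulkDensity α M' F' x * M'.J₀ x) (volume.restrict M'.T) :=
    M'.integrableOn_T (((continuousOn_bulkDensity α M' F').mono hs').mul cJ)
  have hmp : ∀ n, AEStronglyMeasurable (fun x => M.probe η n (M'.ψ₀ x)) (volume.restrict M'.T) :=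
    fun n => ((contDiff_probe hη hs n).continuous.comp_continuousOn
      (M'.continuousOn_ψ₀.mono M'.T_subset_baseDomain)).aestronglyMeasurable hTm
  have hmd : ∀ n, AEStronglyMeasurable (fun x => fderiv ℝ (M.probe η n) (M'.ψ₀ x) (M'.ν x))
      (volume.restrict M'.T) := fun n =>
    ((((contDiff_probe hη hs n).continuous_fderiv (by norm_num)).comp_continuousOn
      M'.continuousOn_ψ₀).clm_apply M'.continuousOn_ν |>.mono
        M'.T_subset_baseDomain).aestronglyMeasurable hTm
  -- the monopole terms vanish in the limit
  have t1 : Tendsto (fun n => ∫ x in M'.T, bulkDensity α M' F' x * M.probe η n (M'.ψ₀ x) *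
      M'.J₀ x) atTop (𝓝 0) := by
    have h := tendsto_integral_of_dominated_convergence (μ := volume.restrict M'.T)
      (F := fun (n : ℕ) x => bulkDensity α M' F' x * M'.J₀ x * M.probe η n (M'.ψ₀ x))
      (f := fun _ => 0) (fun x => ‖bulkDensity α M' F' x * M'.J₀ x‖ * C)
      (fun n => iD.aestronglyMeasurable.mul (hmp n)) (iD.norm.mul_const C)
      (fun n => Eventually.of_forall fun x => by
        rw [norm_mul]
        refine mul_le_mul_of_nonneg_left ((abs_probe_le hC n _).trans ?_) (norm_nonneg _)
        refine mul_le_of_le_one_right hC0 ?_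
        rw [div_le_one (by positivity)]
        linarith [n.cast_nonneg (α := ℝ)])
      (Eventually.of_forall fun x => by
        have : Tendsto (fun n : ℕ => C * (1 / ((n : ℝ) + 1))) atTop (𝓝 0) := by
          simpa using tendsto_one_div_add_atTop_nhds_zero_nat.const_mul C
        simpa using (squeeze_zero_norm (fun n => abs_probe_le hC n (M'.ψ₀ x)) this).const_mul
          (bulkDensity α M' F' x * M'.J₀ x))
    rw [integral_zero] at h
    refine h.congr fun n => integral_congr_ae (Eventually.of_forall fun x => ?_)
    simp only
    ring
  have t2 : Tendsto (fun n => ∫ x in M'.T, F'.p₃ x * fderiv ℝ (M.probe η n) (M'.ψ₀ x) (M'.ν x) *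
      M'.J₀ x) atTop (𝓝 (∫ x in M'.T, F'.p₃ x * M'.J₀ x *
        (M.normalCos M' (M'.ψ₀ x) * η (M'.ψ₀ x)))) := by
    have h := tendsto_integral_of_dominated_convergence (μ := volume.restrict M'.T)
      (F := fun (n : ℕ) x => F'.p₃ x * M'.J₀ x * fderiv ℝ (M.probe η n) (M'.ψ₀ x) (M'.ν x))
      (f := fun x => F'.p₃ x * M'.J₀ x * (M.normalCos M' (M'.ψ₀ x) * η (M'.ψ₀ x)))
      (fun x => ‖F'.p₃ x * M'.J₀ x‖ * (C * |B| + C'))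
      (fun n => iP.aestronglyMeasurable.mul (hmd n)) (iP.norm.mul_const _)
      (fun n => Eventually.of_forall fun x => by
        rw [norm_mul]
        exact mul_le_mul_of_nonneg_left (hbound n _ _ (M'.norm_ν_le x)) (norm_nonneg _))
      ((ae_restrict_mem hTm).mono fun x hx => (hlim x hx).const_mul _)
    refine h.congr fun n => integral_congr_ae (Eventually.of_forall fun x => ?_)
    simp only
    ring
  have h := t1.add (t2.const_mul (α ^ 2))
  rw [zero_add] at h
  refine h.congr fun n => ?_
  rw [bulkSource, normalDerivIndicator]
  ring

end Sheet

theorem eq_inner_smul_of_unit {u v : E3} (hu : ‖u‖ = 1) (hv : ‖v‖ = 1)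
    (h : ⟪u, v⟫ * ⟪u, v⟫ = 1) : u = ⟪u, v⟫ • v := by
  have e : ‖u - ⟪u, v⟫ • v‖ ^ 2 = 0 := by
    rw [norm_sub_sq_real, norm_smul, mul_pow, hu, hv, real_inner_smul_right, Real.norm_eq_abs, sq_abs]
    linarith
  exact sub_eq_zero.1 (norm_eq_zero.1 (pow_eq_zero_iff two_ne_zero |>.1 e))

theorem boundarySource_eq_zero (α : ℝ) (M : Sheet) (F : Fields) {φ : E3 → ℝ}
    (h : ∀ r ∈ M.bdΩ, φ r = 0) : boundarySource α M F φ = 0 := by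
  rw [boundarySource]
  refine setIntegral_eq_zero_of_forall_eq_zero fun x hx => ?_
  rw [h _ (mem_image_of_mem _ hx)]
  ring

/-- The integral over the surface of `w η`, where `w` is a function in the chart. -/
noncomputable def Sheet.surfaceIntegral (M : Sheet) (w : E2 → ℝ) (η : E3 → ℝ) : ℝ :=
  ∫ x in M.T, w x * M.J₀ x * η (M.ψ₀ x)

theorem Sheet.integrable_surface (M : Sheet) {w : E2 → ℝ} (hw : ContinuousOn w (closure M.T))
    {η : E3 → ℝ} (hη : Measurable η) {C : ℝ} (hC : ∀ r, |η r| ≤ C) :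
    Integrable (fun x => w x * M.J₀ x * η (M.ψ₀ x)) (volume.restrict M.T) := by
  have h : Integrable (fun x => w x * M.J₀ x) (volume.restrict M.T) := M.integrableOn_T
    (hw.mul (M.contDiffOn_J₀.continuousOn.mono M.closure_subset_baseDomain))
  exact h.mul_bdd (c := C) (hη.comp_aemeasurable M.aemeasurable_ψ₀_T).aestronglyMeasurable
    (Eventually.of_forall fun x => hC _)

section Uniqueness

variable {α : ℝ} {M M' : Sheet} {F F' : Fields}

/-- The relation between the normal polarizations of two sheets with the same sources. -/
theorem surfaceIntegral_p₃ (hα : α ≠ 0)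
    (hsrc : ∀ φ : E3 → ℝ, ContDiff ℝ 2 φ → bulkSource α M F φ + boundarySource α M F φ =
      bulkSource α M' F' φ + boundarySource α M' F' φ)
    {η : E3 → ℝ} (hη : Measurable η) {C : ℝ} (hC : ∀ r, |η r| ≤ C) :
    M.surfaceIntegral F.p₃ η =
      M'.surfaceIntegral F'.p₃ (fun r => M.normalCos M' r * η r) := by
  -- In the tube `Ω` is exactly the zero set of the height and `∂Ω` is absent; removing `∂Ω'`
  -- silences the other boundary source as well. Nothing is lost, since `∂Ω'` has zero area on both
  -- sheets.
  set V := M.tube \ M'.bdΩ with hVdef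
  have hV : IsOpen V := M.isOpen_tube.sdiff M'.isCompact_bdΩ.isClosed
  have hs := M.closure_subset_baseDomain
  have hs' := M'.closure_subset_baseDomain
  have i1 : Integrable (fun x => F.p₃ x * M.J₀ x) (volume.restrict M.T) :=
    M.integrableOn_T (F.continuous_p₃.continuousOn.mul (M.contDiffOn_J₀.continuousOn.mono hs))
  have i2 : Integrable (fun x => F'.p₃ x * M'.J₀ x * M.normalCos M' (M'.ψ₀ x))
      (volume.restrict M'.T) :=
    M'.integrable_surface F'.continuous_p₃.continuousOn (M.measurable_normalCos M')
      (M.abs_normalCos_le M')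
  have htest : ∀ φ, IsTestFunction φ → tsupport φ ⊆ V →
      ∫ x in M.T, F.p₃ x * M.J₀ x * φ (M.ψ₀ x) =
      ∫ x in M'.T, F'.p₃ x * M'.J₀ x * M.normalCos M' (M'.ψ₀ x) * φ (M'.ψ₀ x) := by
    intro φ hφ hφs
    have hφt : tsupport φ ⊆ M.tube := hφs.trans sdiff_subset
    have hz : ∀ r, r ∉ M.tube ∨ r ∈ M'.bdΩ → φ r = 0 := by
      intro r hr
      refine image_eq_zero_of_notMem_tsupport fun h => ?_
      exact hr.elim (fun h1 => h1 (hφt h)) (hφs h).2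
    have l1 := Sheet.tendsto_bulkSource_probe (M := M) (M' := M) α F hφ hφt
    have l2 := Sheet.tendsto_bulkSource_probe (M := M) (M' := M') α F' hφ hφt
    have e := tendsto_nhds_unique l1 (l2.congr fun n => ?_)
    swap
    · have := hsrc _ (Sheet.contDiff_probe hφ hφt n)
      rw [boundarySource_eq_zero, boundarySource_eq_zero, add_zero, add_zero] at this
      · exact this.symm
      · intro r hr; simp [Sheet.probe, hz r (Or.inr hr)]
      · intro r hr; simp [Sheet.probe, hz r (Or.inl (M.notMem_tube_of_mem_bdΩ hr))]
    have e' := mul_left_cancel₀ (pow_ne_zero 2 hα) e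
    rw [setIntegral_congr_fun (g := fun x => F.p₃ x * M.J₀ x * φ (M.ψ₀ x)) M.isOpen_T.measurableSet
      fun x hx => by
        have hb := M.T_subset_baseDomain hx
        simp only [Sheet.normalCos]
        rw [indicator_of_mem (M.mem_Ω hx), Sheet.normalProd, M.coord_ψ₀ hb,
          real_inner_self_eq_norm_sq, M.norm_ν hb]
        ring] at e'
    rw [e']
    refine integral_congr_ae (Eventually.of_forall fun x => ?_)
    simp only
    ring
  have h := integral_eq_of_test_map M.aemeasurable_ψ₀_T i1 M'.aemeasurable_ψ₀_T i2 hV htest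
    (hη.indicator hV.measurableSet) (C := C) (fun r => by
      by_cases hr : r ∈ V
      · rw [indicator_of_mem hr]; exact hC r
      · rw [indicator_of_notMem hr, abs_zero]; exact (abs_nonneg _).trans (hC r))
    (fun r hr => indicator_of_notMem hr _)
  have e1 : M.surfaceIntegral F.p₃ η =
      ∫ x in M.T, F.p₃ x * M.J₀ x * V.indicator η (M.ψ₀ x) := by
    refine integral_congr_ae ?_
    filter_upwards [M.ae_notMem_bdΩ M', ae_restrict_mem M.isOpen_T.measurableSet] with x hx hxT
    have hV : M.ψ₀ x ∈ V := ⟨M.ψ₀_mem_tube hxT, hx⟩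
    rw [indicator_of_mem hV]
  rw [e1, h]
  refine integral_congr_ae ?_
  filter_upwards [M'.ae_notMem_bdΩ M', ae_restrict_mem M'.isOpen_T.measurableSet] with x hx hxT
  by_cases hr : M'.ψ₀ x ∈ V
  · rw [indicator_of_mem hr]; ring
  · have : M'.ψ₀ x ∉ M.Ω := fun h => hr ⟨M.Ω_subset_tube h, hx⟩
    simp [Sheet.normalCos, indicator_of_notMem this]

/-- The normal polarization vectors of two sheets with the same sources are equal as measures. -/
theorem dipole_eq (hα : α ≠ 0)
    (hsrc : ∀ φ : E3 → ℝ, ContDiff ℝ 2 φ → bulkSource α M F φ + boundarySource α M F φ =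
      bulkSource α M' F' φ + boundarySource α M' F' φ)
    {Y : Fin 3 → E3 → ℝ} (hY : ∀ i, Measurable (Y i)) {C : ℝ} (hC : ∀ i r, |Y i r| ≤ C) :
    ∑ i, M.surfaceIntegral F.p₃ (fun r => M.ν (M.coord r) i * Y i r) =
      ∑ i, M'.surfaceIntegral F'.p₃ (fun r => M'.ν (M'.coord r) i * Y i r) := by
  have hTm := M.isOpen_T.measurableSet
  have hs := M.closure_subset_baseDomain
  have hP := F.continuous_p₃.continuousOn (s := closure M.T)
  have h1 : ∀ {η : E3 → ℝ}, Measurable η → ∀ {C : ℝ}, (∀ r, |η r| ≤ C) →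
      M.surfaceIntegral F.p₃ η = M'.surfaceIntegral F'.p₃ (fun r => M.normalCos M' r * η r) :=
    fun hη _ hC => surfaceIntegral_p₃ hα hsrc hη hC
  have h2 : ∀ {η : E3 → ℝ}, Measurable η → ∀ {C : ℝ}, (∀ r, |η r| ≤ C) →
      M'.surfaceIntegral F'.p₃ η = M.surfaceIntegral F.p₃ (fun r => M'.normalCos M r * η r) :=
    fun hη _ hC => surfaceIntegral_p₃ hα (fun φ hφ => (hsrc φ hφ).symm) hη hC
  have mc := M.measurable_normalCos M'
  have mc' := M'.measurable_normalCos M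
  have bc := M.abs_normalCos_le M'
  have bc' := M'.abs_normalCos_le M
  have bmul : ∀ {f g : E3 → ℝ} {A B : ℝ}, (∀ r, |f r| ≤ A) → (∀ r, |g r| ≤ B) →
      ∀ r, |f r * g r| ≤ A * B := fun {f g A B} hf hg r => by
    rw [abs_mul]
    exact mul_le_mul (hf r) (hg r) (abs_nonneg _) ((abs_nonneg _).trans (hf r))
  have mmul : ∀ {f g : E3 → ℝ}, Measurable f → Measurable g → Measurable fun r => f r * g r :=
    fun hf hg => hf.mul hg
  -- almost everywhere the polarization vanishes or the two normals are parallel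
  obtain ⟨B, hB⟩ := M.isCompact_closure.exists_bound_of_continuousOn hP
  -- Using the relation from `M` to `M'` and back gives `∫ p₃ w η = 0` for all bounded measurable
  -- `η`. The choice `η = p₃ w` turns the integrand into a square, hence `p₃ w = 0` almost
  -- everywhere.
  set w : E3 → ℝ := fun r => 1 - M'.normalCos M r * M.normalCos M' r with hw
  have mw : Measurable w := measurable_const.sub (mc'.mul mc)
  have bw : ∀ r, |w r| ≤ 1 + 1 * 1 := fun r => by
    refine (abs_sub _ _).trans (add_le_add (by simp) (bmul bc' bc r))
  set Q : E3 → ℝ := M.Ω.indicator fun r => F.p₃ (M.coord r) with hQ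
  have mQ : Measurable Q :=
    (F.continuous_p₃.measurable.comp M.measurable_coord).indicator M.measurableSet_Ω
  have bQ : ∀ r, |Q r| ≤ |B| := by
    intro r
    by_cases hr : r ∈ M.Ω
    · rw [hQ, indicator_of_mem hr]
      obtain ⟨x, hx, rfl⟩ := hr
      rw [M.coord_ψ₀ (M.T_subset_baseDomain hx)]
      exact (hB x (subset_closure hx)).trans (le_abs_self B)
    · rw [hQ, indicator_of_notMem hr]; simp
  have mη : Measurable fun r => Q r * w r := mQ.mul mw
  have bη := bmul bQ bw
  have hsq : ∫ x in M.T, F.p₃ x * M.J₀ x * (Q (M.ψ₀ x) * w (M.ψ₀ x) * w (M.ψ₀ x)) = 0 := by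
    have a1 := h1 mη bη
    have a2 := h2 (mmul mc mη) (bmul bc bη)
    have i1 := M.integrable_surface hP mη bη
    have i2 := M.integrable_surface hP (mmul mc' (mmul mc mη)) (bmul bc' (bmul bc bη))
    have a3 := a1.trans a2
    rw [Sheet.surfaceIntegral, Sheet.surfaceIntegral, ← sub_eq_zero, ← integral_sub i1 i2] at a3
    rw [← a3]
    refine integral_congr_ae (Eventually.of_forall fun x => ?_)
    simp only [hw]
    ring
  have hae : ∀ᵐ x ∂volume.restrict M.T, F.p₃ x = 0 ∨ w (M.ψ₀ x) = 0 := by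
    have hval : ∀ x ∈ M.T, F.p₃ x * M.J₀ x * (Q (M.ψ₀ x) * w (M.ψ₀ x) * w (M.ψ₀ x)) =
        M.J₀ x * (F.p₃ x * w (M.ψ₀ x)) ^ 2 := by
      intro x hx
      have : Q (M.ψ₀ x) = F.p₃ x := by
        rw [hQ, indicator_of_mem (M.mem_Ω hx), M.coord_ψ₀ (M.T_subset_baseDomain hx)]
      rw [this]; ring
    have hi := M.integrable_surface hP (mmul mη mw) (bmul bη bw)
    have h0 := (integral_eq_zero_iff_of_nonneg_ae ((ae_restrict_mem hTm).mono fun x hx => by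
      change 0 ≤ _
      rw [hval x hx]
      have := (M.J₀_pos (M.T_subset_baseDomain hx)).le
      positivity) hi).1 hsq
    filter_upwards [h0, ae_restrict_mem hTm] with x hx hxT
    rw [hval x hxT] at hx
    have hJ := (M.J₀_pos (M.T_subset_baseDomain hxT)).ne'
    have : F.p₃ x * w (M.ψ₀ x) = 0 := by
      have := (mul_eq_zero.1 hx).resolve_left hJ
      exact pow_eq_zero_iff (two_ne_zero) |>.1 this
    exact mul_eq_zero.1 this
  have mν : ∀ (M : Sheet) (i : Fin 3), Measurable fun r => M.ν (M.coord r) i := fun M i =>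
    (EuclideanSpace.proj i : E3 →L[ℝ] ℝ).measurable.comp (M.measurable_ν.comp M.measurable_coord)
  have bν : ∀ (M : Sheet) (i : Fin 3) (r : E3), |M.ν (M.coord r) i| ≤ 1 := fun M i r =>
    (PiLp.norm_apply_le _ i).trans (M.norm_ν_le _)
  refine Finset.sum_congr rfl fun i _ => ?_
  rw [h2 (mmul (mν M' i) (hY i)) (bmul (bν M' i) (hC i)), Sheet.surfaceIntegral,
    Sheet.surfaceIntegral]
  refine integral_congr_ae ?_
  filter_upwards [hae, ae_restrict_mem hTm] with x hx hxT
  rcases hx with hx | hx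
  · simp [hx]
  · have hb := M.T_subset_baseDomain hxT
    -- Off `Ω'` the function `normalCos` is zero and `w` would be one. On `Ω'` the equation `w = 0`
    -- says that the cosine of the two unit normals is `1` or `-1`, so they are parallel.
    have hΩ' : M.ψ₀ x ∈ M'.Ω := by
      by_contra hn
      simp [hw, Sheet.normalCos, indicator_of_notMem hn] at hx
    obtain ⟨x', hx', hxx'⟩ := id hΩ'
    have hb' := M'.T_subset_baseDomain hx'
    have ec : M'.normalCos M (M.ψ₀ x) = ⟪M.ν x, M'.ν x'⟫ := by
      rw [Sheet.normalCos, indicator_of_mem hΩ', Sheet.normalProd, M.coord_ψ₀ hb, ← hxx',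
        M'.coord_ψ₀ hb', real_inner_comm]
    have ec' : M.normalCos M' (M.ψ₀ x) = ⟪M.ν x, M'.ν x'⟫ := by
      rw [Sheet.normalCos, indicator_of_mem (M.mem_Ω hxT), Sheet.normalProd,
        M.coord_ψ₀ hb, ← hxx', M'.coord_ψ₀ hb']
    have hcc : ⟪M.ν x, M'.ν x'⟫ * ⟪M.ν x, M'.ν x'⟫ = 1 := by
      have : 1 - M'.normalCos M (M.ψ₀ x) * M.normalCos M' (M.ψ₀ x) = 0 := hx
      rw [ec, ec'] at this
      linarith
    have hν := eq_inner_smul_of_unit (M.norm_ν hb) (M'.norm_ν hb') hcc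
    have hνi : M.ν x i = ⟪M.ν x, M'.ν x'⟫ * M'.ν x' i := by
      conv_lhs => rw [hν]
      simp
    rw [ec, M.coord_ψ₀ hb, ← hxx', M'.coord_ψ₀ hb', hνi]
    ring

end Uniqueness

/-! ### Separation of the bulk and boundary parts of the source -/

section Uniqueness

variable {α : ℝ} {M M' : Sheet} {F F' : Fields}

/-- In coordinates the normal derivative becomes a sum of components of `ν` times partial
derivatives, which are bounded measurable functions; in this form the dipoles of two sheets have
been compared. -/
theorem bulkSource_eq_surfaceIntegral (α : ℝ) (M : Sheet) (F : Fields) {φ : E3 → ℝ}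
    (hφ : IsTestFunction φ) :
    bulkSource α M F φ = M.surfaceIntegral (bulkDensity α M F) φ +
      α ^ 2 * ∑ i, M.surfaceIntegral F.p₃ (fun r => M.ν (M.coord r) i * fderiv ℝ φ r (ax i)) := by
  have c1 : ∀ i, Continuous fun r => fderiv ℝ φ r (ax i) := fun i =>
    (contDiff_fderiv_apply (m := 1) hφ.contDiff_two (by norm_num) (ax i)).continuous
  have i1 : ∀ i, Integrable (fun x => F.p₃ x * M.J₀ x *
      (M.ν (M.coord (M.ψ₀ x)) i * fderiv ℝ φ (M.ψ₀ x) (ax i))) (volume.restrict M.T) := by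
    intro i
    obtain ⟨C, hC⟩ := (hasCompactSupport_fderiv_apply hφ.2 (ax i)).exists_bound_of_continuous (c1 i)
    refine M.integrable_surface F.continuous_p₃.continuousOn
      (η := fun r => M.ν (M.coord r) i * fderiv ℝ φ r (ax i)) (C := 1 * C) ?_ fun r => ?_
    · exact ((EuclideanSpace.proj i : E3 →L[ℝ] ℝ).measurable.comp
        (M.measurable_ν.comp M.measurable_coord)).mul (c1 i).measurable
    · rw [abs_mul]
      exact mul_le_mul ((PiLp.norm_apply_le _ i).trans (M.norm_ν_le _)) (hC r) (abs_nonneg _)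
        zero_le_one
  rw [bulkSource, normalDerivIndicator, mul_neg, sub_neg_eq_add]
  simp only [Sheet.surfaceIntegral]
  rw [← integral_finsetSum _ fun i _ => i1 i]
  congr 1
  · exact integral_congr_ae (Eventually.of_forall fun x => mul_right_comm _ _ _)
  · congr 1
    refine setIntegral_congr_fun M.isOpen_T.measurableSet fun x hx => ?_
    simp only
    rw [clm_apply_E3 _ (M.ν x), ← Finset.mul_sum, M.coord_ψ₀ (M.T_subset_baseDomain hx)]
    ring

/-- The surface charge densities of two sheets with the same sources are equal as measures. -/
theorem monopole_eq (hα : α ≠ 0)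
    (hsrc : ∀ φ : E3 → ℝ, ContDiff ℝ 2 φ → bulkSource α M F φ + boundarySource α M F φ =
      bulkSource α M' F' φ + boundarySource α M' F' φ)
    {η : E3 → ℝ} (hη : Measurable η) {C : ℝ} (hC : ∀ r, |η r| ≤ C) :
    M.surfaceIntegral (bulkDensity α M F) η = M'.surfaceIntegral (bulkDensity α M' F') η := by
  -- Off both boundaries only the bulk sources act. Their dipole parts are already known to agree
  -- and cancel, and what is cut out has zero area on each sheet.
  set V := (M.bdΩ ∪ M'.bdΩ)ᶜ with hVdef
  have hV : IsOpen V := (M.isCompact_bdΩ.isClosed.union M'.isCompact_bdΩ.isClosed).isOpen_compl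
  have ii : ∀ (M : Sheet) (F : Fields), Integrable (fun x => bulkDensity α M F x * M.J₀ x)
      (volume.restrict M.T) := fun M F =>
    M.integrableOn_T (((continuousOn_bulkDensity α M F).mul M.contDiffOn_J₀.continuousOn).mono
      M.closure_subset_baseDomain)
  have h := integral_eq_of_test_map M.aemeasurable_ψ₀_T (ii M F) M'.aemeasurable_ψ₀_T (ii M' F') hV
    (fun φ hφ hφs => by
      have hz : ∀ r, r ∈ M.bdΩ ∪ M'.bdΩ → φ r = 0 := fun r hr =>
        image_eq_zero_of_notMem_tsupport fun h => hφs h hr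
      have e := hsrc φ hφ.contDiff_two
      rw [boundarySource_eq_zero _ _ _ fun r hr => hz r (Or.inl hr),
        boundarySource_eq_zero _ _ _ fun r hr => hz r (Or.inr hr),
        bulkSource_eq_surfaceIntegral α M F hφ, bulkSource_eq_surfaceIntegral α M' F' hφ] at e
      have c1 : ∀ i, Continuous fun r => fderiv ℝ φ r (ax i) := fun i =>
        (contDiff_fderiv_apply (m := 1) hφ.contDiff_two (by norm_num) (ax i)).continuous
      have hdφ : Continuous (fderiv ℝ φ) := hφ.contDiff_two.continuous_fderiv (by norm_num)
      obtain ⟨B, hB⟩ := (hφ.2.fderiv (𝕜 := ℝ)).exists_bound_of_continuous hdφ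
      rw [dipole_eq hα hsrc (Y := fun i r => fderiv ℝ φ r (ax i)) (fun i => (c1 i).measurable)
        (C := B) fun i r => by
          have := (fderiv ℝ φ r).le_opNorm (ax i)
          rw [norm_ax, mul_one] at this
          exact this.trans (hB r)] at e
      have e' : M.surfaceIntegral (bulkDensity α M F) φ =
        M'.surfaceIntegral (bulkDensity α M' F') φ := by linarith
      exact e') (hη.indicator hV.measurableSet) (C := C) (fun r => by
      by_cases hr : r ∈ V
      · rw [indicator_of_mem hr]; exact hC r
      · rw [indicator_of_notMem hr, abs_zero]; exact (abs_nonneg _).trans (hC r))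
    (fun r hr => indicator_of_notMem hr _)
  have hind : ∀ (M₁ : Sheet) (w : E2 → ℝ), (∀ᵐ x ∂volume.restrict M₁.T, M₁.ψ₀ x ∈ V) →
      ∫ x in M₁.T, w x * V.indicator η (M₁.ψ₀ x) = ∫ x in M₁.T, w x * η (M₁.ψ₀ x) := by
    intro M₁ w hw
    refine integral_congr_ae ?_
    filter_upwards [hw] with x hx
    rw [indicator_of_mem hx]
  rw [hind M, hind M'] at h
  · exact h
  · filter_upwards [M'.ae_notMem_bdΩ M', M'.ae_notMem_bdΩ M] with x h1 h2 h3
    exact h3.elim h2 h1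
  · filter_upwards [M.ae_notMem_bdΩ M', M.ae_notMem_bdΩ M] with x h1 h2 h3
    exact h3.elim h2 h1

theorem bulkSource_eq (hsrc : ∀ φ : E3 → ℝ, ContDiff ℝ 2 φ →
      bulkSource α M F φ + boundarySource α M F φ = bulkSource α M' F' φ + boundarySource α M' F' φ)
    {φ : E3 → ℝ} (hφ : IsTestFunction φ) : bulkSource α M F φ = bulkSource α M' F' φ := by
  by_cases hα : α = 0
  · subst hα
    simp [bulkSource, bulkDensity]
  · obtain ⟨C, hC⟩ := hφ.2.exists_bound_of_continuous hφ.1.continuous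
    have c1 : ∀ i, Continuous fun r => fderiv ℝ φ r (ax i) := fun i =>
      (contDiff_fderiv_apply (m := 1) hφ.contDiff_two (by norm_num) (ax i)).continuous
    have hdφ : Continuous (fderiv ℝ φ) := hφ.contDiff_two.continuous_fderiv (by norm_num)
    obtain ⟨B, hB⟩ := (hφ.2.fderiv (𝕜 := ℝ)).exists_bound_of_continuous hdφ
    rw [bulkSource_eq_surfaceIntegral α M F hφ, bulkSource_eq_surfaceIntegral α M' F' hφ,
      monopole_eq hα hsrc hφ.1.continuous.measurable hC,
      dipole_eq hα hsrc (Y := fun i r => fderiv ℝ φ r (ax i)) (fun i => (c1 i).measurable)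
        (C := B) fun i r => by
          have := (fderiv ℝ φ r).le_opNorm (ax i)
          rw [norm_ax, mul_one] at this
          exact this.trans (hB r)]

theorem boundarySource_eq (hsrc : ∀ φ : E3 → ℝ, ContDiff ℝ 2 φ →
      bulkSource α M F φ + boundarySource α M F φ = bulkSource α M' F' φ + boundarySource α M' F' φ)
    {φ : E3 → ℝ} (hφ : IsTestFunction φ) : boundarySource α M F φ = boundarySource α M' F' φ := by
  have h1 := hsrc φ hφ.contDiff_two
  have h2 := bulkSource_eq hsrc hφ
  linarith

end Uniqueness

/-! ### Two parametrizations of one surface -/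

theorem det_E2 (A : E2 →L[ℝ] E2) :
    A.det = A (dir 0) 0 * A (dir 1) 1 - A (dir 1) 0 * A (dir 0) 1 := by
  rw [ContinuousLinearMap.det, ← LinearMap.det_toMatrix
    (EuclideanSpace.basisFun (Fin 2) ℝ).toBasis, Matrix.det_fin_two]
  simp [LinearMap.toMatrix_apply, dir]

/-- An alternating form on the plane is multiplied by the determinant. This serves the three
components of a cross product and, later, `curlForm`. -/
theorem alternating_comp (A : E2 →L[ℝ] E2) (s t : E2 →L[ℝ] ℝ) :
    s (A (dir 0)) * t (A (dir 1)) - s (A (dir 1)) * t (A (dir 0)) =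
      A.det * (s (dir 0) * t (dir 1) - s (dir 1) * t (dir 0)) := by
  rw [det_E2, clm_apply_E2 s (A (dir 0)), clm_apply_E2 t (A (dir 0)), clm_apply_E2 s (A (dir 1)),
    clm_apply_E2 t (A (dir 1))]
  simp only [smul_eq_mul]
  ring

theorem cross_comp (L : E2 →L[ℝ] E3) (A : E2 →L[ℝ] E2) :
    cross (L (A (dir 0))) (L (A (dir 1))) = A.det • cross (L (dir 0)) (L (dir 1)) := by
  have h := fun i j : Fin 3 => alternating_comp A ((EuclideanSpace.proj i : E3 →L[ℝ] ℝ) ∘L L)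
    ((EuclideanSpace.proj j : E3 →L[ℝ] ℝ) ∘L L)
  simp only [ContinuousLinearMap.comp_apply] at h
  ext i
  fin_cases i
  · have := h 1 2
    simp only [PiLp.smul_apply, smul_eq_mul, Fin.zero_eta, cross_apply_zero]
    simp at this
    linarith
  · have := h 2 0
    simp only [PiLp.smul_apply, smul_eq_mul, Fin.mk_one, cross_apply_one]
    simp at this
    linarith
  · have := h 0 1
    simp only [PiLp.smul_apply, smul_eq_mul, Fin.reduceFinMk, cross_apply_two]
    simp at this
    linarith

namespace Sheet

variable {M M' : Sheet}

/-- The change of parameters between two charts. -/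
noncomputable def trans (M M' : Sheet) (x : E2) : E2 := M'.coord (M.ψ₀ x)

/-- By compactness of the parameter domain the closure is taken in the chart. Two sheets with the
same `Ω` then share the closure, and the change of parameters is available up to the boundary. -/
theorem closure_Ω (M : Sheet) : closure M.Ω = M.ψ₀ '' closure M.T := by
  have hc := M.continuousOn_ψ₀.mono M.closure_subset_baseDomain
  refine subset_antisymm ?_ ?_
  · exact closure_minimal (image_mono subset_closure)
      (M.isCompact_closure.image_of_continuousOn hc).isClosed
  · exact hc.image_closure

variable (hΩ : M.Ω = M'.Ω)

include hΩ

theorem trans_mem_closure {x : E2} (hx : x ∈ closure M.T) :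
    M.trans M' x ∈ closure M'.T ∧ M'.ψ₀ (M.trans M' x) = M.ψ₀ x := by
  have h : M.ψ₀ x ∈ closure M'.Ω := by
    rw [← hΩ, closure_Ω]; exact mem_image_of_mem _ hx
  rw [closure_Ω] at h
  obtain ⟨y, hy, hyx⟩ := h
  rw [trans, ← hyx, M'.coord_ψ₀ (M'.mem_U y hy)]
  exact ⟨hy, rfl⟩

theorem trans_mem {x : E2} (hx : x ∈ M.T) : M.trans M' x ∈ M'.T := by
  have h : M.ψ₀ x ∈ M'.Ω := by rw [← hΩ]; exact M.mem_Ω hx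
  obtain ⟨y, hy, hyx⟩ := h
  rwa [trans, ← hyx, M'.coord_ψ₀ (M'.T_subset_baseDomain hy)]

theorem trans_trans {x : E2} (hx : x ∈ closure M.T) : M'.trans M (M.trans M' x) = x := by
  rw [trans, (trans_mem_closure hΩ hx).2, M.coord_ψ₀ (M.mem_U x hx)]

theorem contDiffAt_trans {x : E2} (hx : x ∈ closure M.T) : ContDiffAt ℝ 2 (M.trans M') x := by
  have hb := M.mem_U x hx
  have hr : M.ψ₀ x ∈ M'.ψ '' M'.U := by
    rw [← (trans_mem_closure hΩ hx).2]
    exact M'.ψ₀_mem_range (M'.mem_U _ (trans_mem_closure hΩ hx).1)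
  exact (M'.contDiffOn_coord.contDiffAt (M'.isOpen_range.mem_nhds hr)).comp x
    (M.contDiffOn_ψ₀.contDiffAt (M.isOpen_baseDomain.mem_nhds hb))

theorem continuousOn_trans : ContinuousOn (M.trans M') (closure M.T) := fun _ hx =>
  (contDiffAt_trans hΩ hx).continuousAt.continuousWithinAt

theorem D_trans {x : E2} (hx : x ∈ M.T) :
    M.D x = M'.D (M.trans M' x) ∘L fderiv ℝ (M.trans M') x := by
  have hx' := subset_closure hx
  have h1 : HasFDerivAt (M.trans M') (fderiv ℝ (M.trans M') x) x :=
    ((contDiffAt_trans hΩ hx').differentiableAt (by norm_num)).hasFDerivAt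
  have hb' := M'.T_subset_baseDomain (trans_mem hΩ hx)
  have h2 : HasFDerivAt M'.ψ₀ (M'.D (M.trans M' x)) (M.trans M' x) :=
    (M'.hasFDerivAt_ψ₀ hb').differentiableAt.hasFDerivAt
  have h3 := h2.comp x h1
  have h4 : M'.ψ₀ ∘ M.trans M' =ᶠ[𝓝 x] M.ψ₀ := by
    filter_upwards [M.isOpen_T.mem_nhds hx] with y hy
    exact (trans_mem_closure hΩ (subset_closure hy)).2
  rw [D, ← h4.fderiv_eq, h3.fderiv]

theorem normalVec_trans {x : E2} (hx : x ∈ M.T) : M.normalVec x =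
    (fderiv ℝ (M.trans M') x).det • M'.normalVec (M.trans M' x) := by
  rw [normalVec, D_trans hΩ hx, ContinuousLinearMap.comp_apply, ContinuousLinearMap.comp_apply,
    cross_comp]
  rfl

theorem J₀_trans {x : E2} (hx : x ∈ M.T) : M.J₀ x =
    |(fderiv ℝ (M.trans M') x).det| * M'.J₀ (M.trans M' x) := by
  rw [J₀_eq, J₀_eq, normalVec_trans hΩ hx, norm_smul, Real.norm_eq_abs]

theorem det_trans_ne_zero {x : E2} (hx : x ∈ M.T) : (fderiv ℝ (M.trans M') x).det ≠ 0 := by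
  intro h
  have := J₀_trans hΩ hx
  rw [h, abs_zero, zero_mul] at this
  exact (M.J₀_pos (M.T_subset_baseDomain hx)).ne' this

/-- The normals agree up to the sign of the change of parameters. -/
theorem det_mul_ν {x : E2} (hx : x ∈ M.T) : (fderiv ℝ (M.trans M') x).det • M.ν x =
    |(fderiv ℝ (M.trans M') x).det| • M'.ν (M.trans M' x) := by
  have hd := det_trans_ne_zero hΩ hx
  set d := (fderiv ℝ (M.trans M') x).det with hdef
  have hn : M'.normalVec (M.trans M' x) ≠ 0 :=
    M'.normalVec_ne_zero (M'.T_subset_baseDomain (trans_mem hΩ hx))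
  rw [ν_eq, ν_eq, unitVec, unitVec, normalVec_trans hΩ hx, ← hdef, norm_smul, smul_smul, smul_smul,
    smul_smul, Real.norm_eq_abs]
  congr 1
  have h1 : |d| ≠ 0 := abs_ne_zero.2 hd
  have h2 := norm_ne_zero_iff.2 hn
  field_simp
  rw [sq_abs]

theorem integral_trans (g : E2 → ℝ) : ∫ y in M'.T, g y =
    ∫ x in M.T, |(fderiv ℝ (M.trans M') x).det| * g (M.trans M' x) := by
  have himg : M'.T = M.trans M' '' M.T := by
    refine subset_antisymm (fun y hy => ?_) ?_
    · exact ⟨M'.trans M y, trans_mem hΩ.symm hy, trans_trans hΩ.symm (subset_closure hy)⟩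
    · rintro _ ⟨x, hx, rfl⟩; exact trans_mem hΩ hx
  have hinj : InjOn (M.trans M') M.T := fun x hx y hy h => by
    rw [← trans_trans hΩ (subset_closure hx), h, trans_trans hΩ (subset_closure hy)]
  rw [himg, integral_image_eq_integral_abs_det_fderiv_smul volume M.isOpen_T.measurableSet
    (fun x hx => ((contDiffAt_trans hΩ (subset_closure hx)).differentiableAt
      (by norm_num)).hasFDerivAt.hasFDerivWithinAt) hinj]
  rfl

theorem surfaceIntegral_trans (w : E2 → ℝ) (η : E3 → ℝ) :
    M'.surfaceIntegral w η = M.surfaceIntegral (fun x => w (M.trans M' x)) η := by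
  rw [surfaceIntegral, integral_trans hΩ, surfaceIntegral]
  refine setIntegral_congr_fun M.isOpen_T.measurableSet fun x hx => ?_
  rw [(trans_mem_closure hΩ (subset_closure hx)).2, J₀_trans hΩ hx]
  ring

/-- The difference of the two densities, carried to space and extended by zero, is itself an
admissible `η`; the integral of its square against `J₀` vanishes. Continuity turns equality almost
everywhere into equality on the open set `T`. -/
theorem eq_trans_of_surfaceIntegral_eq {w w' : E2 → ℝ} (hw : ContinuousOn w (closure M.T))
    (hw' : ContinuousOn w' (closure M'.T))
    (h : ∀ η : E3 → ℝ, Measurable η → ∀ C : ℝ, (∀ r, |η r| ≤ C) →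
      M.surfaceIntegral w η = M'.surfaceIntegral w' η) {x : E2} (hx : x ∈ M.T) :
    w x = w' (M.trans M' x) := by
  have hTm := M.isOpen_T.measurableSet
  have ct : ContinuousOn (fun x => w' (M.trans M' x)) (closure M.T) :=
    hw'.comp (continuousOn_trans hΩ) fun x hx => (trans_mem_closure hΩ hx).1
  have cd := hw.sub ct
  obtain ⟨C, hC⟩ := M.isCompact_closure.exists_bound_of_continuousOn cd
  classical
  set η : E3 → ℝ := M.Ω.piecewise (fun r => w (M.coord r) - w' (M.trans M' (M.coord r)))
    (fun _ => 0) with hη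
  have hηψ : ∀ x ∈ M.T, η (M.ψ₀ x) = w x - w' (M.trans M' x) := fun x hx => by
    rw [hη, piecewise_eq_of_mem _ _ _ (M.mem_Ω hx), M.coord_ψ₀ (M.T_subset_baseDomain hx)]
  have cc : ContinuousOn M.coord M.Ω :=
    M.contDiffOn_coord.continuousOn.mono (M.Ω_subset_tube.trans M.tube_subset)
  have mη : Measurable η := by
    refine ContinuousOn.measurable_piecewise ?_ continuousOn_const M.measurableSet_Ω
    refine (cd.mono subset_closure).comp cc ?_
    rintro _ ⟨y, hy, rfl⟩
    rwa [M.coord_ψ₀ (M.T_subset_baseDomain hy)]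
  have bη : ∀ r, |η r| ≤ |C| := fun r => by
    by_cases hr : r ∈ M.Ω
    · obtain ⟨y, hy, rfl⟩ := hr
      rw [hηψ y hy]
      exact (hC y (subset_closure hy)).trans (le_abs_self C)
    · rw [hη, piecewise_eq_of_notMem _ _ _ hr]; simp
  have e := h η mη _ bη
  rw [surfaceIntegral_trans hΩ, surfaceIntegral, surfaceIntegral, ← sub_eq_zero,
    ← integral_sub (M.integrable_surface hw mη bη) (M.integrable_surface ct mη bη)] at e
  have hval : ∀ x ∈ M.T, w x * M.J₀ x * η (M.ψ₀ x) - w' (M.trans M' x) * M.J₀ x * η (M.ψ₀ x) =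
      M.J₀ x * (w x - w' (M.trans M' x)) ^ 2 := fun x hx => by
    rw [hηψ x hx]; ring
  have h0 := (integral_eq_zero_iff_of_nonneg_ae ((ae_restrict_mem hTm).mono fun x hx => by
      change (0 : ℝ) ≤ w x * M.J₀ x * η (M.ψ₀ x) - w' (M.trans M' x) * M.J₀ x * η (M.ψ₀ x)
      rw [hval x hx]
      have := (M.J₀_pos (M.T_subset_baseDomain hx)).le
      positivity) ((M.integrable_surface hw mη bη).sub (M.integrable_surface ct mη bη))).1 e
  have hae : w =ᵐ[volume.restrict M.T] fun x => w' (M.trans M' x) := by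
    filter_upwards [h0, ae_restrict_mem hTm] with x hx hxT
    have hx' : w x * M.J₀ x * η (M.ψ₀ x) - w' (M.trans M' x) * M.J₀ x * η (M.ψ₀ x) = 0 := hx
    rw [hval x hxT] at hx'
    have hJ := (M.J₀_pos (M.T_subset_baseDomain hxT)).ne'
    exact sub_eq_zero.1 (pow_eq_zero_iff two_ne_zero |>.1 ((mul_eq_zero.1 hx').resolve_left hJ))
  exact Measure.eqOn_open_of_ae_eq hae M.isOpen_T (hw.mono subset_closure) (ct.mono subset_closure)
    hx

end Sheet

/-! ### Uniqueness of the densities on a given surface -/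

section

variable {α : ℝ} {M M' : Sheet} {F F' : Fields}

theorem trans_eq {x x' : E2} (hx' : x' ∈ M'.baseDomain) (h : M.ψ₀ x = M'.ψ₀ x') :
    M.trans M' x = x' := by
  rw [Sheet.trans, h, M'.coord_ψ₀ hx']

theorem bulkDensity_eq (hΩ : M.Ω = M'.Ω)
    (hsrc : ∀ φ : E3 → ℝ, ContDiff ℝ 2 φ → bulkSource α M F φ + boundarySource α M F φ =
      bulkSource α M' F' φ + boundarySource α M' F' φ)
    {x x' : E2} (hx : x ∈ M.T) (hx' : x' ∈ M'.T) (h : M.ψ₀ x = M'.ψ₀ x') :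
    bulkDensity α M F x = bulkDensity α M' F' x' := by
  by_cases hα : α = 0
  · subst hα; simp [bulkDensity]
  · rw [← trans_eq (M'.T_subset_baseDomain hx') h]
    exact Sheet.eq_trans_of_surfaceIntegral_eq hΩ
      ((continuousOn_bulkDensity α M F).mono M.closure_subset_baseDomain)
      ((continuousOn_bulkDensity α M' F').mono M'.closure_subset_baseDomain)
      (fun η hη C hC => monopole_eq hα hsrc hη hC) hx

/-- The normal vectors of the two charts differ by the determinant of the change of parameters,
hence the unit normals by its sign. -/
theorem Sheet.exists_sign (hΩ : M.Ω = M'.Ω) {x : E2} (hx : x ∈ M.T) :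
    ∃ s : ℝ, s * s = 1 ∧ M.ν x = s • M'.ν (M.trans M' x) ∧
      ⟪M.ν x, M'.ν (M.trans M' x)⟫ = s ∧
      (fderiv ℝ (M.trans M') x).det = s * |(fderiv ℝ (M.trans M') x).det| := by
  have hd := Sheet.det_trans_ne_zero hΩ hx
  have h := Sheet.det_mul_ν hΩ hx
  set d := (fderiv ℝ (M.trans M') x).det
  have ha := abs_ne_zero.2 hd
  have hν : M.ν x = (d⁻¹ * |d|) • M'.ν (M.trans M' x) := by
    rw [mul_smul, ← h, smul_smul, inv_mul_cancel₀ hd, one_smul]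
  have hs : d⁻¹ * |d| * (d⁻¹ * |d|) = 1 := by
    have : |d| * |d| = d * d := abs_mul_abs_self d
    field_simp
    nlinarith
  refine ⟨d⁻¹ * |d|, hs, hν, ?_, ?_⟩
  · conv_lhs => rw [hν]
    rw [real_inner_smul_left, real_inner_self_eq_norm_sq,
      M'.norm_ν (M'.T_subset_baseDomain (Sheet.trans_mem hΩ hx))]
    ring
  · have : |d| * |d| = d * d := abs_mul_abs_self d
    field_simp
    nlinarith

theorem normalPolarization_eq (hα : α ≠ 0) (hΩ : M.Ω = M'.Ω)
    (hsrc : ∀ φ : E3 → ℝ, ContDiff ℝ 2 φ → bulkSource α M F φ + boundarySource α M F φ =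
      bulkSource α M' F' φ + boundarySource α M' F' φ)
    {x x' : E2} (hx : x ∈ M.T) (hx' : x' ∈ M'.T) (h : M.ψ₀ x = M'.ψ₀ x') :
    F.p₃ x • M.ν x = F'.p₃ x' • M'.ν x' := by
  have ht := trans_eq (M'.T_subset_baseDomain hx') h
  have cν : ContinuousOn (fun y => ⟪M.ν (M'.trans M y), M'.ν y⟫) (closure M'.T) :=
    ((M.continuousOn_ν.mono M.closure_subset_baseDomain).comp
      (Sheet.continuousOn_trans hΩ.symm) fun y hy => (Sheet.trans_mem_closure hΩ.symm hy).1).inner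
      (M'.continuousOn_ν.mono M'.closure_subset_baseDomain)
  -- This gives `p₃ = p₃' ⟪ν, ν'⟫` at every point. The cosine is the sign `s` with `ν = s • ν'`, and
  -- `s * s = 1` makes the vectors agree.
  have e := Sheet.eq_trans_of_surfaceIntegral_eq (w := F.p₃)
    (w' := fun y => F'.p₃ y * ⟪M.ν (M'.trans M y), M'.ν y⟫) hΩ F.continuous_p₃.continuousOn
    (F'.continuous_p₃.continuousOn.mul cν) (fun η hη C hC => by
      rw [surfaceIntegral_p₃ hα hsrc hη hC]
      refine setIntegral_congr_fun M'.isOpen_T.measurableSet fun y hy => ?_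
      have hyΩ : M'.ψ₀ y ∈ M.Ω := by rw [hΩ]; exact M'.mem_Ω hy
      simp only [Sheet.normalCos]
      rw [indicator_of_mem hyΩ, Sheet.normalProd, M'.coord_ψ₀ (M'.T_subset_baseDomain hy),
        ← Sheet.trans]
      ring) hx
  obtain ⟨s, hs, hν, hi, -⟩ := Sheet.exists_sign hΩ hx
  simp only [Sheet.trans_trans hΩ (subset_closure hx)] at e
  rw [hi, ht] at e
  rw [hν, ht, e, smul_smul, mul_assoc, hs, mul_one]

end

/-! ### Stokes' theorem on a sheet -/

namespace Sheet

variable (M : Sheet)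

/-- The density of `curl (g a) · ν` in the chart. -/
noncomputable def curlForm (g : E3 → ℝ) (a : E3) (x : E2) : ℝ :=
  fderiv ℝ g (M.ψ₀ x) (M.D x (dir 0)) * ⟪a, M.D x (dir 1)⟫ -
    fderiv ℝ g (M.ψ₀ x) (M.D x (dir 1)) * ⟪a, M.D x (dir 0)⟫

/-- With `A = ⟪a, ψ₀⟫`, the form is the derivative of `g ∘ ψ₀` along the rotated gradient of `A`,
which is divergence-free by symmetry of second derivatives. The divergence theorem on `T` then
leaves the circulation of `g a` along the boundary, without any parametrization of `∂T`. -/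
theorem integral_curlForm {g : E3 → ℝ} (hg : ContDiff ℝ 2 g) (a : E3) :
    ∫ x in M.T, M.curlForm g a x = ∫ x, g (M.ψ₀ x) * ⟪a, M.bdTangent x⟫ ∂M.bdMeasure := by
  set A : E2 → ℝ := fun x => ⟪a, M.ψ₀ x⟫ with hA
  have cA : ContDiffOn ℝ 2 A M.baseDomain := contDiffOn_const.inner ℝ M.contDiffOn_ψ₀
  have cdA : ContDiffOn ℝ 1 (fderiv ℝ A) M.baseDomain :=
    cA.fderiv_of_isOpen M.isOpen_baseDomain (by norm_num)
  have hdA : ∀ x ∈ M.baseDomain, ∀ v, fderiv ℝ A x v = ⟪a, M.D x v⟫ := fun x hx v => by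
    have h1 : HasFDerivAt A (innerSL ℝ a ∘L M.D x) x :=
      (innerSL ℝ a).hasFDerivAt.comp x (M.hasFDerivAt_ψ₀ hx).differentiableAt.hasFDerivAt
    rw [h1.fderiv]; rfl
  have ce : ∀ i, ContDiffOn ℝ 1 (fun x => fderiv ℝ A x (dir i)) M.baseDomain := fun i =>
    cdA.clm_apply contDiffOn_const
  set V : E2 → E2 := fun x => fderiv ℝ A x (dir 1) • dir 0 - fderiv ℝ A x (dir 0) • dir 1 with hV
  have cV : ContDiffOn ℝ 1 V M.baseDomain :=
    ((ce 1).smul contDiffOn_const).sub ((ce 0).smul contDiffOn_const)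
  have hdiv : ∀ x ∈ M.baseDomain, div2 V x = 0 := by
    intro x hx
    have hn := M.isOpen_baseDomain.mem_nhds hx
    have h2 : DifferentiableAt ℝ (fderiv ℝ A) x :=
      (cdA.contDiffAt hn).differentiableAt (by norm_num)
    have h3 : ∀ i, HasFDerivAt (fun y => fderiv ℝ A y (dir i))
        ((fderiv ℝ (fderiv ℝ A) x).flip (dir i)) x := fun i => by
      simpa using h2.hasFDerivAt.clm_apply (hasFDerivAt_const (dir i) x)
    have h4 := ((h3 1).smul_const (dir 0)).sub ((h3 0).smul_const (dir 1))
    have hsym : fderiv ℝ (fderiv ℝ A) x (dir 0) (dir 1) = fderiv ℝ (fderiv ℝ A) x (dir 1) (dir 0) :=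
      (cA.contDiffAt hn).isSymmSndFDerivAt (by simp) _ _
    have h5 : fderiv ℝ V x = _ := h4.fderiv
    rw [div2, h5]
    simp [dir]
    simp only [dir] at hsym
    linarith
  have cG : ContDiffOn ℝ 1 (fun x => g (M.ψ₀ x)) M.baseDomain :=
    ((hg.of_le (by norm_num)).comp_contDiffOn (M.contDiffOn_ψ₀.of_le (by norm_num)))
  have h := M.integral_mul_div2 cG cV
  have hTm := M.isOpen_T.measurableSet
  rw [setIntegral_congr_fun (g := fun _ => (0 : ℝ)) (f := fun x => g (M.ψ₀ x) * div2 V x) hTm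
    fun x hx => by simp [hdiv x (M.T_subset_baseDomain hx)], integral_zero, sub_zero] at h
  have e1 : ∫ x in M.T, M.curlForm g a x =
      ∫ x in M.T, fderiv ℝ (fun x => g (M.ψ₀ x)) x (V x) := by
    refine setIntegral_congr_fun hTm fun x hx => ?_
    have hb := M.T_subset_baseDomain hx
    have h1 : HasFDerivAt (fun x => g (M.ψ₀ x)) (fderiv ℝ g (M.ψ₀ x) ∘L M.D x) x :=
      (hg.differentiable (by norm_num) _).hasFDerivAt.comp x
        (M.hasFDerivAt_ψ₀ hb).differentiableAt.hasFDerivAt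
    simp only [hV]
    rw [h1.fderiv, hdA x hb, hdA x hb]
    simp only [ContinuousLinearMap.comp_apply, map_sub, map_smul, smul_eq_mul, curlForm]
    ring
  rw [e1, h]
  refine integral_congr_ae (M.ae_bdMeasure fun x hx => ?_)
  have hb := M.frontier_subset_baseDomain hx
  simp only [hV]
  rw [hdA x hb, hdA x hb, bdTangent, clm_apply_E2 (M.D x) (rot _), inner_E2]
  simp [rot, dir, inner_add_right, real_inner_smul_right]
  left
  ring

theorem curlForm_congr {g g' : E3 → ℝ} {x : E2} (h : g =ᶠ[𝓝 (M.ψ₀ x)] g') (a : E3) :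
    M.curlForm g a x = M.curlForm g' a x := by
  rw [curlForm, curlForm, h.fderiv_eq]

theorem curlForm_const_mul (s : ℝ) (g : E3 → ℝ) (a : E3) (x : E2) :
    M.curlForm (fun r => s * g r) a x = s * M.curlForm g a x := by
  have : (fun r => s * g r) = s • g := rfl
  rw [curlForm, curlForm, this, fderiv_const_smul_field]
  simp only [smul_apply, Pi.smul_apply, smul_eq_mul]
  ring

variable {M} {M' : Sheet}

theorem curlForm_trans (hΩ : M.Ω = M'.Ω) {x : E2} (hx : x ∈ M.T) (g : E3 → ℝ) (a : E3) :
    M.curlForm g a x = (fderiv ℝ (M.trans M') x).det * M'.curlForm g a (M.trans M' x) := by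
  have h := alternating_comp (fderiv ℝ (M.trans M') x)
    (fderiv ℝ g (M.ψ₀ x) ∘L M'.D (M.trans M' x)) (innerSL ℝ a ∘L M'.D (M.trans M' x))
  rw [curlForm, curlForm, D_trans hΩ hx, (trans_mem_closure hΩ (subset_closure hx)).2]
  exact h

/-- The relative orientation of two charts of one surface, as a smooth function in space. -/
theorem exists_orientation (hΩ : M.Ω = M'.Ω) : ∃ s : E3 → ℝ, ContDiff ℝ 2 s ∧ (∀ r, |s r| ≤ 1) ∧
    ∀ x ∈ closure M.T, s (M.ψ₀ x) * s (M.ψ₀ x) = 1 ∧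
      s =ᶠ[𝓝 (M.ψ₀ x)] fun _ => ⟪M.ν x, M'.ν (M.trans M' x)⟫ := by
  have hs := M.closure_subset_baseDomain
  set k : E2 → ℝ := fun x => ⟪M.ν x, M'.ν (M.trans M' x)⟫ with hk
  have ck : ContinuousOn k (closure M.T) := (M.continuousOn_ν.mono hs).inner
    ((M'.continuousOn_ν.mono M'.closure_subset_baseDomain).comp (continuousOn_trans hΩ)
      fun x hx => (trans_mem_closure hΩ hx).1)
  have hset : ∀ a : ℝ, IsCompact (closure M.T ∩ k ⁻¹' {a}) := fun a =>
    M.isCompact_closure.of_isClosed_subset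
      (ck.preimage_isClosed_of_isClosed isClosed_closure isClosed_singleton) inter_subset_left
  -- Over `T` the cosine of the two normals is a sign, and continuity extends this to the closure.
  have hkk : ∀ x ∈ closure M.T, k x * k x = 1 := by
    have hcl : IsClosed (closure M.T ∩ (fun x => k x * k x) ⁻¹' {1}) :=
      (ck.mul ck).preimage_isClosed_of_isClosed isClosed_closure isClosed_singleton
    intro x hx
    refine (closure_minimal (fun y hy => ?_) hcl hx).2
    obtain ⟨s, h1, -, h2, -⟩ := exists_sign hΩ hy
    refine ⟨subset_closure hy, ?_⟩
    change k y * k y = 1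
    rw [hk]
    simp only [h2, h1]
  have hcl : ∀ a, IsClosed (M.ψ₀ '' (closure M.T ∩ k ⁻¹' {a})) := fun a =>
    ((hset a).image_of_continuousOn (M.continuousOn_ψ₀.mono (inter_subset_left.trans hs))).isClosed
  -- The images of `{k = 1}` and `{k = -1}` are disjoint compact sets. A cutoff that separates them
  -- gives `2 e - 1`, equal to the sign and constant near each point of the closure, so derivatives
  -- pass through it.
  obtain ⟨e, he, h0, h1, hm⟩ := exists_smooth_zero_one (hcl (-1)) (hcl 1) (by
    rw [disjoint_left]
    rintro _ ⟨x, hx, rfl⟩ ⟨y, hy, hyx⟩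
    have := M.injOn_ψ₀ (hs hy.1) (hs hx.1) hyx
    have h3 : k x = -1 := hx.2
    have h4 : k y = 1 := hy.2
    rw [this, h3] at h4
    norm_num at h4)
  have he2 : ContDiff ℝ 2 e := by exact_mod_cast contDiff_infty.1 he 2
  refine ⟨fun r => 2 * e r - 1, (contDiff_const.mul he2).sub contDiff_const, fun r => ?_,
    fun x hx => ?_⟩
  · obtain ⟨h3, h4⟩ := hm r
    rw [abs_le]; constructor <;> linarith
  · have key : (fun r => 2 * e r - 1) =ᶠ[𝓝 (M.ψ₀ x)] fun _ => k x := by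
      rcases mul_self_eq_one_iff.1 (hkk x hx) with h | h
      · have := h1.filter_mono (nhds_le_nhdsSet (mem_image_of_mem M.ψ₀ (⟨hx, h⟩ :
          x ∈ closure M.T ∩ k ⁻¹' {1})))
        filter_upwards [this] with r hr
        rw [hr, h]; norm_num
      · have := h0.filter_mono (nhds_le_nhdsSet (mem_image_of_mem M.ψ₀ (⟨hx, h⟩ :
          x ∈ closure M.T ∩ k ⁻¹' {-1})))
        filter_upwards [this] with r hr
        rw [hr, h]; norm_num
    refine ⟨?_, key⟩
    have hv : 2 * e (M.ψ₀ x) - 1 = k x := key.eq_of_nhds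
    simp only [hv]
    exact hkk x hx

end Sheet

/-! ### The length measure of the boundary of a surface -/

namespace Sheet

variable (M : Sheet)

theorem measurable_lineJ : Measurable M.lineJ := M.measurable_bdTangent.norm

theorem lineJ_nonneg (x : E2) : 0 ≤ M.lineJ x := norm_nonneg _

theorem integrable_lineJ : Integrable M.lineJ M.bdMeasure := by
  obtain ⟨C, -, hC⟩ := M.exists_lineJ_le
  exact M.integrable_bd_of_bounded M.aestronglyMeasurable_lineJ fun x hx => by
    rw [abs_of_nonneg (M.lineJ_nonneg x)]; exact hC x hx

theorem integrable_bdTangent (i : Fin 3) : Integrable (fun x => M.bdTangent x i) M.bdMeasure := by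
  refine M.integrable_lineJ.mono ((EuclideanSpace.proj i : E3 →L[ℝ] ℝ).measurable.comp
    M.measurable_bdTangent).aestronglyMeasurable (Eventually.of_forall fun x => ?_)
  exact (PiLp.norm_apply_le _ i).trans (le_abs_self _)

/-- The length measure on `∂Ω`. -/
noncomputable def lineMeasure : Measure E3 := pushPos M.bdMeasure M.ψ₀ M.lineJ

instance : IsFiniteMeasure M.lineMeasure := isFiniteMeasure_pushPos M.integrable_lineJ

theorem integral_lineMeasure {η : E3 → ℝ} (hη : Measurable η) :
    ∫ r, η r ∂M.lineMeasure = ∫ x, M.lineJ x * η (M.ψ₀ x) ∂M.bdMeasure := by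
  rw [lineMeasure, integral_pushPos M.aemeasurable_ψ₀_bd M.integrable_lineJ hη]
  simp only [max_eq_left (M.lineJ_nonneg _)]

/-- Since `lineJ` is positive on the frontier, weighting by it creates no new null sets. -/
theorem ae_bd_of_ae_lineMeasure {p : E3 → Prop} (h : ∀ᵐ r ∂M.lineMeasure, p r) :
    ∀ᵐ x ∂M.bdMeasure, p (M.ψ₀ x) := by
  have h1 := ae_of_ae_map (M.aemeasurable_ψ₀_bd.mono_ac (withDensity_absolutelyContinuous _ _)) h
  rw [ae_withDensity_iff M.measurable_lineJ.ennreal_ofReal] at h1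
  filter_upwards [h1, M.ae_bdMeasure fun x hx => hx] with x hx hxf
  exact hx (ENNReal.ofReal_pos.2 (M.lineJ_pos hxf)).ne'

theorem ae_lineMeasure_of_ae_bd {s : Set E3} (hs : MeasurableSet s)
    (h : ∀ᵐ x ∂M.bdMeasure, M.ψ₀ x ∈ s) : ∀ᵐ r ∂M.lineMeasure, r ∈ s := by
  exact (ae_map_iff (M.aemeasurable_ψ₀_bd.mono_ac (withDensity_absolutelyContinuous _ _)) hs).2
    ((withDensity_absolutelyContinuous _ _).ae_le h)

/-- The unit tangent of `∂Ω`. -/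
noncomputable def unitTangent (r : E3) : E3 := unitVec (M.bdTangent (M.coord r))

theorem measurable_unitTangent : Measurable M.unitTangent := by
  have h := M.measurable_bdTangent.comp M.measurable_coord
  exact h.norm.inv.smul h

theorem abs_unitTangent_le (r : E3) (i : Fin 3) : |M.unitTangent r i| ≤ 1 :=
  (PiLp.norm_apply_le _ i).trans (norm_unitVec_le _)

theorem bdTangent_eq {x : E2} (hx : x ∈ frontier M.T) :
    M.bdTangent x = M.lineJ x • M.unitTangent (M.ψ₀ x) := by
  rw [unitTangent, M.coord_ψ₀ (M.frontier_subset_baseDomain hx), unitVec, smul_smul,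
    show ‖M.bdTangent x‖ = M.lineJ x from rfl, mul_inv_cancel₀ (M.lineJ_pos hx).ne', one_smul]

theorem norm_unitTangent {x : E2} (hx : x ∈ frontier M.T) : ‖M.unitTangent (M.ψ₀ x)‖ = 1 := by
  rw [unitTangent, M.coord_ψ₀ (M.frontier_subset_baseDomain hx),
    norm_unitVec (M.bdTangent_ne_zero hx)]

variable {M} {M' : Sheet}

/-- By Stokes' theorem both circulations are integrals over the surface. Under the change of
parameters the form is multiplied by the determinant and area by its absolute value; the factor `s`
makes up for the sign. -/
theorem tangent_test (hΩ : M.Ω = M'.Ω) {s : E3 → ℝ} (hs : ContDiff ℝ 2 s)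
    (hsM : ∀ x ∈ closure M.T, s (M.ψ₀ x) * s (M.ψ₀ x) = 1 ∧
      s =ᶠ[𝓝 (M.ψ₀ x)] fun _ => ⟪M.ν x, M'.ν (M.trans M' x)⟫) {η : E3 → ℝ} (hη : ContDiff ℝ 2 η)
    (a : E3) : ∫ x, η (M.ψ₀ x) * ⟪a, M.bdTangent x⟫ ∂M.bdMeasure =
      ∫ x, s (M'.ψ₀ x) * η (M'.ψ₀ x) * ⟪a, M'.bdTangent x⟫ ∂M'.bdMeasure := by
  rw [← M.integral_curlForm hη a, ← M'.integral_curlForm (hs.mul hη) a, integral_trans hΩ]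
  refine setIntegral_congr_fun M.isOpen_T.measurableSet fun x hx => ?_
  obtain ⟨t, ht, -, hi, hd⟩ := exists_sign hΩ hx
  have hev := (hsM x (subset_closure hx)).2
  rw [← (trans_mem_closure hΩ (subset_closure hx)).2] at hev
  have e : M'.curlForm (fun r => s r * η r) a (M.trans M' x) =
      t * M'.curlForm η a (M.trans M' x) := by
    rw [← M'.curlForm_const_mul, M'.curlForm_congr]
    filter_upwards [hev] with r hr
    rw [hr, hi]
  rw [curlForm_trans hΩ hx, e, hd, abs_mul, abs_abs]
  have ht1 : |t| = 1 := by
    rw [← sq_eq_sq₀ (abs_nonneg t) zero_le_one, sq_abs]; linarith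
  rw [ht1]
  ring

theorem tangent_measurable {s : E3 → ℝ} (hs : Measurable s) (hs1 : ∀ r, |s r| ≤ 1)
    (h : ∀ η, IsTestFunction η → ∀ a, ∫ x, η (M.ψ₀ x) * ⟪a, M.bdTangent x⟫ ∂M.bdMeasure =
      ∫ x, s (M'.ψ₀ x) * η (M'.ψ₀ x) * ⟪a, M'.bdTangent x⟫ ∂M'.bdMeasure)
    {η : E3 → ℝ} (hη : Measurable η) {C : ℝ} (hC : ∀ r, |η r| ≤ C) (i : Fin 3) :
    ∫ x, M.bdTangent x i * η (M.ψ₀ x) ∂M.bdMeasure =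
      ∫ x, M'.bdTangent x i * (s (M'.ψ₀ x) * η (M'.ψ₀ x)) ∂M'.bdMeasure := by
  have i2 : Integrable (fun x => M'.bdTangent x i * s (M'.ψ₀ x)) M'.bdMeasure :=
    (M'.integrable_bdTangent i).mul_bdd (c := 1)
      (hs.comp_aemeasurable M'.aemeasurable_ψ₀_bd).aestronglyMeasurable
      (Eventually.of_forall fun x => hs1 _)
  have hin : ∀ v : E3, ⟪ax i, v⟫ = v i := fun v => by simp [ax, EuclideanSpace.inner_single_left]
  have := integral_eq_of_test_map M.aemeasurable_ψ₀_bd (M.integrable_bdTangent i)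
    M'.aemeasurable_ψ₀_bd i2 isOpen_univ (fun φ hφ _ => by
      have := h φ hφ (ax i)
      simp only [hin] at this
      calc _ = _ := integral_congr_ae (Eventually.of_forall fun x => mul_comm _ _)
        _ = _ := this
        _ = _ := integral_congr_ae (Eventually.of_forall fun x => by simp only; ring))
    hη hC (fun r hr => absurd (mem_univ r) hr)
  rw [this]
  simp only [mul_assoc]

/-- One of the two inequalities between the length measures of two parametrizations. -/
theorem integral_lineMeasure_le {s : E3 → ℝ} (hs : Measurable s) (hs1 : ∀ r, |s r| ≤ 1)
    (h : ∀ η : E3 → ℝ, Measurable η → ∀ C : ℝ, (∀ r, |η r| ≤ C) → ∀ i : Fin 3,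
      ∫ x, M.bdTangent x i * η (M.ψ₀ x) ∂M.bdMeasure =
        ∫ x, M'.bdTangent x i * (s (M'.ψ₀ x) * η (M'.ψ₀ x)) ∂M'.bdMeasure)
    {η : E3 → ℝ} (hη : Measurable η) {C : ℝ} (hC : ∀ r, |η r| ≤ C) (h0 : ∀ r, 0 ≤ η r) :
    ∫ r, η r ∂M.lineMeasure ≤ ∫ r, η r ∂M'.lineMeasure := by
  have mi : ∀ i, Measurable fun r => M.unitTangent r i := fun i =>
    (EuclideanSpace.proj i : E3 →L[ℝ] ℝ).measurable.comp M.measurable_unitTangent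
  have mη : ∀ i, Measurable fun r => M.unitTangent r i * η r := fun i => (mi i).mul hη
  have bη : ∀ i r, |M.unitTangent r i * η r| ≤ 1 * C := fun i r => by
    rw [abs_mul]
    exact mul_le_mul (M.abs_unitTangent_le r i) (hC r) (abs_nonneg _) zero_le_one
  have i1 : ∀ i, Integrable (fun x => M.bdTangent x i * (M.unitTangent (M.ψ₀ x) i * η (M.ψ₀ x)))
      M.bdMeasure := fun i => (M.integrable_bdTangent i).mul_bdd (c := 1 * C)
    ((mη i).comp_aemeasurable M.aemeasurable_ψ₀_bd).aestronglyMeasurable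
    (Eventually.of_forall fun x => bη i _)
  have i2 : ∀ i, Integrable (fun x => M'.bdTangent x i *
      (s (M'.ψ₀ x) * (M.unitTangent (M'.ψ₀ x) i * η (M'.ψ₀ x)))) M'.bdMeasure := fun i =>
    (M'.integrable_bdTangent i).mul_bdd (c := 1 * (1 * C))
      ((hs.mul (mη i)).comp_aemeasurable M'.aemeasurable_ψ₀_bd).aestronglyMeasurable
      (Eventually.of_forall fun x => by
        rw [norm_mul]
        exact mul_le_mul (hs1 _) (bη i _) (norm_nonneg _) zero_le_one)
  -- The vector measure of tangent times length is tested with its own unit tangent, which recovers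
  -- the length. Expressed through `M'`, the same pairing is bounded by the length of `M'`, by the
  -- Cauchy–Schwarz inequality.
  have e1 : ∫ r, η r ∂M.lineMeasure =
      ∑ i, ∫ x, M.bdTangent x i * (M.unitTangent (M.ψ₀ x) i * η (M.ψ₀ x)) ∂M.bdMeasure := by
    rw [M.integral_lineMeasure hη, ← integral_finsetSum _ fun i _ => i1 i]
    refine integral_congr_ae (M.ae_bdMeasure fun x hx => ?_)
    simp only
    rw [M.bdTangent_eq hx, Fin.sum_univ_three]
    have hu : ⟪M.unitTangent (M.ψ₀ x), M.unitTangent (M.ψ₀ x)⟫ = 1 := by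
      rw [real_inner_self_eq_norm_sq, M.norm_unitTangent hx]; norm_num
    rw [inner_E3] at hu
    simp only [PiLp.smul_apply, smul_eq_mul]
    linear_combination (-(M.lineJ x * η (M.ψ₀ x))) * hu
  rw [e1, M'.integral_lineMeasure hη]
  simp only [h _ (mη _) _ (bη _)]
  rw [← integral_finsetSum _ fun i _ => i2 i]
  refine integral_mono_ae (integrable_finsetSum _ fun i _ => i2 i)
    (M'.integrable_lineJ.mul_bdd (c := C)
      (hη.comp_aemeasurable M'.aemeasurable_ψ₀_bd).aestronglyMeasurable
      (Eventually.of_forall fun x => hC _)) (M'.ae_bdMeasure fun x hx => ?_)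
  simp only
  have hle : ∑ i, M'.bdTangent x i * (s (M'.ψ₀ x) * (M.unitTangent (M'.ψ₀ x) i * η (M'.ψ₀ x))) =
      s (M'.ψ₀ x) * ⟪M'.bdTangent x, M.unitTangent (M'.ψ₀ x)⟫ * η (M'.ψ₀ x) := by
    rw [inner_E3, Fin.sum_univ_three]; ring
  rw [hle]
  refine mul_le_mul_of_nonneg_right ((le_abs_self _).trans ?_) (h0 _)
  rw [abs_mul]
  have h2 : |⟪M'.bdTangent x, M.unitTangent (M'.ψ₀ x)⟫| ≤ M'.lineJ x * 1 :=
    (abs_real_inner_le_norm _ _).trans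
      (mul_le_mul_of_nonneg_left (norm_unitVec_le _) (norm_nonneg _))
  calc _ ≤ 1 * (M'.lineJ x * 1) := mul_le_mul (hs1 _) h2 (abs_nonneg _) zero_le_one
    _ = _ := by ring

/-- The length measure of `∂Ω` does not depend on the parametrization of `Ω`. -/
theorem lineMeasure_eq (hΩ : M.Ω = M'.Ω) : M.lineMeasure = M'.lineMeasure := by
  obtain ⟨s, hs, hs1, hsM⟩ := exists_orientation hΩ
  have ms := hs.continuous.measurable
  have h1 : ∀ η : E3 → ℝ, Measurable η → ∀ C : ℝ, (∀ r, |η r| ≤ C) → ∀ i : Fin 3,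
      ∫ x, M.bdTangent x i * η (M.ψ₀ x) ∂M.bdMeasure =
        ∫ x, M'.bdTangent x i * (s (M'.ψ₀ x) * η (M'.ψ₀ x)) ∂M'.bdMeasure :=
    fun η hη C hC i => tangent_measurable ms hs1
      (fun φ hφ a => tangent_test hΩ hs hsM hφ.contDiff_two a) hη hC i
  have hss : ∀ x ∈ frontier M'.T, s (M'.ψ₀ x) * s (M'.ψ₀ x) = 1 := fun x hx => by
    have h2 := trans_mem_closure hΩ.symm (frontier_subset_closure hx)
    rw [← h2.2]
    exact (hsM _ h2.1).1
  -- Because `s² = 1` on the boundary, the relation can be inverted with the same `s`, and both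
  -- inequalities between the length measures follow.
  have h2 : ∀ η : E3 → ℝ, Measurable η → ∀ C : ℝ, (∀ r, |η r| ≤ C) → ∀ i : Fin 3,
      ∫ x, M'.bdTangent x i * η (M'.ψ₀ x) ∂M'.bdMeasure =
        ∫ x, M.bdTangent x i * (s (M.ψ₀ x) * η (M.ψ₀ x)) ∂M.bdMeasure := by
    intro η hη C hC i
    rw [h1 (fun r => s r * η r) (ms.mul hη) (1 * C) (fun r => by
      rw [abs_mul]; exact mul_le_mul (hs1 r) (hC r) (abs_nonneg _) zero_le_one) i]
    refine integral_congr_ae (M'.ae_bdMeasure fun x hx => ?_)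
    simp only
    linear_combination (-(M'.bdTangent x i * η (M'.ψ₀ x))) * hss x hx
  refine Measure.ext fun A hA => ?_
  have mA : Measurable (A.indicator fun _ => (1 : ℝ)) := measurable_const.indicator hA
  have n0 : ∀ r, 0 ≤ A.indicator (fun _ => (1 : ℝ)) r := fun r =>
    indicator_nonneg (fun _ _ => zero_le_one) r
  have bA : ∀ r, |A.indicator (fun _ => (1 : ℝ)) r| ≤ 1 := fun r => by
    rw [abs_of_nonneg (n0 r)]
    exact indicator_le_self' (fun _ _ => zero_le_one) r |>.trans le_rfl
  have e := le_antisymm (integral_lineMeasure_le ms hs1 h1 mA bA n0)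
    (integral_lineMeasure_le ms hs1 h2 mA bA n0)
  rw [integral_indicator_const _ hA, integral_indicator_const _ hA, smul_eq_mul, smul_eq_mul,
    mul_one, mul_one] at e
  exact (measureReal_eq_measureReal_iff).1 e

/-- The boundary densities are determined by the boundary distribution. -/
theorem ae_eq_of_lineIntegral_eq (hΩ : M.Ω = M'.Ω) {β β' : E2 → ℝ}
    (hβ : Integrable (fun x => β x * M.lineJ x) M.bdMeasure)
    (hβ' : Integrable (fun x => β' x * M'.lineJ x) M'.bdMeasure)
    (h : ∀ φ, IsTestFunction φ → ∫ x, β x * M.lineJ x * φ (M.ψ₀ x) ∂M.bdMeasure =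
      ∫ x, β' x * M'.lineJ x * φ (M'.ψ₀ x) ∂M'.bdMeasure) :
    ∀ᵐ x ∂M.bdMeasure, β x = β' (M.trans M' x) := by
  -- The densities are determined only up to null sets. A measurable representative in the chart is
  -- carried to space by `coord`, so that both sides can be written as integrals against one length
  -- measure.
  have key : ∀ (N : Sheet) (u : E2 → ℝ), Integrable (fun x => u x * N.lineJ x) N.bdMeasure →
      ∃ b : E3 → ℝ, Measurable b ∧ ∀ᵐ x ∂N.bdMeasure, b (N.ψ₀ x) = u x := by
    intro N u hu
    set G := hu.aestronglyMeasurable.mk _ with hG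
    have mG : Measurable G := hu.aestronglyMeasurable.stronglyMeasurable_mk.measurable
    refine ⟨fun r => G (N.coord r) / N.lineJ (N.coord r),
      (mG.div N.measurable_lineJ).comp N.measurable_coord, ?_⟩
    filter_upwards [hu.aestronglyMeasurable.ae_eq_mk, N.ae_bdMeasure fun x hx => hx] with x hx hxf
    rw [N.coord_ψ₀ (N.frontier_subset_baseDomain hxf), hG, ← hx,
      mul_div_cancel_right₀ _ (N.lineJ_pos hxf).ne']
  obtain ⟨b, mb, hb⟩ := key M β hβ
  obtain ⟨b', mb', hb'⟩ := key M' β' hβ'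
  have heq : ∀ {η : E3 → ℝ}, Measurable η → ∀ {C : ℝ}, (∀ r, |η r| ≤ C) →
      ∫ r, b r * η r ∂M.lineMeasure = ∫ r, b' r * η r ∂M.lineMeasure := by
    intro η hη C hC
    have e := integral_eq_of_test_map M.aemeasurable_ψ₀_bd hβ M'.aemeasurable_ψ₀_bd hβ' isOpen_univ
      (fun φ hφ _ => h φ hφ) hη hC (fun r hr => absurd (mem_univ r) hr)
    have mbη : Measurable fun r => b r * η r := mb.mul hη
    have mbη' : Measurable fun r => b' r * η r := mb'.mul hη
    rw [M.integral_lineMeasure mbη, lineMeasure_eq hΩ, M'.integral_lineMeasure mbη']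
    calc _ = _ := integral_congr_ae (by
          filter_upwards [hb] with x hx
          rw [hx, ← mul_assoc, mul_comm (M.lineJ x)])
      _ = _ := e
      _ = _ := integral_congr_ae (by
          filter_upwards [hb'] with x hx
          rw [hx, ← mul_assoc, mul_comm (M'.lineJ x)])
  have hbb : ∀ᵐ r ∂M.lineMeasure, b r = b' r := by
    -- The densities need not be bounded, so their difference is used as a test function only where
    -- both are at most `N`.
    have hN : ∀ N : ℕ, ∀ᵐ r ∂M.lineMeasure, |b r| ≤ N → |b' r| ≤ N → b r = b' r := by
      intro N
      set A : Set E3 := {r | |b r| ≤ N} ∩ {r | |b' r| ≤ N} with hA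
      have mA : MeasurableSet A := (measurableSet_le mb.abs measurable_const).inter
        (measurableSet_le mb'.abs measurable_const)
      set η := A.indicator fun r => b r - b' r with hη
      have mη : Measurable η := (mb.sub mb').indicator mA
      have bη : ∀ r, |η r| ≤ 2 * N := fun r => by
        by_cases hr : r ∈ A
        · rw [hη, indicator_of_mem hr]
          have h1 := abs_sub (b r) (b' r)
          have h2 : |b r| ≤ N := hr.1
          have h3 : |b' r| ≤ N := hr.2
          linarith
        · rw [hη, indicator_of_notMem hr, abs_zero]; positivity
      have bnd : ∀ {u : E3 → ℝ}, Measurable u → (∀ r ∈ A, |u r| ≤ N) →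
          Integrable (fun r => u r * η r) M.lineMeasure := by
        intro u hu hub
        refine Integrable.of_bound (hu.mul mη).aestronglyMeasurable (N * (2 * N))
          (Eventually.of_forall fun r => ?_)
        by_cases hr : r ∈ A
        · rw [norm_mul]
          exact mul_le_mul (hub r hr) (bη r) (norm_nonneg _) (by positivity)
        · rw [hη, indicator_of_notMem hr, mul_zero, norm_zero]; positivity
      have i1 := bnd mb fun r hr => hr.1
      have i2 := bnd mb' fun r hr => hr.2
      have e := heq mη bη
      rw [← sub_eq_zero, ← integral_sub i1 i2] at e
      have hval : ∀ r, b r * η r - b' r * η r = η r ^ 2 := fun r => by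
        by_cases hr : r ∈ A
        · rw [hη, indicator_of_mem hr]; ring
        · rw [hη, indicator_of_notMem hr]; ring
      have h0 := (integral_eq_zero_iff_of_nonneg (fun r => by
        change (0 : ℝ) ≤ b r * η r - b' r * η r
        rw [hval]; positivity) (i1.sub i2)).1 e
      filter_upwards [h0] with r hr h1 h2
      have hr' : b r * η r - b' r * η r = 0 := hr
      rw [hval] at hr'
      have := pow_eq_zero_iff (two_ne_zero) |>.1 hr'
      have hrA : r ∈ A := ⟨h1, h2⟩
      rw [hη, indicator_of_mem hrA] at this
      exact sub_eq_zero.1 this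
    filter_upwards [ae_all_iff.2 hN] with r hr
    obtain ⟨N, hN⟩ := exists_nat_ge (max |b r| |b' r|)
    exact hr N ((le_max_left _ _).trans hN) ((le_max_right _ _).trans hN)
  -- The set where the representative fails is enlarged to a measurable null set. It can then be
  -- described in space and transferred to the chart of `M` by equality of the length measures.
  set Z := toMeasurable M'.bdMeasure {x | ¬ b' (M'.ψ₀ x) = β' x} with hZ
  have hZ0 : M'.bdMeasure Z = 0 := by rw [hZ, measure_toMeasurable]; exact hb'
  have mZ : MeasurableSet (M'.coord ⁻¹' Zᶜ) :=
    M'.measurable_coord (measurableSet_toMeasurable _ _).compl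
  have hZ' : ∀ᵐ r ∂M.lineMeasure, r ∈ M'.coord ⁻¹' Zᶜ := by
    rw [lineMeasure_eq hΩ]
    refine M'.ae_lineMeasure_of_ae_bd mZ ?_
    filter_upwards [measure_eq_zero_iff_ae_notMem.1 hZ0, M'.ae_bdMeasure fun x hx => hx] with x hx hxf
    rw [mem_preimage, M'.coord_ψ₀ (M'.frontier_subset_baseDomain hxf)]
    exact hx
  filter_upwards [hb, M.ae_bd_of_ae_lineMeasure hbb, M.ae_bd_of_ae_lineMeasure hZ',
    M.ae_bdMeasure fun x hx => hx] with x h1 h2 h3 hxf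
  have h4 : b' (M'.ψ₀ (M.trans M' x)) = β' (M.trans M' x) := by
    by_contra hne
    exact h3 (subset_toMeasurable _ _ hne)
  rw [← h1, h2, ← h4, (trans_mem_closure hΩ (frontier_subset_closure hxf)).2]

end Sheet

/-- Uniqueness of the bulk and boundary sources and, on a given surface, of their densities and
of the normal polarization. -/
theorem sources_unique {α : ℝ} (S : ChargeSequence α) (c c' : Choice) (F F' : Fields)
    (hA : S.AdaptedTo c) (hA' : S.AdaptedTo c') (hH : IsHomogenized S c F)
    (hH' : IsHomogenized S c' F') :
    (∀ φ, IsTestFunction φ → bulkSource α c.sheet F φ = bulkSource α c'.sheet F' φ) ∧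
    (∀ φ, IsTestFunction φ → boundarySource α c.sheet F φ = boundarySource α c'.sheet F' φ) ∧
    (c.sheet.Ω = c'.sheet.Ω →
      (∀ x ∈ c.sheet.T, ∀ x' ∈ c'.sheet.T, c.sheet.ψ₀ x = c'.sheet.ψ₀ x' →
        bulkDensity α c.sheet F x = bulkDensity α c'.sheet F' x' ∧
        (0 < α → F.p₃ x • c.sheet.ν x = F'.p₃ x' • c'.sheet.ν x' ∧
          (c.sheet.ν x = c'.sheet.ν x' → F.p₃ x = F'.p₃ x'))) ∧
      (∀ᵐ x ∂((μH[1] : Measure E2).restrict (frontier c.sheet.T)), ∀ x' ∈ frontier c'.sheet.T,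
        c.sheet.ψ₀ x = c'.sheet.ψ₀ x' →
          boundaryDensity α c.sheet F x = boundaryDensity α c'.sheet F' x')) := by
  have hsrc : ∀ φ : E3 → ℝ, ContDiff ℝ 2 φ →
      bulkSource α c.sheet F φ + boundarySource α c.sheet F φ =
      bulkSource α c'.sheet F' φ + boundarySource α c'.sheet F' φ :=
    fun φ hφ => sources_eq hA hH hA' hH' hφ
  have hbd := fun φ hφ => boundarySource_eq (φ := φ) hsrc hφ
  refine ⟨fun φ hφ => bulkSource_eq hsrc hφ, hbd, fun hΩ => ⟨fun x hx x' hx' h => ?_, ?_⟩⟩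
  · refine ⟨bulkDensity_eq hΩ hsrc hx hx' h, fun hα => ?_⟩
    have hp := normalPolarization_eq hα.ne' hΩ hsrc hx hx' h
    refine ⟨hp, fun hν => ?_⟩
    have hb := c'.sheet.T_subset_baseDomain hx'
    rw [hν] at hp
    have hne : c'.sheet.ν x' ≠ 0 := by
      intro h0
      have := c'.sheet.norm_ν hb
      rw [h0, norm_zero] at this
      exact zero_ne_one this
    exact smul_left_injective ℝ hne hp
  · have h := Sheet.ae_eq_of_lineIntegral_eq hΩ
      (integrable_boundaryDensity α (F := F) hH.integrable_σ)
      (integrable_boundaryDensity α (F := F') hH'.integrable_σ) (fun φ hφ => by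
        have := hbd φ hφ
        rw [boundarySource, boundarySource] at this
        calc _ = _ := integral_congr_ae (Eventually.of_forall fun x => mul_right_comm _ _ _)
          _ = _ := this
          _ = _ := integral_congr_ae (Eventually.of_forall fun x => mul_right_comm _ _ _))
    filter_upwards [h] with x hx x' hx' hxx'
    rw [hx, trans_eq (c'.sheet.frontier_subset_baseDomain hx') hxx']

/-! ### Rectangles in the parameter plane -/

/-- The plane as a product of lines. -/
noncomputable def planeHomeo : ℝ × ℝ ≃ₜ E2 where
  toFun p := !₂[p.1, p.2]
  invFun x := (x 0, x 1)
  left_inv p := by simp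
  right_inv x := by ext i; fin_cases i <;> simp
  continuous_toFun := by
    refine (PiLp.continuous_toLp 2 _).comp (continuous_pi fun i => ?_)
    fin_cases i
    · exact continuous_fst
    · exact continuous_snd
  continuous_invFun := by fun_prop

theorem measurePreserving_planeHomeo : MeasurePreserving planeHomeo := by
  have h := (PiLp.volume_preserving_toLp (Fin 2)).comp (volume_preserving_finTwoArrow ℝ).symm
  have e : (planeHomeo : ℝ × ℝ → E2) = WithLp.toLp 2 ∘ MeasurableEquiv.finTwoArrow.symm := by
    funext p
    ext i
    fin_cases i <;> rfl
  rw [e]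
  exact h

theorem measurableEmbedding_planeHomeo : MeasurableEmbedding planeHomeo :=
  planeHomeo.measurableEmbedding

/-- The product of two sets of real numbers, as a subset of the plane. -/
def box (s t : Set ℝ) : Set E2 := {x | x 0 ∈ s ∧ x 1 ∈ t}

theorem preimage_box (s t : Set ℝ) : planeHomeo ⁻¹' box s t = s ×ˢ t := rfl

theorem box_eq_image (s t : Set ℝ) : box s t = planeHomeo '' (s ×ˢ t) := by
  rw [← preimage_box, planeHomeo.surjective.image_preimage]

theorem measurableSet_box {s t : Set ℝ} (hs : MeasurableSet s) (ht : MeasurableSet t) :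
    MeasurableSet (box s t) := by
  rw [box_eq_image, measurableEmbedding_planeHomeo.measurableSet_image]
  exact hs.prod ht

theorem volume_box (s t : Set ℝ) : volume (box s t) = volume s * volume t := by
  rw [← measurePreserving_planeHomeo.measure_preimage_emb measurableEmbedding_planeHomeo,
    preimage_box, Measure.volume_eq_prod, Measure.prod_prod]

theorem setIntegral_box {F : Type*} [NormedAddCommGroup F] [NormedSpace ℝ F] (s t : Set ℝ)
    (g : E2 → F) : ∫ x in box s t, g x = ∫ p in s ×ˢ t, g (planeHomeo p) := by
  rw [← measurePreserving_planeHomeo.setIntegral_preimage_emb measurableEmbedding_planeHomeo,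
    preimage_box]

theorem setIntegral_box_mul (s t : Set ℝ) (u v : ℝ → ℝ) :
    ∫ x in box s t, u (x 0) * v (x 1) = (∫ a in s, u a) * ∫ b in t, v b := by
  rw [setIntegral_box, Measure.volume_eq_prod]
  exact setIntegral_prod_mul u v s t

theorem isBounded_box {s t : Set ℝ} (hs : Bornology.IsBounded s) (ht : Bornology.IsBounded t) :
    Bornology.IsBounded (box s t) := by
  rw [box_eq_image]
  exact ((hs.prod ht).isCompact_closure.image planeHomeo.continuous).isBounded.subset
    (image_mono subset_closure)

theorem frontier_box (s t : Set ℝ) :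
    frontier (box s t) = box (closure s) (frontier t) ∪ box (frontier s) (closure t) := by
  rw [box_eq_image, ← planeHomeo.image_frontier, frontier_prod_eq, image_union, ← box_eq_image,
    ← box_eq_image]

/-- The vertical line through `(a, 0)`. -/
noncomputable def vertical (a : ℝ) (t : ℝ) : E2 := !₂[a, t]

/-- The horizontal line through `(0, b)`. -/
noncomputable def horizontal (b : ℝ) (t : ℝ) : E2 := !₂[t, b]

theorem isometry_vertical (a : ℝ) : Isometry (vertical a) := Isometry.of_dist_eq fun s t => by
  simp [vertical, EuclideanSpace.dist_eq, Real.dist_eq, Real.sqrt_sq_eq_abs]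

theorem isometry_horizontal (a : ℝ) : Isometry (horizontal a) := Isometry.of_dist_eq fun s t => by
  simp [horizontal, EuclideanSpace.dist_eq, Real.dist_eq, Real.sqrt_sq_eq_abs]

theorem hausdorff_image {e : ℝ → E2} (he : Isometry e) (s : Set ℝ) :
    (μH[1] : Measure E2) (e '' s) = volume s := by
  rw [he.hausdorffMeasure_image (Or.inl zero_le_one), hausdorffMeasure_real]

theorem setIntegral_hausdorff_image {e : ℝ → E2} (he : Isometry e) (s : Set ℝ) (g : E2 → ℝ) :
    ∫ x in e '' s, g x ∂(μH[1] : Measure E2) = ∫ t in s, g (e t) := by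
  have h1 := he.map_hausdorffMeasure (d := 1) (Or.inl zero_le_one)
  rw [hausdorffMeasure_real] at h1
  have h2 := he.isClosedEmbedding.measurableEmbedding.setIntegral_map (μ := volume) g (e '' s)
  rw [h1, preimage_image_eq _ he.injective,
    Measure.restrict_restrict_of_subset (image_subset_range e s)] at h2
  exact h2

theorem measurableSet_image_isometry {e : ℝ → E2} (he : Isometry e) {s : Set ℝ}
    (hs : MeasurableSet s) : MeasurableSet (e '' s) :=
  he.isClosedEmbedding.measurableEmbedding.measurableSet_image.2 hs

theorem inner_dir (v : E2) (i : Fin 2) : ⟪v, dir i⟫ = v i := by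
  rw [real_inner_comm]
  simp [dir, EuclideanSpace.inner_single_left]

/-- The rectangle `(r, r + 1) × (0, d)`. -/
def rect (r d : ℝ) : Set E2 := box (Ioo r (r + 1)) (Ioo 0 d)

variable {r d : ℝ}

theorem isOpen_rect : IsOpen (rect r d) :=
  ((isOpen_Ioo.preimage (by fun_prop : Continuous fun x : E2 => x 0)).inter
    (isOpen_Ioo.preimage (by fun_prop : Continuous fun x : E2 => x 1)))

theorem isBounded_rect : Bornology.IsBounded (rect r d) :=
  isBounded_box (Metric.isBounded_Ioo _ _) (Metric.isBounded_Ioo _ _)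

/-- The outer unit normal of the rectangle. -/
noncomputable def rectNormal (r : ℝ) (x : E2) : E2 :=
  if x 0 = r then -dir 0 else if x 0 = r + 1 then dir 0 else if x 1 = 0 then -dir 1 else dir 1

theorem measurable_rectNormal : Measurable (rectNormal r) := by
  have m : ∀ (i : Fin 2) (a : ℝ), MeasurableSet {x : E2 | x i = a} := fun i a =>
    (isClosed_eq (by fun_prop) continuous_const).measurableSet
  exact Measurable.ite (m 0 _) measurable_const (Measurable.ite (m 0 _) measurable_const
    (Measurable.ite (m 1 _) measurable_const measurable_const))

theorem norm_rectNormal (x : E2) : ‖rectNormal r x‖ = 1 := by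
  rw [rectNormal]
  split_ifs <;> simp [dir]

/-- The corners are given to the vertical sides. The four pieces are then disjoint and compatible
with the order of the cases in `rectNormal`. -/
theorem frontier_rect (hd : 0 < d) : frontier (rect r d) =
    (vertical r '' Icc 0 d ∪ vertical (r + 1) '' Icc 0 d) ∪
      (horizontal 0 '' Ioo r (r + 1) ∪ horizontal d '' Ioo r (r + 1)) := by
  have hr : r < r + 1 := by linarith
  rw [rect, frontier_box, closure_Ioo hr.ne, closure_Ioo hd.ne, frontier_Ioo hr, frontier_Ioo hd]
  have key : ∀ (x : E2) (a b : ℝ), x = !₂[a, b] ↔ x 0 = a ∧ x 1 = b := fun x a b => by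
    constructor
    · rintro rfl; simp
    · rintro ⟨h1, h2⟩; ext i; fin_cases i <;> simp [h1, h2]
  ext x
  simp only [box, mem_union, mem_ofPred_eq, mem_image, mem_insert_iff, mem_singleton_iff, vertical,
    horizontal, mem_Icc, mem_Ioo, eq_comm (b := x), key]
  constructor
  · rintro (⟨⟨h1, h2⟩, h3⟩ | ⟨h1, h2, h3⟩)
    · rcases h1.lt_or_eq with h1 | h1
      · rcases h2.lt_or_eq with h2 | h2
        · right
          rcases h3 with h3 | h3
          · exact Or.inl ⟨_, ⟨h1, h2⟩, rfl, h3⟩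
          · exact Or.inr ⟨_, ⟨h1, h2⟩, rfl, h3⟩
        · left; right
          exact ⟨_, ⟨by rcases h3 with h3 | h3 <;> linarith,
            by rcases h3 with h3 | h3 <;> linarith⟩, h2, rfl⟩
      · left; left
        exact ⟨_, ⟨by rcases h3 with h3 | h3 <;> linarith,
            by rcases h3 with h3 | h3 <;> linarith⟩, h1.symm, rfl⟩
    · left
      rcases h1 with h1 | h1
      · exact Or.inl ⟨_, ⟨h2, h3⟩, h1, rfl⟩
      · exact Or.inr ⟨_, ⟨h2, h3⟩, h1, rfl⟩
  · rintro ((⟨t, ⟨h1, h2⟩, h3, h4⟩ | ⟨t, ⟨h1, h2⟩, h3, h4⟩) |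
      (⟨t, ⟨h1, h2⟩, h3, h4⟩ | ⟨t, ⟨h1, h2⟩, h3, h4⟩))
    · right; exact ⟨Or.inl h3, by linarith, by linarith⟩
    · right; exact ⟨Or.inr h3, by linarith, by linarith⟩
    · left; exact ⟨⟨by linarith, by linarith⟩, Or.inl h4⟩
    · left; exact ⟨⟨by linarith, by linarith⟩, Or.inr h4⟩

theorem hausdorff_frontier_rect (hd : 0 < d) : (μH[1] : Measure E2) (frontier (rect r d)) < ⊤ := by
  rw [frontier_rect hd]
  refine measure_union_lt_top (measure_union_lt_top ?_ ?_) (measure_union_lt_top ?_ ?_) <;>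
    first
    | rw [hausdorff_image (isometry_vertical _)]; simp
    | rw [hausdorff_image (isometry_horizontal _)]; simp

theorem setIntegral_frontier_rect (hd : 0 < d) {g : E2 → ℝ}
    (hg : IntegrableOn g (frontier (rect r d)) (μH[1] : Measure E2)) :
    ∫ x in frontier (rect r d), g x ∂(μH[1] : Measure E2) =
      ((∫ t in Icc 0 d, g (vertical r t)) + ∫ t in Icc 0 d, g (vertical (r + 1) t)) +
      ((∫ t in Ioo r (r + 1), g (horizontal 0 t)) + ∫ t in Ioo r (r + 1), g (horizontal d t)) := by
  rw [frontier_rect hd] at hg ⊢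
  have h1 := hg.mono_set subset_union_left
  have h2 := hg.mono_set subset_union_right
  have mh : ∀ b, MeasurableSet (horizontal b '' Ioo r (r + 1)) := fun b =>
    measurableSet_image_isometry (isometry_horizontal b) measurableSet_Ioo
  have mv : ∀ b, MeasurableSet (vertical b '' Icc 0 d) := fun b =>
    measurableSet_image_isometry (isometry_vertical b) measurableSet_Icc
  rw [setIntegral_union _ ((mh _).union (mh _)) h1 h2,
    setIntegral_union _ (mv _) (h1.mono_set subset_union_left) (h1.mono_set subset_union_right),
    setIntegral_union _ (mh _) (h2.mono_set subset_union_left) (h2.mono_set subset_union_right)]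
  · simp only [setIntegral_hausdorff_image (isometry_vertical _),
      setIntegral_hausdorff_image (isometry_horizontal _)]
  · rw [disjoint_left]
    rintro _ ⟨s, -, rfl⟩ ⟨t, -, h⟩
    have := congrArg (fun x : E2 => x 1) h
    simp [horizontal] at this
    exact hd.ne' this
  · rw [disjoint_left]
    rintro _ ⟨s, -, rfl⟩ ⟨t, -, h⟩
    have := congrArg (fun x : E2 => x 0) h
    simp [vertical] at this
  · rw [disjoint_left]
    rintro _ (⟨s, -, rfl⟩ | ⟨s, -, rfl⟩) (⟨t, ht, h⟩ | ⟨t, ht, h⟩) <;>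
    · have := congrArg (fun x : E2 => x 0) h
      simp [vertical, horizontal] at this
      rw [this] at ht
      simp at ht

theorem integral_div2_rect (hd : 0 < d) {X : E2 → E2} (hX : ContDiff ℝ 1 X) :
    ∫ x in rect r d, div2 X x =
      (((∫ t in r..r + 1, X (horizontal d t) 1) - ∫ t in r..r + 1, X (horizontal 0 t) 1) +
        ∫ t in (0 : ℝ)..d, X (vertical (r + 1) t) 0) - ∫ t in (0 : ℝ)..d, X (vertical r t) 0 := by
  set L : ℝ × ℝ →L[ℝ] E2 := (ContinuousLinearMap.fst ℝ ℝ ℝ).smulRight (dir 0) +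
    (ContinuousLinearMap.snd ℝ ℝ ℝ).smulRight (dir 1) with hL
  have hLe : ∀ p, planeHomeo p = L p := fun p => by
    ext i
    fin_cases i <;> simp [hL, planeHomeo, dir]
  have hder : ∀ (i : Fin 2) p, HasFDerivAt (fun p => X (planeHomeo p) i)
      ((EuclideanSpace.proj i : E2 →L[ℝ] ℝ) ∘L (fderiv ℝ X (planeHomeo p) ∘L L)) p := fun i p => by
    have h1 : HasFDerivAt planeHomeo L p := by
      have : (planeHomeo : ℝ × ℝ → E2) = L := funext hLe
      rw [this]
      exact L.hasFDerivAt
    exact (EuclideanSpace.proj i : E2 →L[ℝ] ℝ).hasFDerivAt.comp p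
      ((hX.differentiable (by norm_num) _).hasFDerivAt.comp p h1)
  have hc : Continuous fun p => (fderiv ℝ X (planeHomeo p) (dir 0)) 0 +
      (fderiv ℝ X (planeHomeo p) (dir 1)) 1 := by
    have h1 : Continuous (fderiv ℝ X) := hX.continuous_fderiv (by norm_num)
    have h2 := h1.comp planeHomeo.continuous
    have h3 : ∀ v, Continuous fun p => fderiv ℝ X (planeHomeo p) v := fun v => h2.clm_apply
      continuous_const
    have h4 := h3 (dir 0)
    have h5 := h3 (dir 1)
    fun_prop
  have h0 : ∀ p, ((EuclideanSpace.proj (0 : Fin 2) : E2 →L[ℝ] ℝ) ∘L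
      (fderiv ℝ X (planeHomeo p) ∘L L)) (1, 0) + ((EuclideanSpace.proj (1 : Fin 2) : E2 →L[ℝ] ℝ) ∘L
      (fderiv ℝ X (planeHomeo p) ∘L L)) (0, 1) = (fderiv ℝ X (planeHomeo p) (dir 0)) 0 +
      (fderiv ℝ X (planeHomeo p) (dir 1)) 1 := fun p => by simp [hL]
  have hr : r ≤ r + 1 := by linarith
  have key := integral_divergence_prod_Icc_of_hasFDerivAt_of_le
    (fun p => X (planeHomeo p) 0) (fun p => X (planeHomeo p) 1) _ _ (r, 0) (r + 1, d)
    ⟨hr, hd.le⟩ (fun p _ => (hder 0 p).continuousAt.continuousWithinAt)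
    (fun p _ => (hder 1 p).continuousAt.continuousWithinAt)
    (fun p _ => hder 0 p) (fun p _ => hder 1 p) (by
      simp only [h0]
      exact hc.continuousOn.integrableOn_compact isCompact_Icc)
  simp only [h0] at key
  rw [rect, setIntegral_box]
  have hae : (Ioo r (r + 1) ×ˢ Ioo 0 d : Set (ℝ × ℝ)) =ᵐ[volume] Icc (r, 0) (r + 1, d) := by
    rw [← Icc_prod_Icc, Measure.volume_eq_prod]
    exact Measure.set_prod_ae_eq Ioo_ae_eq_Icc Ioo_ae_eq_Icc
  rw [setIntegral_congr_set hae]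
  simp only [div2, Fin.sum_univ_two]
  exact key

theorem isOuterNormal_rect (hd : 0 < d) : IsOuterNormal (rect r d) (rectNormal r) := by
  refine ⟨measurable_rectNormal, fun x _ => norm_rectNormal x, fun X hX hXc => ?_⟩
  have hfin : IsFiniteMeasure ((μH[1] : Measure E2).restrict (frontier (rect r d))) :=
    ⟨by simpa using hausdorff_frontier_rect hd⟩
  obtain ⟨C, hC⟩ := hXc.exists_bound_of_continuous hX.continuous
  have hint : IntegrableOn (fun x => ⟪X x, rectNormal r x⟫) (frontier (rect r d))
      (μH[1] : Measure E2) := by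
    refine Integrable.of_bound (hX.continuous.measurable.inner
      measurable_rectNormal).aestronglyMeasurable C (Eventually.of_forall fun x => ?_)
    refine (norm_inner_le_norm _ _).trans ?_
    rw [norm_rectNormal, mul_one]
    exact hC x
  have hr : r ≤ r + 1 := by linarith
  rw [setIntegral_frontier_rect hd hint, integral_div2_rect hd hX]
  rw [intervalIntegral.integral_of_le hr, intervalIntegral.integral_of_le hr,
    intervalIntegral.integral_of_le hd.le, intervalIntegral.integral_of_le hd.le,
    integral_Ioc_eq_integral_Ioo, integral_Ioc_eq_integral_Ioo, ← integral_Icc_eq_integral_Ioc,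
    ← integral_Icc_eq_integral_Ioc]
  have e1 : ∀ t, ⟪X (vertical r t), rectNormal r (vertical r t)⟫ = -(X (vertical r t) 0) :=
    fun t => by simp [rectNormal, vertical, inner_dir]
  have e2 : ∀ t, ⟪X (vertical (r + 1) t), rectNormal r (vertical (r + 1) t)⟫ =
      X (vertical (r + 1) t) 0 := fun t => by simp [rectNormal, vertical, inner_dir]
  have e3 : ∀ t ∈ Ioo r (r + 1), ⟪X (horizontal 0 t), rectNormal r (horizontal 0 t)⟫ =
      -(X (horizontal 0 t) 1) := fun t ht => by
    simp [rectNormal, horizontal, inner_dir, ht.1.ne', ht.2.ne]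
  have e4 : ∀ t ∈ Ioo r (r + 1), ⟪X (horizontal d t), rectNormal r (horizontal d t)⟫ =
      X (horizontal d t) 1 := fun t ht => by
    simp [rectNormal, horizontal, inner_dir, ht.1.ne', ht.2.ne, hd.ne']
  rw [setIntegral_congr_fun measurableSet_Ioo e3, setIntegral_congr_fun measurableSet_Ioo e4]
  simp only [e1, e2, integral_neg]
  ring

/-! ### Flat sheets over rectangles -/

theorem cross_liftL_dir : cross (liftL (dir 0)) (liftL (dir 1)) = dir3 := by
  ext i
  fin_cases i <;> simp [cross_apply_zero, cross_apply_one, cross_apply_two, liftL_apply, lift, dir,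
    dir3]

theorem norm_rot (v : E2) : ‖rot v‖ = ‖v‖ := by
  rw [EuclideanSpace.norm_eq, EuclideanSpace.norm_eq]
  simp [rot, Fin.sum_univ_two, add_comm]

variable {r d : ℝ}

theorem det_fderiv_translate (a X : E3) : (fderiv ℝ (fun X => X + a) X).det = 1 := by
  rw [fderiv_add_const, fderiv_fun_id]
  exact LinearMap.det_id

theorem fderiv_translate_lift (a : E3) (x : E2) :
    fderiv ℝ (fun y => lift y 0 + a) x = liftL := by
  rw [fderiv_add_const]
  exact liftL.hasFDerivAt.fderiv

theorem unitNormal_translate (a : E3) (x : E2) : unitNormal (fun X => X + a) x = dir3 := by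
  rw [unitNormal, fderiv_translate_lift, cross_liftL_dir, unitVec, norm_dir3, inv_one, one_smul]

/-- The rectangle `(0, 1) × (0, d)` in the plane `x₃ = 0` of the physical space, parametrized over
`(r, r + 1) × (0, d)`. -/
noncomputable def flatSheet (r d : ℝ) (hd : 0 < d) : Sheet where
  T := rect r d
  isOpen_T := isOpen_rect
  isBounded_T := isBounded_rect
  finite_boundary := hausdorff_frontier_rect hd
  nT := rectNormal r
  isOuterNormal := isOuterNormal_rect hd
  ψ X := X + !₂[-r, 0, 0]
  U := univ
  isOpen_U := isOpen_univ
  mem_U _ _ := mem_univ _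
  contDiffOn := by fun_prop
  injOn := (add_left_injective _).injOn
  det_ne_zero X _ := by
    rw [det_fderiv_translate]
    exact one_ne_zero
  normal_coord x _ := by
    rw [unitNormal_translate, fderiv_add_const, fderiv_fun_id]
    rfl

variable {hd : 0 < d}

theorem flatSheet_D (x : E2) : (flatSheet r d hd).D x = liftL := fderiv_translate_lift _ _

theorem flatSheet_J (X : E3) : (flatSheet r d hd).J X = 1 := by
  change |(fderiv ℝ (fun X => X + !₂[-r, 0, 0]) X).det| = 1
  rw [det_fderiv_translate, abs_one]

theorem flatSheet_J₀ (x : E2) : (flatSheet r d hd).J₀ x = 1 := by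
  rw [Sheet.J₀_eq, Sheet.normalVec, flatSheet_D, cross_liftL_dir, norm_dir3]

theorem flatSheet_lineJ (x : E2) : (flatSheet r d hd).lineJ x = 1 := by
  rw [Sheet.lineJ, Sheet.bdTangent, flatSheet_D, norm_liftL, norm_rot]
  exact norm_rectNormal x

theorem flatSheet_ψ (x : E2) (z : ℝ) :
    (flatSheet r d hd).ψ (lift x z) = !₂[x 0 - r, x 1, z] := by
  change lift x z + !₂[-r, 0, 0] = _
  ext i
  fin_cases i <;> simp [lift, sub_eq_add_neg]

theorem flatSheet_film (h : ℝ) : (flatSheet r d hd).film h =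
    {X | X 0 ∈ Ioo (0 : ℝ) 1 ∧ X 1 ∈ Ioo 0 d ∧ X 2 ∈ Ioo (-h) h} := by
  ext X
  constructor
  · rintro ⟨⟨x, z⟩, ⟨⟨hx, hx'⟩, hz⟩, rfl⟩
    simp only [flatSheet_ψ]
    refine ⟨?_, hx', hz⟩
    simp only [Matrix.cons_val_zero, mem_Ioo] at hx ⊢
    constructor <;> linarith [hx.1, hx.2]
  · rintro ⟨h0, h1, h2⟩
    refine ⟨(!₂[X 0 + r, X 1], X 2), ⟨⟨?_, ?_⟩, h2⟩, ?_⟩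
    · simp only [Matrix.cons_val_zero, mem_Ioo] at h0 ⊢
      constructor <;> linarith [h0.1, h0.2]
    · simpa using h1
    · simp only [flatSheet_ψ]
      ext i
      fin_cases i <;> simp

theorem flatSheet_Ω : (flatSheet r d hd).Ω =
    {X | X 0 ∈ Ioo (0 : ℝ) 1 ∧ X 1 ∈ Ioo 0 d ∧ X 2 = 0} := by
  ext X
  constructor
  · rintro ⟨x, ⟨hx, hx'⟩, rfl⟩
    simp only [Sheet.ψ₀, flatSheet_ψ]
    refine ⟨?_, hx', by simp⟩
    simp only [Matrix.cons_val_zero, mem_Ioo] at hx ⊢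
    constructor <;> linarith [hx.1, hx.2]
  · rintro ⟨h0, h1, h2⟩
    refine ⟨!₂[X 0 + r, X 1], ⟨?_, ?_⟩, ?_⟩
    · simp only [Matrix.cons_val_zero, mem_Ioo] at h0 ⊢
      constructor <;> linarith [h0.1, h0.2]
    · simpa using h1
    · simp only [Sheet.ψ₀, flatSheet_ψ]
      ext i
      fin_cases i <;> simp [h2]

/-! ### Choices of parallelogram lattices with square cells -/

/-- The basis `(1, 0), (t, 1)`. -/
noncomputable def shearBasis (t : ℝ) : Fin 2 → E2 := ![dir 0, !₂[t, 1]]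

theorem sum_shearBasis (t : ℝ) (n : Fin 2 → ℤ) :
    ∑ i, (n i : ℝ) • shearBasis t i = !₂[n 0 + t * n 1, (n 1 : ℝ)] := by
  rw [Fin.sum_univ_two]
  ext i
  fin_cases i <;> simp [shearBasis, dir, mul_comm]

/-- The square `[e, e + 1) × [0, 1)`. -/
def square (e : ℝ) : Set E2 := box (Ico e (e + 1)) (Ico 0 1)

/-- The second coordinate alone determines the row `n 1`; once the shift `t * n 1` of that row is
subtracted, the first coordinate determines the column. -/
theorem existsUnique_shearBasis (t e : ℝ) (x : E2) : ∃! n : Fin 2 → ℤ,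
    ∃ y ∈ square e, x = (∑ i, (n i : ℝ) • shearBasis t i) + (0 + y) := by
  have key : ∀ n : Fin 2 → ℤ, (∃ y ∈ square e, x = (∑ i, (n i : ℝ) • shearBasis t i) + (0 + y)) ↔
      ⌊x 1⌋ = n 1 ∧ ⌊x 0 - t * n 1 - e⌋ = n 0 := by
    intro n
    rw [Int.floor_eq_iff, Int.floor_eq_iff, sum_shearBasis]
    constructor
    · rintro ⟨y, ⟨⟨h0, h0'⟩, h1, h1'⟩, rfl⟩
      simp only [zero_add, PiLp.add_apply, Matrix.cons_val_zero, Matrix.cons_val_one]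
      refine ⟨⟨?_, ?_⟩, ?_, ?_⟩ <;> linarith
    · rintro ⟨⟨h1, h1'⟩, h0, h0'⟩
      refine ⟨x - !₂[n 0 + t * n 1, (n 1 : ℝ)], ⟨⟨?_, ?_⟩, ?_, ?_⟩, by simp⟩ <;>
      · simp only [PiLp.sub_apply, Matrix.cons_val_zero, Matrix.cons_val_one]
        linarith
  refine ⟨![⌊x 0 - t * ⌊x 1⌋ - e⌋, ⌊x 1⌋], (key _).2 ⟨rfl, rfl⟩, fun n hn => ?_⟩
  obtain ⟨h1, h0⟩ := (key n).1 hn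
  rw [← h1] at h0
  ext i
  fin_cases i
  · exact h0.symm
  · exact h1.symm

/-- The choice of the origin `(o, 0)`, of the basis `(1, 0), (t, 1)`, of the cell
`[e, e + 1) × [0, 1)`, and of the flat sheet over `(r, r + 1) × (0, d)`. -/
noncomputable def flatChoice (o t e r d : ℝ) (hd : 0 < d) : Choice where
  origin := !₂[o, 0]
  basis := shearBasis t
  linearIndependent := by
    rw [shearBasis, LinearIndependent.pair_iff' (by simp [dir])]
    intro a h
    have := congrArg (fun x : E2 => x 1) h
    simp [dir] at this
  sheet := flatSheet r d hd
  cell := square e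
  corner := 0
  measurableSet_cell := measurableSet_box measurableSet_Ico measurableSet_Ico
  isBounded_cell := isBounded_box (Metric.isBounded_Ico _ _) (Metric.isBounded_Ico _ _)
  tiling := existsUnique_shearBasis t e

variable {o t e l : ℝ}

theorem flatChoice_cornerAt (n : Fin 2 → ℤ) : (flatChoice o t e r d hd).cornerAt l n =
    !₂[o + l * (n 0 + t * n 1), l * n 1] := by
  change !₂[o, 0] + l • ((∑ i, (n i : ℝ) • shearBasis t i) + 0) = _
  rw [sum_shearBasis]
  ext i
  fin_cases i <;> simp

/-- Translation by the second basis vector. -/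
theorem flatChoice_idx_add (hl : 0 < l) (x : E2) (i : Fin 2) :
    (flatChoice o t e r d hd).idx l (x + l • shearBasis t i) =
      (flatChoice o t e r d hd).idx l x + Pi.single i 1 := by
  set c := flatChoice o t e r d hd
  rw [← c.mem_cellAt_iff_idx hl]
  obtain ⟨y, hy, hx⟩ := c.mem_cellAt_idx hl x
  refine ⟨y, hy, ?_⟩
  simp only at hx ⊢
  nth_rewrite 2 [← hx]
  simp only [c, flatChoice_cornerAt]
  ext j
  fin_cases i <;> fin_cases j <;> simp [shearBasis, dir] <;> ring

/-- The area of the partial cells is of the order of the lattice scale. -/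
theorem flatChoice_partialPart (hl : 0 < l) :
    volume.real ((flatChoice o t e r d hd).partialPart l) ≤
      l * (8 * (flatChoice o t e r d hd).cellRadius * (d + 1)) := by
  set c := flatChoice o t e r d hd
  set δ := l * (2 * c.cellRadius) with hδ
  have hδ0 : 0 ≤ δ := by have := c.cellRadius_pos; positivity
  have hK : IsCompact (frontier (rect r d)) :=
    (isBounded_rect.isCompact_closure).of_isClosed_subset isClosed_frontier frontier_subset_closure
  have hr : r < r + 1 := by linarith
  -- The partial cells lie in four strips of half-width `δ = 2 l · cellRadius` along the sides.
  -- Their total area is at most `4 δ (d + 1)`.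
  have hsub : c.partialPart l ⊆
      (box (Icc (r - δ) (r + δ)) (Ioo 0 d) ∪ box (Icc (r + 1 - δ) (r + 1 + δ)) (Ioo 0 d)) ∪
      (box (Ioo r (r + 1)) (Icc (0 - δ) (0 + δ)) ∪ box (Ioo r (r + 1)) (Icc (d - δ) (d + δ))) := by
    intro x hx
    have hxT : x ∈ rect r d := hx.1
    have h1 := c.partialPart_subset hl hx
    change x ∈ Metric.cthickening δ (frontier (rect r d)) at h1
    rw [hK.cthickening_eq_biUnion_closedBall hδ0] at h1
    simp only [mem_iUnion, Metric.mem_closedBall, exists_prop] at h1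
    obtain ⟨z, hz, hxz⟩ := h1
    have hb : ∀ (i : Fin 2) a, z i = a → x i ∈ Icc (a - δ) (a + δ) := fun i a ha => by
      have h2 := PiLp.norm_apply_le (x - z) i
      rw [← dist_eq_norm, PiLp.sub_apply, Real.norm_eq_abs] at h2
      have h3 := abs_le.1 (h2.trans hxz)
      rw [ha] at h3
      exact ⟨by linarith [h3.1], by linarith [h3.2]⟩
    rw [rect, frontier_box, frontier_Ioo hr, frontier_Ioo hd] at hz
    rcases hz with ⟨-, hz | hz⟩ | ⟨hz | hz, -⟩
    · exact Or.inr (Or.inl ⟨hxT.1, hb 1 _ hz⟩)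
    · exact Or.inr (Or.inr ⟨hxT.1, hb 1 _ hz⟩)
    · exact Or.inl (Or.inl ⟨hb 0 _ hz, hxT.2⟩)
    · exact Or.inl (Or.inr ⟨hb 0 _ hz, hxT.2⟩)
  have h1 := (measure_mono hsub).trans ((measure_union_le _ _).trans
    (add_le_add (measure_union_le _ _) (measure_union_le (μ := volume) _ _)))
  simp only [volume_box, Real.volume_Icc, Real.volume_Ioo] at h1
  have h2 := ENNReal.toReal_mono (by finiteness) h1
  refine h2.trans (le_of_eq ?_)
  have e1 : ∀ a : ℝ, a + δ - (a - δ) = 2 * δ := fun a => by ring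
  simp only [e1, add_sub_cancel_left, sub_zero]
  rw [← ENNReal.ofReal_mul (by positivity), ← ENNReal.ofReal_mul (by positivity),
    ← ENNReal.ofReal_add (by positivity) (by positivity),
    ← ENNReal.ofReal_add (by positivity) (by positivity),
    ← ENNReal.ofReal_add (by positivity) (by positivity), ENNReal.toReal_ofReal (by positivity), hδ]
  ring

/-! ### An oscillating charge -/

/-- The oscillation `-2π sin (2πs)`, the derivative of `cos (2πs)`. -/
noncomputable def wave (s : ℝ) : ℝ := -(2 * Real.pi) * Real.sin (2 * Real.pi * s)

/-- A smooth function vanishing for `s ≥ 1`. -/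
noncomputable def taper (s : ℝ) : ℝ := expNegInvGlue (1 - s)

/-- The distribution of the charge across the film. -/
noncomputable def thicknessProfile (z : ℝ) : ℝ := 3 / 4 * (1 - z ^ 2)

theorem contDiff_taper : ContDiff ℝ ∞ taper :=
  expNegInvGlue.contDiff.comp (contDiff_const.sub contDiff_id)

theorem continuous_taper : Continuous taper := contDiff_taper.continuous

theorem continuous_wave : Continuous wave := by unfold wave; fun_prop

theorem continuous_thicknessProfile : Continuous thicknessProfile := by
  unfold thicknessProfile; fun_prop

theorem taper_nonneg (s : ℝ) : 0 ≤ taper s := expNegInvGlue.nonneg _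

theorem taper_le_one (s : ℝ) : taper s ≤ 1 := by
  rw [taper, expNegInvGlue]
  split_ifs with h
  · exact zero_le_one
  · rw [Real.exp_le_one_iff, neg_nonpos, inv_nonneg]
    exact (not_le.1 h).le

/-- No charge lies above height one, so one and the same charge is admissible for flat sheets of any
height between `1` and `2`. -/
theorem taper_eq_zero {s : ℝ} (hs : 1 ≤ s) : taper s = 0 :=
  expNegInvGlue.zero_of_nonpos (by linarith)

theorem taper_pos {s : ℝ} (hs : s < 1) : 0 < taper s :=
  expNegInvGlue.pos_of_pos (by linarith)

theorem abs_wave_le (s : ℝ) : |wave s| ≤ 2 * Real.pi := by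
  have h := Real.abs_sin_le_one (2 * Real.pi * s)
  have hp := Real.pi_pos
  rw [wave, abs_mul, abs_neg, abs_of_pos (by positivity)]
  nlinarith

/-- The normalization lets integration across the film return the planar charge unchanged; being
even, the profile has no normal dipole moment. -/
theorem integral_thicknessProfile : ∫ z in (-1 : ℝ)..1, thicknessProfile z = 1 := by
  simp only [thicknessProfile]
  rw [intervalIntegral.integral_const_mul, intervalIntegral.integral_sub
    (continuous_const.intervalIntegrable _ _) ((continuous_pow 2).intervalIntegrable _ _)]
  simp only [integral_pow, intervalIntegral.integral_const]
  norm_num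

theorem integral_mul_thicknessProfile : ∫ z in (-1 : ℝ)..1, z * thicknessProfile z = 0 := by
  have h : ∀ z : ℝ, z * thicknessProfile z = 3 / 4 * z - 3 / 4 * z ^ 3 := fun z => by
    rw [thicknessProfile]; ring
  simp only [h]
  rw [intervalIntegral.integral_sub ((by fun_prop : Continuous _).intervalIntegrable _ _)
    ((by fun_prop : Continuous _).intervalIntegrable _ _)]
  rw [intervalIntegral.integral_const_mul, intervalIntegral.integral_const_mul, integral_id,
    integral_pow]
  norm_num

theorem hasDerivAt_cos_scaled (r l s : ℝ) :
    HasDerivAt (fun s => Real.cos (2 * Real.pi * ((s - r) / l)))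
      (-Real.sin (2 * Real.pi * ((s - r) / l)) * (2 * Real.pi / l)) s := by
  have h : HasDerivAt (fun s => 2 * Real.pi * ((s - r) / l)) (2 * Real.pi / l) s :=
    ((((hasDerivAt_id s).sub_const r).div_const l).const_mul (2 * Real.pi)).congr_deriv (by ring)
  exact (Real.hasDerivAt_cos _).comp s h

theorem hasDerivAt_sin_scaled (r l s : ℝ) :
    HasDerivAt (fun s => Real.sin (2 * Real.pi * ((s - r) / l)))
      (Real.cos (2 * Real.pi * ((s - r) / l)) * (2 * Real.pi / l)) s := by
  have h : HasDerivAt (fun s => 2 * Real.pi * ((s - r) / l)) (2 * Real.pi / l) s :=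
    ((((hasDerivAt_id s).sub_const r).div_const l).const_mul (2 * Real.pi)).congr_deriv (by ring)
  exact (Real.hasDerivAt_sin _).comp s h

theorem scaled_period {r l a : ℝ} (hl : 0 < l) :
    2 * Real.pi * ((a + l - r) / l) = 2 * Real.pi * ((a - r) / l) + 2 * Real.pi := by
  field_simp
  ring

/-- The first moment of the oscillation over a period. -/
theorem integral_mul_wave {l : ℝ} (hl : 0 < l) (r a : ℝ) :
    ∫ s in Ico a (a + l), (s - r) * wave ((s - r) / l) =
      l ^ 2 * Real.cos (2 * Real.pi * ((a - r) / l)) := by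
  have hp := Real.pi_pos.ne'
  rw [integral_Ico_eq_integral_Ioc, ← intervalIntegral.integral_of_le (by linarith)]
  -- The antiderivative comes from one integration by parts. Over a period only its non-periodic
  -- factor `s - r` changes, by `l`.
  rw [intervalIntegral.integral_eq_sub_of_hasDerivAt
    (f := fun s => l * (s - r) * Real.cos (2 * Real.pi * ((s - r) / l)) -
      l ^ 2 / (2 * Real.pi) * Real.sin (2 * Real.pi * ((s - r) / l)))]
  · rw [scaled_period hl, Real.cos_add_two_pi, Real.sin_add_two_pi]
    ring
  · intro s _
    have h1 := ((((hasDerivAt_id s).sub_const r).const_mul l).mul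
      (hasDerivAt_cos_scaled r l s)).sub
      ((hasDerivAt_sin_scaled r l s).const_mul (l ^ 2 / (2 * Real.pi)))
    refine h1.congr_deriv ?_
    rw [wave, id]
    field_simp
    ring
  · exact ((by fun_prop : Continuous fun s : ℝ => s - r).mul
      (continuous_wave.comp (by fun_prop))).intervalIntegrable _ _

/-- The second moment of the oscillation over a period. -/
theorem integral_mul_wave_mul {l : ℝ} (hl : 0 < l) (r c e : ℝ) :
    ∫ s in Ico (c + l * e) (c + l * e + l), (s - r) * wave ((s - r) / l) * (s - c) =
      l ^ 2 * ((c - r) * Real.cos (2 * Real.pi * ((c + l * e - r) / l)) +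
        l * ((2 * e + 1) * Real.cos (2 * Real.pi * ((c + l * e - r) / l)) -
          Real.sin (2 * Real.pi * ((c + l * e - r) / l)) / Real.pi)) := by
  have hp := Real.pi_pos.ne'
  rw [integral_Ico_eq_integral_Ioc, ← intervalIntegral.integral_of_le (by linarith)]
  rw [intervalIntegral.integral_eq_sub_of_hasDerivAt
    (f := fun s => l * ((s - r) * (s - c)) * Real.cos (2 * Real.pi * ((s - r) / l)) -
      l ^ 2 / (2 * Real.pi) * ((s - r) + (s - c)) * Real.sin (2 * Real.pi * ((s - r) / l)) -
      l ^ 3 / (2 * Real.pi ^ 2) * Real.cos (2 * Real.pi * ((s - r) / l)))]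
  · rw [scaled_period hl, Real.cos_add_two_pi, Real.sin_add_two_pi]
    field_simp
    ring
  · intro s _
    have h1 := (((((hasDerivAt_id s).sub_const r).mul ((hasDerivAt_id s).sub_const c)).const_mul
      l).mul (hasDerivAt_cos_scaled r l s)).sub
      (((((hasDerivAt_id s).sub_const r).add ((hasDerivAt_id s).sub_const c)).const_mul
        (l ^ 2 / (2 * Real.pi))).mul (hasDerivAt_sin_scaled r l s))
    have h2 := h1.sub ((hasDerivAt_cos_scaled r l s).const_mul (l ^ 3 / (2 * Real.pi ^ 2)))
    refine h2.congr_deriv ?_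
    rw [wave]
    simp only [id, Pi.add_apply, Pi.mul_apply]
    field_simp
    ring
  · exact (((by fun_prop : Continuous fun s : ℝ => s - r).mul
      (continuous_wave.comp (by fun_prop))).mul (by fun_prop)).intervalIntegrable _ _

/-- The oscillating charge, integrated across the film, in the chart of a flat sheet. -/
noncomputable def waveCharge (r l : ℝ) (x : E2) : ℝ :=
  (x 0 - r) * wave ((x 0 - r) / l) * taper (x 1)

theorem continuous_waveCharge (r l : ℝ) : Continuous (waveCharge r l) :=
  ((by fun_prop : Continuous fun x : E2 => x 0 - r).mul (continuous_wave.comp (by fun_prop))).mul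
    (continuous_taper.comp (by fun_prop))

theorem abs_waveCharge_le {r d : ℝ} (l : ℝ) {x : E2} (hx : x ∈ rect r d) :
    |waveCharge r l x| ≤ 2 * Real.pi := by
  have h1 : |x 0 - r| ≤ 1 := abs_le.2 ⟨by linarith [hx.1.1], by linarith [hx.1.2]⟩
  have h3 : |taper (x 1)| ≤ 1 := by
    rw [abs_of_nonneg (taper_nonneg _)]; exact taper_le_one _
  rw [waveCharge, abs_mul, abs_mul]
  calc _ ≤ 1 * (2 * Real.pi) * 1 := by
        gcongr
        exact abs_wave_le _
    _ = _ := by ring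

/-! ### Its moments over the cells -/

/-- The phase of the oscillation at the left edge of a cell. -/
noncomputable def cellAngle (o t e r l : ℝ) (n : Fin 2 → ℤ) : ℝ :=
  2 * Real.pi * ((o - r) / l + n 0 + t * n 1 + e)

variable {o t e r d l : ℝ} {hd : 0 < d}

theorem flatChoice_cellAt (hl : 0 < l) (n : Fin 2 → ℤ) : (flatChoice o t e r d hd).cellAt l n =
    box (Ico ((flatChoice o t e r d hd).cornerAt l n 0 + l * e)
      ((flatChoice o t e r d hd).cornerAt l n 0 + l * e + l))
      (Ico ((flatChoice o t e r d hd).cornerAt l n 1)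
        ((flatChoice o t e r d hd).cornerAt l n 1 + l)) := by
  set c := flatChoice o t e r d hd
  have hll : l * l⁻¹ = 1 := mul_inv_cancel₀ hl.ne'
  ext x
  rw [c.mem_cellAt_iff hl]
  change (l⁻¹ * (x 0 - c.cornerAt l n 0) ∈ Ico e (e + 1) ∧
    l⁻¹ * (x 1 - c.cornerAt l n 1) ∈ Ico (0 : ℝ) 1) ↔ (_ ∈ _ ∧ _ ∈ _)
  simp only [mem_Ico, inv_mul_eq_div, le_div_iff₀ hl, div_lt_iff₀ hl]
  constructor
  · rintro ⟨⟨h1, h2⟩, h3, h4⟩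
    refine ⟨⟨?_, ?_⟩, ?_, ?_⟩ <;> linarith
  · rintro ⟨⟨h1, h2⟩, h3, h4⟩
    refine ⟨⟨?_, ?_⟩, ?_, ?_⟩ <;> linarith

theorem cellAngle_eq (hl : 0 < l) (n : Fin 2 → ℤ) :
    2 * Real.pi * (((flatChoice o t e r d hd).cornerAt l n 0 + l * e - r) / l) =
      cellAngle o t e r l n := by
  rw [flatChoice_cornerAt, cellAngle]
  simp only [Matrix.cons_val_zero]
  field_simp
  ring

theorem setIntegral_Ico_const (a l : ℝ) (hl : 0 < l) : ∫ _ in Ico a (a + l), (1 : ℝ) = l := by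
  simp [hl.le]

/-- A pure oscillation has mean zero over a period; the linear factor `x 0 - r` leaves `l²` times
the cosine of the phase at the left edge. The right-hand integrand no longer oscillates inside the
cell, so that limits can be taken. -/
theorem cell_waveCharge (hl : 0 < l) (n : Fin 2 → ℤ) :
    ∫ x in (flatChoice o t e r d hd).cellAt l n, waveCharge r l x =
      ∫ x in (flatChoice o t e r d hd).cellAt l n,
        l * (Real.cos (cellAngle o t e r l n) * taper (x 1)) := by
  have h1 := setIntegral_box_mul (Ico ((flatChoice o t e r d hd).cornerAt l n 0 + l * e)
      ((flatChoice o t e r d hd).cornerAt l n 0 + l * e + l))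
      (Ico ((flatChoice o t e r d hd).cornerAt l n 1)
        ((flatChoice o t e r d hd).cornerAt l n 1 + l)) (fun s => (s - r) * wave ((s - r) / l))
        taper
  have h2 := setIntegral_box_mul (Ico ((flatChoice o t e r d hd).cornerAt l n 0 + l * e)
      ((flatChoice o t e r d hd).cornerAt l n 0 + l * e + l))
      (Ico ((flatChoice o t e r d hd).cornerAt l n 1)
        ((flatChoice o t e r d hd).cornerAt l n 1 + l)) (fun _ => 1) taper
  simp only [one_mul] at h2
  rw [← flatChoice_cellAt hl] at h1 h2
  rw [integral_const_mul, integral_const_mul, h2, setIntegral_Ico_const _ _ hl]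
  simp only [waveCharge]
  rw [h1, integral_mul_wave hl, cellAngle_eq hl]
  ring

theorem cell_waveCharge_zero (hl : 0 < l) (n : Fin 2 → ℤ) :
    ∫ x in (flatChoice o t e r d hd).cellAt l n,
        waveCharge r l x * (x 0 - (flatChoice o t e r d hd).cornerAt l n 0) =
      ∫ x in (flatChoice o t e r d hd).cellAt l n,
        l * ((((flatChoice o t e r d hd).cornerAt l n 0 - r) * Real.cos (cellAngle o t e r l n) +
          l * ((2 * e + 1) * Real.cos (cellAngle o t e r l n) -
            Real.sin (cellAngle o t e r l n) / Real.pi)) * taper (x 1)) := by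
  have h1 := setIntegral_box_mul (Ico ((flatChoice o t e r d hd).cornerAt l n 0 + l * e)
      ((flatChoice o t e r d hd).cornerAt l n 0 + l * e + l))
      (Ico ((flatChoice o t e r d hd).cornerAt l n 1)
        ((flatChoice o t e r d hd).cornerAt l n 1 + l)) (fun s => (s - r) * wave ((s - r) / l) *
        (s - (flatChoice o t e r d hd).cornerAt l n 0)) taper
  have h2 := setIntegral_box_mul (Ico ((flatChoice o t e r d hd).cornerAt l n 0 + l * e)
      ((flatChoice o t e r d hd).cornerAt l n 0 + l * e + l))
      (Ico ((flatChoice o t e r d hd).cornerAt l n 1)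
        ((flatChoice o t e r d hd).cornerAt l n 1 + l)) (fun _ => 1) taper
  simp only [one_mul] at h2
  rw [← flatChoice_cellAt hl] at h1 h2
  rw [integral_const_mul, integral_const_mul, h2, setIntegral_Ico_const _ _ hl]
  simp only [waveCharge, mul_right_comm _ (taper _)]
  rw [h1, integral_mul_wave_mul hl, cellAngle_eq hl]
  ring

theorem cell_waveCharge_one (hl : 0 < l) (n : Fin 2 → ℤ) :
    ∫ x in (flatChoice o t e r d hd).cellAt l n,
        waveCharge r l x * (x 1 - (flatChoice o t e r d hd).cornerAt l n 1) =
      ∫ x in (flatChoice o t e r d hd).cellAt l n, l * (Real.cos (cellAngle o t e r l n) *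
        (taper (x 1) * (x 1 - (flatChoice o t e r d hd).cornerAt l n 1))) := by
  have h1 := setIntegral_box_mul (Ico ((flatChoice o t e r d hd).cornerAt l n 0 + l * e)
      ((flatChoice o t e r d hd).cornerAt l n 0 + l * e + l))
      (Ico ((flatChoice o t e r d hd).cornerAt l n 1)
        ((flatChoice o t e r d hd).cornerAt l n 1 + l)) (fun s => (s - r) * wave ((s - r) / l))
        (fun s => taper s * (s - (flatChoice o t e r d hd).cornerAt l n 1))
  have h2 := setIntegral_box_mul (Ico ((flatChoice o t e r d hd).cornerAt l n 0 + l * e)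
      ((flatChoice o t e r d hd).cornerAt l n 0 + l * e + l))
      (Ico ((flatChoice o t e r d hd).cornerAt l n 1)
        ((flatChoice o t e r d hd).cornerAt l n 1 + l)) (fun _ => 1)
        (fun s => taper s * (s - (flatChoice o t e r d hd).cornerAt l n 1))
  simp only [one_mul] at h2
  rw [← flatChoice_cellAt hl] at h1 h2
  rw [integral_const_mul, integral_const_mul, h2, setIntegral_Ico_const _ _ hl]
  simp only [waveCharge, mul_assoc] at h1 ⊢
  rw [h1]
  have h3 := integral_mul_wave hl r ((flatChoice o t e r d hd).cornerAt l n 0 + l * e)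
  rw [h3, cellAngle_eq hl]
  ring

/-! ### The charge distributions -/

/-- The charge density in the film `(0, 1) × (0, 2) × (-h, h)`. -/
noncomputable def filmCharge (l h : ℝ) : E3 → ℝ :=
  ((flatSheet 0 2 two_pos).film h).indicator fun X =>
    X 0 * wave (X 0 / l) * taper (X 1) * thicknessProfile (X 2 / h)

theorem abs_thicknessProfile_le {z : ℝ} (hz : z ∈ Ioo (-1 : ℝ) 1) : |thicknessProfile z| ≤ 1 := by
  have : z ^ 2 ≤ 1 := by nlinarith [hz.1, hz.2]
  rw [thicknessProfile, abs_le]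
  constructor <;> nlinarith [sq_nonneg z]

theorem abs_filmCharge_le {l h : ℝ} (hh : 0 < h) (X : E3) : |filmCharge l h X| ≤ 2 * Real.pi := by
  have hp := Real.pi_pos
  rw [filmCharge]
  by_cases hX : X ∈ (flatSheet 0 2 two_pos).film h
  · rw [indicator_of_mem hX]
    rw [flatSheet_film] at hX
    obtain ⟨h0, h1, h2⟩ := hX
    have e0 : |X 0| ≤ 1 := abs_le.2 ⟨by linarith [h0.1], h0.2.le⟩
    have e1 : |taper (X 1)| ≤ 1 := by
      rw [abs_of_nonneg (taper_nonneg _)]; exact taper_le_one _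
    have e2 : |thicknessProfile (X 2 / h)| ≤ 1 := abs_thicknessProfile_le
      ⟨by rw [lt_div_iff₀ hh]; linarith [h2.1], by rw [div_lt_iff₀ hh]; linarith [h2.2]⟩
    rw [abs_mul, abs_mul, abs_mul]
    calc _ ≤ 1 * (2 * Real.pi) * 1 * 1 := by
          gcongr
          exact abs_wave_le _
      _ = _ := by ring
  · rw [indicator_of_notMem hX, abs_zero]
    positivity

theorem tendsto_scale : Tendsto (fun k : ℕ => 1 / (2 * (k : ℝ) + 1)) atTop (𝓝 0) := by
  simp only [one_div]
  refine tendsto_inv_atTop_zero.comp (tendsto_atTop_add_const_right _ _ ?_)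
  exact tendsto_natCast_atTop_atTop.const_mul_atTop two_pos

/-- Oscillating charges with the lattice scales `1 / (2k + 1)`. -/
noncomputable def flatCharge (α : ℝ) (hα : 0 ≤ α) : ChargeSequence α where
  -- With odd reciprocals a side of length one holds a whole number of periods, while a shift by `1
  -- / 2` is a whole number of periods plus one half.
  l k := 1 / (2 * (k : ℝ) + 1)
  -- The quadratic term keeps the thickness positive when `α = 0`; the ratio is `α + l` and still
  -- tends to `α`.
  h k := α * (1 / (2 * (k : ℝ) + 1)) + (1 / (2 * (k : ℝ) + 1)) ^ 2
  l_pos k := by positivity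
  h_pos k := by positivity
  l_tendsto := tendsto_scale
  h_tendsto := by simpa using (tendsto_scale.const_mul α).add (tendsto_scale.pow 2)
  ratio_tendsto := by
    have h := tendsto_scale.const_add α
    rw [add_zero] at h
    refine h.congr fun k => ?_
    have : (2 * (k : ℝ) + 1) ≠ 0 := by positivity
    field_simp
  ρ k := filmCharge (1 / (2 * (k : ℝ) + 1))
    (α * (1 / (2 * (k : ℝ) + 1)) + (1 / (2 * (k : ℝ) + 1)) ^ 2)
  bounded := ⟨2 * Real.pi, fun k r => abs_filmCharge_le (by positivity) r⟩

variable {α : ℝ} {hα : 0 ≤ α} {o t e r d : ℝ} {hd : 0 < d}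

theorem flatCharge_l (k : ℕ) : (flatCharge α hα).l k = 1 / (2 * (k : ℝ) + 1) := rfl

theorem flatCharge_ρ (k : ℕ) : (flatCharge α hα).ρ k =
    filmCharge ((flatCharge α hα).l k) ((flatCharge α hα).h k) := rfl

theorem flatCharge_l_le (k : ℕ) : (flatCharge α hα).l k ≤ 1 := by
  rw [flatCharge_l, div_le_one (by positivity)]
  have : (0 : ℝ) ≤ k := k.cast_nonneg
  linarith

theorem flatCharge_adaptedTo (h1 : 1 ≤ d) (h2 : d ≤ 2) :
    (flatCharge α hα).AdaptedTo (flatChoice o t e r d hd) := by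
  refine Eventually.of_forall fun k => ?_
  have hsub : (flatSheet r d hd).film ((flatCharge α hα).h k) ⊆
      (flatSheet 0 2 two_pos).film ((flatCharge α hα).h k) := by
    rw [flatSheet_film, flatSheet_film]
    exact fun X hX => ⟨hX.1, ⟨hX.2.1.1, hX.2.1.2.trans_le h2⟩, hX.2.2⟩
  constructor
  · have hc : Continuous fun X : E3 => X 0 * wave (X 0 / (flatCharge α hα).l k) * taper (X 1) *
        thicknessProfile (X 2 / (flatCharge α hα).h k) :=
      (((by fun_prop : Continuous fun X : E3 => X 0).mul
        (continuous_wave.comp (by fun_prop))).mul (continuous_taper.comp (by fun_prop))).mul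
        (continuous_thicknessProfile.comp (by fun_prop))
    refine hc.continuousOn.congr fun X hX => ?_
    rw [flatCharge_ρ, filmCharge, indicator_of_mem (hsub hX)]
  · intro X hX
    rw [flatCharge_ρ, filmCharge, Function.mem_support] at hX
    have hXf := mem_of_indicator_ne_zero hX
    rw [indicator_of_mem hXf] at hX
    rw [flatSheet_film] at hXf
    change X ∈ (flatSheet r d hd).film _
    rw [flatSheet_film]
    refine ⟨hXf.1, ⟨hXf.2.1.1, ?_⟩, hXf.2.2⟩
    by_contra hlt
    rw [taper_eq_zero (by linarith)] at hX
    simp at hX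

theorem flatCharge_paramCharge (h2 : d ≤ 2) (k : ℕ) {x : E2} (hx : x ∈ rect r d) {z : ℝ}
    (hz : z ∈ Ioo (-1 : ℝ) 1) :
    (flatCharge α hα).paramCharge (flatChoice o t e r d hd) k x z =
      waveCharge r ((flatCharge α hα).l k) x * thicknessProfile z := by
  have hh := (flatCharge α hα).h_pos k
  rw [ChargeSequence.paramCharge]
  change (flatCharge α hα).ρ k ((flatSheet r d hd).ψ _) * (flatSheet r d hd).J _ = _
  have hmem : (!₂[x 0 - r, x 1, (flatCharge α hα).h k * z] : E3) ∈
      (flatSheet 0 2 two_pos).film ((flatCharge α hα).h k) := by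
    rw [flatSheet_film]
    refine ⟨⟨?_, ?_⟩, ⟨hx.2.1, hx.2.2.trans_le h2⟩, ⟨?_, ?_⟩⟩
    · simpa using hx.1.1
    · have := hx.1.2
      simp only [Matrix.cons_val_zero]
      linarith
    · simp only [Matrix.cons_val]
      nlinarith [hz.1]
    · simp only [Matrix.cons_val]
      nlinarith [hz.2]
  rw [flatSheet_J, flatSheet_ψ, mul_one, flatCharge_ρ, filmCharge, indicator_of_mem hmem,
    waveCharge]
  simp only [Matrix.cons_val_zero, Matrix.cons_val_one, Matrix.cons_val]
  rw [mul_div_cancel_left₀ _ hh.ne']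

theorem flatCharge_isLayerBounded (h2 : d ≤ 2) (k : ℕ) :
    IsLayerBounded (rect r d) (2 * Real.pi)
      ((flatCharge α hα).paramCharge (flatChoice o t e r d hd) k) where
  cont := by
    have hc : Continuous fun p : E2 × ℝ =>
        waveCharge r ((flatCharge α hα).l k) p.1 * thicknessProfile p.2 :=
      ((continuous_waveCharge _ _).comp continuous_fst).mul
        (continuous_thicknessProfile.comp continuous_snd)
    exact hc.continuousOn.congr fun p hp => flatCharge_paramCharge h2 k hp.1 hp.2
  bound x hx z hz := by
    rw [flatCharge_paramCharge h2 k hx hz, abs_mul]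
    have hp := Real.pi_pos
    calc _ ≤ 2 * Real.pi * 1 := mul_le_mul (abs_waveCharge_le _ hx) (abs_thicknessProfile_le hz)
          (abs_nonneg _) (by positivity)
      _ = _ := mul_one _

theorem flatCharge_layer (h2 : d ≤ 2) (k : ℕ) {x : E2} (hx : x ∈ rect r d) :
    layer ((flatCharge α hα).paramCharge (flatChoice o t e r d hd) k) x =
      waveCharge r ((flatCharge α hα).l k) x := by
  rw [layer, setIntegral_congr_fun measurableSet_Ioo fun z hz =>
    flatCharge_paramCharge h2 k hx hz, integral_const_mul, ← intervalIntegral_eq_layer,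
    integral_thicknessProfile, mul_one]

theorem flatCharge_layer_third (h2 : d ≤ 2) (k : ℕ) {x : E2} (hx : x ∈ rect r d) :
    layer (fun x z => z * (flatCharge α hα).paramCharge (flatChoice o t e r d hd) k x z) x = 0 := by
  have h : ∀ z ∈ Ioo (-1 : ℝ) 1,
      z * (flatCharge α hα).paramCharge (flatChoice o t e r d hd) k x z =
        waveCharge r ((flatCharge α hα).l k) x * (z * thicknessProfile z) := fun z hz => by
    rw [flatCharge_paramCharge h2 k hx hz]; ring
  rw [layer, setIntegral_congr_fun measurableSet_Ioo h, integral_const_mul,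
    ← intervalIntegral_eq_layer, integral_mul_thicknessProfile, mul_zero]

/-! ### Averages of the phase -/

/-- The average of a sequence of functions over the cells of a choice is `m`. -/
def HasPhaseMean (S : ChargeSequence α) (c : Choice) (M : ℕ → (Fin 2 → ℤ) → ℝ) (m : ℝ) : Prop :=
  (∀ k n, |M k n| ≤ 1) ∧ ∀ g : E2 → ℝ, Continuous g →
    Tendsto (fun k => ∫ x in c.sheet.T, g x * M k (c.idx (S.l k) x)) atTop
      (𝓝 (m * ∫ x in c.sheet.T, g x))

variable {S : ChargeSequence α} {c : Choice} {M : ℕ → (Fin 2 → ℤ) → ℝ} {m : ℝ}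

theorem continuous_integrableOn_T {g : E2 → ℝ} (hg : Continuous g) : IntegrableOn g c.sheet.T :=
  (hg.continuousOn.integrableOn_compact c.sheet.isCompact_closure).mono_set subset_closure

/-- Averages of convergent functions over the full cells. -/
theorem HasPhaseMean.tendsto_fullPart (hM : HasPhaseMean S c M m) {f : ℕ → E2 → ℝ} {g : E2 → ℝ}
    (hf : ∀ k, Measurable (f k)) {K : ℝ} (hK : ∀ k, ∀ x ∈ c.sheet.T, |f k x| ≤ K)
    (hg : Continuous g) (hlim : ∀ x ∈ c.sheet.T, Tendsto (fun k => f k x) atTop (𝓝 (g x))) :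
    Tendsto (fun k => ∫ x in c.fullPart (S.l k), f k x * M k (c.idx (S.l k) x)) atTop
      (𝓝 (m * ∫ x in c.sheet.T, g x)) := by
  have hTv : volume c.sheet.T < ⊤ := c.sheet.isBounded_T.measure_lt_top
  have hTm : MeasurableSet c.sheet.T := c.sheet.isOpen_T.measurableSet
  have hfin : IsFiniteMeasure (volume.restrict c.sheet.T) := ⟨by simpa using hTv⟩
  have mM : ∀ k, Measurable fun x => M k (c.idx (S.l k) x) := fun k =>
    (measurable_of_countable (M k)).comp (c.measurable_idx (S.l_pos k))
  have bM : ∀ k, ∀ x ∈ c.sheet.T, ‖f k x * M k (c.idx (S.l k) x)‖ ≤ K := fun k x hx => by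
    rw [norm_mul]
    calc _ ≤ K * 1 := mul_le_mul (hK k x hx) (hM.1 _ _) (abs_nonneg _)
          ((abs_nonneg _).trans (hK k x hx))
      _ = K := mul_one K
  have i1 : ∀ k, IntegrableOn (fun x => f k x * M k (c.idx (S.l k) x)) c.sheet.T := fun k =>
    Integrable.of_bound ((hf k).mul (mM k)).aestronglyMeasurable K
      ((ae_restrict_mem hTm).mono fun x hx => bM k x hx)
  have ig := continuous_integrableOn_T (c := c) hg
  have i2 : ∀ k, IntegrableOn (fun x => g x * M k (c.idx (S.l k) x)) c.sheet.T := fun k =>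
    ig.mul_bdd (c := 1) (mM k).aestronglyMeasurable (Eventually.of_forall fun x => hM.1 _ _)
  -- The partial part contributes nothing in the limit because its area vanishes, and replacing `f
  -- k` by `g` is a dominated error. The hypothesis on the phase is then needed only for the fixed
  -- function `g`.
  have h1 : Tendsto (fun k => ∫ x in c.partialPart (S.l k), f k x * M k (c.idx (S.l k) x)) atTop
      (𝓝 0) := by
    have h := (c.tendsto_volume_partialPart S.l_pos S.l_tendsto).const_mul K
    rw [mul_zero] at h
    refine squeeze_zero_norm (fun k => ?_) h
    exact norm_setIntegral_le_of_norm_le_const ((measure_mono sdiff_subset).trans_lt hTv)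
      fun x hx => bM k x hx.1
  have h2 : Tendsto (fun k => ∫ x in c.sheet.T, (f k x * M k (c.idx (S.l k) x) -
      g x * M k (c.idx (S.l k) x))) atTop (𝓝 0) := by
    rw [← integral_zero E2 ℝ (μ := volume.restrict c.sheet.T)]
    refine tendsto_integral_of_dominated_convergence (fun x => K + |g x|)
      (fun k => ((i1 k).sub (i2 k)).aestronglyMeasurable) ((integrable_const K).add ig.abs)
      (fun k => (ae_restrict_mem hTm).mono fun x hx => ?_)
      ((ae_restrict_mem hTm).mono fun x hx => ?_)
    · refine (norm_sub_le _ _).trans (add_le_add (bM k x hx) ?_)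
      rw [norm_mul]
      exact (mul_le_mul_of_nonneg_left (hM.1 _ _) (norm_nonneg _)).trans (mul_one _).le
    · have h3 := ((hlim x hx).sub_const (g x)).norm
      rw [sub_self, norm_zero] at h3
      refine squeeze_zero_norm (fun k => ?_) h3
      rw [← sub_mul, norm_mul]
      exact (mul_le_mul_of_nonneg_left (hM.1 _ _) (norm_nonneg _)).trans (mul_one _).le
  have h3 := (h2.add (hM.2 g hg)).sub h1
  rw [zero_add, sub_zero] at h3
  refine h3.congr fun k => ?_
  have hs := setIntegral_sdiff (c.measurableSet_fullPart (S.l_pos k)) (i1 k)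
    (c.fullPart_subset (S.l_pos k)) (μ := volume)
  have hp : c.partialPart (S.l k) = c.sheet.T \ c.fullPart (S.l k) := rfl
  rw [integral_sub (i1 k) (i2 k), hp, hs]
  ring

theorem tendsto_cornerOf (x : E2) : Tendsto (fun k => c.cornerOf (S.l k) x) atTop (𝓝 x) := by
  rw [tendsto_iff_norm_sub_tendsto_zero]
  have h := S.l_tendsto.mul_const c.cellRadius
  rw [zero_mul] at h
  refine squeeze_zero (fun _ => norm_nonneg _) (fun k => ?_) h
  rw [norm_sub_rev]
  exact c.norm_sub_cornerOf_le (S.l_pos k) x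

/-- A constant phase. -/
theorem hasPhaseMean_const (hm : |m| ≤ 1) (hM : ∀ k n, M k n = m) : HasPhaseMean S c M m := by
  refine ⟨fun k n => by rw [hM]; exact hm, fun g _ => ?_⟩
  simp only [hM, mul_comm _ m, integral_const_mul]
  exact tendsto_const_nhds

/-- A phase alternating along a lattice direction has average zero. -/
theorem hasPhaseMean_zero {b : E2} {i : Fin 2} (h1 : ∀ k n, |M k n| ≤ 1)
    (hb : ∀ k x, c.idx (S.l k) (x + S.l k • b) = c.idx (S.l k) x + Pi.single i 1)
    (hM : ∀ k n, M k (n + Pi.single i 1) = -M k n) : HasPhaseMean S c M 0 := by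
  refine ⟨h1, fun g hg => ?_⟩
  rw [zero_mul]
  have hTm : MeasurableSet c.sheet.T := c.sheet.isOpen_T.measurableSet
  set G := c.sheet.T.indicator g with hG
  have iG : Integrable G := (integrable_indicator_iff hTm).2 (continuous_integrableOn_T hg)
  have mM : ∀ k, Measurable fun x => M k (c.idx (S.l k) x) := fun k =>
    (measurable_of_countable (M k)).comp (c.measurable_idx (S.l_pos k))
  have iGM : ∀ k v, Integrable fun x => G (x + v) * M k (c.idx (S.l k) x) := fun k v =>
    (iG.comp_add_right v).mul_bdd (c := 1) (mM k).aestronglyMeasurable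
      (Eventually.of_forall fun x => h1 _ _)
  have e1 : ∀ k, ∫ x in c.sheet.T, g x * M k (c.idx (S.l k) x) =
      ∫ x, G x * M k (c.idx (S.l k) x) := fun k => by
    rw [← integral_indicator hTm]
    congr 1 with x
    by_cases hx : x ∈ c.sheet.T
    · rw [hG, indicator_of_mem hx, indicator_of_mem hx]
    · rw [hG, indicator_of_notMem hx, indicator_of_notMem hx, zero_mul]
  -- A step `S.l k • b` reverses the sign of the phase, so the integral is half of the one with `G`
  -- minus its translate. That difference tends to zero wherever `G` is continuous, in particular
  -- off the frontier of `T`, a null set.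
  have e2 : ∀ k, ∫ x, G x * M k (c.idx (S.l k) x) =
      (1 / 2) * ∫ x, (G x - G (x + S.l k • b)) * M k (c.idx (S.l k) x) := fun k => by
    have h := integral_add_right_eq_self (μ := volume)
      (fun x => G x * M k (c.idx (S.l k) x)) (S.l k • b)
    simp only [hb, hM, mul_neg, integral_neg] at h
    simp only [sub_mul]
    have i0 := iGM k 0
    simp only [add_zero] at i0
    rw [integral_sub i0 (iGM k _)]
    linarith
  obtain ⟨K, hK⟩ := c.sheet.isCompact_closure.exists_bound_of_continuousOn hg.continuousOn
  have hK0 : ∀ x, ‖G x‖ ≤ |K| := fun x => by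
    by_cases hx : x ∈ c.sheet.T
    · rw [hG, indicator_of_mem hx]
      exact (hK x (subset_closure hx)).trans (le_abs_self K)
    · rw [hG, indicator_of_notMem hx, norm_zero]; positivity
  obtain ⟨B, hB⟩ := c.sheet.isBounded_T.exists_norm_le
  obtain ⟨L, hL⟩ := S.l_tendsto.bddAbove_range
  set R := |B| + |L| * ‖b‖ with hR
  have hvan : ∀ k x, R < ‖x‖ → G x - G (x + S.l k • b) = 0 := fun k x hx => by
    have hL1 : S.l k ≤ |L| := (hL (mem_range_self k)).trans (le_abs_self L)
    have hsm : ‖S.l k • b‖ ≤ |L| * ‖b‖ := by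
      rw [norm_smul, Real.norm_of_nonneg (S.l_pos k).le]
      gcongr
    have hb0 : (0 : ℝ) ≤ |L| * ‖b‖ := by positivity
    have n1 : x ∉ c.sheet.T := fun h => by
      have := hB x h
      linarith [le_abs_self B]
    have n2 : x + S.l k • b ∉ c.sheet.T := fun h => by
      have h3 := hB _ h
      have h4 := norm_sub_le (x + S.l k • b) (S.l k • b)
      rw [add_sub_cancel_right] at h4
      linarith [le_abs_self B]
    rw [hG, indicator_of_notMem n1, indicator_of_notMem n2, sub_zero]
  have h0 : Tendsto (fun k => ∫ x, (G x - G (x + S.l k • b)) * M k (c.idx (S.l k) x)) atTop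
      (𝓝 0) := by
    rw [← integral_zero E2 ℝ (μ := volume)]
    refine tendsto_integral_of_dominated_convergence
      ((Metric.closedBall (0 : E2) R).indicator fun _ => |K| + |K|)
      (fun k => ?_) ?_ (fun k => Eventually.of_forall fun x => ?_) ?_
    · exact (iG.sub (iG.comp_add_right _)).aestronglyMeasurable.mul (mM k).aestronglyMeasurable
    · exact (integrable_indicator_iff Metric.isClosed_closedBall.measurableSet).2
        (integrableOn_const (measure_closedBall_lt_top).ne)
    · by_cases hx : x ∈ Metric.closedBall (0 : E2) R
      · rw [indicator_of_mem hx, norm_mul]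
        calc _ ≤ (|K| + |K|) * 1 := mul_le_mul ((norm_sub_le _ _).trans
              (add_le_add (hK0 _) (hK0 _))) (h1 _ _) (abs_nonneg _) (by positivity)
          _ = _ := mul_one _
      · rw [indicator_of_notMem hx, hvan k x (by simpa using hx), zero_mul, norm_zero]
    · have hfr : volume (frontier c.sheet.T) = 0 :=
        volume_eq_zero_of_hausdorff_lt_top c.sheet.finite_boundary
      filter_upwards [measure_eq_zero_iff_ae_notMem.1 hfr] with x hx
      have hcont : ContinuousAt G x := by
        by_cases hxT : x ∈ c.sheet.T
        · refine hg.continuousAt.congr ?_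
          filter_upwards [c.sheet.isOpen_T.mem_nhds hxT] with y hy
          rw [hG, indicator_of_mem hy]
        · have hxc : x ∈ (closure c.sheet.T)ᶜ := fun h =>
            hx ⟨h, by rwa [c.sheet.isOpen_T.interior_eq]⟩
          refine (continuousAt_const (y := (0 : ℝ))).congr ?_
          filter_upwards [isClosed_closure.isOpen_compl.mem_nhds hxc] with y hy
          rw [hG, indicator_of_notMem fun h => hy (subset_closure h)]
      have hs : Tendsto (fun k => x + S.l k • b) atTop (𝓝 x) := by
        have := (S.l_tendsto.smul_const b).const_add x
        simpa using this
      have h3 := ((hcont.tendsto.comp hs).const_sub (G x)).norm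
      rw [sub_self, norm_zero] at h3
      refine squeeze_zero_norm (fun k => ?_) h3
      rw [norm_mul]
      exact (mul_le_mul_of_nonneg_left (h1 _ _) (norm_nonneg _)).trans (mul_one _).le
  have h5 := h0.const_mul (1 / 2)
  rw [mul_zero] at h5
  refine h5.congr fun k => ?_
  rw [e1, e2]

/-! ### The limits of the bulk moments -/

/-- The integrand matters only through its integrals over single cells. This is where the
oscillation inside a cell is averaged out exactly. -/
theorem Choice.integral_fullPart_congr (c : Choice) {l : ℝ} (hl : 0 < l)
    {G G' : (Fin 2 → ℤ) → E2 → ℝ} (hG : ∀ n, Continuous (G n)) (hG' : ∀ n, Continuous (G' n))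
    (h : ∀ n, ∫ x in c.cellAt l n, G n x = ∫ x in c.cellAt l n, G' n x) :
    ∫ x in c.fullPart l, G (c.idx l x) x = ∫ x in c.fullPart l, G' (c.idx l x) x := by
  have hsub : ∀ n ∈ c.fullCells l, c.cellAt l n ⊆ closure c.sheet.T := fun n hn =>
    (show c.cellAt l n ⊆ c.sheet.T from hn).trans subset_closure
  rw [← c.finsum_full_eq hl fun n hn =>
      ((hG n).continuousOn.integrableOn_compact c.sheet.isCompact_closure).mono_set (hsub n hn),
    ← c.finsum_full_eq hl fun n hn =>
      ((hG' n).continuousOn.integrableOn_compact c.sheet.isCompact_closure).mono_set (hsub n hn)]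
  exact finsum_mem_congr rfl fun n _ => h n

theorem ChargeSequence.dipoleSum_apply {α : ℝ} {S : ChargeSequence α} {c : Choice} {k : ℕ} {C : ℝ}
    (hQ : IsLayerBounded c.sheet.T C (S.paramCharge c k)) {φ : E2 → ℝ} (hφ : Continuous φ)
    (hc : HasCompactSupport φ) (i : Fin 2) :
    S.dipoleSum c k φ i = (S.l k)⁻¹ * ∫ x in c.fullPart (S.l k),
      φ (c.cornerOf (S.l k) x) * layer (S.paramCharge c k) x * (x i - c.cornerOf (S.l k) x i) := by
  obtain ⟨K, hK⟩ := hc.exists_bound_of_continuous hφ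
  have hl := S.l_pos k
  have hF := c.fullPart_subset hl
  have hFm := c.measurableSet_fullPart hl
  have hfin : IsFiniteMeasure (volume.restrict (c.fullPart (S.l k))) :=
    ⟨by simpa using (measure_mono hF).trans_lt c.sheet.isBounded_T.measure_lt_top⟩
  have m1 : AEStronglyMeasurable (layer (S.paramCharge c k))
      (volume.restrict (c.fullPart (S.l k))) :=
    (hQ.aestronglyMeasurable c.sheet.isOpen_T.measurableSet).mono_measure
      (Measure.restrict_mono hF le_rfl)
  have iv : IntegrableOn (fun x => (φ (c.cornerOf (S.l k) x) * layer (S.paramCharge c k) x) •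
      (x - c.cornerOf (S.l k) x)) (c.fullPart (S.l k)) := by
    refine Integrable.of_bound (((hφ.measurable.comp
      (c.measurable_cornerOf hl)).aestronglyMeasurable.mul m1).smul
      (measurable_id.sub (c.measurable_cornerOf hl)).aestronglyMeasurable)
      (K * (2 * C) * (S.l k * c.cellRadius)) ((ae_restrict_mem hFm).mono fun x hx => ?_)
    rw [norm_smul, norm_mul]
    have h1 := hK (c.cornerOf (S.l k) x)
    have h2 : ‖layer (S.paramCharge c k) x‖ ≤ 2 * C := hQ.abs_layer_le (hF hx)
    have h3 := c.norm_sub_cornerOf_le hl x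
    have h4 := (norm_nonneg _).trans h1
    have h5 := (norm_nonneg _).trans h2
    gcongr
  rw [dipoleSum_eq hQ, PiLp.smul_apply, smul_eq_mul]
  congr 1
  exact ((EuclideanSpace.proj i : E2 →L[ℝ] ℝ).integral_comp_comm iv).symm

variable {α : ℝ} {hα : 0 ≤ α} {o t e r d : ℝ} {hd : 0 < d}

/-- The amplitude of the dipole moments of the oscillating charge. -/
noncomputable def amplitude (r : ℝ) (x : E2) : ℝ := (x 0 - r) * taper (x 1)

theorem contDiff_coord (i : Fin 2) : ContDiff ℝ ∞ fun x : E2 => x i :=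
  (EuclideanSpace.proj i : E2 →L[ℝ] ℝ).contDiff

theorem contDiff_amplitude : ContDiff ℝ ∞ (amplitude r) :=
  ((contDiff_coord 0).sub contDiff_const).mul (contDiff_taper.comp (contDiff_coord 1))

/-- The homogenized fields of the oscillating charge. -/
noncomputable def flatFields (r m : ℝ) : Fields where
  -- The combinations `q - div p = 0` and `σ + p · n = amplitude · n₀` are free of `m`, as
  -- uniqueness of the sources demands, although each field separately depends on it.
  q x := m * taper (x 1)
  p x := (m * amplitude r x) • dir 0
  p₃ _ := 0
  σ x := (1 - m) * (amplitude r x * rectNormal r x 0)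
  continuous_q := by
    have := continuous_taper
    fun_prop
  contDiff_p := ((contDiff_const.mul contDiff_amplitude).smul contDiff_const).of_le
    (by exact_mod_cast le_top)
  continuous_p₃ := continuous_const

/-- The oscillation at the edges of the cells. -/
noncomputable def cellPhase (o t e r : ℝ) (k : ℕ) (n : Fin 2 → ℤ) : ℝ :=
  Real.cos (cellAngle o t e r (1 / (2 * (k : ℝ) + 1)) n)

theorem abs_cellPhase_le (k : ℕ) (n : Fin 2 → ℤ) : |cellPhase o t e r k n| ≤ 1 :=
  Real.abs_cos_le_one _

section

variable (h2 : d ≤ 2) {φ : E2 → ℝ} (hφ : Continuous φ) (hc : HasCompactSupport φ)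
include h2

theorem flat_chargeSum (k : ℕ) (φ : E2 → ℝ) :
    (flatCharge α hα).chargeSum (flatChoice o t e r d hd) k φ =
      ∫ x in (flatChoice o t e r d hd).fullPart ((flatCharge α hα).l k),
        φ ((flatChoice o t e r d hd).cornerOf ((flatCharge α hα).l k) x) * taper (x 1) *
          cellPhase o t e r k ((flatChoice o t e r d hd).idx ((flatCharge α hα).l k) x) := by
  have hl := (flatCharge α hα).l_pos k
  set c := flatChoice o t e r d hd
  set l := (flatCharge α hα).l k with hldef
  have h1 := c.integral_fullPart_congr hl
    (G := fun n x => φ (c.cornerAt l n) * waveCharge r l x)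
    (G' := fun n x => φ (c.cornerAt l n) * (l * (cellPhase o t e r k n * taper (x 1))))
    (fun n => continuous_const.mul (continuous_waveCharge _ _))
    (fun n => by have := continuous_taper; fun_prop)
    (fun n => by
      rw [integral_const_mul, integral_const_mul, cell_waveCharge hl]
      rfl)
  rw [ChargeSequence.chargeSum_eq (flatCharge_isLayerBounded h2 k)]
  have h3 : ∫ x in c.fullPart l, φ (c.cornerOf l x) *
      layer ((flatCharge α hα).paramCharge c k) x =
      ∫ x in c.fullPart l, φ (c.cornerAt l (c.idx l x)) * waveCharge r l x :=
    setIntegral_congr_fun (c.measurableSet_fullPart hl) fun x hx => by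
      rw [flatCharge_layer h2 k (c.fullPart_subset hl hx)]
      rfl
  rw [h3, h1, ← integral_const_mul]
  refine integral_congr_ae (Eventually.of_forall fun x => ?_)
  simp only [Choice.cornerOf, ← hldef]
  field_simp

theorem flat_dipoleSum_one (k : ℕ) (hφ : Continuous φ) (hc : HasCompactSupport φ) :
    (flatCharge α hα).dipoleSum (flatChoice o t e r d hd) k φ 1 =
      ∫ x in (flatChoice o t e r d hd).fullPart ((flatCharge α hα).l k),
        φ ((flatChoice o t e r d hd).cornerOf ((flatCharge α hα).l k) x) * (taper (x 1) *
          (x 1 - (flatChoice o t e r d hd).cornerOf ((flatCharge α hα).l k) x 1)) *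
          cellPhase o t e r k ((flatChoice o t e r d hd).idx ((flatCharge α hα).l k) x) := by
  have hl := (flatCharge α hα).l_pos k
  set c := flatChoice o t e r d hd
  set l := (flatCharge α hα).l k with hldef
  have h1 := c.integral_fullPart_congr hl
    (G := fun n x => φ (c.cornerAt l n) * (waveCharge r l x * (x 1 - c.cornerAt l n 1)))
    (G' := fun n x => φ (c.cornerAt l n) * (l * (cellPhase o t e r k n *
      (taper (x 1) * (x 1 - c.cornerAt l n 1)))))
    (fun n => continuous_const.mul ((continuous_waveCharge _ _).mul (by fun_prop)))
    (fun n => by have := continuous_taper; fun_prop)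
    (fun n => by
      rw [integral_const_mul, integral_const_mul, cell_waveCharge_one hl]
      rfl)
  rw [ChargeSequence.dipoleSum_apply (flatCharge_isLayerBounded h2 k) hφ hc]
  have h3 : ∫ x in c.fullPart l, φ (c.cornerOf l x) *
      layer ((flatCharge α hα).paramCharge c k) x * (x 1 - c.cornerOf l x 1) =
      ∫ x in c.fullPart l, φ (c.cornerAt l (c.idx l x)) *
        (waveCharge r l x * (x 1 - c.cornerAt l (c.idx l x) 1)) :=
    setIntegral_congr_fun (c.measurableSet_fullPart hl) fun x hx => by
      simp only
      rw [flatCharge_layer h2 k (c.fullPart_subset hl hx), mul_assoc]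
      rfl
  rw [h3, h1, ← integral_const_mul]
  refine integral_congr_ae (Eventually.of_forall fun x => ?_)
  simp only [Choice.cornerOf, ← hldef]
  field_simp

/-- Only the term with the distance from the corner to the left side survives in the limit; the
others come with an additional factor `l`. -/
theorem flat_dipoleSum_zero (k : ℕ) (hφ : Continuous φ) (hc : HasCompactSupport φ) :
    (flatCharge α hα).dipoleSum (flatChoice o t e r d hd) k φ 0 =
      ∫ x in (flatChoice o t e r d hd).fullPart ((flatCharge α hα).l k),
        φ ((flatChoice o t e r d hd).cornerOf ((flatCharge α hα).l k) x) *
          ((((flatChoice o t e r d hd).cornerOf ((flatCharge α hα).l k) x 0 - r) *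
          cellPhase o t e r k ((flatChoice o t e r d hd).idx ((flatCharge α hα).l k) x) +
          (flatCharge α hα).l k * ((2 * e + 1) *
            cellPhase o t e r k ((flatChoice o t e r d hd).idx ((flatCharge α hα).l k) x) -
          Real.sin (cellAngle o t e r ((flatCharge α hα).l k)
            ((flatChoice o t e r d hd).idx ((flatCharge α hα).l k) x)) / Real.pi)) *
            taper (x 1)) := by
  have hl := (flatCharge α hα).l_pos k
  set c := flatChoice o t e r d hd
  set l := (flatCharge α hα).l k with hldef
  have h1 := c.integral_fullPart_congr hl
    (G := fun n x => φ (c.cornerAt l n) * (waveCharge r l x * (x 0 - c.cornerAt l n 0)))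
    (G' := fun n x => φ (c.cornerAt l n) * (l * (((c.cornerAt l n 0 - r) * cellPhase o t e r k n +
      l * ((2 * e + 1) * cellPhase o t e r k n - Real.sin (cellAngle o t e r l n) / Real.pi)) *
        taper (x 1))))
    (fun n => continuous_const.mul ((continuous_waveCharge _ _).mul (by fun_prop)))
    (fun n => by have := continuous_taper; fun_prop)
    (fun n => by
      rw [integral_const_mul, integral_const_mul, cell_waveCharge_zero hl]
      rfl)
  rw [ChargeSequence.dipoleSum_apply (flatCharge_isLayerBounded h2 k) hφ hc]
  have h3 : ∫ x in c.fullPart l, φ (c.cornerOf l x) *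
      layer ((flatCharge α hα).paramCharge c k) x * (x 0 - c.cornerOf l x 0) =
      ∫ x in c.fullPart l, φ (c.cornerAt l (c.idx l x)) *
        (waveCharge r l x * (x 0 - c.cornerAt l (c.idx l x) 0)) :=
    setIntegral_congr_fun (c.measurableSet_fullPart hl) fun x hx => by
      simp only
      rw [flatCharge_layer h2 k (c.fullPart_subset hl hx), mul_assoc]
      rfl
  rw [h3, h1, ← integral_const_mul]
  refine integral_congr_ae (Eventually.of_forall fun x => ?_)
  simp only [Choice.cornerOf, ← hldef]
  field_simp

theorem flat_normalSum (k : ℕ) (φ : E2 → ℝ) :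
    (flatCharge α hα).normalSum (flatChoice o t e r d hd) k φ = 0 := by
  have hl := (flatCharge α hα).l_pos k
  rw [ChargeSequence.normalSum_eq (flatCharge_isLayerBounded h2 k)]
  rw [setIntegral_congr_fun (g := fun _ => (0 : ℝ))
    ((flatChoice o t e r d hd).measurableSet_fullPart hl) fun x hx => by
      simp only
      rw [flatCharge_layer_third h2 k ((flatChoice o t e r d hd).fullPart_subset hl hx), mul_zero]]
  simp

variable {m : ℝ} (hM : HasPhaseMean (flatCharge α hα) (flatChoice o t e r d hd)
  (cellPhase o t e r) m)
include hM hφ hc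

theorem flat_tendsto_chargeSum :
    Tendsto (fun k => (flatCharge α hα).chargeSum (flatChoice o t e r d hd) k φ) atTop
      (𝓝 (∫ x in rect r d, φ x * (flatFields r m).q x)) := by
  obtain ⟨K, hK⟩ := hc.exists_bound_of_continuous hφ
  have hK0 := (norm_nonneg _).trans (hK 0)
  have h := hM.tendsto_fullPart (K := K)
    (f := fun k x => φ ((flatChoice o t e r d hd).cornerOf ((flatCharge α hα).l k) x) *
      taper (x 1)) (g := fun x => φ x * taper (x 1))
    (fun k => (hφ.measurable.comp ((flatChoice o t e r d hd).measurable_cornerOf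
      ((flatCharge α hα).l_pos k))).mul (continuous_taper.measurable.comp (by fun_prop)))
    (fun k x _ => by
      rw [abs_mul, abs_of_nonneg (taper_nonneg _)]
      exact (mul_le_mul (hK _) (taper_le_one _) (taper_nonneg _) hK0).trans (mul_one _).le)
    (by have := continuous_taper; fun_prop)
    (fun x _ => ((hφ.tendsto x).comp (tendsto_cornerOf x)).mul_const _)
  simp only [flat_chargeSum h2]
  convert h using 2
  rw [← integral_const_mul]
  refine integral_congr_ae (Eventually.of_forall fun x => ?_)
  simp only [flatFields]
  ring

theorem flat_tendsto_dipoleSum_one :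
    Tendsto (fun k => (flatCharge α hα).dipoleSum (flatChoice o t e r d hd) k φ 1) atTop
      (𝓝 0) := by
  obtain ⟨K, hK⟩ := hc.exists_bound_of_continuous hφ
  have hK0 := (norm_nonneg _).trans (hK 0)
  set c := flatChoice o t e r d hd with hcdef
  have hR := c.cellRadius_pos
  have h := hM.tendsto_fullPart (K := K * (1 * c.cellRadius))
    (f := fun k x => φ (c.cornerOf ((flatCharge α hα).l k) x) *
      (taper (x 1) * (x 1 - c.cornerOf ((flatCharge α hα).l k) x 1))) (g := fun x => 0)
    (fun k => (hφ.measurable.comp (c.measurable_cornerOf ((flatCharge α hα).l_pos k))).mul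
      ((continuous_taper.measurable.comp (by fun_prop)).mul (Measurable.sub (by fun_prop)
        ((by fun_prop : Measurable fun x : E2 => x 1).comp
          (c.measurable_cornerOf ((flatCharge α hα).l_pos k))))))
    (fun k x _ => by
      rw [abs_mul, abs_mul, abs_of_nonneg (taper_nonneg _)]
      have h3 : |x 1 - c.cornerOf ((flatCharge α hα).l k) x 1| ≤ c.cellRadius := by
        refine (PiLp.norm_apply_le (x - c.cornerOf ((flatCharge α hα).l k) x) 1).trans
          ((c.norm_sub_cornerOf_le ((flatCharge α hα).l_pos k) x).trans ?_)
        exact mul_le_of_le_one_left hR.le (flatCharge_l_le k)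
      have h4 := taper_le_one (x 1)
      have h5 := taper_nonneg (x 1)
      have h6 := hK (c.cornerOf ((flatCharge α hα).l k) x)
      rw [Real.norm_eq_abs] at h6
      gcongr)
    continuous_const
    (fun x _ => by
      have h1 := (hφ.tendsto x).comp (tendsto_cornerOf (S := flatCharge α hα) (c := c) x)
      have h3 : Tendsto (fun k => c.cornerOf ((flatCharge α hα).l k) x 1) atTop (𝓝 (x 1)) :=
        ((by fun_prop : Continuous fun x : E2 => x 1).tendsto x).comp (tendsto_cornerOf x)
      have h4 := h1.mul ((h3.const_sub (x 1)).const_mul (taper (x 1)))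
      rw [sub_self, mul_zero, mul_zero] at h4
      exact h4)
  rw [integral_zero, mul_zero] at h
  exact h.congr fun k => (flat_dipoleSum_one h2 k hφ hc).symm

theorem flat_tendsto_dipoleSum_zero :
    Tendsto (fun k => (flatCharge α hα).dipoleSum (flatChoice o t e r d hd) k φ 0) atTop
      (𝓝 (∫ x in rect r d, φ x * (m * amplitude r x))) := by
  obtain ⟨K, hK⟩ := hc.exists_bound_of_continuous hφ
  have hK0 := (norm_nonneg _).trans (hK 0)
  set c := flatChoice o t e r d hd with hcdef
  have hR := c.cellRadius_pos
  have hl0 := (flatCharge α hα).l_pos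
  have mco : ∀ k, Measurable fun x => φ (c.cornerOf ((flatCharge α hα).l k) x) := fun k =>
    hφ.measurable.comp (c.measurable_cornerOf (hl0 k))
  have mta : Measurable fun x : E2 => taper (x 1) := continuous_taper.measurable.comp (by fun_prop)
  have mc0 : ∀ k, Measurable fun x => c.cornerOf ((flatCharge α hα).l k) x 0 - r := fun k =>
    ((by fun_prop : Measurable fun x : E2 => x 0).comp (c.measurable_cornerOf (hl0 k))).sub_const r
  have b1 : ∀ k, ∀ x ∈ rect r d, |φ (c.cornerOf ((flatCharge α hα).l k) x) *
      ((c.cornerOf ((flatCharge α hα).l k) x 0 - r) * taper (x 1))| ≤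
        K * ((1 + c.cellRadius) * 1) := fun k x hx => by
    rw [abs_mul, abs_mul, abs_of_nonneg (taper_nonneg _)]
    have h3 : |x 0 - c.cornerOf ((flatCharge α hα).l k) x 0| ≤ c.cellRadius := by
      refine (PiLp.norm_apply_le (x - c.cornerOf ((flatCharge α hα).l k) x) 0).trans
        ((c.norm_sub_cornerOf_le (hl0 k) x).trans ?_)
      exact mul_le_of_le_one_left hR.le (flatCharge_l_le k)
    have h3' : |c.cornerOf ((flatCharge α hα).l k) x 0 - r| ≤ 1 + c.cellRadius := by
      have h7 := abs_le.1 h3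
      have h8 := hx.1
      exact abs_le.2 ⟨by linarith [h8.1, h7.2], by linarith [h8.2, h7.1]⟩
    have h4 := taper_le_one (x 1)
    have h5 := taper_nonneg (x 1)
    have h6 := hK (c.cornerOf ((flatCharge α hα).l k) x)
    rw [Real.norm_eq_abs] at h6
    gcongr
  have h := hM.tendsto_fullPart (K := K * ((1 + c.cellRadius) * 1))
    (f := fun k x => φ (c.cornerOf ((flatCharge α hα).l k) x) *
      ((c.cornerOf ((flatCharge α hα).l k) x 0 - r) * taper (x 1)))
    (g := fun x => φ x * amplitude r x)
    (fun k => (mco k).mul ((mc0 k).mul mta)) b1 (hφ.mul contDiff_amplitude.continuous)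
    (fun x _ => by
      have h1 := (hφ.tendsto x).comp (tendsto_cornerOf (S := flatCharge α hα) (c := c) x)
      have h3 : Tendsto (fun k => c.cornerOf ((flatCharge α hα).l k) x 0) atTop (𝓝 (x 0)) :=
        ((by fun_prop : Continuous fun x : E2 => x 0).tendsto x).comp (tendsto_cornerOf x)
      exact h1.mul ((h3.sub_const r).mul_const (taper (x 1))))
  -- the remainder
  set E : ℕ → E2 → ℝ := fun k x => φ (c.cornerOf ((flatCharge α hα).l k) x) *
    (((2 * e + 1) * cellPhase o t e r k (c.idx ((flatCharge α hα).l k) x) -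
      Real.sin (cellAngle o t e r ((flatCharge α hα).l k)
        (c.idx ((flatCharge α hα).l k) x)) / Real.pi) * taper (x 1)) with hE
  have bE : ∀ k x, ‖E k x‖ ≤ K * ((|2 * e + 1| * 1 + 1) * 1) := fun k x => by
    simp only [hE]
    rw [norm_mul, norm_mul, Real.norm_of_nonneg (taper_nonneg _)]
    have h4 := taper_le_one (x 1)
    have h5 := taper_nonneg (x 1)
    have h6 := hK (c.cornerOf ((flatCharge α hα).l k) x)
    have h7 : ‖(2 * e + 1) * cellPhase o t e r k (c.idx ((flatCharge α hα).l k) x) -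
      Real.sin (cellAngle o t e r ((flatCharge α hα).l k)
        (c.idx ((flatCharge α hα).l k) x)) / Real.pi‖ ≤ |2 * e + 1| * 1 + 1 := by
      refine (norm_sub_le _ _).trans (add_le_add ?_ ?_)
      · rw [norm_mul]
        exact mul_le_mul_of_nonneg_left (abs_cellPhase_le _ _) (norm_nonneg _)
      · rw [norm_div, Real.norm_of_nonneg Real.pi_pos.le, div_le_one Real.pi_pos]
        exact (Real.abs_sin_le_one _).trans (by linarith [Real.pi_gt_three])
    gcongr
  have mE : ∀ k, Measurable (E k) := fun k => by
    have mi := c.measurable_idx (hl0 k)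
    exact (mco k).mul ((((measurable_of_countable (cellPhase o t e r k)).comp mi).const_mul _
      |>.sub ((measurable_of_countable fun n => Real.sin (cellAngle o t e r
        ((flatCharge α hα).l k) n) / Real.pi).comp mi)).mul mta)
  have hTv : volume (rect r d) < ⊤ := isBounded_rect.measure_lt_top
  have hfv : ∀ k, volume (c.fullPart ((flatCharge α hα).l k)) < ⊤ := fun k =>
    (measure_mono (c.fullPart_subset (hl0 k))).trans_lt hTv
  have hEl : Tendsto (fun k => (flatCharge α hα).l k * ∫ x in
      c.fullPart ((flatCharge α hα).l k), E k x) atTop (𝓝 0) := by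
    have h5 := (flatCharge α hα).l_tendsto.mul_const
      (K * ((|2 * e + 1| * 1 + 1) * 1) * volume.real (rect r d))
    rw [zero_mul] at h5
    refine squeeze_zero_norm (fun k => ?_) h5
    rw [norm_mul, Real.norm_of_nonneg (hl0 k).le]
    refine mul_le_mul_of_nonneg_left ?_ (hl0 k).le
    refine (norm_setIntegral_le_of_norm_le_const (hfv k) fun x _ => bE k x).trans ?_
    refine mul_le_mul_of_nonneg_left (measureReal_mono (c.fullPart_subset (hl0 k)) hTv.ne)
      (by positivity)
  have h6 := h.add hEl
  rw [add_zero] at h6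
  have e1 : m * ∫ x in c.sheet.T, φ x * amplitude r x =
      ∫ x in rect r d, φ x * (m * amplitude r x) := by
    rw [← integral_const_mul]
    refine integral_congr_ae (Eventually.of_forall fun x => ?_)
    simp only
    ring
  rw [e1] at h6
  refine h6.congr fun k => ?_
  have hfin : IsFiniteMeasure (volume.restrict (c.fullPart ((flatCharge α hα).l k))) :=
    ⟨by simpa using hfv k⟩
  rw [flat_dipoleSum_zero h2 k hφ hc, ← integral_const_mul, ← integral_add]
  · refine integral_congr_ae (Eventually.of_forall fun x => ?_)
    simp only [hE]
    ring
  · refine Integrable.of_bound (((mco k).mul ((mc0 k).mul mta)).mul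
      ((measurable_of_countable (cellPhase o t e r k)).comp
        (c.measurable_idx (hl0 k)))).aestronglyMeasurable
      (K * ((1 + c.cellRadius) * 1) * 1)
      ((ae_restrict_mem (c.measurableSet_fullPart (hl0 k))).mono fun x hx => ?_)
    rw [norm_mul]
    exact mul_le_mul (b1 k x (c.fullPart_subset (hl0 k) hx)) (abs_cellPhase_le _ _)
      (norm_nonneg _) (by positivity)
  · exact (Integrable.of_bound (mE k).aestronglyMeasurable _
      (Eventually.of_forall fun x => bE k x)).const_mul _

end

variable {α : ℝ} {hα : 0 ≤ α} {o t e r d m : ℝ} {hd : 0 < d}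

/-! ### The limit of the surface charge -/

/-- As `1 / l = 2k + 1`, the offset `(o - r) / l` equals `j k + (o - r)`, an integer plus a fixed
number. All cells have the same phase, and it does not depend on `k`. -/
theorem hasPhaseMean_flat {j : ℤ} (hj : 2 * (o - r) = j) :
    HasPhaseMean (flatCharge α hα) (flatChoice o 0 e r d hd) (cellPhase o 0 e r)
      (Real.cos (2 * Real.pi * (o - r + e))) := by
  refine hasPhaseMean_const (Real.abs_cos_le_one _) fun k n => ?_
  have h : cellAngle o 0 e r (1 / (2 * (k : ℝ) + 1)) n =
      2 * Real.pi * (o - r + e) + ((n 0 + j * k : ℤ) : ℝ) * (2 * Real.pi) := by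
    rw [cellAngle]
    push_cast
    rw [← hj]
    field_simp
    ring
  rw [cellPhase, h, Real.cos_add_int_mul_two_pi]

/-- Each row is displaced by half a period against the one before, so the cosine changes sign from
row to row. -/
theorem hasPhaseMean_shear :
    HasPhaseMean (flatCharge α hα) (flatChoice 0 (1 / 2) 0 0 d hd) (cellPhase 0 (1 / 2) 0 0) 0 := by
  refine hasPhaseMean_zero (b := shearBasis (1 / 2) 1) (i := 1) abs_cellPhase_le
    (fun k x => flatChoice_idx_add ((flatCharge α hα).l_pos k) x 1) fun k n => ?_
  rw [cellPhase, cellPhase, ← Real.cos_add_pi]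
  congr 1
  simp only [cellAngle, Pi.add_apply, Pi.single_eq_same, ne_eq, zero_ne_one, not_false_eq_true,
    Pi.single_eq_of_ne, Int.cast_add, Int.cast_one, Int.cast_zero]
  ring

theorem div2_smul_dir {u : E2 → ℝ} {x : E2} (hu : DifferentiableAt ℝ u x) (i : Fin 2) :
    div2 (fun y => u y • dir i) x = fderiv ℝ u x (dir i) := by
  rw [Sheet.div2_smul hu (differentiableAt_const _)]
  simp [div2]

/-- The divergence theorem for a field parallel to a coordinate axis. -/
theorem integral_fderiv_rect (hd : 0 < d) {u : E2 → ℝ} (hu : ContDiff ℝ 1 u)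
    (hc : HasCompactSupport u) (i : Fin 2) : ∫ x in rect r d, fderiv ℝ u x (dir i) =
      ∫ x in frontier (rect r d), u x * rectNormal r x i ∂(μH[1] : Measure E2) := by
  have h := (isOuterNormal_rect (r := r) hd).2.2 (fun x => u x • dir i) (hu.smul contDiff_const)
    hc.smul_right
  have hdu : Differentiable ℝ u := hu.differentiable (by norm_num)
  simp only [div2_smul_dir (hdu _), inner_smul_left] at h
  rw [h]
  refine integral_congr_ae (Eventually.of_forall fun x => ?_)
  simp only [RCLike.conj_to_real]
  rw [real_inner_comm, inner_dir]

theorem rectNormal_zero {x : E2} (h : rectNormal r x 0 ≠ 0) : x 0 = r ∨ x 0 = r + 1 := by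
  by_contra! hx
  rw [rectNormal, if_neg hx.1, if_neg hx.2] at h
  split_ifs at h <;> simp [dir] at h

/-- Divided by `l`, the charge is the amplitude times the derivative of `cos (2π (x₀ - r) / l)`.
Integration by parts leaves the boundary term, where the cosine is one on both vertical sides, and
an oscillating integral that a second integration by parts shows to be of order `l`. -/
theorem tendsto_integral_waveCharge (hd : 0 < d) {f : E2 → ℝ} (hf : ContDiff ℝ 2 f)
    (hc : HasCompactSupport f) :
    Tendsto (fun k => ((flatCharge α hα).l k)⁻¹ *
      ∫ x in rect r d, waveCharge r ((flatCharge α hα).l k) x * f x) atTop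
      (𝓝 (∫ x in frontier (rect r d), f x * amplitude r x * rectNormal r x 0
        ∂(μH[1] : Measure E2))) := by
  set G : E2 → ℝ := fun x => f x * amplitude r x with hGdef
  have hG : ContDiff ℝ 2 G := hf.mul (by exact_mod_cast contDiff_infty.1 contDiff_amplitude 2)
  have hGc : HasCompactSupport G := hc.mul_right
  set G1 : E2 → ℝ := fun x => fderiv ℝ G x (dir 0) with hG1def
  have hG1 : ContDiff ℝ 1 G1 := (hG.fderiv_right (m := 1) (by norm_num)).clm_apply contDiff_const
  have hG1c : HasCompactSupport G1 := hGc.fderiv_apply (𝕜 := ℝ) (dir 0)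
  set G2 : E2 → ℝ := fun x => fderiv ℝ G1 x (dir 0) with hG2def
  have hG2 : Continuous G2 := (hG1.continuous_fderiv (by norm_num)).clm_apply continuous_const
  have hG2c : HasCompactSupport G2 := hG1c.fderiv_apply (𝕜 := ℝ) (dir 0)
  obtain ⟨K, hK⟩ := hG2c.exists_bound_of_continuous hG2
  have hK0 := (norm_nonneg _).trans (hK 0)
  have hp := Real.pi_pos
  have key : ∀ k, ((flatCharge α hα).l k)⁻¹ *
      (∫ x in rect r d, waveCharge r ((flatCharge α hα).l k) x * f x) =
      (∫ x in frontier (rect r d), G x * rectNormal r x 0 ∂(μH[1] : Measure E2)) +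
      (flatCharge α hα).l k / (2 * Real.pi) * ∫ x in rect r d,
        G2 x * Real.sin (2 * Real.pi * ((x 0 - r) / (flatCharge α hα).l k)) := by
    intro k
    set l := (flatCharge α hα).l k with hl
    have hl0 : l ≠ 0 := ((flatCharge α hα).l_pos k).ne'
    -- The second term is the corrector: it cancels the derivative of `G` times the cosine and
    -- replaces it by a term of order `l`.
    set u : E2 → ℝ := fun x => G x * Real.cos (2 * Real.pi * ((x 0 - r) / l)) -
      l / (2 * Real.pi) * (G1 x * Real.sin (2 * Real.pi * ((x 0 - r) / l))) with hu
    have hsm : ContDiff ℝ 1 fun x : E2 => 2 * Real.pi * ((x 0 - r) / l) :=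
      contDiff_const.mul ((((contDiff_coord 0).of_le (by exact_mod_cast le_top)).sub
        contDiff_const).div_const l)
    have hu1 : ContDiff ℝ 1 u := ((hG.of_le (by norm_num)).mul
      (Real.contDiff_cos.comp hsm)).sub (contDiff_const.mul (hG1.mul (Real.contDiff_sin.comp hsm)))
    have huc : HasCompactSupport u := by
      refine HasCompactSupport.sub hGc.mul_right ?_
      exact HasCompactSupport.mul_left (f := fun _ => l / (2 * Real.pi)) hG1c.mul_right
    have hder : ∀ x, fderiv ℝ u x (dir 0) = l⁻¹ * (waveCharge r l x * f x) -
        l / (2 * Real.pi) * (G2 x * Real.sin (2 * Real.pi * ((x 0 - r) / l))) := by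
      intro x
      have p0 : HasFDerivAt (fun x : E2 => x 0) (EuclideanSpace.proj (0 : Fin 2) : E2 →L[ℝ] ℝ) x :=
        (EuclideanSpace.proj (0 : Fin 2) : E2 →L[ℝ] ℝ).hasFDerivAt
      have hcos := (hasDerivAt_cos_scaled r l (x 0)).comp_hasFDerivAt x p0
      have hsin := (hasDerivAt_sin_scaled r l (x 0)).comp_hasFDerivAt x p0
      have hGd := (hG.differentiable (by norm_num) x).hasFDerivAt
      have hG1d := (hG1.differentiable (by norm_num) x).hasFDerivAt
      have h1 := (hGd.mul hcos).sub ((hG1d.mul hsin).const_mul (l / (2 * Real.pi)))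
      have h2 : fderiv ℝ u x = _ := h1.fderiv
      rw [h2]
      have e1 : fderiv ℝ G x (dir 0) = G1 x := rfl
      have e2 : fderiv ℝ G1 x (dir 0) = G2 x := rfl
      have e3 : (EuclideanSpace.proj (0 : Fin 2) : E2 →L[ℝ] ℝ) (dir 0) = 1 := by simp [dir]
      have e4 : G x = f x * ((x 0 - r) * taper (x 1)) := rfl
      simp only [sub_apply, add_apply, smul_apply, smul_eq_mul, e1, e2, e3, e4, Function.comp_apply]
      rw [waveCharge, wave]
      field_simp
      ring
    have h1 := integral_fderiv_rect (r := r) hd hu1 huc 0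
    have h2 : ∫ x in frontier (rect r d), u x * rectNormal r x 0 ∂(μH[1] : Measure E2) =
        ∫ x in frontier (rect r d), G x * rectNormal r x 0 ∂(μH[1] : Measure E2) := by
      refine integral_congr_ae (Eventually.of_forall fun x => ?_)
      by_cases hn : rectNormal r x 0 = 0
      · simp only [hn, mul_zero]
      -- The normal has a horizontal component only on the vertical sides, and these are `1 / l = 2k
      -- + 1` whole periods apart.
      · have hcs : Real.cos (2 * Real.pi * ((x 0 - r) / l)) = 1 ∧
            Real.sin (2 * Real.pi * ((x 0 - r) / l)) = 0 := by
          rcases rectNormal_zero hn with h | h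
          · rw [h, sub_self, zero_div, mul_zero]
            exact ⟨Real.cos_zero, Real.sin_zero⟩
          · have : 2 * Real.pi * ((x 0 - r) / l) = 0 + ((2 * k + 1 : ℤ) : ℝ) * (2 * Real.pi) := by
              rw [h, hl, flatCharge_l]
              push_cast
              field_simp
              ring
            rw [this, Real.cos_add_int_mul_two_pi, Real.sin_add_int_mul_two_pi]
            exact ⟨Real.cos_zero, Real.sin_zero⟩
        simp only [hu, hcs.1, hcs.2, mul_zero, mul_one, sub_zero]
    have iw : IntegrableOn (fun x => waveCharge r l x * f x) (rect r d) :=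
      (((continuous_waveCharge r l).mul hf.continuous).continuousOn.integrableOn_compact
        isBounded_rect.isCompact_closure).mono_set subset_closure
    have i2 : IntegrableOn (fun x => G2 x * Real.sin (2 * Real.pi * ((x 0 - r) / l)))
        (rect r d) :=
      ((hG2.mul (Real.continuous_sin.comp hsm.continuous)).continuousOn.integrableOn_compact
        isBounded_rect.isCompact_closure).mono_set subset_closure
    simp only [hder] at h1
    rw [integral_sub (iw.const_mul _) (i2.const_mul _), integral_const_mul, integral_const_mul,
      h2] at h1
    linarith
  simp only [key]
  have h0 : Tendsto (fun k => (flatCharge α hα).l k / (2 * Real.pi) * ∫ x in rect r d,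
      G2 x * Real.sin (2 * Real.pi * ((x 0 - r) / (flatCharge α hα).l k))) atTop (𝓝 0) := by
    have h1 := ((flatCharge α hα).l_tendsto.div_const (2 * Real.pi)).mul_const
      (K * volume.real (rect r d))
    rw [zero_div, zero_mul] at h1
    refine squeeze_zero_norm (fun k => ?_) h1
    have hl := (flatCharge α hα).l_pos k
    rw [norm_mul, Real.norm_of_nonneg (by positivity)]
    refine mul_le_mul_of_nonneg_left ?_ (by positivity)
    refine norm_setIntegral_le_of_norm_le_const isBounded_rect.measure_lt_top fun x _ => ?_
    rw [norm_mul]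
    calc _ ≤ K * 1 := mul_le_mul (hK x) (Real.abs_sin_le_one _) (abs_nonneg _) hK0
      _ = K := mul_one K
  simpa using h0.const_add
    (∫ x in frontier (rect r d), G x * rectNormal r x 0 ∂(μH[1] : Measure E2))

/-- A compactly supported extension of a function on the plane to space. -/
theorem exists_space_extension {f : E2 → ℝ} (hf : ContDiff ℝ 2 f) (hc : HasCompactSupport f) :
    ∃ g : E3 → ℝ, ContDiff ℝ 2 g ∧ HasCompactSupport g ∧
      ∀ x : E2, ∀ s : ℝ, |s| ≤ 1 → g (lift x s) = f x := by
  obtain ⟨R, hR⟩ := hc.isCompact.isBounded.exists_norm_le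
  set χ : ContDiffBump (0 : E3) := ⟨|R| + 1, |R| + 2, by positivity, by linarith⟩ with hχ
  refine ⟨fun X => χ X * f (planeProj X), χ.contDiff.mul (hf.comp planeProj.contDiff),
    χ.hasCompactSupport.mul_right, fun x s hs => ?_⟩
  simp only
  rw [planeProj_lift]
  by_cases hx : x ∈ tsupport f
  · rw [χ.one_of_mem_closedBall, one_mul]
    rw [mem_closedBall_zero_iff, lift_eq]
    refine (norm_add_le _ _).trans ?_
    rw [norm_liftL, norm_smul, norm_dir3, mul_one]
    exact add_le_add ((hR x hx).trans (le_abs_self R)) hs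
  · rw [image_eq_zero_of_notMem_tsupport hx, mul_zero]

theorem baseDeriv_liftL {g : E3 → ℝ} (hg : ContDiff ℝ 2 g) (x v : E2) :
    baseDeriv g (liftL v) x = fderiv ℝ (base g) x v := by
  have h := (hg.differentiable (by norm_num) (liftL x)).hasFDerivAt.comp x liftL.hasFDerivAt
  have h2 : fderiv ℝ (base g) x = _ := h.fderiv
  rw [h2]
  rfl

theorem flatCharge_h_le : ∀ᶠ k in atTop, (flatCharge α hα).h k ≤ 1 :=
  (flatCharge α hα).h_tendsto.eventually_le_const one_pos

/-- The limit of the surface charges, tested with smooth functions. -/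
theorem flat_tendsto_surfaceSum_smooth (h2 : d ≤ 2)
    (hM : HasPhaseMean (flatCharge α hα) (flatChoice o t e r d hd) (cellPhase o t e r) m)
    {f : E2 → ℝ} (hf : ContDiff ℝ 2 f) (hc : HasCompactSupport f) :
    Tendsto (fun k => (flatCharge α hα).surfaceSum (flatChoice o t e r d hd) k f) atTop
      (𝓝 (∫ x in frontier (rect r d), f x * (flatFields r m).σ x ∂(μH[1] : Measure E2))) := by
  obtain ⟨g, hg, hgc, hgf⟩ := exists_space_extension hf hc
  set c := flatChoice o t e r d hd with hcdef
  have hbase : base g = f := funext fun x => hgf x 0 (by simp)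
  set D : Fin 2 → E2 → ℝ := fun i => baseDeriv g (liftL (dir i)) with hD
  have hDc : ∀ i, Continuous (D i) := fun i => continuous_baseDeriv hg _
  have hDs : ∀ i, HasCompactSupport (D i) := fun i => hasCompactSupport_baseDeriv hgc _
  have hD0 : ∀ x, D 0 x = fderiv ℝ f x (dir 0) := fun x => by
    rw [hD]; simp only; rw [baseDeriv_liftL hg, hbase]
  have t1 := ChargeSequence.tendsto_testedCharge_sub (S := flatCharge α hα) (c := c)
    (Eventually.of_forall fun k => flatCharge_isLayerBounded h2 k) hg hgc
  have t2 := flat_tendsto_chargeSum (hα := hα) h2 hf.continuous hc hM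
  have t3 := flat_tendsto_dipoleSum_zero (hα := hα) h2 (hDc 0) (hDs 0) hM
  have t4 := flat_tendsto_dipoleSum_one (hα := hα) h2 (hDc 1) (hDs 1) hM
  have t5 := tendsto_integral_waveCharge (hα := hα) (r := r) hd hf hc
  -- The multipole expansion is solved for the surface sum. The total charge and the bulk moments
  -- have known limits, so the partial cells need not be examined one by one.
  have ht := (((t5.sub t1).sub t2).sub t3).sub t4
  have hA : ContDiff ℝ 1 (fun x => f x * amplitude r x) :=
    (hf.of_le (by norm_num)).mul (contDiff_amplitude.of_le (by exact_mod_cast le_top))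
  have hlim : (∫ x in frontier (rect r d), f x * amplitude r x * rectNormal r x 0
        ∂(μH[1] : Measure E2)) - 0 - (∫ x in rect r d, f x * (flatFields r m).q x) -
        (∫ x in rect r d, D 0 x * (m * amplitude r x)) - 0 =
      ∫ x in frontier (rect r d), f x * (flatFields r m).σ x ∂(μH[1] : Measure E2) := by
    have e1 := integral_fderiv_rect (r := r) hd hA hc.mul_right 0
    have e2 : ∀ x, fderiv ℝ (fun x => f x * amplitude r x) x (dir 0) =
        f x * taper (x 1) + D 0 x * amplitude r x := fun x => by
      rw [hD0, fderiv_fun_mul (hf.differentiable (by norm_num) x)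
        (contDiff_amplitude.differentiable (by simp) x)]
      have e3 : fderiv ℝ (amplitude r) x (dir 0) = taper (x 1) := by
        have p0 : HasFDerivAt (fun x : E2 => x 0 - r)
          (EuclideanSpace.proj (0 : Fin 2) : E2 →L[ℝ] ℝ) x :=
          (EuclideanSpace.proj (0 : Fin 2) : E2 →L[ℝ] ℝ).hasFDerivAt.sub_const r
        have p1 := ((contDiff_taper.differentiable (by simp) (x 1)).hasDerivAt).comp_hasFDerivAt x
          (EuclideanSpace.proj (1 : Fin 2) : E2 →L[ℝ] ℝ).hasFDerivAt
        have h3 : fderiv ℝ (amplitude r) x = _ := (p0.mul p1).fderiv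
        rw [h3]
        simp [dir]
      simp only [add_apply, smul_apply, smul_eq_mul, e3]
      ring
    have i1 : IntegrableOn (fun x => f x * taper (x 1)) (rect r d) :=
      ((hf.continuous.mul (continuous_taper.comp (by fun_prop))).continuousOn.integrableOn_compact
        isBounded_rect.isCompact_closure).mono_set subset_closure
    have i2 : IntegrableOn (fun x => D 0 x * amplitude r x) (rect r d) :=
      (((hDc 0).mul contDiff_amplitude.continuous).continuousOn.integrableOn_compact
        isBounded_rect.isCompact_closure).mono_set subset_closure
    simp only [e2] at e1
    rw [integral_add i1 i2] at e1
    have e4 : ∫ x in rect r d, f x * (flatFields r m).q x =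
        m * ∫ x in rect r d, f x * taper (x 1) := by
      rw [← integral_const_mul]
      refine integral_congr_ae (Eventually.of_forall fun x => ?_)
      simp only [flatFields]; ring
    have e5 : ∫ x in rect r d, D 0 x * (m * amplitude r x) =
        m * ∫ x in rect r d, D 0 x * amplitude r x := by
      rw [← integral_const_mul]
      refine integral_congr_ae (Eventually.of_forall fun x => ?_)
      simp only; ring
    have e6 : ∫ x in frontier (rect r d), f x * (flatFields r m).σ x ∂(μH[1] : Measure E2) =
        (1 - m) * ∫ x in frontier (rect r d), f x * amplitude r x * rectNormal r x 0
          ∂(μH[1] : Measure E2) := by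
      rw [← integral_const_mul]
      refine integral_congr_ae (Eventually.of_forall fun x => ?_)
      simp only [flatFields]; ring
    rw [e4, e5, e6, ← e1]
    ring
  rw [hlim] at ht
  refine ht.congr' ?_
  filter_upwards [flatCharge_h_le (hα := hα)] with k hk
  have htest : (flatCharge α hα).testedCharge c k g = ((flatCharge α hα).l k)⁻¹ *
      ∫ x in rect r d, waveCharge r ((flatCharge α hα).l k) x * f x := by
    rw [ChargeSequence.testedCharge]
    congr 1
    refine setIntegral_congr_fun isOpen_rect.measurableSet fun x hx => ?_
    have hh := (flatCharge α hα).h_pos k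
    have h3 : layer (fun x z => (flatCharge α hα).paramCharge c k x z *
        g (lift x ((flatCharge α hα).h k * z))) x =
        ∫ z in Ioo (-1 : ℝ) 1, (flatCharge α hα).paramCharge c k x z * f x := by
      rw [layer]
      refine setIntegral_congr_fun measurableSet_Ioo fun z hz => ?_
      rw [hgf]
      rw [abs_mul, abs_of_pos hh]
      have : |z| ≤ 1 := abs_le.2 ⟨hz.1.le, hz.2.le⟩
      nlinarith [abs_nonneg z]
    rw [h3, integral_mul_const]
    have h4 := flatCharge_layer (hα := hα) (o := o) (t := t) (e := e) (hd := hd) h2 k hx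
    rw [layer] at h4
    rw [h4]
  rw [htest, ChargeSequence.multipoleSum, hbase, flat_normalSum h2, Fin.sum_univ_two]
  ring

/-- The surface charges are bounded uniformly in the lattice scale. -/
theorem exists_surfaceSum_le (h2 : d ≤ 2) : ∃ B, 0 ≤ B ∧ ∀ (k : ℕ) (f : E2 → ℝ) (ε : ℝ),
    (∀ x, |f x| ≤ ε) → |(flatCharge α hα).surfaceSum (flatChoice o t e r d hd) k f| ≤ ε * B := by
  set c := flatChoice o t e r d hd with hcdef
  have hR := c.cellRadius_pos
  have hp := Real.pi_pos
  refine ⟨2 * Real.pi * (8 * c.cellRadius * (d + 1)), by positivity, fun k f ε hf => ?_⟩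
  have hl := (flatCharge α hα).l_pos k
  have hε : 0 ≤ ε := (abs_nonneg _).trans (hf 0)
  rw [ChargeSequence.surfaceSum_eq (flatCharge_isLayerBounded h2 k), abs_mul,
    abs_of_pos (inv_pos.2 hl)]
  have h1 := norm_setIntegral_le_of_norm_le_const (μ := volume)
    (s := c.partialPart ((flatCharge α hα).l k)) (C := ε * (2 * Real.pi))
    (f := fun x => f (c.cornerOf ((flatCharge α hα).l k) x) *
      layer ((flatCharge α hα).paramCharge c k) x)
    ((measure_mono sdiff_subset).trans_lt c.sheet.isBounded_T.measure_lt_top) (fun x hx => by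
      rw [norm_mul]
      refine mul_le_mul (hf _) ?_ (norm_nonneg _) hε
      rw [flatCharge_layer h2 k hx.1]
      exact abs_waveCharge_le _ hx.1)
  have h3 := flatChoice_partialPart (o := o) (t := t) (e := e) (r := r) (hd := hd) hl
  calc _ ≤ ((flatCharge α hα).l k)⁻¹ * (ε * (2 * Real.pi) *
        ((flatCharge α hα).l k * (8 * c.cellRadius * (d + 1)))) := by
        refine mul_le_mul_of_nonneg_left (h1.trans ?_) (inv_pos.2 hl).le
        exact mul_le_mul_of_nonneg_left h3 (by positivity)
    _ = _ := by field_simp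

theorem ChargeSequence.surfaceSum_sub (S : ChargeSequence α) (c : Choice) (k : ℕ) (f g : E2 → ℝ) :
    S.surfaceSum c k (fun x => f x - g x) = S.surfaceSum c k f - S.surfaceSum c k g := by
  have hfin := c.finite_partialCells (S.l_pos k)
  rw [surfaceSum, surfaceSum, surfaceSum, finsum_mem_eq_finite_toFinset_sum _ hfin,
    finsum_mem_eq_finite_toFinset_sum _ hfin, finsum_mem_eq_finite_toFinset_sum _ hfin,
    ← Finset.sum_sub_distrib]
  exact Finset.sum_congr rfl fun n _ => by ring

/-- Uniform approximation by compactly supported smooth functions. -/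
theorem exists_smooth_approx {f : E2 → ℝ} (hf : Continuous f) (hc : HasCompactSupport f) {ε : ℝ}
    (hε : 0 < ε) : ∃ g : E2 → ℝ, ContDiff ℝ 2 g ∧ HasCompactSupport g ∧ ∀ x, |f x - g x| ≤ ε := by
  obtain ⟨g, hg, hgf⟩ := (hc.uniformContinuous_of_continuous hf).exists_contDiff_dist_le hε
  obtain ⟨R, hR⟩ := hc.isCompact.isBounded.exists_norm_le
  set χ : ContDiffBump (0 : E2) := ⟨|R| + 1, |R| + 2, by positivity, by linarith⟩ with hχ
  refine ⟨fun x => χ x * g x, χ.contDiff.mul (hg.of_le (by exact_mod_cast le_top)),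
    χ.hasCompactSupport.mul_right, fun x => ?_⟩
  have h1 := (hgf x).le
  rw [Real.dist_eq] at h1
  by_cases hx : x ∈ tsupport f
  · simp only
    rw [χ.one_of_mem_closedBall, one_mul, abs_sub_comm]
    · exact h1
    · rw [mem_closedBall_zero_iff]
      have := hR x hx
      change ‖x‖ ≤ |R| + 1
      linarith [le_abs_self R]
  · rw [image_eq_zero_of_notMem_tsupport hx] at h1 ⊢
    rw [zero_sub, abs_neg, abs_mul, abs_of_nonneg χ.nonneg]
    rw [sub_zero] at h1
    calc _ ≤ 1 * ε := mul_le_mul χ.le_one h1 (abs_nonneg _) zero_le_one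
      _ = ε := one_mul ε

theorem abs_σ_le {x : E2} (hx : x ∈ frontier (rect r d)) :
    |(flatFields r m).σ x| ≤ |1 - m| := by
  have hcl : ∀ y ∈ closure (rect r d), |y 0 - r| ≤ 1 := by
    refine fun y hy => closure_minimal (s := rect r d) (t := {y : E2 | |y 0 - r| ≤ 1})
      (fun z hz => show |z 0 - r| ≤ 1 from
        abs_le.2 ⟨by linarith [hz.1.1], by linarith [hz.1.2]⟩)
      (isClosed_le (by fun_prop) continuous_const) hy
  have h1 := hcl x (frontier_subset_closure hx)
  have h2 : |rectNormal r x 0| ≤ 1 := (PiLp.norm_apply_le _ 0).trans (norm_rectNormal x).le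
  have h3 := taper_le_one (x 1)
  have h4 := taper_nonneg (x 1)
  simp only [flatFields, amplitude]
  rw [abs_mul, abs_mul, abs_mul, abs_of_nonneg h4]
  calc _ ≤ |1 - m| * (1 * 1 * 1) := by gcongr
    _ = _ := by ring

theorem integrableOn_σ (hd : 0 < d) :
    IntegrableOn (flatFields r m).σ (frontier (rect r d)) (μH[1] : Measure E2) := by
  have hfin : IsFiniteMeasure ((μH[1] : Measure E2).restrict (frontier (rect r d))) :=
    ⟨by simpa using hausdorff_frontier_rect hd⟩
  refine Integrable.of_bound (Measurable.aestronglyMeasurable ?_) |1 - m|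
    ((ae_restrict_mem isClosed_frontier.measurableSet).mono fun x hx => abs_σ_le hx)
  exact (contDiff_amplitude.continuous.measurable.mul ((by fun_prop :
    Measurable fun x : E2 => x 0).comp measurable_rectNormal)).const_mul _

/-- Smooth functions approximate `f` uniformly, and the surface sums are controlled by the supremum
norm with a constant that does not depend on `k`. -/
theorem flat_tendsto_surfaceSum (h2 : d ≤ 2)
    (hM : HasPhaseMean (flatCharge α hα) (flatChoice o t e r d hd) (cellPhase o t e r) m)
    {f : E2 → ℝ} (hf : Continuous f) (hc : HasCompactSupport f) :
    Tendsto (fun k => (flatCharge α hα).surfaceSum (flatChoice o t e r d hd) k f) atTop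
      (𝓝 (∫ x in frontier (rect r d), f x * (flatFields r m).σ x ∂(μH[1] : Measure E2))) := by
  obtain ⟨B, hB0, hB⟩ := exists_surfaceSum_le (hα := hα) (o := o) (t := t) (e := e) (r := r)
    (hd := hd) h2
  set μ := (μH[1] : Measure E2).restrict (frontier (rect r d)) with hμ
  have iσ : Integrable (flatFields r m).σ μ := integrableOn_σ hd
  set B' := ∫ x, |(flatFields r m).σ x| ∂μ with hB'
  have hB'0 : 0 ≤ B' := integral_nonneg fun x => abs_nonneg _
  have iσf : ∀ {g : E2 → ℝ}, Continuous g → HasCompactSupport g →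
      Integrable (fun x => g x * (flatFields r m).σ x) μ := fun {g} hg hgc => by
    obtain ⟨K, hK⟩ := hgc.exists_bound_of_continuous hg
    exact iσ.bdd_mul (c := K) hg.aestronglyMeasurable (Eventually.of_forall hK)
  rw [Metric.tendsto_atTop]
  intro δ hδ
  set ε := δ / (2 * (B + B' + 1)) with hε
  have hε0 : 0 < ε := by positivity
  obtain ⟨g, hg, hgc, hfg⟩ := exists_smooth_approx hf hc hε0
  obtain ⟨N, hN⟩ := Metric.tendsto_atTop.1 (flat_tendsto_surfaceSum_smooth h2 hM hg hgc) (δ / 2)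
    (by positivity)
  refine ⟨N, fun k hk => ?_⟩
  have h3 := hN k hk
  rw [Real.dist_eq] at h3 ⊢
  have h4 := hB k (fun x => f x - g x) ε hfg
  rw [ChargeSequence.surfaceSum_sub] at h4
  have h5 : |(∫ x, g x * (flatFields r m).σ x ∂μ) - ∫ x, f x * (flatFields r m).σ x ∂μ| ≤
      ε * B' := by
    rw [← integral_sub (iσf hg.continuous hgc) (iσf hf hc), hB', ← integral_const_mul]
    rw [← Real.norm_eq_abs]
    refine norm_integral_le_of_norm_le (iσ.abs.const_mul ε) (Eventually.of_forall fun x => ?_)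
    rw [← sub_mul, norm_mul]
    refine mul_le_mul_of_nonneg_right ?_ (norm_nonneg _)
    rw [norm_sub_rev]
    exact hfg x
  have h6 : ε * B + ε * B' < δ / 2 := by
    have : ε * (B + B' + 1) = δ / 2 := by rw [hε]; field_simp
    nlinarith
  have tri : ∀ a b c' d' : ℝ, |a - d'| ≤ |a - b| + |b - c'| + |c' - d'| := fun a b c' d' => by
    have e : a - d' = (a - b) + (b - c') + (c' - d') := by ring
    rw [e]
    exact abs_add_three _ _ _
  refine (tri _ ((flatCharge α hα).surfaceSum (flatChoice o t e r d hd) k g)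
    (∫ x, g x * (flatFields r m).σ x ∂μ) _).trans_lt ?_
  linarith

/-- The homogenized fields of the oscillating charge. -/
theorem isHomogenized_flat (h2 : d ≤ 2)
    (hM : HasPhaseMean (flatCharge α hα) (flatChoice o t e r d hd) (cellPhase o t e r) m) :
    IsHomogenized (flatCharge α hα) (flatChoice o t e r d hd) (flatFields r m) where
  integrable_σ := integrableOn_σ hd
  free_charge φ hφ hc := by
    have h := flat_tendsto_chargeSum (hα := hα) h2 hφ hc hM
    have e1 : ∫ x in (flatChoice o t e r d hd).sheet.T, φ x * (flatFields r m).q x *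
        (flatChoice o t e r d hd).sheet.J₀ x = ∫ x in rect r d, φ x * (flatFields r m).q x :=
      integral_congr_ae (Eventually.of_forall fun x => by
        change φ x * (flatFields r m).q x * (flatSheet r d hd).J₀ x = _
        rw [flatSheet_J₀, mul_one])
    rw [e1]
    exact h
  tangential φ hφ hc := by
    have t0 := flat_tendsto_dipoleSum_zero (hα := hα) h2 hφ hc hM
    have t1 := flat_tendsto_dipoleSum_one (hα := hα) h2 hφ hc hM
    have h := (planeHomeo.continuous.tendsto _).comp (t0.prodMk_nhds t1)
    have e1 : ∫ x in (flatChoice o t e r d hd).sheet.T,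
        (φ x * (flatChoice o t e r d hd).sheet.J₀ x) • (flatFields r m).p x =
        planeHomeo (∫ x in rect r d, φ x * (m * amplitude r x), 0) := by
      have e2 : ∀ x, (φ x * (flatChoice o t e r d hd).sheet.J₀ x) • (flatFields r m).p x =
          (φ x * (m * amplitude r x)) • dir 0 := fun x => by
        change (φ x * (flatSheet r d hd).J₀ x) • ((m * amplitude r x) • dir 0) = _
        rw [flatSheet_J₀, mul_one, smul_smul]
      simp only [e2]
      rw [integral_smul_const]
      ext i
      fin_cases i <;> simp [planeHomeo, dir, flatChoice, flatSheet]
    rw [e1]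
    refine h.congr fun k => ?_
    ext i
    fin_cases i <;> rfl
  normal φ _ _ := by
    have e1 : ∫ x in (flatChoice o t e r d hd).sheet.T, φ x * (flatFields r m).p₃ x *
        (flatChoice o t e r d hd).sheet.J₀ x = 0 := by simp [flatFields]
    rw [e1]
    exact tendsto_const_nhds.congr fun k => (flat_normalSum h2 k φ).symm
  surface_charge φ hφ hc := by
    have h := flat_tendsto_surfaceSum (hα := hα) h2 hM hφ hc
    have e1 : ∫ x in frontier (flatChoice o t e r d hd).sheet.T, φ x * (flatFields r m).σ x *
        (flatChoice o t e r d hd).sheet.lineJ x ∂(μH[1] : Measure E2) =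
        ∫ x in frontier (rect r d), φ x * (flatFields r m).σ x ∂(μH[1] : Measure E2) :=
      integral_congr_ae (Eventually.of_forall fun x => by
        change φ x * (flatFields r m).σ x * (flatSheet r d hd).lineJ x = _
        rw [flatSheet_lineJ, mul_one])
    rw [e1]
    exact h

/-! ### Dependence of the fields on the choices -/

variable {r d m : ℝ}

theorem flatSheet_ψ₀ {hd : 0 < d} (x : E2) : (flatSheet r d hd).ψ₀ x = !₂[x 0 - r, x 1, 0] :=
  flatSheet_ψ x 0

/-- For `m = 1` the surface charge vanishes identically. Free charge and polarization are
proportional to `m` and are compared at the centre of the unit square. -/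
theorem fieldsDiffer_flat {hd : 0 < d} (h1 : 1 ≤ d) (hm : m ≠ 1) :
    FieldsDiffer (flatSheet 0 1 one_pos) (flatFields 0 1) (flatSheet r d hd) (flatFields r m) := by
  have hx : (!₂[1 / 2, 1 / 2] : E2) ∈ rect 0 1 := by
    refine ⟨⟨?_, ?_⟩, ?_, ?_⟩ <;> norm_num
  have hx' : (!₂[1 / 2 + r, 1 / 2] : E2) ∈ rect r d := by
    refine ⟨⟨?_, ?_⟩, ?_, ?_⟩ <;>
    · simp only [Matrix.cons_val_zero, Matrix.cons_val_one]
      linarith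
  have hψ : (flatSheet 0 1 one_pos).ψ₀ !₂[1 / 2, 1 / 2] =
      (flatSheet r d hd).ψ₀ !₂[1 / 2 + r, 1 / 2] := by
    simp [flatSheet_ψ₀]
  have ht : 0 < taper (1 / 2) := taper_pos (by norm_num)
  refine ⟨⟨_, hx, _, hx', hψ, ?_⟩, ⟨_, hx, _, hx', hψ, ?_⟩, ?_⟩
  · intro h
    simp only [flatFields, Matrix.cons_val_one] at h
    exact hm (mul_right_cancel₀ ht.ne' h).symm
  · intro h
    rw [tangentialPolarization, tangentialPolarization, flatSheet_D, flatSheet_D] at h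
    have h0 := congrArg (fun X : E3 => X 0) h
    simp only [flatFields, amplitude, liftL_apply, lift, dir, PiLp.smul_apply,
      PiLp.single_apply, Matrix.cons_val_zero, Matrix.cons_val_one, smul_eq_mul,
      if_true, mul_one, sub_zero, add_sub_cancel_right] at h0
    have hne : (1 / 2 : ℝ) * taper (1 / 2) ≠ 0 := by positivity
    exact hm (mul_right_cancel₀ hne h0).symm
  · intro h
    -- On the right side the amplitude is `taper`, positive below height one; on the left side it is
    -- zero. This segment also lies on the boundary of the higher sheet.
    set A : Set E2 := vertical (0 + 1) '' Ioo 0 1 with hA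
    have hAf : A ⊆ frontier (rect 0 1) := by
      rw [frontier_rect one_pos]
      exact fun x hx => Or.inl (Or.inr (image_mono Ioo_subset_Icc_self hx))
    have hbad : A ⊆ {x | ¬ ∀ x' ∈ frontier (flatSheet r d hd).T,
        (flatSheet 0 1 one_pos).ψ₀ x = (flatSheet r d hd).ψ₀ x' →
          (flatFields 0 1).σ x = (flatFields r m).σ x'} := by
      rintro _ ⟨s, hs, rfl⟩ hall
      have hmem : vertical (r + 1) s ∈ frontier (rect r d) := by
        rw [frontier_rect hd]
        exact Or.inl (Or.inr ⟨s, ⟨hs.1.le, hs.2.le.trans h1⟩, rfl⟩)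
      have hσ := hall _ hmem (by simp [flatSheet_ψ₀, vertical])
      have hn : rectNormal r !₂[r + 1, s] 0 = 1 := by simp [rectNormal, dir]
      simp only [flatFields, amplitude, hn, sub_self, zero_mul, vertical, Matrix.cons_val_zero,
        Matrix.cons_val_one, add_sub_cancel_left, one_mul, mul_one] at hσ
      rcases mul_eq_zero.1 hσ.symm with h0 | h0
      · exact hm (by linarith)
      · exact (taper_pos hs.2).ne' h0
    have h0 : ((μH[1] : Measure E2).restrict (frontier (rect 0 1))) A = 0 :=
      measure_mono_null hbad h
    rw [Measure.restrict_eq_self _ hAf, hA, hausdorff_image (isometry_vertical _)] at h0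
    simp at h0

/-- For every limit of the ratio of thickness and lattice scale there are charges whose free
charge, tangential polarization and surface charge change with each of the choices. -/
theorem exists_fields_differ (α : ℝ) (hα : 0 ≤ α) :
    ∃ (S : ChargeSequence α) (c₀ c₁ c₂ c₃ c₄ : Choice) (F₀ F₁ F₂ F₃ F₄ : Fields),
      (S.AdaptedTo c₀ ∧ S.AdaptedTo c₁ ∧ S.AdaptedTo c₂ ∧ S.AdaptedTo c₃ ∧ S.AdaptedTo c₄) ∧
      (IsHomogenized S c₀ F₀ ∧ IsHomogenized S c₁ F₁ ∧ IsHomogenized S c₂ F₂ ∧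
        IsHomogenized S c₃ F₃ ∧ IsHomogenized S c₄ F₄) ∧
      (c₁.origin ≠ c₀.origin ∧ c₁.basis = c₀.basis ∧ c₁.sheet = c₀.sheet ∧
        c₁.cell = c₀.cell ∧ c₁.corner = c₀.corner ∧ FieldsDiffer c₀.sheet F₀ c₁.sheet F₁) ∧
      (c₂.lattice ≠ c₀.lattice ∧ c₂.origin = c₀.origin ∧ c₂.sheet = c₀.sheet ∧
        c₂.cell = c₀.cell ∧ c₂.corner = c₀.corner ∧ FieldsDiffer c₀.sheet F₀ c₂.sheet F₂) ∧
      (c₃.sheet.Ω ≠ c₀.sheet.Ω ∧ c₃.origin = c₀.origin ∧ c₃.basis = c₀.basis ∧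
        c₃.cell = c₀.cell ∧ c₃.corner = c₀.corner ∧ FieldsDiffer c₀.sheet F₀ c₃.sheet F₃) ∧
      (c₄.cell ≠ c₀.cell ∧ c₄.origin = c₀.origin ∧ c₄.basis = c₀.basis ∧
        c₄.sheet = c₀.sheet ∧ c₄.corner = c₀.corner ∧
        FieldsDiffer c₀.sheet F₀ c₄.sheet F₄) := by
  -- The phase is read at `o - r + e`. It is `0` for the reference choice, and half a period in size
  -- when the origin, the chart or the cell is moved, so the mean is `1` in the first case and `-1`
  -- in the others.
  have p0 : Real.cos (2 * Real.pi * ((0 : ℝ) - 0 + 0)) = 1 := by simp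
  have p1 : Real.cos (2 * Real.pi * ((1 / 2 : ℝ) - 0 + 0)) = -1 := by
    rw [← Real.cos_pi]; congr 1; ring
  have p3 : Real.cos (2 * Real.pi * ((0 : ℝ) - (-(1 / 2)) + 0)) = -1 := by
    rw [← Real.cos_pi]; congr 1; ring
  have p4 : Real.cos (2 * Real.pi * ((0 : ℝ) - 0 + -(1 / 2))) = -1 := by
    rw [← Real.cos_pi, ← Real.cos_neg Real.pi]; congr 1; ring
  have m0 := hasPhaseMean_flat (hα := hα) (o := 0) (r := 0) (e := 0) (hd := one_pos) (j := 0)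
    (by norm_num)
  have m1 := hasPhaseMean_flat (hα := hα) (o := 1 / 2) (r := 0) (e := 0) (hd := one_pos) (j := 1)
    (by norm_num)
  have m3 := hasPhaseMean_flat (hα := hα) (o := 0) (r := -(1 / 2)) (e := 0) (hd := two_pos)
    (j := 1) (by norm_num)
  have m4 := hasPhaseMean_flat (hα := hα) (o := 0) (r := 0) (e := -(1 / 2)) (hd := one_pos)
    (j := 0) (by norm_num)
  rw [p0] at m0
  rw [p1] at m1
  rw [p3] at m3
  rw [p4] at m4
  refine ⟨flatCharge α hα, flatChoice 0 0 0 0 1 one_pos, flatChoice (1 / 2) 0 0 0 1 one_pos,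
    flatChoice 0 (1 / 2) 0 0 1 one_pos, flatChoice 0 0 0 (-(1 / 2)) 2 two_pos,
    flatChoice 0 0 (-(1 / 2)) 0 1 one_pos, flatFields 0 1, flatFields 0 (-1), flatFields 0 0,
    flatFields (-(1 / 2)) (-1), flatFields 0 (-1),
    ⟨flatCharge_adaptedTo le_rfl one_le_two, flatCharge_adaptedTo le_rfl one_le_two,
      flatCharge_adaptedTo le_rfl one_le_two, flatCharge_adaptedTo one_le_two le_rfl,
      flatCharge_adaptedTo le_rfl one_le_two⟩,
    ⟨isHomogenized_flat one_le_two m0, isHomogenized_flat one_le_two m1,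
      isHomogenized_flat one_le_two hasPhaseMean_shear, isHomogenized_flat le_rfl m3,
      isHomogenized_flat one_le_two m4⟩,
    ⟨?_, rfl, rfl, rfl, rfl, fieldsDiffer_flat (hd := one_pos) le_rfl (by norm_num)⟩,
    ⟨?_, rfl, rfl, rfl, rfl, fieldsDiffer_flat (hd := one_pos) le_rfl (by norm_num)⟩,
    ⟨?_, rfl, rfl, rfl, rfl, fieldsDiffer_flat (hd := two_pos) one_le_two (by norm_num)⟩,
    ⟨?_, rfl, rfl, rfl, rfl, fieldsDiffer_flat (hd := one_pos) le_rfl (by norm_num)⟩⟩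
  · intro h
    have := congrArg (fun x : E2 => x 0) h
    simp [flatChoice] at this
  · intro h
    have h1 : shearBasis (1 / 2) 1 ∈ (flatChoice 0 (1 / 2) 0 0 1 one_pos).lattice :=
      ⟨Pi.single 1 1, by simp [flatChoice]⟩
    rw [h] at h1
    obtain ⟨n, hn⟩ := h1
    have h2 : ∑ i, (n i : ℝ) • shearBasis 0 i = shearBasis (1 / 2) 1 := hn
    rw [sum_shearBasis] at h2
    have h3 : (n 0 : ℝ) = 1 / 2 := by
      have := congrArg (fun x : E2 => x 0) h2
      simpa [shearBasis] using this
    have h4 : (2 : ℝ) * n 0 = 1 := by rw [h3]; norm_num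
    have h5 : 2 * n 0 = 1 := by exact_mod_cast h4
    omega
  -- Moving the parameter domain would leave the set `Ω` as it is, because the chart moves it back.
  -- The height `2` in place of `1` makes `Ω` a different set.
  · intro h
    have h1 : (!₂[1 / 2, 3 / 2, 0] : E3) ∈ (flatSheet (-(1 / 2)) 2 two_pos).Ω := by
      rw [flatSheet_Ω]
      refine ⟨⟨?_, ?_⟩, ⟨?_, ?_⟩, rfl⟩ <;> norm_num
    have h2 : (!₂[1 / 2, 3 / 2, 0] : E3) ∈ (flatSheet 0 1 one_pos).Ω := h ▸ h1
    rw [flatSheet_Ω] at h2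
    have := h2.2.1.2
    norm_num at this
  · intro h
    have h1 : (!₂[-(1 / 2), 0] : E2) ∈ square (-(1 / 2)) := by
      refine ⟨⟨?_, ?_⟩, ?_, ?_⟩ <;> norm_num
    have h2 : square (-(1 / 2)) = square 0 := h
    rw [h2] at h1
    have := h1.1.1
    norm_num at this

end TwoDMaterial

theorem mainTheorem2 (α : ℝ) (hα : 0 ≤ α) :
    -- the homogenized potential does not depend on the choices
    (∀ S : ChargeSequence α, ∃ Φ₀ : E3 → ℝ, ∀ (c : Choice) (F : Fields),
      S.AdaptedTo c → IsHomogenized S c F →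
        SolvesHomogenized α c F Φ₀ ∧
        (∀ Φ : E3 → ℝ, SolvesHomogenized α c F Φ →
          Φ =ᵐ[volume] Φ₀ ∧
          -- nor do the electric field and the energy in any region
          ∀ (W : Set E3) (E E₀ : E3 → E3), IsOpen W →
            IsElectricField W Φ E → IsElectricField W Φ₀ E₀ →
              E =ᵐ[volume.restrict W] E₀ ∧ fieldEnergy W E = fieldEnergy W E₀) ∧
        (∀ᶠ k in atTop, ∃ Φ : E3 → ℝ, SolvesPoisson (S.source k) Φ) ∧
        (∀ Φ : ℕ → E3 → ℝ, (∀ᶠ k in atTop, SolvesPoisson (S.source k) (Φ k)) →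
          ConvergesWeakly Φ Φ₀)) ∧
    -- uniqueness of the bulk and boundary sources, and of the normal polarization
    (∀ (S : ChargeSequence α) (c c' : Choice) (F F' : Fields),
      S.AdaptedTo c → S.AdaptedTo c' → IsHomogenized S c F → IsHomogenized S c' F' →
        (∀ φ, IsTestFunction φ → bulkSource α c.sheet F φ = bulkSource α c'.sheet F' φ) ∧
        (∀ φ, IsTestFunction φ → boundarySource α c.sheet F φ = boundarySource α c'.sheet F' φ) ∧
        (c.sheet.Ω = c'.sheet.Ω →
          (∀ x ∈ c.sheet.T, ∀ x' ∈ c'.sheet.T, c.sheet.ψ₀ x = c'.sheet.ψ₀ x' →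
            bulkDensity α c.sheet F x = bulkDensity α c'.sheet F' x' ∧
            (0 < α → F.p₃ x • c.sheet.ν x = F'.p₃ x' • c'.sheet.ν x' ∧
              (c.sheet.ν x = c'.sheet.ν x' → F.p₃ x = F'.p₃ x'))) ∧
          (∀ᵐ x ∂((μH[1] : Measure E2).restrict (frontier c.sheet.T)), ∀ x' ∈ frontier c'.sheet.T,
            c.sheet.ψ₀ x = c'.sheet.ψ₀ x' →
              boundaryDensity α c.sheet F x = boundaryDensity α c'.sheet F' x'))) ∧
    -- free charge, tangential polarization and surface charge depend on each of the choices
    (∃ (S : ChargeSequence α) (c₀ c₁ c₂ c₃ c₄ : Choice) (F₀ F₁ F₂ F₃ F₄ : Fields),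
      (S.AdaptedTo c₀ ∧ S.AdaptedTo c₁ ∧ S.AdaptedTo c₂ ∧ S.AdaptedTo c₃ ∧ S.AdaptedTo c₄) ∧
      (IsHomogenized S c₀ F₀ ∧ IsHomogenized S c₁ F₁ ∧ IsHomogenized S c₂ F₂ ∧
        IsHomogenized S c₃ F₃ ∧ IsHomogenized S c₄ F₄) ∧
      -- another origin
      (c₁.origin ≠ c₀.origin ∧ c₁.basis = c₀.basis ∧ c₁.sheet = c₀.sheet ∧
        c₁.cell = c₀.cell ∧ c₁.corner = c₀.corner ∧ FieldsDiffer c₀.sheet F₀ c₁.sheet F₁) ∧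
      -- another lattice
      (c₂.lattice ≠ c₀.lattice ∧ c₂.origin = c₀.origin ∧ c₂.sheet = c₀.sheet ∧
        c₂.cell = c₀.cell ∧ c₂.corner = c₀.corner ∧ FieldsDiffer c₀.sheet F₀ c₂.sheet F₂) ∧
      -- another manifold
      (c₃.sheet.Ω ≠ c₀.sheet.Ω ∧ c₃.origin = c₀.origin ∧ c₃.basis = c₀.basis ∧
        c₃.cell = c₀.cell ∧ c₃.corner = c₀.corner ∧ FieldsDiffer c₀.sheet F₀ c₃.sheet F₃) ∧
      -- another unit cell
      (c₄.cell ≠ c₀.cell ∧ c₄.origin = c₀.origin ∧ c₄.basis = c₀.basis ∧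
        c₄.sheet = c₀.sheet ∧ c₄.corner = c₀.corner ∧ FieldsDiffer c₀.sheet F₀ c₄.sheet F₄)) :=
  ⟨exists_homogenized_potential, sources_unique, exists_fields_differ α hα⟩
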